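/- **Setting.** $\mathbb R^n$ carries the maximum norm $|\cdot|$, matrices the induced norm; $\mathcal P_1(\mathbb R^d)$ is the set of Borel probability measures with finite first moment, with the Monge–Kantorovich distance $d_1(\mu,\nu)=\inf_\pi\int|x-y|\,d\pi$ over couplings $\pi$ of $\mu,\nu$. Let $T>0$, $p\in(1,\infty)$, $d=r+s$, $A:[0,T]\times\mathbb R^d\to\mathbb R^d$, $B:[0,T]\times\mathbb R^d\to\mathbb R^{d\times r}$, $\ell:[0,T]\times\mathbb R^r\times\mathbb R^d\times\mathcal P_1(\mathbb R^d)\to\mathbb R$, $g:\mathbb R^d\times\mathcal P_1(\mathbb R^d)\to\mathbb R$, $m_0\in\mathcal P(\mathbb R^d)$. Assume: * **(H1)** $\ell$ is continuous; $\underline\ell|a|^p-C_\ell\le\ell(t,a,x,\mu)\le\overline\ell|a|^p+C_\ell$ and $|\ell(t,a,x,\mu)-\ell(t,a,y,\mu)|\le L_\ell(1+|a|^p)|x-y|$ for some positive constants; $\ell$ is convex and $C^1$ in $a$. * **(H2)** $g$ is continuous, bounded from below, and Lipschitz in $x$ uniformly in $\mu$. * **(H3)** $A,B$ are continuous and Lipschitz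 in $x$ uniformly in $t$; $B$ is bounded; there are $r$ fixed row indices such that the corresponding rows of $B(t,x)$ are linearly independent for all $(t,x)$. Write $x=(x_1,x_2)\in\mathbb R^r\times\mathbb R^s$ for the components with these indices and the remaining ones, and split $A=(A_1,A_2)$, $B=(B_1,B_2)$ accordingly. * **(H4)** $\operatorname{supp}(m_0)$ is compact. **Continuous problem.** For $m\in C([0,T];\mathcal P_1(\mathbb R^d))$ let $v[m](t,x)$ be the infimum of $\int_t^T\ell(\tau,\alpha,\gamma,m(\tau))\,d\tau+g(\gamma(T),m(T))$ over $\alpha\in L^p([t,T];\mathbb R^r)$, $\gamma\in W^{1,p}([t,T];\mathbb R^d)$ with $\dot\gamma=A(\tau,\gamma)+B(\tau,\gamma)\alpha$ a.e. and $\gamma(t)=x$. Let $\Gamma=C([0,T];\mathbb R^d)$ and $e_t(\gamma)=\gamma(t)$. A measure $\xi\in\mathcal P_1(\Gamma)$ is a *Lagrangian MFG equilibrium* if $e_0\sharp\xi=m_0$, $m(t)=e_t\sharp\xi$ defines an element of $C([0,T];\mathcal P_1(\mathbb R^d))$, and for $\xi$-a.e. $\gamma$ there is $\alpha$ such that $(\gamma,\alpha)$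 is optimal for this problem with initial time $0$ and initial state $\gamma(0)$. **Control bound.** Call $\widehat C>0$ a *control bound* if for all $N\ge1$, $m\in C([0,T];\mathcal P_1(\mathbb R^d))$, $k<N$ and $x\in\mathbb R^d$, with $\Delta=T/N$ and $t_j=j\Delta$, every minimizer $(\alpha_k,\dots,\alpha_{N-1})\in(\mathbb R^r)^{N-k}$ of $\Delta\sum_{j=k}^{N-1}\ell(t_j,\alpha_j,\gamma_j,m(t_j))+g(\gamma_N,m(T))$, where $\gamma_k=x$ and $\gamma_{j+1}=\gamma_j+\Delta(A(t_j,\gamma_j)+B(t_j,\gamma_j)\alpha_j)$, satisfies $\max_j|\alpha_j|\le\widehat C$. **Discrete problem.** Fix a control bound $\widehat C$, a compact $K_0\supseteq\operatorname{supp}(m_0)$ and $C_I>0$. Given integers $N_t,N_s\ge1$ and $\varepsilon>0$, put $\Delta t=T/N_t$, $\Delta x=1/N_s$, $t_k=k\Delta t$, $\mathcal G_n=\Delta x\,\mathbb Z^n$. Let $(\beta_z)_{z\in\mathcal G_s}$ be nonnegative functions on $\mathbb R^s$ with $\beta_z(z)=1$, $\beta_z(z')=0$ for $z\ne z'\in\mathcal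 G_s$, $\sum_z\beta_z\equiv1$ and $\operatorname{supp}\beta_z\subseteq\overline B(z,C_I\Delta x)$ (for instance a $\mathbb Q_1$ basis). Call the discretization *admissible* if also $\Delta x\le\Delta t$. Put $$\alpha(k,x,y_1)=B_1(t_k,x)^{-1}\Big[\tfrac{y_1-x_1}{\Delta t}-A_1(t_k,x)\Big],\qquad \mathbf y_2(k,x,y_1)=x_2+\Delta t\big[A_2(t_k,x)+B_2(t_k,x)\alpha(k,x,y_1)\big],$$ $\mathcal S^1_{k+1}(x)=\{y_1\in\mathcal G_r:|\alpha(k,x,y_1)|\le\widehat C\}$, $\mathcal S^2_{k+1}(x,y_1)=\{y_2\in\mathcal G_s:\mathbf y_2(k,x,y_1)\in\operatorname{supp}\beta_{y_2}\}$, $\mathcal S_{k+1}(x)=\{(y_1,y_2):y_1\in\mathcal S^1_{k+1}(x),\,y_2\in\mathcal S^2_{k+1}(x,y_1)\}$, $\mathcal S_0=\mathcal G_d\cap K_0$, $\mathcal S_{k+1}=\bigcup_{x\in\mathcal S_k}\mathcal S_{k+1}(x)$. For $M=(M_k)\in\prod_{k=0}^{N_t}\mathcal P(\mathcal S_k)$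 let $V_{N_t}(x)=g(x,M_{N_t})$ for $x\in\mathcal S_{N_t}$ and, for $k<N_t$, $x\in\mathcal S_k$, let $V_k(x)$ be the minimum and $p_k(x,\cdot)$ the minimizer over $p\in\mathcal P(\mathcal S^1_{k+1}(x))$ of $$\sum_{y_1}p(y_1)\Big[\Delta t\,\ell(t_k,\alpha(k,x,y_1),x,M_k)+\sum_{y_2\in\mathcal S^2_{k+1}(x,y_1)}\beta_{y_2}(\mathbf y_2(k,x,y_1))V_{k+1}(y_1,y_2)\Big]+\varepsilon\sum_{y_1}p(y_1)\log p(y_1).$$ Let $P_k(x,y)=p_k(x,y_1)\beta_{y_2}(\mathbf y_2(k,x,y_1))$ if $y\in\mathcal S_{k+1}(x)$ and $0$ otherwise. $M$ is a *discrete MFG equilibrium* if $M_0(x)=m_0(\overline B(x,\Delta x/2))$ for $x\in\mathcal S_0$ and $M_{k+1}(y)=\sum_{x\in\mathcal S_k}P_k(x,y)M_k(x)$ for $k<N_t$, $y\in\mathcal S_{k+1}$. Its path measure is $\xi=\sum_\gamma M_0(\gamma(0))\prod_{k<N_t}P_k(\gamma(t_k),\gamma(t_{k+1}))\,\delta_\gamma$,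 the sum running over the paths that are affine on each $[t_k,t_{k+1}]$ with $\gamma(t_k)\in\mathcal S_k$ for all $k$. **Theorem.** A control bound exists. For every control bound $\widehat C$ there is $C_\infty>0$ such that $\mathcal S_k\subseteq\overline B(0,C_\infty)$ for all $k\le N_t$ and every admissible discretization, and such that the following holds. Consider a sequence of admissible discretizations $(N^n_t,N^n_s,\varepsilon_n,\beta^n)$ with $m_0(\partial\overline B(x,\Delta x_n/2))=0$ for all $x\in\mathcal G^n_d$, and discrete MFG equilibria $M^n$ with value functions $V^n$ and path measures $\xi^n$. Assume $N^n_t\to\infty$, $N^n_s\to\infty$, $N^n_t/N^n_s\to0$ and $\varepsilon_n=o\big(1/(N^n_t\log N^n_s)\big)$. Then $\xi^n\in\mathcal P(\Gamma)$, $M^n(t):=e_t\sharp\xi^n$ defines $M^n\in C([0,T];\mathcal P_1(\mathbb R^d))$ with $M^n(t^n_k)=M^n_k$, and: 1. $(\xi^n)$ is relatively compact in $\mathcal P(\Gamma)$ for the narrow topology; it has a narrowly convergent subsequence, and every accumulation point is a Lagrangian MFG equilibrium. 2. If a subsequence $\xi^{n_l}$ converges narrowly to $\xi^*$ and $m^*(t)=e_t\sharp\xi^*$,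 then $m^*\in C([0,T];\mathcal P_1(\mathbb R^d))$, $\operatorname{supp}(m^*(t))\subseteq\overline B(0,C_\infty)$ for all $t\in[0,T]$, $M^{n_l}\to m^*$ in $C([0,T];\mathcal P_1(\mathbb R^d))$, and $$\sup\big\{|V^{n_l}_k(x)-v[m^*](t^{n_l}_k,x)|:\ 0\le k\le N^{n_l}_t,\ x\in\mathcal S^{n_l}_k\big\}\xrightarrow[l\to\infty]{}0.$$ -/

import Mathlib

open MeasureTheory Filter Topology Set
open scoped ENNReal ProbabilityTheory Matrix

set_option linter.unusedSectionVars false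

namespace MFG

/-! ### The space of probability measures with finite first moment -/

/-- Borel probability measures on `X` with finite first moment. -/
structure P1 (X : Type*) [PseudoMetricSpace X] [MeasurableSpace X] where
  toMeasure : Measure X
  isProb : IsProbabilityMeasure toMeasure
  moment : ∃ x₀ : X, Integrable (fun x => dist x x₀) toMeasure

namespace P1

section Defs
variable {X : Type*} [PseudoMetricSpace X] [MeasurableSpace X]

instance (μ : P1 X) : IsProbabilityMeasure μ.toMeasure := μ.isProb

/-- `π` is a coupling of `μ` and `ν`. -/
def IsCoupling (μ ν : P1 X) (π : Measure (X × X)) : Prop :=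
  π.map Prod.fst = μ.toMeasure ∧ π.map Prod.snd = ν.toMeasure

/-- The Monge--Kantorovich distance `d₁`. -/
noncomputable def d1 (μ ν : P1 X) : ℝ :=
  sInf {c : ℝ | ∃ π : Measure (X × X), IsCoupling μ ν π ∧ c = ∫ z, dist z.1 z.2 ∂π}

end Defs

section Metric
variable {X : Type*} [MetricSpace X] [SecondCountableTopology X] [CompleteSpace X]
  [MeasurableSpace X] [BorelSpace X]

theorem IsCoupling.isProb {μ ν : P1 X} {π : Measure (X × X)} (h : IsCoupling μ ν π) :
    IsProbabilityMeasure π := by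
  constructor
  have h1 : (π.map Prod.fst) Set.univ = 1 := by rw [h.1]; exact measure_univ
  rwa [Measure.map_apply measurable_fst MeasurableSet.univ, Set.preimage_univ] at h1

theorem integrable_dist (μ : P1 X) (y : X) : Integrable (fun x => dist x y) μ.toMeasure := by
  obtain ⟨x₀, h⟩ := μ.moment
  refine (h.add (integrable_const (dist x₀ y))).mono'
    (continuous_id.dist continuous_const).aestronglyMeasurable ?_
  filter_upwards with x
  simpa [abs_of_nonneg dist_nonneg] using dist_triangle x x₀ y

theorem IsCoupling.integrable {μ ν : P1 X} {π : Measure (X × X)} (h : IsCoupling μ ν π) :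
    Integrable (fun z : X × X => dist z.1 z.2) π := by
  obtain ⟨x₀, -⟩ := μ.moment
  have h1 : Integrable (fun z : X × X => dist z.1 x₀) π := by
    have := μ.integrable_dist x₀
    rw [← h.1] at this
    exact this.comp_measurable measurable_fst
  have h2 : Integrable (fun z : X × X => dist z.2 x₀) π := by
    have := ν.integrable_dist x₀
    rw [← h.2] at this
    exact this.comp_measurable measurable_snd
  refine (h1.add h2).mono' (continuous_fst.dist continuous_snd).aestronglyMeasurable ?_
  filter_upwards with z
  simpa [abs_of_nonneg dist_nonneg] using dist_triangle_right z.1 z.2 x₀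

theorem IsCoupling.swap {μ ν : P1 X} {π : Measure (X × X)} (h : IsCoupling μ ν π) :
    IsCoupling ν μ (π.map Prod.swap) := by
  constructor
  · rw [Measure.map_map measurable_fst measurable_swap]; exact h.2
  · rw [Measure.map_map measurable_snd measurable_swap]; exact h.1

theorem d1_bddBelow (μ ν : P1 X) :
    BddBelow {c : ℝ | ∃ π : Measure (X × X), IsCoupling μ ν π ∧ c = ∫ z, dist z.1 z.2 ∂π} := by
  refine ⟨0, ?_⟩
  rintro c ⟨π, -, rfl⟩
  exact integral_nonneg fun _ => dist_nonneg

theorem d1_le {μ ν : P1 X} {π : Measure (X × X)} (h : IsCoupling μ ν π) :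
    d1 μ ν ≤ ∫ z, dist z.1 z.2 ∂π :=
  csInf_le (d1_bddBelow μ ν) ⟨π, h, rfl⟩

theorem exists_coupling_lt (μ ν : P1 X) {ε : ℝ} (hε : 0 < ε) :
    ∃ π : Measure (X × X), IsCoupling μ ν π ∧ ∫ z, dist z.1 z.2 ∂π < d1 μ ν + ε := by
  have hne : {c : ℝ | ∃ π : Measure (X × X),
      IsCoupling μ ν π ∧ c = ∫ z, dist z.1 z.2 ∂π}.Nonempty := by
    refine ⟨_, μ.toMeasure.prod ν.toMeasure, ⟨?_, ?_⟩, rfl⟩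
    · simp
    · simp
  obtain ⟨c, ⟨π, hπ, rfl⟩, hc⟩ := exists_lt_of_csInf_lt hne (lt_add_of_pos_right _ hε)
  exact ⟨π, hπ, hc⟩

theorem d1_nonneg (μ ν : P1 X) : 0 ≤ d1 μ ν := by
  refine Real.sInf_nonneg ?_
  rintro c ⟨π, -, rfl⟩
  exact integral_nonneg fun _ => dist_nonneg

theorem d1_self (μ : P1 X) : d1 μ μ = 0 := by
  refine le_antisymm ?_ (d1_nonneg μ μ)
  have hm : Measurable fun x : X => (x, x) := measurable_id.prodMk measurable_id
  have hc : IsCoupling μ μ (μ.toMeasure.map fun x => (x, x)) := by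
    constructor
    · rw [Measure.map_map measurable_fst hm]; exact Measure.map_id
    · rw [Measure.map_map measurable_snd hm]; exact Measure.map_id
  refine (d1_le hc).trans_eq ?_
  rw [integral_map hm.aemeasurable (continuous_fst.dist continuous_snd).aestronglyMeasurable]
  simp

theorem d1_comm_le (μ ν : P1 X) : d1 ν μ ≤ d1 μ ν := by
  refine le_of_forall_pos_le_add fun ε hε => ?_
  obtain ⟨π, hπ, h⟩ := exists_coupling_lt μ ν hε
  refine ((d1_le hπ.swap).trans_eq ?_).trans h.le
  rw [integral_map measurable_swap.aemeasurable
    (continuous_fst.dist continuous_snd).aestronglyMeasurable]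
  simp [dist_comm]

/-- Gluing of couplings. -/
theorem exists_glue {μ ν ρ : P1 X} {π σ : Measure (X × X)} (hπ : IsCoupling μ ν π)
    (hσ : IsCoupling ν ρ σ) : ∃ τ : Measure ((X × X) × X),
      τ.map Prod.fst = π ∧ τ.map (fun z => (z.1.2, z.2)) = σ := by
  have := hπ.isProb
  have := hσ.isProb
  have : Nonempty X := ⟨μ.moment.choose⟩
  have hσ1 : σ.fst = ν.toMeasure := hσ.1
  have hm : Measurable fun z : (X × X) × X => (z.1.2, z.2) :=
    (measurable_snd.comp measurable_fst).prodMk measurable_snd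
  refine ⟨π ⊗ₘ (σ.condKernel.comap Prod.snd measurable_snd), ?_, ?_⟩
  · exact Measure.fst_compProd _ _
  · ext s hs
    rw [Measure.map_apply hm hs, Measure.compProd_apply (hm hs)]
    conv_rhs => rw [← σ.disintegrate σ.condKernel, Measure.compProd_apply hs, hσ1, ← hπ.2]
    rw [lintegral_map (ProbabilityTheory.Kernel.measurable_kernel_prodMk_left hs) measurable_snd]
    rfl

theorem d1_triangle (μ ν ρ : P1 X) : d1 μ ρ ≤ d1 μ ν + d1 ν ρ := by
  refine le_of_forall_pos_le_add fun ε hε => ?_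
  obtain ⟨π, hπ, h1⟩ := exists_coupling_lt μ ν (half_pos hε)
  obtain ⟨σ, hσ, h2⟩ := exists_coupling_lt ν ρ (half_pos hε)
  obtain ⟨τ, hτ1, hτ2⟩ := exists_glue hπ hσ
  have m1 : Measurable fun z : (X × X) × X => z.1 := measurable_fst
  have m2 : Measurable fun z : (X × X) × X => (z.1.2, z.2) :=
    (measurable_snd.comp measurable_fst).prodMk measurable_snd
  have m3 : Measurable fun z : (X × X) × X => (z.1.1, z.2) :=
    (measurable_fst.comp measurable_fst).prodMk measurable_snd
  have hc : IsCoupling μ ρ (τ.map fun z => (z.1.1, z.2)) := by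
    constructor
    · rw [Measure.map_map measurable_fst m3, ← hπ.1, ← hτ1,
        Measure.map_map measurable_fst measurable_fst]
      rfl
    · rw [Measure.map_map measurable_snd m3, ← hσ.2, ← hτ2,
        Measure.map_map measurable_snd m2]
      rfl
  have i1 : Integrable (fun z : (X × X) × X => dist z.1.1 z.1.2) τ := by
    have := hπ.integrable
    rw [← hτ1] at this
    exact this.comp_measurable m1
  have i2 : Integrable (fun z : (X × X) × X => dist z.1.2 z.2) τ := by
    have := hσ.integrable
    rw [← hτ2] at this
    exact this.comp_measurable m2
  have i3 : Integrable (fun z : (X × X) × X => dist z.1.1 z.2) τ :=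
    hc.integrable.comp_measurable m3
  have cd : Continuous fun z : X × X => dist z.1 z.2 := continuous_fst.dist continuous_snd
  have e1 : ∫ z, dist z.1 z.2 ∂π = ∫ z, dist z.1.1 z.1.2 ∂τ := by
    rw [← hτ1, integral_map m1.aemeasurable cd.aestronglyMeasurable]
  have e2 : ∫ z, dist z.1 z.2 ∂σ = ∫ z, dist z.1.2 z.2 ∂τ := by
    rw [← hτ2, integral_map m2.aemeasurable cd.aestronglyMeasurable]
  have key : d1 μ ρ ≤ ∫ z, dist z.1.1 z.1.2 ∂τ + ∫ z, dist z.1.2 z.2 ∂τ := by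
    refine (d1_le hc).trans ?_
    rw [integral_map m3.aemeasurable cd.aestronglyMeasurable, ← integral_add i1 i2]
    exact integral_mono i3 (i1.add i2) fun z => dist_triangle _ _ _
  linarith

/-- `P1 X` is equipped with the distance `d₁`. -/
noncomputable instance : PseudoMetricSpace (P1 X) where
  dist := d1
  dist_self := d1_self
  dist_comm μ ν := le_antisymm (d1_comm_le ν μ) (d1_comm_le μ ν)
  dist_triangle := d1_triangle

end Metric

end P1

/-! ### Data and assumptions -/

/-- `ℝⁿ` with the maximum norm. -/
abbrev Vec (n : ℕ) := Fin n → ℝ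

/-- The data of the mean field game: state space `ℝᵈ`, control space `ℝʳ`, `d = r + s`.
The bijection `rows` lists the coordinates of the state: `rows (inl j)`, `j = 1, …, r`, are the
distinguished rows `i₁, …, i_r` of `B`, and `rows (inr j)` are the remaining ones. -/
structure Data (d r s : ℕ) where
  T : ℝ
  T_pos : 0 < T
  p : ℝ
  one_lt_p : 1 < p
  A : ℝ → Vec d → Vec d
  B : ℝ → Vec d → Matrix (Fin d) (Fin r) ℝ
  ℓ : ℝ → Vec r → Vec d → P1 (Vec d) → ℝ
  g : Vec d → P1 (Vec d) → ℝ
  m₀ : Measure (Vec d)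
  m₀_prob : IsProbabilityMeasure m₀
  rows : Fin r ⊕ Fin s ≃ Fin d

namespace Data

section Assumptions
variable {d r s : ℕ} (D : Data d r s)

/-- Continuity, growth, Lipschitz continuity in the state, convexity and continuous
differentiability in the control of the running cost. -/
structure H1 : Prop where
  continuous : ContinuousOn
    (fun z : ℝ × Vec r × Vec d × P1 (Vec d) => D.ℓ z.1 z.2.1 z.2.2.1 z.2.2.2)
    (Icc 0 D.T ×ˢ univ)
  growth : ∃ lo > 0, ∃ up > 0, ∃ C > 0, ∀ t ∈ Icc 0 D.T, ∀ a x μ,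
    lo * ‖a‖ ^ D.p - C ≤ D.ℓ t a x μ ∧ D.ℓ t a x μ ≤ up * ‖a‖ ^ D.p + C
  lipschitz : ∃ L > 0, ∀ t ∈ Icc 0 D.T, ∀ a μ x y,
    |D.ℓ t a x μ - D.ℓ t a y μ| ≤ L * (1 + ‖a‖ ^ D.p) * ‖x - y‖
  convex : ∀ t ∈ Icc 0 D.T, ∀ x μ, ConvexOn ℝ univ fun a => D.ℓ t a x μ
  contDiff : ∀ t ∈ Icc 0 D.T, ∀ x μ, ContDiff ℝ 1 fun a => D.ℓ t a x μ

/-- Continuity, lower bound and Lipschitz continuity in the state of the final cost. -/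
structure H2 : Prop where
  continuous : Continuous fun z : Vec d × P1 (Vec d) => D.g z.1 z.2
  lower : ∃ c : ℝ, ∀ x μ, c ≤ D.g x μ
  lipschitz : ∃ L > 0, ∀ μ x y, |D.g x μ - D.g y μ| ≤ L * ‖x - y‖

/-- Assumptions on the dynamics. The bounds on `B` say that the matrix norm induced by the
maximum norms of `B t x - B t y`, respectively `B t x`, is at most `L * ‖x - y‖`,
respectively `C`. -/
structure H3 : Prop where
  continuous_A : ContinuousOn (fun z : ℝ × Vec d => D.A z.1 z.2) (Icc 0 D.T ×ˢ univ)
  continuous_B : ContinuousOn (fun z : ℝ × Vec d => D.B z.1 z.2) (Icc 0 D.T ×ˢ univ)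
  lipschitz_A : ∃ L > 0, ∀ t ∈ Icc 0 D.T, ∀ x y, ‖D.A t x - D.A t y‖ ≤ L * ‖x - y‖
  lipschitz_B : ∃ L > 0, ∀ t ∈ Icc 0 D.T, ∀ x y, ∀ a : Vec r,
    ‖(D.B t x - D.B t y) *ᵥ a‖ ≤ L * ‖x - y‖ * ‖a‖
  bounded_B : ∃ C > 0, ∀ t ∈ Icc 0 D.T, ∀ x, ∀ a : Vec r, ‖D.B t x *ᵥ a‖ ≤ C * ‖a‖
  independent_rows : ∀ t ∈ Icc 0 D.T, ∀ x,
    LinearIndependent ℝ fun j : Fin r => D.B t x (D.rows (Sum.inl j))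

/-- The initial distribution has compact support. -/
def H4 : Prop := IsCompact D.m₀.support

end Assumptions

/-! ### The optimal control problem and Lagrangian equilibria -/

section Continuous
variable {d r s : ℕ} (D : Data d r s)

/-- The path space `C([0,T]; ℝᵈ)` with the supremum norm. -/
abbrev PathSpace : Type := C(Icc (0 : ℝ) D.T, Vec d)

/-- The space `C([0,T]; 𝒫₁(ℝᵈ))` with the topology of uniform convergence. -/
abbrev Flow : Type := C(Icc (0 : ℝ) D.T, P1 (Vec d))

/-- Evaluation at a real time of a function on `[0,T]`; times outside `[0,T]` are never used. -/
noncomputable def atTime {Y : Type*} (f : Icc (0 : ℝ) D.T → Y) (t : ℝ) : Y :=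
  f (projIcc 0 D.T D.T_pos.le t)

/-- `γ` belongs to `W^{1,p}([a,b]; ℝᵈ)` and has derivative `w ∈ Lᵖ([a,b]; ℝᵈ)`. -/
def HasW1pDeriv (a b : ℝ) (γ w : ℝ → Vec d) : Prop :=
  MemLp w (ENNReal.ofReal D.p) (volume.restrict (Icc a b)) ∧
    ∀ t ∈ Icc a b, γ t = γ a + ∫ τ in a..t, w τ

/-- `γ ∈ W^{1,p}([t,T]; ℝᵈ)` and `α ∈ Lᵖ([t,T]; ℝʳ)` satisfy `γ(t) = x` and
`γ'(τ) = A(τ, γ(τ)) + B(τ, γ(τ)) α(τ)` for almost every `τ ∈ (t,T)`. -/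
structure IsTrajectory (t : ℝ) (x : Vec d) (γ : ℝ → Vec d) (α : ℝ → Vec r) : Prop where
  control : MemLp α (ENNReal.ofReal D.p) (volume.restrict (Icc t D.T))
  dynamics : ∃ w : ℝ → Vec d, D.HasW1pDeriv t D.T γ w ∧
    ∀ᵐ τ ∂(volume.restrict (Icc t D.T)), w τ = D.A τ (γ τ) + D.B τ (γ τ) *ᵥ α τ
  initial : γ t = x

/-- The cost of a trajectory on `[t,T]` when the population evolves according to `m`. -/
noncomputable def cost (m : D.Flow) (t : ℝ) (γ : ℝ → Vec d) (α : ℝ → Vec r) : ℝ :=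
  (∫ τ in t..D.T, D.ℓ τ (α τ) (γ τ) (D.atTime m τ)) + D.g (γ D.T) (D.atTime m D.T)

/-- The value function associated with `m`. -/
noncomputable def value (m : D.Flow) (t : ℝ) (x : Vec d) : ℝ :=
  sInf {c : ℝ | ∃ γ α, D.IsTrajectory t x γ α ∧ c = D.cost m t γ α}

/-- `(γ, α)` solves the optimal control problem on `[0,T]` with initial state `x`. -/
def IsOptimal (m : D.Flow) (x : Vec d) (γ : ℝ → Vec d) (α : ℝ → Vec r) : Prop :=
  D.IsTrajectory 0 x γ α ∧
    ∀ γ' α', D.IsTrajectory 0 x γ' α' → D.cost m 0 γ α ≤ D.cost m 0 γ' α'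

end Continuous

end Data

noncomputable instance pathMeasurableSpace (T : ℝ) (d : ℕ) :
    MeasurableSpace C(Icc (0 : ℝ) T, Vec d) := borel _

instance pathBorelSpace (T : ℝ) (d : ℕ) : BorelSpace C(Icc (0 : ℝ) T, Vec d) := ⟨rfl⟩

namespace Data

section Equilibrium
variable {d r s : ℕ} (D : Data d r s)

/-- `m t` is the image of `ξ` under evaluation at time `t`, for every `t ∈ [0,T]`. -/
def IsMarginalFlow (ξ : ProbabilityMeasure D.PathSpace) (m : D.Flow) : Prop :=
  ∀ t, (m t).toMeasure = (ξ : Measure D.PathSpace).map fun γ => γ t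

/-- `ξ` is a Lagrangian MFG equilibrium. -/
structure IsLagrangianEquilibrium (ξ : ProbabilityMeasure D.PathSpace) : Prop where
  moment : ∃ γ₀ : D.PathSpace, Integrable (fun γ => dist γ γ₀) (ξ : Measure D.PathSpace)
  initial : (ξ : Measure D.PathSpace).map (fun γ : D.PathSpace => D.atTime γ 0) = D.m₀
  optimal : ∃ m : D.Flow, D.IsMarginalFlow ξ m ∧
    ∀ᵐ γ : D.PathSpace ∂(ξ : Measure D.PathSpace), ∃ α : ℝ → Vec r,
      D.IsOptimal m (D.atTime γ 0) (D.atTime γ) α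

end Equilibrium

/-! ### The semi-discrete control problem and the bound on its optimal controls -/

section SemiDiscrete
variable {d r s : ℕ} (D : Data d r s)

/-- The state at step `k + i` of the Euler scheme with `N` time steps, started at `x` at step `k`
and driven by the controls `α k, α (k + 1), …`. -/
noncomputable def eulerState (N k : ℕ) (x : Vec d) (α : ℕ → Vec r) : ℕ → Vec d
  | 0 => x
  | i + 1 => eulerState N k x α i + (D.T / N) •
      (D.A ((k + i : ℕ) * (D.T / N)) (eulerState N k x α i) +
        D.B ((k + i : ℕ) * (D.T / N)) (eulerState N k x α i) *ᵥ α (k + i))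

/-- The discrete time cost `J_{k,x}`; it only depends on `α k, …, α (N - 1)`. -/
noncomputable def eulerCost (N : ℕ) (m : D.Flow) (k : ℕ) (x : Vec d) (α : ℕ → Vec r) : ℝ :=
  (D.T / N) * ∑ i ∈ Finset.range (N - k),
      D.ℓ ((k + i : ℕ) * (D.T / N)) (α (k + i)) (D.eulerState N k x α i)
        (D.atTime m ((k + i : ℕ) * (D.T / N)))
    + D.g (D.eulerState N k x α (N - k)) (D.atTime m D.T)

/-- `C` bounds every minimizer of every discrete time control problem, uniformly in the number of
time steps, the flow `m`, the initial step and the initial state. -/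
def IsControlBound (C : ℝ) : Prop :=
  ∀ N : ℕ, 0 < N → ∀ m : D.Flow, ∀ k < N, ∀ x, ∀ α : ℕ → Vec r,
    (∀ α' : ℕ → Vec r, D.eulerCost N m k x α ≤ D.eulerCost N m k x α') →
    ∀ j, k ≤ j → j < N → ‖α j‖ ≤ C

end SemiDiscrete

end Data

/-! ### The fully discrete mean field game -/

/-- The grid `N⁻¹ ℤⁿ`. -/
def grid (N n : ℕ) : Set (Vec n) := {x | ∃ i : Fin n → ℤ, ∀ j, x j = i j / N}

/-- The interpolation basis `(β_z)` indexed by the nodes `z ∈ N⁻¹ ℤⁿ`. Only the properties of a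
`ℚ₁` basis listed here are required, so the family may come from any mesh. -/
structure IsInterpolationBasis (N n : ℕ) (CI : ℝ) (β : Vec n → Vec n → ℝ) : Prop where
  nonneg : ∀ z ∈ grid N n, ∀ y, 0 ≤ β z y
  self : ∀ z ∈ grid N n, β z z = 1
  other : ∀ z ∈ grid N n, ∀ z' ∈ grid N n, z' ≠ z → β z z' = 0
  sum_eq_one : ∀ y, HasSum (fun z : grid N n => β z y) 1
  support : ∀ z ∈ grid N n, tsupport (β z) ⊆ Metric.closedBall z (CI * (1 / N))

/-- Discretization parameters: `Nt` time steps, space step `1 / Ns`, entropy weight `ε` and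
interpolation basis `β`. -/
structure Discretization (s : ℕ) where
  Nt : ℕ
  Nt_pos : 0 < Nt
  Ns : ℕ
  Ns_pos : 0 < Ns
  ε : ℝ
  ε_pos : 0 < ε
  β : Vec s → Vec s → ℝ

/-- `q` restricts to a probability vector on the finite set `F`. -/
def IsProbOn {Y : Type*} (F : Set Y) (q : Y → ℝ) : Prop :=
  (∀ y ∈ F, 0 ≤ q y) ∧ ∑ᶠ y ∈ F, q y = 1

namespace Data

section Scheme
variable {d r s : ℕ} (D : Data d r s) (h : Discretization s)

/-- The time step. -/
noncomputable def dt : ℝ := D.T / h.Nt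

/-- The space step. -/
noncomputable def dx (h : Discretization s) : ℝ := 1 / h.Ns

/-- The grid times. -/
noncomputable def time (k : ℕ) : ℝ := k * D.dt h

/-- The space step is at most the time step and `β` is an interpolation basis. -/
def Admissible (CI : ℝ) : Prop :=
  dx h ≤ D.dt h ∧ IsInterpolationBasis h.Ns s CI h.β

/-- The component `x₁ ∈ ℝʳ` of `x`. -/
def fst (x : Vec d) : Vec r := fun j => x (D.rows (Sum.inl j))

/-- The component `x₂ ∈ ℝˢ` of `x`. -/
def snd (x : Vec d) : Vec s := fun j => x (D.rows (Sum.inr j))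

/-- The state with components `y₁` and `y₂`. -/
def join (y₁ : Vec r) (y₂ : Vec s) : Vec d := fun i => Sum.elim y₁ y₂ (D.rows.symm i)

/-- The block of `B` made of the distinguished rows. -/
def B₁ (t : ℝ) (x : Vec d) : Matrix (Fin r) (Fin r) ℝ :=
  (D.B t x).submatrix (fun j => D.rows (Sum.inl j)) id

/-- The block of `B` made of the remaining rows. -/
def B₂ (t : ℝ) (x : Vec d) : Matrix (Fin s) (Fin r) ℝ :=
  (D.B t x).submatrix (fun j => D.rows (Sum.inr j)) id

/-- The control `α(k, x, y₁)` that steers the first component from `x₁` to `y₁`. -/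
noncomputable def ctrl (k : ℕ) (x : Vec d) (y₁ : Vec r) : Vec r :=
  (D.B₁ (D.time h k) x)⁻¹ *ᵥ
    ((D.dt h)⁻¹ • (y₁ - D.fst x) - D.fst (D.A (D.time h k) x))

/-- The resulting second component at the next step. -/
noncomputable def next₂ (k : ℕ) (x : Vec d) (y₁ : Vec r) : Vec s :=
  D.snd x + D.dt h •
    (D.snd (D.A (D.time h k) x) + D.B₂ (D.time h k) x *ᵥ D.ctrl h k x y₁)

/-- The set `𝒮¹_{k+1}(x)`, where `C` is the bound on the controls. -/
def S₁ (C : ℝ) (k : ℕ) (x : Vec d) : Set (Vec r) :=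
  {y₁ | y₁ ∈ grid h.Ns r ∧ ‖D.ctrl h k x y₁‖ ≤ C}

/-- The set `𝒮²_{k+1}(x, y₁)`. -/
def S₂ (k : ℕ) (x : Vec d) (y₁ : Vec r) : Set (Vec s) :=
  {y₂ | y₂ ∈ grid h.Ns s ∧ D.next₂ h k x y₁ ∈ tsupport (h.β y₂)}

/-- The set `𝒮_{k+1}(x)`. -/
def SNext (C : ℝ) (k : ℕ) (x : Vec d) : Set (Vec d) :=
  {y | D.fst y ∈ D.S₁ h C k x ∧ D.snd y ∈ D.S₂ h k x (D.fst y)}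

/-- The set `𝒮_k` of states at step `k`, started from the grid points of `K₀`. -/
def S (C : ℝ) (K₀ : Set (Vec d)) : ℕ → Set (Vec d)
  | 0 => grid h.Ns d ∩ K₀
  | k + 1 => ⋃ x ∈ S C K₀ k, D.SNext h C k x

/-- The interpolant of `φ(y₁, ·)` at the point `next₂`. -/
noncomputable def interp (k : ℕ) (x : Vec d) (y₁ : Vec r) (φ : Vec d → ℝ) : ℝ :=
  ∑ᶠ y₂ ∈ D.S₂ h k x y₁, h.β y₂ (D.next₂ h k x y₁) * φ (D.join y₁ y₂)

/-- The function of `q ∈ 𝒫(𝒮¹_{k+1}(x))` minimized in the discrete dynamic programming equation. -/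
noncomputable def stepCost (C : ℝ) (M : ℕ → P1 (Vec d)) (V : ℕ → Vec d → ℝ) (k : ℕ) (x : Vec d)
    (q : Vec r → ℝ) : ℝ :=
  (∑ᶠ y₁ ∈ D.S₁ h C k x, q y₁ *
      (D.dt h * D.ℓ (D.time h k) (D.ctrl h k x y₁) x (M k) + D.interp h k x y₁ (V (k + 1))))
    + h.ε * ∑ᶠ y₁ ∈ D.S₁ h C k x, q y₁ * Real.log (q y₁)

/-- `V` is the discrete value function associated with `M`, and `q k x` is the minimizer in the
dynamic programming equation at step `k` and state `x`. -/
structure SolvesHJB (C : ℝ) (K₀ : Set (Vec d)) (M : ℕ → P1 (Vec d)) (V : ℕ → Vec d → ℝ)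
    (q : ℕ → Vec d → Vec r → ℝ) : Prop where
  terminal : ∀ x ∈ D.S h C K₀ h.Nt, V h.Nt x = D.g x (M h.Nt)
  prob : ∀ k < h.Nt, ∀ x ∈ D.S h C K₀ k, IsProbOn (D.S₁ h C k x) (q k x)
  minimizer : ∀ k < h.Nt, ∀ x ∈ D.S h C K₀ k, ∀ q', IsProbOn (D.S₁ h C k x) q' →
    D.stepCost h C M V k x (q k x) ≤ D.stepCost h C M V k x q'
  value_eq : ∀ k < h.Nt, ∀ x ∈ D.S h C K₀ k, V k x = D.stepCost h C M V k x (q k x)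

/-- The transition probabilities `P_k(x, y)` built from the weights `q`. -/
noncomputable def transition (C : ℝ) (q : ℕ → Vec d → Vec r → ℝ) (k : ℕ) (x y : Vec d) : ℝ :=
  (D.SNext h C k x).indicator
    (fun y => q k x (D.fst y) * h.β (D.snd y) (D.next₂ h k x (D.fst y))) y

/-- `M'` is the sequence of distributions on `𝒮_0, …, 𝒮_{Nt}` of the Markov chain with transition
probabilities given by `q` and started from the discretization of `m₀`, which gives to `x` the
mass of the cell of centre `x`. -/
structure IsPropagated (C : ℝ) (K₀ : Set (Vec d)) (q : ℕ → Vec d → Vec r → ℝ)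
    (M' : ℕ → P1 (Vec d)) : Prop where
  support : ∀ k ≤ h.Nt, (M' k).toMeasure (D.S h C K₀ k)ᶜ = 0
  initial : ∀ x ∈ D.S h C K₀ 0,
    (M' 0).toMeasure.real {x} = D.m₀.real (Metric.closedBall x (dx h / 2))
  step : ∀ k < h.Nt, ∀ y ∈ D.S h C K₀ (k + 1), (M' (k + 1)).toMeasure.real {y} =
    ∑ᶠ x ∈ D.S h C K₀ k, D.transition h C q k x y * (M' k).toMeasure.real {x}

/-- `M` is a solution of the discrete mean field game, i.e. a fixed point of the best response
mapping, with discrete value function `V` and optimal weights `q`. -/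
def IsDiscreteEquilibrium (C : ℝ) (K₀ : Set (Vec d)) (M : ℕ → P1 (Vec d)) (V : ℕ → Vec d → ℝ)
    (q : ℕ → Vec d → Vec r → ℝ) : Prop :=
  D.SolvesHJB h C K₀ M V q ∧ D.IsPropagated h C K₀ q M

/-- The paths that visit `𝒮_k` at the `k`-th grid time and are affine in between. -/
def gridPaths (C : ℝ) (K₀ : Set (Vec d)) : Set D.PathSpace :=
  {γ | (∀ k ≤ h.Nt, D.atTime γ (D.time h k) ∈ D.S h C K₀ k) ∧
    ∀ k < h.Nt, ∀ θ ∈ Icc (0 : ℝ) 1, D.atTime γ (D.time h k + θ * D.dt h) =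
      (1 - θ) • D.atTime γ (D.time h k) + θ • D.atTime γ (D.time h (k + 1))}

/-- The law on paths of the interpolated Markov chain. -/
noncomputable def pathMeasure (C : ℝ) (K₀ : Set (Vec d)) (M : ℕ → P1 (Vec d))
    (q : ℕ → Vec d → Vec r → ℝ) : Measure D.PathSpace :=
  Measure.sum fun γ : D.gridPaths h C K₀ =>
    ENNReal.ofReal ((M 0).toMeasure.real {D.atTime γ.1 0} *
      ∏ k ∈ Finset.range h.Nt,
        D.transition h C q k (D.atTime γ.1 (D.time h k)) (D.atTime γ.1 (D.time h (k + 1)))) •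
      Measure.dirac γ.1

end Scheme

end Data

end MFG

/-!
Lagrangian equilibria are obtained as limits of the laws of interpolated Markov chains, for which
three facts are needed: the laws are tight, the discrete value functions converge, and the limit
only charges optimal paths.

*Control bound.* Changing an optimal control of the Euler scheme to zero at one step perturbs the
later states by an amount that is controlled by Gronwall's inequality. The perturbation of the cost
is Lipschitz in this amount, with a constant governed by the discrete `Lᵖ` norm of the control,
which is bounded independently of the number of steps (`Bounds.exists_energy_bound`). Comparison
with the `p`-growth of the running cost yields `Bounds.exists_controlBound`.

*Compactness.* Under a bound on the controls the interpolated chains take values in a fixed ball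
and have a common Lipschitz constant (`Bounds.norm_le_of_mem_S`, `Bounds.pathOf_mem_lipPaths`).
The path measures are therefore carried by one compact set of paths, narrow limits are carried by
the same set, and their marginal flows converge uniformly for `d₁`. For the last point, measures
carried by a fixed compact set which converge narrowly also converge for `d₁`: cutting the compact
set into small continuity sets, most of the mass is transported within the cells
(`P1.tendsto_of_tendsto_toPM`).

*Convergence of the values.* For the upper bound (`exists_value_upper`), an almost optimal
trajectory is replaced by an optimal control of the Euler scheme, which obeys the control bound. It
is shrunk slightly so that rounding the next first component to the grid, which alters the control
by `O(Δx / Δt)`, keeps it admissible; interpolation errors are of size `Δx` at each step and sum up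
to `O(Δx / Δt)`. For the lower bound (`exists_value_lower`), the dynamic programming equation
provides a chain whose cost is at most the discrete value plus the total entropy, which is
negligible; its affine interpolation almost solves the controlled equation and is close to an
actual trajectory.

*Optimality of limit paths.* The expected cost of the chain under the equilibrium weights exceeds
the initial value by at most the total entropy, and every chain costs at least its initial value up
to a small error. By Markov's inequality, chains whose cost is far from the value carry little mass
(`mul_pathMeasure_le`). A neighbourhood of a path in the support of a limit keeps a positive mass,
and so contains interpolations of almost optimal chains. Their limit is an optimal trajectory
(`exists_isOptimal_of_limit`): over a short time step an approximate trajectory moves as with the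
mean of its controls, and by convexity the running cost of the mean control is at most the cost
incurred. At the points where the limit path is differentiable this yields the control which
produces its derivative, and lower semicontinuity of the cost.
-/

namespace MFG

/-! ### Elementary inequalities -/

theorem gronwall_range {u b c : ℕ → ℝ} {n : ℕ} (hu : ∀ i < n, u (i + 1) ≤ (1 + c i) * u i + b i)
    (h0 : 0 ≤ u 0) (hc : ∀ i < n, 0 ≤ c i) (hb : ∀ i < n, 0 ≤ b i) :
    ∀ i ≤ n, u i ≤ (u 0 + ∑ j ∈ Finset.range i, b j) *
      Real.exp (∑ j ∈ Finset.range i, c j) := by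
  intro i
  induction i with
  | zero => simp
  | succ i ih =>
    intro hi
    have hi' : i < n := hi
    have h1 := ih hi'.le
    have hci := hc i hi'
    have hbi := hb i hi'
    have hS : 0 ≤ ∑ j ∈ Finset.range i, c j :=
      Finset.sum_nonneg fun j hj => hc j ((Finset.mem_range.1 hj).trans hi')
    have hSb : 0 ≤ ∑ j ∈ Finset.range i, b j :=
      Finset.sum_nonneg fun j hj => hb j ((Finset.mem_range.1 hj).trans hi')
    rw [Finset.sum_range_succ, Finset.sum_range_succ, Real.exp_add]
    have e1 : 1 + c i ≤ Real.exp (c i) := by linarith [Real.add_one_le_exp (c i)]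
    have e2 : 1 ≤ Real.exp (∑ j ∈ Finset.range i, c j) := Real.one_le_exp hS
    have e3 : 1 ≤ Real.exp (c i) := Real.one_le_exp hci
    set E := Real.exp (∑ j ∈ Finset.range i, c j)
    set F := Real.exp (c i)
    have hEF : 1 ≤ E * F := one_le_mul_of_one_le_of_one_le e2 e3
    calc u (i + 1) ≤ (1 + c i) * u i + b i := hu i hi'
      _ ≤ (1 + c i) * ((u 0 + ∑ j ∈ Finset.range i, b j) * E) + b i := by gcongr
      _ ≤ F * ((u 0 + ∑ j ∈ Finset.range i, b j) * E) + b i * (E * F) := by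
        gcongr
        exact le_mul_of_one_le_right hbi hEF
      _ = _ := by ring

/-- A power with exponent greater than one dominates linear growth. -/
theorem exists_linear_le_rpow {p : ℝ} (hp : 1 < p) {η : ℝ} (hη : 0 < η) :
    ∃ K : ℝ, 0 ≤ K ∧ ∀ y : ℝ, 0 ≤ y → y ≤ η * y ^ p + K := by
  refine ⟨(1 / η) ^ (1 / (p - 1)), by positivity, fun y hy => ?_⟩
  have hp1 : 0 < p - 1 := by linarith
  rcases le_or_gt y ((1 / η) ^ (1 / (p - 1))) with h | h
  · have : 0 ≤ η * y ^ p := by positivity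
    linarith
  · have hy0 : 0 < y := lt_of_le_of_lt (by positivity) h
    have h2 : 1 / η ≤ y ^ (p - 1) := by
      have := Real.rpow_le_rpow (by positivity) h.le hp1.le
      rwa [← Real.rpow_mul (by positivity), one_div_mul_cancel hp1.ne', Real.rpow_one] at this
    have h3 : y ^ p = y ^ (p - 1) * y := by
      rw [← Real.rpow_add_one hy0.ne']; congr 1; ring
    have h4 : 1 ≤ η * y ^ (p - 1) := by
      rw [div_le_iff₀ hη] at h2; linarith
    have : y ≤ η * y ^ p := by
      rw [h3, ← mul_assoc]; exact le_mul_of_one_le_left hy h4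
    have : 0 ≤ (1 / η) ^ (1 / (p - 1)) := by positivity
    linarith

namespace Data

variable {d r s : ℕ} {D : Data d r s}

/-! ### Constants of the problem -/

/-- The constants in the assumptions on the data: Lipschitz constants of `A` and `B`, a bound on
`B` and on `A · 0`, growth and Lipschitz constants of the running cost, the Lipschitz constant
and a lower bound of the final cost. -/
structure Bounds (D : Data d r s) where
  (LA LB CB A0 lo up Cl Ll Lg gl : ℝ)
  LA_pos : 0 < LA
  LB_pos : 0 < LB
  CB_pos : 0 < CB
  A0_nonneg : 0 ≤ A0
  lo_pos : 0 < lo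
  up_pos : 0 < up
  Cl_pos : 0 < Cl
  Ll_pos : 0 < Ll
  Lg_pos : 0 < Lg
  A_lip : ∀ t ∈ Icc 0 D.T, ∀ x y, ‖D.A t x - D.A t y‖ ≤ LA * ‖x - y‖
  B_lip : ∀ t ∈ Icc 0 D.T, ∀ x y, ∀ a : Vec r,
    ‖D.B t x *ᵥ a - D.B t y *ᵥ a‖ ≤ LB * ‖x - y‖ * ‖a‖
  B_le : ∀ t ∈ Icc 0 D.T, ∀ x, ∀ a : Vec r, ‖D.B t x *ᵥ a‖ ≤ CB * ‖a‖
  A_zero : ∀ t ∈ Icc 0 D.T, ‖D.A t 0‖ ≤ A0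
  ℓ_ge : ∀ t ∈ Icc 0 D.T, ∀ a x μ, lo * ‖a‖ ^ D.p - Cl ≤ D.ℓ t a x μ
  ℓ_le : ∀ t ∈ Icc 0 D.T, ∀ a x μ, D.ℓ t a x μ ≤ up * ‖a‖ ^ D.p + Cl
  ℓ_lip : ∀ t ∈ Icc 0 D.T, ∀ a μ x y,
    |D.ℓ t a x μ - D.ℓ t a y μ| ≤ Ll * (1 + ‖a‖ ^ D.p) * ‖x - y‖
  g_ge : ∀ x μ, gl ≤ D.g x μ
  g_lip : ∀ μ x y, |D.g x μ - D.g y μ| ≤ Lg * ‖x - y‖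

theorem exists_bounds (h1 : D.H1) (h2 : D.H2) (h3 : D.H3) : Nonempty D.Bounds := by
  obtain ⟨lo, hlo, up, hup, Cl, hCl, hg⟩ := h1.growth
  obtain ⟨Ll, hLl, hl⟩ := h1.lipschitz
  obtain ⟨gl, hgl⟩ := h2.lower
  obtain ⟨Lg, hLg, hgL⟩ := h2.lipschitz
  obtain ⟨LA, hLA, hA⟩ := h3.lipschitz_A
  obtain ⟨LB, hLB, hB⟩ := h3.lipschitz_B
  obtain ⟨CB, hCB, hBb⟩ := h3.bounded_B
  have hc : ContinuousOn (fun t => D.A t 0) (Icc 0 D.T) :=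
    h3.continuous_A.comp (f := fun t : ℝ => (t, (0 : Vec d))) (by fun_prop)
      fun t ht => ⟨ht, mem_univ _⟩
  obtain ⟨A0, hA0⟩ := isCompact_Icc.exists_bound_of_continuousOn hc
  exact ⟨{
    LA := LA, LB := LB, CB := CB, A0 := A0, lo := lo, up := up, Cl := Cl, Ll := Ll, Lg := Lg
    gl := gl
    LA_pos := hLA, LB_pos := hLB, CB_pos := hCB
    A0_nonneg := (norm_nonneg _).trans (hA0 0 ⟨le_rfl, D.T_pos.le⟩)
    lo_pos := hlo, up_pos := hup, Cl_pos := hCl, Ll_pos := hLl, Lg_pos := hLg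
    A_lip := hA
    B_lip := fun t ht x y a => by rw [← Matrix.sub_mulVec]; exact hB t ht x y a
    B_le := hBb, A_zero := hA0
    ℓ_ge := fun t ht a x μ => (hg t ht a x μ).1
    ℓ_le := fun t ht a x μ => (hg t ht a x μ).2
    ℓ_lip := hl, g_ge := hgl, g_lip := hgL }⟩

theorem Bounds.A_le (c : D.Bounds) {t : ℝ} (ht : t ∈ Icc 0 D.T) (x : Vec d) :
    ‖D.A t x‖ ≤ c.A0 + c.LA * ‖x‖ := by
  have h1 := c.A_lip t ht x 0
  have h2 := c.A_zero t ht
  have h3 := norm_le_norm_add_norm_sub' (D.A t x) (D.A t 0)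
  rw [sub_zero] at h1
  linarith

theorem p_pos (D : Data d r s) : 0 < D.p := by linarith [D.one_lt_p]

theorem zero_rpow_p (D : Data d r s) : (0 : ℝ) ^ D.p = 0 := Real.zero_rpow D.p_pos.ne'

/-- Difference of the velocities at two states with two controls. -/
theorem Bounds.velocity_sub_le (c : D.Bounds) {t : ℝ} (ht : t ∈ Icc 0 D.T) (x y : Vec d)
    (a b : Vec r) :
    ‖(D.A t y + D.B t y *ᵥ b) - (D.A t x + D.B t x *ᵥ a)‖ ≤
      (c.LA + c.LB * ‖a‖) * ‖y - x‖ + c.CB * ‖b - a‖ := by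
  have e : (D.A t y + D.B t y *ᵥ b) - (D.A t x + D.B t x *ᵥ a) =
      (D.A t y - D.A t x) + (D.B t y *ᵥ a - D.B t x *ᵥ a) + D.B t y *ᵥ (b - a) := by
    rw [Matrix.mulVec_sub]; abel
  rw [e]
  have h1 := c.A_lip t ht y x
  have h2 := c.B_lip t ht y x a
  have h3 := c.B_le t ht y (b - a)
  have h4 := norm_add₃_le (a := D.A t y - D.A t x) (b := D.B t y *ᵥ a - D.B t x *ᵥ a)
    (c := D.B t y *ᵥ (b - a))
  nlinarith

/-! ### The Euler scheme -/

theorem step_pos (D : Data d r s) {N : ℕ} (hN : 0 < N) : 0 < D.T / N :=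
  div_pos D.T_pos (by exact_mod_cast hN)

theorem step_time_mem (D : Data d r s) {N j : ℕ} (hN : 0 < N) (hj : j ≤ N) :
    (j : ℝ) * (D.T / N) ∈ Icc 0 D.T := by
  have hN' : (0 : ℝ) < N := by exact_mod_cast hN
  have hj' : (j : ℝ) ≤ N := by exact_mod_cast hj
  refine ⟨mul_nonneg (Nat.cast_nonneg _) (D.step_pos hN).le, ?_⟩
  calc (j : ℝ) * (D.T / N) ≤ N * (D.T / N) := by
        gcongr; exact (D.step_pos hN).le
    _ = D.T := by field_simp

theorem card_mul_step_le (D : Data d r s) {N i : ℕ} (hN : 0 < N) (hi : i ≤ N) :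
    (i : ℝ) * (D.T / N) ≤ D.T := (D.step_time_mem hN hi).2

/-- Stability of the Euler scheme with respect to the initial state and the controls. -/
theorem Bounds.eulerState_sub_le (c : D.Bounds) {N k : ℕ} (hN : 0 < N) (x y : Vec d)
    (α β : ℕ → Vec r) {i : ℕ} (hi : k + i ≤ N) :
    ‖D.eulerState N k y β i - D.eulerState N k x α i‖ ≤
      (‖y - x‖ + ∑ j ∈ Finset.range i, D.T / N * (c.CB * ‖β (k + j) - α (k + j)‖)) *
        Real.exp (∑ j ∈ Finset.range i, D.T / N * (c.LA + c.LB * ‖α (k + j)‖)) := by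
  have hΔ := (D.step_pos hN).le
  have hLA := c.LA_pos.le
  have hLB := c.LB_pos.le
  have hCB := c.CB_pos.le
  refine gronwall_range (u := fun i => ‖D.eulerState N k y β i - D.eulerState N k x α i‖)
    (n := i) ?_ (norm_nonneg _) (fun j _ => by positivity) (fun j _ => by positivity) i le_rfl
  intro j hj
  have ht := D.step_time_mem hN (show k + j ≤ N by omega)
  have h := c.velocity_sub_le ht (D.eulerState N k x α j) (D.eulerState N k y β j)
    (α (k + j)) (β (k + j))
  simp only [eulerState]
  set X := D.eulerState N k x α j
  set Y := D.eulerState N k y β j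
  rw [add_sub_add_comm, ← smul_sub]
  refine (norm_add_le _ _).trans ?_
  rw [norm_smul, Real.norm_of_nonneg hΔ]
  nlinarith [mul_le_mul_of_nonneg_left h hΔ]

theorem eulerState_congr (D : Data d r s) (N k : ℕ) (x : Vec d) {α β : ℕ → Vec r} {i : ℕ}
    (h : ∀ j, k ≤ j → j < k + i → α j = β j) :
    D.eulerState N k x α i = D.eulerState N k x β i := by
  induction i with
  | zero => rfl
  | succ i ih =>
    simp only [eulerState]
    rw [ih fun j h1 h2 => h j h1 (by omega), h (k + i) (by omega) (by omega)]

theorem eulerCost_congr (D : Data d r s) {N k : ℕ} (m : D.Flow) (x : Vec d) {α β : ℕ → Vec r}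
    (h : ∀ j, k ≤ j → j < N → α j = β j) :
    D.eulerCost N m k x α = D.eulerCost N m k x β := by
  unfold eulerCost
  congr 1
  · congr 1
    refine Finset.sum_congr rfl fun i hi => ?_
    have := Finset.mem_range.1 hi
    rw [D.eulerState_congr N k x (i := i) fun j h1 h2 => h j h1 (by omega),
      h (k + i) (by omega) (by omega)]
  · rw [D.eulerState_congr N k x (i := N - k) fun j h1 h2 => h j h1 (by omega)]

theorem eulerState_shift (D : Data d r s) (N k : ℕ) (x : Vec d) (α : ℕ → Vec r) (i : ℕ) :
    D.eulerState N k x α (i + 1) =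
      D.eulerState N (k + 1) (D.eulerState N k x α 1) α i := by
  induction i with
  | zero => rfl
  | succ i ih =>
    rw [eulerState, ih]
    conv_rhs => rw [eulerState]
    rw [show k + (i + 1) = k + 1 + i by ring]

/-- Dynamic programming for the Euler cost of a fixed sequence of controls. -/
theorem eulerCost_step (D : Data d r s) {N k : ℕ} (hk : k < N) (m : D.Flow) (x : Vec d)
    (α : ℕ → Vec r) :
    D.eulerCost N m k x α =
      D.T / N * D.ℓ (k * (D.T / N)) (α k) x (D.atTime m (k * (D.T / N))) +
        D.eulerCost N m (k + 1) (D.eulerState N k x α 1) α := by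
  unfold eulerCost
  have e : N - k = (N - (k + 1)) + 1 := by omega
  rw [e, Finset.sum_range_succ', D.eulerState_shift]
  have : ∀ i, D.ℓ ((k + (i + 1) : ℕ) * (D.T / N)) (α (k + (i + 1)))
      (D.eulerState N k x α (i + 1)) (D.atTime m ((k + (i + 1) : ℕ) * (D.T / N))) =
      D.ℓ ((k + 1 + i : ℕ) * (D.T / N)) (α (k + 1 + i))
      (D.eulerState N (k + 1) (D.eulerState N k x α 1) α i)
      (D.atTime m ((k + 1 + i : ℕ) * (D.T / N))) := by
    intro i
    rw [D.eulerState_shift, show k + (i + 1) = k + 1 + i by ring]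
  simp only [this]
  simp [eulerState]
  ring

theorem eulerCost_self (D : Data d r s) {N : ℕ} (m : D.Flow) (x : Vec d) (α : ℕ → Vec r) :
    D.eulerCost N m N x α = D.g x (D.atTime m D.T) := by
  simp [eulerCost, eulerState]

/-- The Euler cost depends in a Lipschitz way on the initial state and on the controls, as long as
these are bounded; the dependence of the running cost on the control is left as it is. -/
theorem Bounds.eulerCost_sub_le (c : D.Bounds) {N k : ℕ} (hN : 0 < N) (m : D.Flow)
    (x y : Vec d) (α β : ℕ → Vec r) (K δ : ℝ)
    (hδ : ∀ i ≤ N - k, ‖D.eulerState N k y β i - D.eulerState N k x α i‖ ≤ δ)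
    (hK : ∑ i ∈ Finset.range (N - k), D.T / N * ‖α (k + i)‖ ^ D.p ≤ K) :
    D.eulerCost N m k y β - D.eulerCost N m k x α ≤
      D.T / N * ∑ i ∈ Finset.range (N - k),
        (D.ℓ ((k + i : ℕ) * (D.T / N)) (β (k + i)) (D.eulerState N k y β i)
            (D.atTime m ((k + i : ℕ) * (D.T / N))) -
          D.ℓ ((k + i : ℕ) * (D.T / N)) (α (k + i)) (D.eulerState N k y β i)
            (D.atTime m ((k + i : ℕ) * (D.T / N))))
      + (c.Ll * (D.T + K) + c.Lg) * δ := by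
  have hΔ := (D.step_pos hN).le
  have hδ0 : 0 ≤ δ := (norm_nonneg _).trans (hδ 0 (Nat.zero_le _))
  unfold eulerCost
  have hg := (abs_le.1 (c.g_lip (D.atTime m D.T) (D.eulerState N k y β (N - k))
    (D.eulerState N k x α (N - k)))).2
  have hg2 := mul_le_mul_of_nonneg_left (hδ (N - k) le_rfl) c.Lg_pos.le
  have key : D.T / N * ∑ i ∈ Finset.range (N - k),
      (D.ℓ ((k + i : ℕ) * (D.T / N)) (α (k + i)) (D.eulerState N k y β i)
            (D.atTime m ((k + i : ℕ) * (D.T / N))) -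
      D.ℓ ((k + i : ℕ) * (D.T / N)) (α (k + i)) (D.eulerState N k x α i)
            (D.atTime m ((k + i : ℕ) * (D.T / N)))) ≤ c.Ll * (D.T + K) * δ := by
    have : ∀ i ∈ Finset.range (N - k),
      (D.ℓ ((k + i : ℕ) * (D.T / N)) (α (k + i)) (D.eulerState N k y β i)
            (D.atTime m ((k + i : ℕ) * (D.T / N))) -
      D.ℓ ((k + i : ℕ) * (D.T / N)) (α (k + i)) (D.eulerState N k x α i)
            (D.atTime m ((k + i : ℕ) * (D.T / N)))) ≤
        c.Ll * (1 + ‖α (k + i)‖ ^ D.p) * δ := by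
      intro i hi
      have hi' := Finset.mem_range.1 hi
      have ht := D.step_time_mem hN (show k + i ≤ N by omega)
      refine (le_abs_self _).trans ((c.ℓ_lip _ ht _ _ _ _).trans ?_)
      have := c.Ll_pos.le
      gcongr
      exact hδ i hi'.le
    refine (mul_le_mul_of_nonneg_left (Finset.sum_le_sum this) hΔ).trans ?_
    rw [← Finset.sum_mul, ← Finset.mul_sum, Finset.sum_add_distrib]
    simp only [Finset.sum_const, Finset.card_range, nsmul_eq_mul, mul_one]
    rw [← Finset.mul_sum] at hK
    have hcard := D.card_mul_step_le hN (Nat.sub_le N k)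
    have := c.Ll_pos.le
    calc D.T / N * (c.Ll * (((N - k : ℕ) : ℝ) + ∑ i ∈ Finset.range (N - k), ‖α (k + i)‖ ^ D.p)
          * δ)
        = c.Ll * (((N - k : ℕ) : ℝ) * (D.T / N) + D.T / N *
            ∑ i ∈ Finset.range (N - k), ‖α (k + i)‖ ^ D.p) * δ := by ring
      _ ≤ _ := by gcongr
  rw [Finset.sum_sub_distrib, mul_sub] at key ⊢
  nlinarith

theorem sum_step_const (D : Data d r s) {N i : ℕ} (hN : 0 < N) (hi : i ≤ N) {K : ℝ} (hK : 0 ≤ K)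
    {f : ℕ → ℝ} (hf : ∀ j < i, f j ≤ K) :
    ∑ j ∈ Finset.range i, D.T / N * f j ≤ D.T * K := by
  have hΔ := (D.step_pos hN).le
  calc ∑ j ∈ Finset.range i, D.T / N * f j ≤ ∑ j ∈ Finset.range i, D.T / N * K :=
        Finset.sum_le_sum fun j hj => by
          gcongr; exact hf j (Finset.mem_range.1 hj)
    _ = (i * (D.T / N)) * K := by simp; ring
    _ ≤ _ := by
      gcongr; exact D.card_mul_step_le hN hi

/-- The Euler cost is Lipschitz in the initial state, uniformly over controls bounded by `C`. -/
theorem Bounds.eulerCost_lipschitz (c : D.Bounds) {C : ℝ} (hC : 0 ≤ C) {N k : ℕ} (hN : 0 < N)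
    (hk : k ≤ N) (m : D.Flow) {α : ℕ → Vec r} (hα : ∀ j, k ≤ j → j < N → ‖α j‖ ≤ C)
    (x y : Vec d) :
    D.eulerCost N m k y α - D.eulerCost N m k x α ≤
      (c.Ll * (D.T + D.T * C ^ D.p) + c.Lg) * Real.exp (D.T * (c.LA + c.LB * C)) * ‖y - x‖ := by
  have hLA := c.LA_pos.le
  have hLB := c.LB_pos.le
  have hLl := c.Ll_pos.le
  have hLg := c.Lg_pos.le
  have hT := D.T_pos.le
  have h := c.eulerCost_sub_le (k := k) hN m x y α α (D.T * C ^ D.p)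
    (Real.exp (D.T * (c.LA + c.LB * C)) * ‖y - x‖) (fun i hi => ?_) ?_
  · simpa [mul_assoc] using h
  · refine (c.eulerState_sub_le hN x y α α (by omega)).trans ?_
    simp only [sub_self, norm_zero, mul_zero, Finset.sum_const_zero, add_zero]
    rw [mul_comm]
    gcongr
    refine D.sum_step_const hN (by omega) (by positivity) fun j hj => ?_
    gcongr
    exact hα _ (by omega) (by omega)
  · refine D.sum_step_const hN (by omega) (by positivity) fun j hj => ?_
    exact Real.rpow_le_rpow (norm_nonneg _) (hα _ (by omega) (by omega)) D.p_pos.le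

end Data
end MFG

namespace MFG
namespace Data

variable {d r s : ℕ} {D : Data d r s}

/-! ### Bounds on the optimal controls of the Euler scheme -/

/-- Every minimizer of the Euler cost has `p`-energy bounded independently of the number of time
steps and of the initial state, by comparison with the zero control. -/
theorem Bounds.exists_energy_bound (c : D.Bounds) : ∃ K : ℝ, 0 ≤ K ∧ ∀ N : ℕ, 0 < N →
    ∀ m : D.Flow, ∀ k < N, ∀ x, ∀ α : ℕ → Vec r,
    (∀ α' : ℕ → Vec r, D.eulerCost N m k x α ≤ D.eulerCost N m k x α') →
    ∑ i ∈ Finset.range (N - k), D.T / N * ‖α (k + i)‖ ^ D.p ≤ K := by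
  have hLA := c.LA_pos
  have hLg := c.Lg_pos
  have hCB := c.CB_pos
  have hlo := c.lo_pos
  have hCl := c.Cl_pos
  have hT := D.T_pos
  set E := c.Lg * c.CB * Real.exp (D.T * c.LA) with hE
  have hE0 : 0 < E := by positivity
  obtain ⟨K1, hK1, hlin⟩ := exists_linear_le_rpow D.one_lt_p (η := c.lo / (2 * E)) (by positivity)
  refine ⟨2 / c.lo * (2 * c.Cl * D.T + E * (D.T * K1)), by positivity, ?_⟩
  intro N hN m k hk x α hα
  have hΔ := (D.step_pos hN).le
  have h0 := hα 0
  set X := D.eulerState N k x α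
  set Y := D.eulerState N k x 0
  set S := ∑ i ∈ Finset.range (N - k), D.T / N * ‖α (k + i)‖ ^ D.p
  set S1 := ∑ i ∈ Finset.range (N - k), D.T / N * ‖α (k + i)‖
  have hS1 : S1 ≤ c.lo / (2 * E) * S + D.T * K1 := by
    have : S1 ≤ ∑ i ∈ Finset.range (N - k),
        (c.lo / (2 * E) * (D.T / N * ‖α (k + i)‖ ^ D.p) + D.T / N * K1) := by
      refine Finset.sum_le_sum fun i _ => ?_
      have := mul_le_mul_of_nonneg_left (hlin _ (norm_nonneg (α (k + i)))) hΔ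
      linarith
    refine this.trans ?_
    rw [Finset.sum_add_distrib, ← Finset.mul_sum]
    gcongr
    exact D.sum_step_const hN (Nat.sub_le _ _) hK1 fun _ _ => le_rfl
  have hdist : ‖Y (N - k) - X (N - k)‖ ≤ c.CB * S1 * Real.exp (D.T * c.LA) := by
    have := c.eulerState_sub_le hN x x 0 α (i := N - k) (k := k) (by omega)
    rw [← norm_neg, neg_sub]
    refine this.trans ?_
    simp only [sub_self, norm_zero, zero_add, Pi.zero_apply, sub_zero, mul_zero, add_zero]
    have e : ∑ j ∈ Finset.range (N - k), D.T / ↑N * (c.CB * ‖α (k + j)‖) = c.CB * S1 := by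
      rw [Finset.mul_sum]
      exact Finset.sum_congr rfl fun _ _ => by ring
    rw [e]
    have : 0 ≤ S1 := Finset.sum_nonneg fun _ _ => by positivity
    gcongr
    exact D.sum_step_const hN (Nat.sub_le _ _) hLA.le fun _ _ => le_rfl
  have hlow : c.lo * S - c.Cl * D.T + D.g (X (N - k)) (D.atTime m D.T) ≤
      D.eulerCost N m k x α := by
    unfold eulerCost
    gcongr
    have : ∑ i ∈ Finset.range (N - k), (D.T / N * (c.lo * ‖α (k + i)‖ ^ D.p - c.Cl)) ≤
      D.T / N * ∑ i ∈ Finset.range (N - k),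
      D.ℓ ((k + i : ℕ) * (D.T / N)) (α (k + i)) (D.eulerState N k x α i)
        (D.atTime m ((k + i : ℕ) * (D.T / N))) := by
      rw [Finset.mul_sum]
      refine Finset.sum_le_sum fun i hi => ?_
      have := Finset.mem_range.1 hi
      gcongr
      exact c.ℓ_ge _ (D.step_time_mem hN (by omega)) _ _ _
    refine le_trans ?_ this
    have h2 := D.sum_step_const hN (Nat.sub_le N k) hCl.le (f := fun _ => c.Cl) fun _ _ => le_rfl
    have e : ∑ i ∈ Finset.range (N - k), (D.T / N * (c.lo * ‖α (k + i)‖ ^ D.p - c.Cl)) =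
        c.lo * S - ∑ i ∈ Finset.range (N - k), D.T / N * c.Cl := by
      rw [Finset.mul_sum, ← Finset.sum_sub_distrib]
      exact Finset.sum_congr rfl fun _ _ => by ring
    rw [e]
    linarith
  have hup : D.eulerCost N m k x 0 ≤ c.Cl * D.T + D.g (Y (N - k)) (D.atTime m D.T) := by
    unfold eulerCost
    refine add_le_add ?_ le_rfl
    rw [Finset.mul_sum, mul_comm c.Cl]
    refine D.sum_step_const hN (Nat.sub_le N k) hCl.le fun i hi => ?_
    have := c.ℓ_le _ (D.step_time_mem hN (j := k + i) (by omega)) (0 : Vec r)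
      (D.eulerState N k x 0 i) (D.atTime m ((k + i : ℕ) * (D.T / N)))
    rw [norm_zero, D.zero_rpow_p, mul_zero, zero_add] at this
    exact this
  have hg := (abs_le.1 (c.g_lip (D.atTime m D.T) (Y (N - k)) (X (N - k)))).2
  have h3 := mul_le_mul_of_nonneg_left hdist hLg.le
  have h4 : c.lo * S ≤ 2 * c.Cl * D.T + E * S1 := by
    have : c.Lg * (c.CB * S1 * Real.exp (D.T * c.LA)) = E * S1 := by rw [hE]; ring
    linarith
  have h5 : E * S1 ≤ c.lo / 2 * S + E * (D.T * K1) := by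
    have := mul_le_mul_of_nonneg_left hS1 hE0.le
    have e : E * (c.lo / (2 * E) * S + D.T * K1) = c.lo / 2 * S + E * (D.T * K1) := by
      field_simp
    linarith
  have h6 : c.lo / 2 * S ≤ 2 * c.Cl * D.T + E * (D.T * K1) := by linarith
  calc S = 2 / c.lo * (c.lo / 2 * S) := by field_simp
    _ ≤ _ := by gcongr

/-- A bound on the optimal controls of the Euler scheme exists: replacing one control of a
minimizer by zero changes the later states and costs by at most a multiple of its norm, while the
gain grows like its `p`-th power. -/
theorem Bounds.exists_controlBound (c : D.Bounds) : ∃ C : ℝ, 0 < C ∧ D.IsControlBound C := by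
  obtain ⟨K, hK, hE⟩ := c.exists_energy_bound
  have hLA := c.LA_pos
  have hLB := c.LB_pos
  have hLl := c.Ll_pos
  have hLg := c.Lg_pos
  have hCB := c.CB_pos
  have hlo := c.lo_pos
  have hup := c.up_pos
  have hCl := c.Cl_pos
  have hT := D.T_pos
  obtain ⟨K1, hK1, hlin1⟩ := exists_linear_le_rpow D.one_lt_p (η := 1) one_pos
  set K2 := D.T * K1 + K with hK2
  set F := Real.exp (D.T * c.LA + c.LB * K2) * c.CB with hF
  set G := (c.Ll * (D.T + K) + c.Lg) * F with hG
  have hF0 : 0 < F := by positivity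
  have hG0 : 0 < G := by positivity
  obtain ⟨K3, hK3, hlin3⟩ := exists_linear_le_rpow D.one_lt_p (η := c.lo / (2 * G)) (by positivity)
  refine ⟨2 / c.lo * (2 * c.Cl + G * K3) + K1 + 1, by positivity, ?_⟩
  intro N hN m k hk x α hα j hj1 hj2
  have hΔ := D.step_pos hN
  obtain ⟨i₀, rfl⟩ := Nat.exists_eq_add_of_le hj1
  have hS := hE N hN m k hk x α hα
  have hS1 : ∑ i ∈ Finset.range (N - k), D.T / N * ‖α (k + i)‖ ≤ K2 := by
    calc ∑ i ∈ Finset.range (N - k), D.T / N * ‖α (k + i)‖ ≤ ∑ i ∈ Finset.range (N - k),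
        (D.T / N * K1 + D.T / N * ‖α (k + i)‖ ^ D.p) := by
          refine Finset.sum_le_sum fun i _ => ?_
          have := mul_le_mul_of_nonneg_left (hlin1 _ (norm_nonneg (α (k + i)))) hΔ.le
          linarith
      _ ≤ _ := by
        rw [Finset.sum_add_distrib]
        exact add_le_add (D.sum_step_const hN (Nat.sub_le _ _) hK1 fun _ _ => le_rfl) hS
  -- the minimizer is compared with the control which vanishes at step `k + i₀`
  set β := Function.update α (k + i₀) 0 with hβ
  have hne : ∀ i, i ≠ i₀ → β (k + i) = α (k + i) := fun i hi => by
    rw [hβ, Function.update_of_ne (by omega)]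
  have heq : β (k + i₀) = 0 := by rw [hβ, Function.update_self]
  set a := ‖α (k + i₀)‖ with ha
  have ha0 : 0 ≤ a := norm_nonneg _
  have hδ : ∀ i ≤ N - k, ‖D.eulerState N k x β i - D.eulerState N k x α i‖ ≤
      F * (D.T / N * a) := by
    intro i hi
    refine (c.eulerState_sub_le hN x x α β (by omega)).trans ?_
    rw [sub_self, norm_zero, zero_add, hF, mul_comm, mul_assoc]
    gcongr
    · rw [Finset.sum_congr rfl fun j _ => mul_add (D.T / N) c.LA (c.LB * ‖α (k + j)‖),
        Finset.sum_add_distrib]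
      refine add_le_add (D.sum_step_const hN (by omega) hLA.le fun _ _ => le_rfl) ?_
      calc ∑ j ∈ Finset.range i, D.T / N * (c.LB * ‖α (k + j)‖)
          = c.LB * ∑ j ∈ Finset.range i, D.T / N * ‖α (k + j)‖ := by
            rw [Finset.mul_sum]; exact Finset.sum_congr rfl fun _ _ => by ring
        _ ≤ c.LB * ∑ j ∈ Finset.range (N - k), D.T / N * ‖α (k + j)‖ := by
            gcongr
        _ ≤ _ := by gcongr
    · calc ∑ j ∈ Finset.range i, D.T / N * (c.CB * ‖β (k + j) - α (k + j)‖)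
          ≤ ∑ j ∈ Finset.range i, if j = i₀ then c.CB * (D.T / N * a) else 0 := by
            refine Finset.sum_le_sum fun j _ => ?_
            split_ifs with h
            · rw [h, heq, zero_sub, norm_neg]; apply le_of_eq; ring
            · rw [hne j h]; simp
        _ ≤ _ := by
            rw [Finset.sum_ite_eq']
            split_ifs
            · exact le_rfl
            · positivity
  have h1 := c.eulerCost_sub_le hN m x x α β K _ hδ hS
  have h2 : D.T / N * ∑ i ∈ Finset.range (N - k),
        (D.ℓ ((k + i : ℕ) * (D.T / N)) (β (k + i)) (D.eulerState N k x β i)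
            (D.atTime m ((k + i : ℕ) * (D.T / N))) -
          D.ℓ ((k + i : ℕ) * (D.T / N)) (α (k + i)) (D.eulerState N k x β i)
            (D.atTime m ((k + i : ℕ) * (D.T / N)))) ≤
      D.T / N * (2 * c.Cl - c.lo * a ^ D.p) := by
    gcongr
    rw [Finset.sum_eq_single i₀ (fun i _ hi => by rw [hne i hi]; ring)
      (fun h => absurd (Finset.mem_range.2 (by omega)) h), heq]
    have ht := D.step_time_mem hN (show k + i₀ ≤ N by omega)
    have u1 := c.ℓ_le _ ht (0 : Vec r) (D.eulerState N k x β i₀)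
      (D.atTime m ((k + i₀ : ℕ) * (D.T / N)))
    have u2 := c.ℓ_ge _ ht (α (k + i₀)) (D.eulerState N k x β i₀)
      (D.atTime m ((k + i₀ : ℕ) * (D.T / N)))
    rw [norm_zero, D.zero_rpow_p, mul_zero, zero_add] at u1
    linarith
  have h3 : 0 ≤ D.T / N * (2 * c.Cl - c.lo * a ^ D.p) + (c.Ll * (D.T + K) + c.Lg) *
      (F * (D.T / N * a)) := by
    linarith [hα β]
  -- after division by the time step, the gain and the loss compare `a ^ p` with `a`
  have h4 : 0 ≤ 2 * c.Cl - c.lo * a ^ D.p + G * a := by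
    have : D.T / N * (2 * c.Cl - c.lo * a ^ D.p) + (c.Ll * (D.T + K) + c.Lg) *
      (F * (D.T / N * a)) = D.T / N * (2 * c.Cl - c.lo * a ^ D.p + G * a) := by rw [hG]; ring
    rw [this] at h3
    exact nonneg_of_mul_nonneg_right h3 hΔ
  have h5 : G * a ≤ c.lo / 2 * a ^ D.p + G * K3 := by
    have := mul_le_mul_of_nonneg_left (hlin3 a ha0) hG0.le
    have e : G * (c.lo / (2 * G) * a ^ D.p + K3) = c.lo / 2 * a ^ D.p + G * K3 := by
      field_simp
    linarith
  have h6 : a ^ D.p ≤ 2 / c.lo * (2 * c.Cl + G * K3) := by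
    have : c.lo / 2 * a ^ D.p ≤ 2 * c.Cl + G * K3 := by linarith
    calc a ^ D.p = 2 / c.lo * (c.lo / 2 * a ^ D.p) := by field_simp
      _ ≤ _ := by gcongr
  have := hlin1 a ha0
  linarith

/-! ### Continuity of the data and existence of optimal controls for the Euler scheme -/

/-- The running cost along a flow, extended to all times by freezing it outside `[0,T]`. -/
noncomputable def lag (D : Data d r s) (m : D.Flow) (t : ℝ) (a : Vec r) (x : Vec d) : ℝ :=
  D.ℓ (projIcc 0 D.T D.T_pos.le t) a x (m (projIcc 0 D.T D.T_pos.le t))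

theorem lag_eq (D : Data d r s) (m : D.Flow) {t : ℝ} (ht : t ∈ Icc 0 D.T) (a : Vec r) (x : Vec d) :
    D.lag m t a x = D.ℓ t a x (D.atTime m t) := by
  rw [lag, atTime, projIcc_of_mem _ ht]

theorem continuous_lag (h1 : D.H1) (m : D.Flow) :
    Continuous fun z : ℝ × Vec r × Vec d => D.lag m z.1 z.2.1 z.2.2 := by
  have hp : Continuous fun z : ℝ × Vec r × Vec d => projIcc 0 D.T D.T_pos.le z.1 :=
    continuous_projIcc.comp continuous_fst
  refine h1.continuous.comp_continuous
    (f := fun z : ℝ × Vec r × Vec d => (((projIcc 0 D.T D.T_pos.le z.1 : Icc 0 D.T) : ℝ), z.2.1,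
      z.2.2, m (projIcc 0 D.T D.T_pos.le z.1))) ?_ fun z => ⟨Subtype.coe_prop _, mem_univ _⟩
  exact (continuous_subtype_val.comp hp).prodMk
    (continuous_snd.fst.prodMk (continuous_snd.snd.prodMk (m.continuous.comp hp)))

theorem continuous_A_at (h3 : D.H3) {t : ℝ} (ht : t ∈ Icc 0 D.T) : Continuous (D.A t) :=
  h3.continuous_A.comp_continuous (f := fun x : Vec d => (t, x)) (by fun_prop)
    fun _ => ⟨ht, mem_univ _⟩

theorem continuous_B_at (h3 : D.H3) {t : ℝ} (ht : t ∈ Icc 0 D.T) : Continuous (D.B t) :=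
  h3.continuous_B.comp_continuous (f := fun x : Vec d => (t, x)) (by fun_prop)
    fun _ => ⟨ht, mem_univ _⟩

theorem continuous_g_at (h2 : D.H2) (μ : P1 (Vec d)) : Continuous fun x => D.g x μ :=
  h2.continuous.comp (f := fun x : Vec d => (x, μ)) (by fun_prop)

theorem continuous_eulerState (h3 : D.H3) {N k : ℕ} (hN : 0 < N) (x : Vec d) {i : ℕ}
    (hi : k + i ≤ N) : Continuous fun α : ℕ → Vec r => D.eulerState N k x α i := by
  induction i with
  | zero => exact continuous_const
  | succ i ih =>
    have ht := D.step_time_mem hN (show k + i ≤ N by omega)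
    have hX := ih (by omega)
    simp only [eulerState]
    have hA := (continuous_A_at h3 ht).comp hX
    have hB : Continuous fun α : ℕ → Vec r =>
        D.B ((k + i : ℕ) * (D.T / N)) (D.eulerState N k x α i) *ᵥ α (k + i) :=
      Continuous.matrix_mulVec ((continuous_B_at h3 ht).comp hX) (continuous_apply (k + i))
    simp only [Function.comp_def] at hA
    exact hX.add ((hA.add hB).const_smul (D.T / N : ℝ))

theorem continuous_eulerCost (h1 : D.H1) (h2 : D.H2) (h3 : D.H3) {N k : ℕ} (hN : 0 < N)
    (hk : k ≤ N) (m : D.Flow) (x : Vec d) : Continuous (D.eulerCost N m k x) := by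
  have e : D.eulerCost N m k x = fun α => (D.T / N) * ∑ i ∈ Finset.range (N - k),
      D.lag m ((k + i : ℕ) * (D.T / N)) (α (k + i)) (D.eulerState N k x α i)
    + D.g (D.eulerState N k x α (N - k)) (D.atTime m D.T) := by
    ext α
    unfold eulerCost
    congr 2
    refine Finset.sum_congr rfl fun i hi => ?_
    have := Finset.mem_range.1 hi
    rw [D.lag_eq m (D.step_time_mem hN (by omega))]
  rw [e]
  refine (continuous_const.mul (continuous_finsetSum _ fun i hi => ?_)).add
    ((continuous_g_at h2 _).comp (continuous_eulerState (k := k) h3 hN x (by omega)))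
  have := Finset.mem_range.1 hi
  exact (continuous_lag h1 m).comp (continuous_const.prodMk
    ((continuous_apply (k + i)).prodMk
      (continuous_eulerState (k := k) (i := i) h3 hN x (by omega))))

/-- The Euler cost has a minimizer. -/
theorem exists_eulerCost_minimizer (h1 : D.H1) (h2 : D.H2) (h3 : D.H3) {N k : ℕ} (hN : 0 < N)
    (hk : k ≤ N) (m : D.Flow) (x : Vec d) :
    ∃ α : ℕ → Vec r, ∀ α', D.eulerCost N m k x α ≤ D.eulerCost N m k x α' := by
  obtain ⟨c⟩ := D.exists_bounds h1 h2 h3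
  have hΔ := D.step_pos hN
  have hlo := c.lo_pos
  obtain ⟨K1, hK1, hlin1⟩ := exists_linear_le_rpow D.one_lt_p (η := 1) one_pos
  -- controls with a component of norm larger than `R` are worse than the zero control
  set R := |D.eulerCost N m k x 0 + c.Cl * D.T - c.gl| / (D.T / N * c.lo) + K1 with hR
  have hR0 : 0 ≤ R := by positivity
  set Q : Set (ℕ → Vec r) := {α | ∀ j, α j ∈ Metric.closedBall (0 : Vec r) R}
  have hQ : IsCompact Q := isCompact_pi_infinite fun _ => isCompact_closedBall _ _
  have h0 : (0 : ℕ → Vec r) ∈ Q := fun j => by simpa using hR0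
  obtain ⟨α, hα, hmin⟩ := hQ.exists_isMinOn ⟨0, h0⟩
    (continuous_eulerCost h1 h2 h3 hN hk m x).continuousOn
  refine ⟨α, fun α' => ?_⟩
  by_cases hb : ∀ j, k ≤ j → j < N → ‖α' j‖ ≤ R
  · rw [D.eulerCost_congr m x (α := α') (β := fun j => if k ≤ j ∧ j < N then α' j else 0)
      fun j h h' => by simp [h, h']]
    refine hmin fun j => ?_
    rw [mem_closedBall_zero_iff]
    split_ifs with h
    · exact hb j h.1 h.2
    · simpa using hR0
  · push Not at hb
    obtain ⟨j, hj1, hj2, hj⟩ := hb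
    refine (hmin h0).trans ?_
    change D.eulerCost N m k x 0 ≤ D.eulerCost N m k x α'
    obtain ⟨i₀, rfl⟩ := Nat.exists_eq_add_of_le hj1
    have hl : ∑ i ∈ Finset.range (N - k), (D.T / N * (c.lo * ‖α' (k + i)‖ ^ D.p) -
        D.T / N * c.Cl) ≤ D.T / N * ∑ i ∈ Finset.range (N - k),
      D.ℓ ((k + i : ℕ) * (D.T / N)) (α' (k + i)) (D.eulerState N k x α' i)
        (D.atTime m ((k + i : ℕ) * (D.T / N))) := by
      rw [Finset.mul_sum]
      refine Finset.sum_le_sum fun i hi => ?_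
      have := Finset.mem_range.1 hi
      rw [← mul_sub]
      gcongr
      exact c.ℓ_ge _ (D.step_time_mem hN (by omega)) _ _ _
    rw [Finset.sum_sub_distrib] at hl
    have h2 := D.sum_step_const hN (Nat.sub_le N k) c.Cl_pos.le (f := fun _ => c.Cl)
      fun _ _ => le_rfl
    have h3 : D.T / N * (c.lo * ‖α' (k + i₀)‖ ^ D.p) ≤
        ∑ i ∈ Finset.range (N - k), D.T / N * (c.lo * ‖α' (k + i)‖ ^ D.p) :=
      Finset.single_le_sum (f := fun i => D.T / N * (c.lo * ‖α' (k + i)‖ ^ D.p))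
        (fun i _ => by positivity) (Finset.mem_range.2 (by omega))
    have h4 := hlin1 _ (norm_nonneg (α' (k + i₀)))
    have h5 : |D.eulerCost N m k x 0 + c.Cl * D.T - c.gl| / (D.T / N * c.lo) ≤
        ‖α' (k + i₀)‖ ^ D.p := by linarith
    rw [div_le_iff₀ (by positivity)] at h5
    have h6 := le_abs_self (D.eulerCost N m k x 0 + c.Cl * D.T - c.gl)
    have h7 := c.g_ge (D.eulerState N k x α' (N - k)) (D.atTime m D.T)
    have : D.eulerCost N m k x α' = D.T / N * ∑ i ∈ Finset.range (N - k),
      D.ℓ ((k + i : ℕ) * (D.T / N)) (α' (k + i)) (D.eulerState N k x α' i)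
        (D.atTime m ((k + i : ℕ) * (D.T / N))) +
        D.g (D.eulerState N k x α' (N - k)) (D.atTime m D.T) := rfl
    nlinarith

end Data
end MFG

namespace MFG

/-! ### Differential equations with measurable right-hand side -/

theorem weighted_integral_le {a t κ K : ℝ} (hK : 0 ≤ K) :
    Real.exp (-(2 * κ * (t - a))) * ∫ τ in a..t, κ * Real.exp (2 * κ * (τ - a)) * K ≤ K / 2 := by
  have h : ∀ τ ∈ uIcc a t, HasDerivAt (fun τ => Real.exp (2 * κ * (τ - a)) * (K / 2))
      (κ * Real.exp (2 * κ * (τ - a)) * K) τ := by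
    intro τ _
    have h1 : HasDerivAt (fun τ : ℝ => 2 * κ * (τ - a)) (2 * κ) τ := by
      simpa using ((hasDerivAt_id τ).sub_const a).const_mul (2 * κ)
    exact (h1.exp.mul_const (K / 2)).congr_deriv (by ring)
  rw [intervalIntegral.integral_eq_sub_of_hasDerivAt h
    (Continuous.intervalIntegrable (by fun_prop) _ _), sub_self, mul_zero, Real.exp_zero]
  have e : Real.exp (-(2 * κ * (t - a))) * Real.exp (2 * κ * (t - a)) = 1 := by
    rw [← Real.exp_add]; simp
  have := Real.exp_pos (-(2 * κ * (t - a)))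
  calc _ = (Real.exp (-(2 * κ * (t - a))) * Real.exp (2 * κ * (t - a))) * (K / 2) -
        Real.exp (-(2 * κ * (t - a))) * (K / 2) := by ring
    _ ≤ _ := by rw [e, one_mul]; linarith [show 0 ≤
        Real.exp (-(2 * κ * (t - a))) * (K / 2) by positivity]

/-- An approximate solution `γ` of `u' = f(t, u)`, with `f` measurable in time and uniformly
Lipschitz in the state, is shadowed by an exact solution with the same initial value. The exact
solution is the fixed point of the integral operator, which contracts the weighted norm
`sup |e^{-2κ(t-a)} u(t)|`. -/
theorem exists_solution_near {E : Type*} [NormedAddCommGroup E] [NormedSpace ℝ E]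
    [CompleteSpace E] {a b κ M η : ℝ} (hab : a ≤ b) (hκ : 0 < κ) {f : ℝ → E → E}
    (hmeas : ∀ u : ℝ → E, Continuous u →
      AEStronglyMeasurable (fun τ => f τ (u τ)) (volume.restrict (Ioc a b)))
    (hlip : ∀ τ ∈ Ioc a b, ∀ x y, ‖f τ x - f τ y‖ ≤ κ * ‖x - y‖)
    (hbd : ∀ τ ∈ Ioc a b, ‖f τ 0‖ ≤ M) {γ w : ℝ → E} (hw : IntervalIntegrable w volume a b)
    (hγ : ∀ t ∈ Icc a b, γ t = γ a + ∫ τ in a..t, w τ)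
    (hη0 : 0 ≤ η) (hη : ∀ τ ∈ Ioc a b, ‖w τ - f τ (γ τ)‖ ≤ η) :
    ∃ u : ℝ → E, Continuous u ∧ IntervalIntegrable (fun τ => f τ (u τ)) volume a b ∧
      (∀ t ∈ Icc a b, u t = γ a + ∫ τ in a..t, f τ (u τ)) ∧
      ∀ t ∈ Icc a b, ‖u t - γ t‖ ≤ 2 * (b - a) * Real.exp (2 * κ * (b - a)) * η := by
  have hint : ∀ u : ℝ → E, Continuous u → IntervalIntegrable (fun τ => f τ (u τ)) volume a b := by
    intro u hu
    rw [intervalIntegrable_iff_integrableOn_Ioc_of_le hab]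
    obtain ⟨R, hR⟩ := isCompact_Icc.exists_bound_of_continuousOn (s := Icc a b) hu.continuousOn
    refine Integrable.of_bound (hmeas u hu) (M + κ * R) ?_
    filter_upwards [ae_restrict_mem measurableSet_Ioc] with τ hτ
    have h1 := hlip τ hτ (u τ) 0
    have h2 := hbd τ hτ
    have h3 := norm_le_norm_add_norm_sub' (f τ (u τ)) (f τ 0)
    have h4 := mul_le_mul_of_nonneg_left (hR τ (Ioc_subset_Icc_self hτ)) hκ.le
    rw [sub_zero] at h1
    linarith
  have hprim : ∀ v : ℝ → E, IntervalIntegrable v volume a b →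
      ContinuousOn (fun t => ∫ τ in a..t, v τ) (Icc a b) := by
    intro v hv
    have := intervalIntegral.continuousOn_primitive_interval (a := a) (b := b) (f := v)
      (by rw [uIcc_of_le hab]; exact (intervalIntegrable_iff_integrableOn_Icc_of_le hab).1 hv)
    rwa [uIcc_of_le hab] at this
  -- Picard iteration is written for `exp (-2κ(t - a)) • u t`: the weight makes the map contracting
  -- on the whole interval
  let ext : C(Icc a b, E) → ℝ → E := fun u τ => Real.exp (2 * κ * (τ - a)) • u (projIcc a b hab τ)
  have hext : ∀ u, Continuous (ext u) := fun u =>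
    Continuous.smul (by fun_prop) (u.continuous.comp continuous_projIcc)
  let Ψ : C(Icc a b, E) → C(Icc a b, E) := fun u =>
    ⟨fun t => Real.exp (-(2 * κ * ((t : ℝ) - a))) • (γ a + ∫ τ in a..t, f τ (ext u τ)), by
      refine Continuous.smul (by fun_prop) (continuous_const.add ?_)
      exact continuousOn_iff_continuous_domRestrict.1 (hprim _ (hint _ (hext u)))⟩
  have hΨ : ContractingWith (1 / 2) Ψ := by
    refine ⟨by rw [← NNReal.coe_lt_coe]; norm_num, LipschitzWith.of_dist_le_mul fun u v => ?_⟩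
    rw [ContinuousMap.dist_le (by positivity)]
    rintro ⟨t, ht⟩
    rw [dist_eq_norm]
    change ‖Real.exp (-(2 * κ * (t - a))) • (γ a + ∫ τ in a..t, f τ (ext u τ)) -
      Real.exp (-(2 * κ * (t - a))) • (γ a + ∫ τ in a..t, f τ (ext v τ))‖ ≤ _
    have hsub : uIcc a t ⊆ uIcc a b := by
      rw [uIcc_of_le ht.1, uIcc_of_le hab]; exact Icc_subset_Icc le_rfl ht.2
    rw [← smul_sub, add_sub_add_left_eq_sub, norm_smul, Real.norm_of_nonneg (Real.exp_pos _).le,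
      ← intervalIntegral.integral_sub ((hint _ (hext u)).mono_set hsub)
        ((hint _ (hext v)).mono_set hsub)]
    have := weighted_integral_le (a := a) (t := t) (κ := κ) (dist_nonneg (x := u) (y := v))
    refine le_trans ?_ (this.trans_eq ?_)
    · gcongr
      refine intervalIntegral.norm_integral_le_of_norm_le ht.1 ?_
        (Continuous.intervalIntegrable (by fun_prop) _ _)
      refine Eventually.of_forall fun τ hτ => ?_
      refine (hlip τ ⟨hτ.1, hτ.2.trans ht.2⟩ _ _).trans ?_
      change κ * ‖Real.exp (2 * κ * (τ - a)) • u _ - Real.exp (2 * κ * (τ - a)) • v _‖ ≤ _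
      rw [← smul_sub, norm_smul, Real.norm_of_nonneg (Real.exp_pos _).le, ← dist_eq_norm,
        mul_assoc κ]
      exact mul_le_mul_of_nonneg_left (mul_le_mul_of_nonneg_left
        (ContinuousMap.dist_apply_le_dist _) (Real.exp_pos _).le) hκ.le
    · simp; ring
  have hγc : ContinuousOn γ (Icc a b) :=
    (continuousOn_const.add (hprim w hw)).congr hγ
  let g : C(Icc a b, E) := ⟨fun t => Real.exp (-(2 * κ * ((t : ℝ) - a))) • γ t,
    Continuous.smul (by fun_prop) (continuousOn_iff_continuous_domRestrict.1 hγc)⟩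
  have hexp : ∀ t, Real.exp (2 * κ * (t - a)) * Real.exp (-(2 * κ * (t - a))) = 1 := fun t => by
    rw [← Real.exp_add]; simp
  have hextg : ∀ τ ∈ Icc a b, ext g τ = γ τ := by
    intro τ hτ
    change Real.exp (2 * κ * (τ - a)) •
      (Real.exp (-(2 * κ * ((projIcc a b hab τ : ℝ) - a))) • γ (projIcc a b hab τ)) = _
    rw [projIcc_of_mem hab hτ, smul_smul, hexp, one_smul]
  have hgΨ : dist g (Ψ g) ≤ (b - a) * η := by
    rw [ContinuousMap.dist_le (mul_nonneg (sub_nonneg.2 hab) hη0)]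
    rintro ⟨t, ht⟩
    have hsub : uIcc a t ⊆ uIcc a b := by
      rw [uIcc_of_le ht.1, uIcc_of_le hab]; exact Icc_subset_Icc le_rfl ht.2
    rw [dist_eq_norm]
    change ‖Real.exp (-(2 * κ * (t - a))) • γ t -
      Real.exp (-(2 * κ * (t - a))) • (γ a + ∫ τ in a..t, f τ (ext g τ))‖ ≤ _
    rw [← smul_sub, hγ t ht, add_sub_add_left_eq_sub, norm_smul,
      Real.norm_of_nonneg (Real.exp_pos _).le,
      ← intervalIntegral.integral_sub (hw.mono_set hsub) ((hint _ (hext g)).mono_set hsub)]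
    have h1 : ‖∫ τ in a..t, w τ - f τ (ext g τ)‖ ≤ η * |t - a| := by
      refine intervalIntegral.norm_integral_le_of_norm_le_const fun τ hτ => ?_
      rw [uIoc_of_le ht.1] at hτ
      rw [hextg τ ⟨hτ.1.le, hτ.2.trans ht.2⟩]
      exact hη τ ⟨hτ.1, hτ.2.trans ht.2⟩
    rw [abs_of_nonneg (sub_nonneg.2 ht.1)] at h1
    have h2 : Real.exp (-(2 * κ * (t - a))) ≤ 1 := by
      rw [Real.exp_le_one_iff]
      have := sub_nonneg.2 ht.1
      have : 0 ≤ 2 * κ * (t - a) := by positivity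
      linarith
    calc _ ≤ 1 * ‖∫ τ in a..t, w τ - f τ (ext g τ)‖ := by gcongr
      _ ≤ η * (t - a) := by rw [one_mul]; exact h1
      _ ≤ η * (b - a) := by gcongr; exact ht.2
      _ = _ := mul_comm _ _
  set v := hΨ.fixedPoint Ψ with hv
  have hfix : Ψ v = v := hΨ.fixedPoint_isFixedPt
  have hd : dist g v ≤ 2 * (b - a) * η := by
    refine (hΨ.dist_fixedPoint_le g).trans ?_
    have e : (1 : ℝ) - ((1 / 2 : NNReal) : ℝ) = 1 / 2 := by push_cast; norm_num
    rw [e]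
    linarith
  refine ⟨ext v, hext v, hint _ (hext v), fun t ht => ?_, fun t ht => ?_⟩
  · have h1 : v ⟨t, ht⟩ = Real.exp (-(2 * κ * (t - a))) •
        (γ a + ∫ τ in a..t, f τ (ext v τ)) := by
      conv_lhs => rw [← hfix]
      rfl
    change Real.exp (2 * κ * (t - a)) • v (projIcc a b hab t) = _
    rw [projIcc_of_mem hab ht, h1, smul_smul, hexp, one_smul]
  · rw [← hextg t ht]
    change ‖Real.exp (2 * κ * (t - a)) • v (projIcc a b hab t) -
      Real.exp (2 * κ * (t - a)) • g (projIcc a b hab t)‖ ≤ _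
    rw [← smul_sub, norm_smul, Real.norm_of_nonneg (Real.exp_pos _).le, ← dist_eq_norm, dist_comm]
    have h3 : dist (g (projIcc a b hab t)) (v (projIcc a b hab t)) ≤ 2 * (b - a) * η :=
      (ContinuousMap.dist_apply_le_dist _).trans hd
    have h0 : 0 ≤ 2 * (b - a) * η := dist_nonneg.trans h3
    calc _ ≤ Real.exp (2 * κ * (b - a)) * (2 * (b - a) * η) := by
          gcongr
          exact ht.2
      _ = _ := by ring

/-- Integral form of Grönwall's inequality. -/
theorem gronwall_integral {a b κ K : ℝ} (hκ : 0 < κ) {u : ℝ → ℝ} (hK : 0 ≤ K)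
    (hu : ContinuousOn u (Icc a b)) (hu0 : ∀ t ∈ Icc a b, 0 ≤ u t)
    (h : ∀ t ∈ Icc a b, u t ≤ K + ∫ τ in a..t, κ * u τ) :
    ∀ t ∈ Icc a b, u t ≤ 2 * K * Real.exp (2 * κ * (b - a)) := by
  rcases lt_or_ge b a with hab | hab
  · intro t ht; exact absurd (ht.1.trans ht.2) (not_le.2 hab)
  have hc : ContinuousOn (fun t => Real.exp (-(2 * κ * (t - a))) * u t) (Icc a b) :=
    ContinuousOn.mul (by fun_prop) hu
  obtain ⟨t₀, ht₀, hmax⟩ := isCompact_Icc.exists_isMaxOn ⟨a, left_mem_Icc.2 hab⟩ hc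
  set M := Real.exp (-(2 * κ * (t₀ - a))) * u t₀ with hM
  have hM0 : 0 ≤ M := mul_nonneg (Real.exp_pos _).le (hu0 t₀ ht₀)
  have hexp : ∀ t, Real.exp (2 * κ * (t - a)) * Real.exp (-(2 * κ * (t - a))) = 1 := fun t => by
    rw [← Real.exp_add]; simp
  have hle : ∀ t ∈ Icc a b, u t ≤ Real.exp (2 * κ * (t - a)) * M := by
    intro t ht
    have := mul_le_mul_of_nonneg_left (hmax ht) (Real.exp_pos (2 * κ * (t - a))).le
    simp only [← mul_assoc, hexp, one_mul] at this
    exact this.trans_eq (by rw [hM]; ring)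
  have h1 : ∫ τ in a..t₀, κ * u τ ≤ ∫ τ in a..t₀, κ * Real.exp (2 * κ * (τ - a)) * M := by
    refine intervalIntegral.integral_mono_on ht₀.1 ?_
      (Continuous.intervalIntegrable (by fun_prop) _ _) fun τ hτ => ?_
    · refine ContinuousOn.intervalIntegrable ?_
      rw [uIcc_of_le ht₀.1]
      exact continuousOn_const.mul (hu.mono (Icc_subset_Icc le_rfl ht₀.2))
    · rw [mul_assoc]
      exact mul_le_mul_of_nonneg_left (hle τ ⟨hτ.1, hτ.2.trans ht₀.2⟩) hκ.le
  have h2 := weighted_integral_le (a := a) (t := t₀) (κ := κ) hM0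
  have h3 := (h t₀ ht₀).trans (add_le_add_right h1 K)
  have h4 := mul_le_mul_of_nonneg_left h3 (Real.exp_pos (-(2 * κ * (t₀ - a)))).le
  rw [mul_add] at h4
  have h5 : Real.exp (-(2 * κ * (t₀ - a))) * K ≤ K := by
    refine mul_le_of_le_one_left hK ?_
    rw [Real.exp_le_one_iff]
    have := sub_nonneg.2 ht₀.1
    have : 0 ≤ 2 * κ * (t₀ - a) := by positivity
    linarith
  have h6 : M ≤ 2 * K := by linarith
  intro t ht
  calc u t ≤ Real.exp (2 * κ * (t - a)) * M := hle t ht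
    _ ≤ Real.exp (2 * κ * (b - a)) * (2 * K) := by
      gcongr
      exact ht.2
    _ = _ := by ring

end MFG

namespace MFG

/-! ### Moduli of continuity on compact sets -/

theorem exists_modulus {X Y : Type*} [PseudoMetricSpace X] [PseudoMetricSpace Y] {f : X → Y}
    {K : Set X} (hK : IsCompact K) (hf : ContinuousOn f K) {ε : ℝ} (hε : 0 < ε) :
    ∃ δ > 0, ∀ x ∈ K, ∀ y ∈ K, dist x y ≤ δ → dist (f x) (f y) ≤ ε := by
  obtain ⟨δ, hδ, h⟩ := Metric.uniformContinuousOn_iff.1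
    (hK.uniformContinuousOn_of_continuous hf) ε hε
  exact ⟨δ / 2, half_pos hδ, fun x hx y hy hxy => (h x hx y hy (by linarith)).le⟩

theorem exists_modulus_near {X Y : Type*} [PseudoMetricSpace X] [PseudoMetricSpace Y] {f : X → Y}
    {K : Set X} (hK : IsCompact K) (hf : Continuous f) {ε : ℝ} (hε : 0 < ε) :
    ∃ δ > 0, ∀ x ∈ K, ∀ y, dist x y ≤ δ → dist (f x) (f y) ≤ ε := by
  have h := hK.uniformContinuousAt_of_continuousAt f (fun a _ => hf.continuousAt)
    (Metric.dist_mem_uniformity hε)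
  obtain ⟨δ, hδ, h⟩ := Metric.mem_uniformity_dist.1 h
  exact ⟨δ / 2, half_pos hδ, fun x hx y hxy => (h (show dist x y < δ by linarith) hx).le⟩

namespace Data

variable {d r s : ℕ} {D : Data d r s}

theorem exists_velocity_modulus (h3 : D.H3) (R : ℝ) {ε : ℝ} (hε : 0 < ε) :
    ∃ δ > 0, ∀ t ∈ Icc 0 D.T, ∀ t' ∈ Icc 0 D.T, ∀ x y : Vec d, ‖x‖ ≤ R → ‖y‖ ≤ R →
      |t - t'| ≤ δ → ‖x - y‖ ≤ δ → ‖D.A t x - D.A t' y‖ ≤ ε ∧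
        ∀ a : Vec r, ‖D.B t x *ᵥ a - D.B t' y *ᵥ a‖ ≤ ε * ‖a‖ := by
  obtain ⟨δ₁, hδ₁, hA⟩ := exists_modulus
    (isCompact_Icc.prod (isCompact_closedBall (0 : Vec d) R))
    (h3.continuous_A.mono (Set.prod_mono le_rfl (subset_univ _))) hε
  have hBc : ContinuousOn (fun z : (ℝ × Vec d) × Vec r => D.B z.1.1 z.1.2 *ᵥ z.2)
      ((Icc 0 D.T ×ˢ Metric.closedBall 0 R) ×ˢ Metric.closedBall 0 1) := by
    rw [continuousOn_iff_continuous_domRestrict]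
    refine Continuous.matrix_mulVec ?_ (by fun_prop)
    exact continuousOn_iff_continuous_domRestrict.1 (h3.continuous_B.comp continuousOn_fst
      fun z hz => ⟨hz.1.1, mem_univ _⟩)
  obtain ⟨δ₂, hδ₂, hB⟩ := exists_modulus
    ((isCompact_Icc.prod (isCompact_closedBall (0 : Vec d) R)).prod
      (isCompact_closedBall (0 : Vec r) 1)) hBc hε
  refine ⟨min δ₁ δ₂, lt_min hδ₁ hδ₂, fun t ht t' ht' x y hx hy h1 h2 => ⟨?_, fun a => ?_⟩⟩
  · rw [← dist_eq_norm]
    refine hA (t, x) ⟨ht, by simpa using hx⟩ (t', y) ⟨ht', by simpa using hy⟩ ?_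
    rw [Prod.dist_eq, Real.dist_eq, dist_eq_norm]
    exact max_le (h1.trans (min_le_left _ _)) (h2.trans (min_le_left _ _))
  · have ha : ‖a‖ • (‖a‖⁻¹ • a) = a := by
      rcases eq_or_ne a 0 with rfl | h
      · simp
      · rw [smul_smul, mul_inv_cancel₀ (norm_ne_zero_iff.2 h), one_smul]
    have hu : ‖‖a‖⁻¹ • a‖ ≤ 1 := by
      rw [norm_smul, norm_inv, norm_norm]; exact inv_mul_le_one
    have := hB ((t, x), ‖a‖⁻¹ • a) ⟨⟨ht, by simpa using hx⟩, by simpa using hu⟩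
      ((t', y), ‖a‖⁻¹ • a) ⟨⟨ht', by simpa using hy⟩, by simpa using hu⟩ (by
        rw [Prod.dist_eq, dist_self, Prod.dist_eq, Real.dist_eq, dist_eq_norm]
        exact max_le (max_le (h1.trans (min_le_right _ _)) (h2.trans (min_le_right _ _)))
          hδ₂.le)
    rw [dist_eq_norm] at this
    have e : D.B t x *ᵥ a - D.B t' y *ᵥ a =
        ‖a‖ • (D.B t x *ᵥ (‖a‖⁻¹ • a) - D.B t' y *ᵥ (‖a‖⁻¹ • a)) := by
      rw [smul_sub, ← Matrix.mulVec_smul, ← Matrix.mulVec_smul, ha]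
    rw [e, norm_smul, norm_norm, mul_comm]
    exact mul_le_mul_of_nonneg_right this (norm_nonneg _)

/-- Uniform continuity of the running cost near the compact set of the points `(t, a, x, m(t))`. -/
theorem exists_ℓ_modulus (h1 : D.H1) (m : D.Flow) (C R : ℝ) {ε : ℝ} (hε : 0 < ε) :
    ∃ δ > 0, ∀ t ∈ Icc 0 D.T, ∀ t' ∈ Icc 0 D.T, ∀ (a b : Vec r) (x y : Vec d) (μ : P1 (Vec d)),
      ‖a‖ ≤ C → ‖x‖ ≤ R → |t - t'| ≤ δ → ‖a - b‖ ≤ δ → ‖x - y‖ ≤ δ →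
      dist (D.atTime m t) μ ≤ δ → |D.ℓ t a x (D.atTime m t) - D.ℓ t' b y μ| ≤ ε := by
  set F : ℝ × Vec r × Vec d × P1 (Vec d) → ℝ := fun z =>
    D.ℓ (projIcc 0 D.T D.T_pos.le z.1) z.2.1 z.2.2.1 z.2.2.2
  have hF : Continuous F := by
    refine h1.continuous.comp_continuous
      (f := fun z : ℝ × Vec r × Vec d × P1 (Vec d) =>
        (((projIcc 0 D.T D.T_pos.le z.1 : Icc 0 D.T) : ℝ), z.2)) ?_
      fun z => ⟨Subtype.coe_prop _, mem_univ _⟩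
    exact (continuous_subtype_val.comp (continuous_projIcc.comp continuous_fst)).prodMk
      continuous_snd
  set K : Set (ℝ × Vec r × Vec d × P1 (Vec d)) :=
    (fun z : ℝ × Vec r × Vec d => (z.1, z.2.1, z.2.2, m (projIcc 0 D.T D.T_pos.le z.1))) ''
      (Icc 0 D.T ×ˢ Metric.closedBall 0 C ×ˢ Metric.closedBall 0 R)
  have hK : IsCompact K := by
    refine IsCompact.image (isCompact_Icc.prod ((isCompact_closedBall _ _).prod
      (isCompact_closedBall _ _))) ?_
    exact continuous_fst.prodMk (continuous_snd.fst.prodMk (continuous_snd.snd.prodMk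
      (m.continuous.comp (continuous_projIcc.comp continuous_fst))))
  obtain ⟨δ, hδ, h⟩ := exists_modulus_near hK hF hε
  refine ⟨δ, hδ, fun t ht t' ht' a b x y μ ha hx e1 e2 e3 e4 => ?_⟩
  have := h (t, a, x, D.atTime m t) ⟨(t, a, x), ⟨ht, by simpa using ha, by simpa using hx⟩, rfl⟩
    (t', b, y, μ) (by
      simp only [Prod.dist_eq, Real.dist_eq, dist_eq_norm (a := a), dist_eq_norm (a := x)]
      exact max_le e1 (max_le e2 (max_le e3 e4)))
  simpa only [F, projIcc_of_mem _ ht, projIcc_of_mem _ ht', Real.dist_eq] using this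

theorem exists_g_modulus (h2 : D.H2) (μ : P1 (Vec d)) (R : ℝ) {ε : ℝ} (hε : 0 < ε) :
    ∃ δ > 0, ∀ (x y : Vec d) (ν : P1 (Vec d)), ‖x‖ ≤ R → ‖x - y‖ ≤ δ → dist μ ν ≤ δ →
      |D.g x μ - D.g y ν| ≤ ε := by
  obtain ⟨δ, hδ, h⟩ := exists_modulus_near ((isCompact_closedBall (0 : Vec d) R).prod
    (isCompact_singleton (x := μ))) h2.continuous hε
  refine ⟨δ, hδ, fun x y ν hx e1 e2 => ?_⟩
  have := h (x, μ) ⟨by simpa using hx, rfl⟩ (y, ν) (by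
    rw [Prod.dist_eq, dist_eq_norm]; exact max_le e1 e2)
  simpa only [Real.dist_eq] using this

/-! ### Trajectories and their costs -/

/-- A path remains bounded if its speed is bounded by the sum of a multiple of its norm and of an
integrable function. -/
theorem norm_le_of_speed_le {t₀ t₁ κ F : ℝ} (hκ : 0 < κ) {γ w : ℝ → Vec d} {f : ℝ → ℝ}
    (hw : IntervalIntegrable w volume t₀ t₁) (hf : IntervalIntegrable f volume t₀ t₁)
    (hf0 : ∀ τ, 0 ≤ f τ) (hγ : ∀ t ∈ Icc t₀ t₁, γ t = γ t₀ + ∫ τ in t₀..t, w τ)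
    (hwf : ∀ᵐ τ ∂(volume.restrict (Ioc t₀ t₁)), ‖w τ‖ ≤ κ * ‖γ τ‖ + f τ)
    (hF : ∫ τ in t₀..t₁, f τ ≤ F) :
    ∀ t ∈ Icc t₀ t₁, ‖γ t‖ ≤ 2 * (‖γ t₀‖ + F) * Real.exp (2 * κ * (t₁ - t₀)) := by
  rcases lt_or_ge t₁ t₀ with hab | hab
  · intro t ht; exact absurd (ht.1.trans ht.2) (not_le.2 hab)
  have hF0 : 0 ≤ F := (intervalIntegral.integral_nonneg hab fun τ _ => hf0 τ).trans hF
  have hc : ContinuousOn γ (Icc t₀ t₁) := by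
    have := intervalIntegral.continuousOn_primitive_interval (a := t₀) (b := t₁) (f := w)
      (by rw [uIcc_of_le hab]; exact (intervalIntegrable_iff_integrableOn_Icc_of_le hab).1 hw)
    rw [uIcc_of_le hab] at this
    exact (continuousOn_const.add this).congr hγ
  refine gronwall_integral hκ (u := fun t => ‖γ t‖) (by positivity) hc.norm
    (fun _ _ => norm_nonneg _) fun t ht => ?_
  have hsub : uIcc t₀ t ⊆ uIcc t₀ t₁ := by
    rw [uIcc_of_le ht.1, uIcc_of_le hab]; exact Icc_subset_Icc le_rfl ht.2
  have hcn : IntervalIntegrable (fun τ => κ * ‖γ τ‖) volume t₀ t := by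
    refine ContinuousOn.intervalIntegrable ?_
    rw [uIcc_of_le ht.1]
    exact continuousOn_const.mul (hc.norm.mono (Icc_subset_Icc le_rfl ht.2))
  have h1 : ‖∫ τ in t₀..t, w τ‖ ≤ ∫ τ in t₀..t, (κ * ‖γ τ‖ + f τ) := by
    refine intervalIntegral.norm_integral_le_of_norm_le ht.1 ?_ (hcn.add (hf.mono_set hsub))
    rw [ae_restrict_iff' measurableSet_Ioc] at hwf
    filter_upwards [hwf] with τ hτ h
    exact hτ ⟨h.1, h.2.trans ht.2⟩
  rw [intervalIntegral.integral_add hcn (hf.mono_set hsub)] at h1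
  have h2 : ∫ τ in t₀..t, f τ ≤ ∫ τ in t₀..t₁, f τ :=
    intervalIntegral.integral_mono_interval le_rfl ht.1 ht.2 (Eventually.of_forall hf0) hf
  rw [hγ t ht]
  have h3 := norm_add_le (γ t₀) (∫ τ in t₀..t, w τ)
  change _ ≤ ‖γ t₀‖ + F + _
  linarith

theorem aestronglyMeasurable_lag (h1 : D.H1) (m : D.Flow) {t₀ t₁ : ℝ} {γ : ℝ → Vec d}
    {α : ℝ → Vec r} (hγ : ContinuousOn γ (Icc t₀ t₁))
    (hα : AEStronglyMeasurable α (volume.restrict (Ioc t₀ t₁))) :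
    AEStronglyMeasurable (fun τ => D.lag m τ (α τ) (γ τ)) (volume.restrict (Ioc t₀ t₁)) :=
  (continuous_lag h1 m).comp_aestronglyMeasurable
    (continuous_id.aestronglyMeasurable.prodMk (hα.prodMk
      ((hγ.mono Ioc_subset_Icc_self).aestronglyMeasurable measurableSet_Ioc)))

theorem Bounds.abs_ℓ_le (c : D.Bounds) {t : ℝ} (ht : t ∈ Icc 0 D.T) (a : Vec r) (x : Vec d)
    (μ : P1 (Vec d)) : |D.ℓ t a x μ| ≤ (c.up + c.lo) * ‖a‖ ^ D.p + c.Cl := by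
  have h1 := c.ℓ_ge t ht a x μ
  have h2 := c.ℓ_le t ht a x μ
  have h3 : 0 ≤ c.up * ‖a‖ ^ D.p := mul_nonneg c.up_pos.le (by positivity)
  have h4 : 0 ≤ c.lo * ‖a‖ ^ D.p := mul_nonneg c.lo_pos.le (by positivity)
  rw [abs_le]
  constructor <;> linarith

/-- The running cost is integrable along a continuous path whose control has integrable
`p`-energy, so that its integral is never a default value. -/
theorem Bounds.intervalIntegrable_ℓ (c : D.Bounds) (h1 : D.H1) (m : D.Flow) {t₀ t₁ : ℝ}
    (h01 : t₀ ≤ t₁) (h0 : 0 ≤ t₀) (hT : t₁ ≤ D.T) {γ : ℝ → Vec d}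
    {α : ℝ → Vec r} (hγ : ContinuousOn γ (Icc t₀ t₁))
    (hα : AEStronglyMeasurable α (volume.restrict (Ioc t₀ t₁)))
    (hαp : IntervalIntegrable (fun τ => ‖α τ‖ ^ D.p) volume t₀ t₁) :
    IntervalIntegrable (fun τ => D.ℓ τ (α τ) (γ τ) (D.atTime m τ)) volume t₀ t₁ := by
  have hm : AEStronglyMeasurable (fun τ => D.ℓ τ (α τ) (γ τ) (D.atTime m τ))
      (volume.restrict (Ioc t₀ t₁)) := by
    refine (aestronglyMeasurable_lag h1 m hγ hα).congr ?_
    filter_upwards [ae_restrict_mem measurableSet_Ioc] with τ hτ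
    exact D.lag_eq m ⟨h0.trans hτ.1.le, hτ.2.trans hT⟩ _ _
  refine IntervalIntegrable.mono_fun' (g := fun τ => (c.up + c.lo) * ‖α τ‖ ^ D.p + c.Cl)
    ((hαp.const_mul _).add intervalIntegrable_const) (by rwa [uIoc_of_le h01]) ?_
  rw [uIoc_of_le h01]
  filter_upwards [ae_restrict_mem measurableSet_Ioc] with τ hτ
  exact c.abs_ℓ_le ⟨h0.trans hτ.1.le, hτ.2.trans hT⟩ _ _ _

theorem memLp_iff_energy {t₀ t₁ : ℝ} (h01 : t₀ ≤ t₁) {n : ℕ} {α : ℝ → Vec n}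
    (hα : MemLp α (ENNReal.ofReal D.p) (volume.restrict (Icc t₀ t₁))) :
    AEStronglyMeasurable α (volume.restrict (Ioc t₀ t₁)) ∧
      IntervalIntegrable (fun τ => ‖α τ‖ ^ D.p) volume t₀ t₁ ∧
      IntervalIntegrable α volume t₀ t₁ := by
  have hα' : MemLp α (ENNReal.ofReal D.p) (volume.restrict (Ioc t₀ t₁)) := by
    rwa [restrict_Ioc_eq_restrict_Icc]
  refine ⟨hα'.1, ?_, ?_⟩
  · rw [intervalIntegrable_iff_integrableOn_Ioc_of_le h01]
    have := hα'.integrable_norm_rpow (by simpa using D.p_pos) ENNReal.ofReal_ne_top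
    rwa [ENNReal.toReal_ofReal D.p_pos.le] at this
  · rw [intervalIntegrable_iff_integrableOn_Ioc_of_le h01]
    exact hα'.integrable (by simpa using D.one_lt_p.le)

theorem HasW1pDeriv.continuousOn {a b : ℝ} {γ w : ℝ → Vec d} (h : D.HasW1pDeriv a b γ w)
    (hab : a ≤ b) : ContinuousOn γ (Icc a b) := by
  have hw := (memLp_iff_energy hab h.1).2.2
  have := intervalIntegral.continuousOn_primitive_interval (a := a) (b := b) (f := w)
    (by rw [uIcc_of_le hab]; exact (intervalIntegrable_iff_integrableOn_Icc_of_le hab).1 hw)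
  rw [uIcc_of_le hab] at this
  exact (continuousOn_const.add this).congr h.2

theorem IsTrajectory.continuousOn {t : ℝ} (ht : t ≤ D.T) {x : Vec d} {γ : ℝ → Vec d}
    {α : ℝ → Vec r} (h : D.IsTrajectory t x γ α) : ContinuousOn γ (Icc t D.T) := by
  obtain ⟨w, hw, -⟩ := h.dynamics
  exact hw.continuousOn ht

theorem IsTrajectory.intervalIntegrable_ℓ (c : D.Bounds) (h1 : D.H1) (m : D.Flow) {t : ℝ}
    (ht : t ∈ Icc 0 D.T) {x : Vec d} {γ : ℝ → Vec d} {α : ℝ → Vec r}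
    (h : D.IsTrajectory t x γ α) :
    IntervalIntegrable (fun τ => D.ℓ τ (α τ) (γ τ) (D.atTime m τ)) volume t D.T := by
  obtain ⟨e1, e2, -⟩ := memLp_iff_energy ht.2 h.control
  exact c.intervalIntegrable_ℓ h1 m ht.2 ht.1 le_rfl (h.continuousOn ht.2) e1 e2

/-- The cost of a trajectory controls the `p`-energy of its control. -/
theorem IsTrajectory.energy_le_cost (c : D.Bounds) (h1 : D.H1) (m : D.Flow) {t : ℝ}
    (ht : t ∈ Icc 0 D.T) {x : Vec d} {γ : ℝ → Vec d} {α : ℝ → Vec r}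
    (h : D.IsTrajectory t x γ α) :
    c.lo * ∫ τ in t..D.T, ‖α τ‖ ^ D.p ≤ D.cost m t γ α + c.Cl * D.T - c.gl := by
  obtain ⟨-, e2, -⟩ := memLp_iff_energy ht.2 h.control
  have h3 : ∫ τ in t..D.T, (c.lo * ‖α τ‖ ^ D.p - c.Cl) ≤
      ∫ τ in t..D.T, D.ℓ τ (α τ) (γ τ) (D.atTime m τ) :=
    intervalIntegral.integral_mono_on ht.2 ((e2.const_mul _).sub intervalIntegrable_const)
      (h.intervalIntegrable_ℓ c h1 m ht) fun τ hτ => c.ℓ_ge _ ⟨ht.1.trans hτ.1, hτ.2⟩ _ _ _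
  rw [intervalIntegral.integral_sub (e2.const_mul _) intervalIntegrable_const,
    intervalIntegral.integral_const_mul, intervalIntegral.integral_const, smul_eq_mul] at h3
  have h4 := c.g_ge (γ D.T) (D.atTime m D.T)
  have h5 : (D.T - t) * c.Cl ≤ D.T * c.Cl := by
    have := c.Cl_pos.le
    gcongr
    linarith [ht.1]
  unfold cost
  linarith

theorem IsTrajectory.le_cost (c : D.Bounds) (h1 : D.H1) (m : D.Flow) {t : ℝ}
    (ht : t ∈ Icc 0 D.T) {x : Vec d} {γ : ℝ → Vec d} {α : ℝ → Vec r}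
    (h : D.IsTrajectory t x γ α) : c.gl - c.Cl * D.T ≤ D.cost m t γ α := by
  have h2 := h.energy_le_cost c h1 m ht
  have h3 : 0 ≤ c.lo * ∫ τ in t..D.T, ‖α τ‖ ^ D.p :=
    mul_nonneg c.lo_pos.le (intervalIntegral.integral_nonneg ht.2 fun _ _ => by positivity)
  linarith

theorem IsTrajectory.value_le (c : D.Bounds) (h1 : D.H1) (m : D.Flow) {t : ℝ}
    (ht : t ∈ Icc 0 D.T) {x : Vec d} {γ : ℝ → Vec d} {α : ℝ → Vec r}
    (h : D.IsTrajectory t x γ α) : D.value m t x ≤ D.cost m t γ α := by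
  refine csInf_le ⟨c.gl - c.Cl * D.T, ?_⟩ ⟨γ, α, h, rfl⟩
  rintro _ ⟨γ', α', h', rfl⟩
  exact h'.le_cost c h1 m ht

/-! ### Approximate trajectories -/

/-- On `[t₀,T]` the path `γ` has derivative `w` which differs by at most `η` from the velocity
produced by the control `α`, and this control is bounded by `C`. -/
structure NearTrajectory (D : Data d r s) (t₀ C η : ℝ) (γ : ℝ → Vec d) (α : ℝ → Vec r)
    (w : ℝ → Vec d) : Prop where
  measurable : Measurable α
  integrable : IntervalIntegrable w volume t₀ D.T
  bound : ∀ τ ∈ Ioc t₀ D.T, ‖α τ‖ ≤ C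
  integral_eq : ∀ t ∈ Icc t₀ D.T, γ t = γ t₀ + ∫ τ in t₀..t, w τ
  near : ∀ τ ∈ Ioc t₀ D.T, ‖w τ - (D.A τ (γ τ) + D.B τ (γ τ) *ᵥ α τ)‖ ≤ η

theorem aestronglyMeasurable_velocity (h3 : D.H3) {t₀ : ℝ} (h0 : 0 ≤ t₀) {u : ℝ → Vec d}
    (hu : Continuous u) {α : ℝ → Vec r} (hα : Measurable α) :
    AEStronglyMeasurable (fun τ => D.A τ (u τ) + D.B τ (u τ) *ᵥ α τ)
      (volume.restrict (Ioc t₀ D.T)) := by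
  set pr : ℝ → ℝ := fun τ => (projIcc 0 D.T D.T_pos.le τ : ℝ)
  have hpr : Continuous pr := continuous_subtype_val.comp continuous_projIcc
  have hmem : ∀ τ, pr τ ∈ Icc 0 D.T := fun τ => Subtype.coe_prop _
  have hA : Continuous fun τ => D.A (pr τ) (u τ) :=
    h3.continuous_A.comp_continuous (hpr.prodMk hu) fun τ => ⟨hmem τ, mem_univ _⟩
  have hB : Continuous fun τ => D.B (pr τ) (u τ) :=
    h3.continuous_B.comp_continuous (hpr.prodMk hu) fun τ => ⟨hmem τ, mem_univ _⟩
  have hm : Measurable fun τ => D.A (pr τ) (u τ) + D.B (pr τ) (u τ) *ᵥ α τ := by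
    refine hA.measurable.add (measurable_pi_lambda _ fun i => ?_)
    have : ∀ j, Measurable fun τ => D.B (pr τ) (u τ) i j * α τ j := fun j =>
      (hB.matrix_elem i j).measurable.mul ((measurable_pi_apply j).comp hα)
    exact Finset.measurable_sum Finset.univ fun j _ => this j
  refine hm.aestronglyMeasurable.congr ?_
  filter_upwards [ae_restrict_mem measurableSet_Ioc] with τ hτ
  have : pr τ = τ := by
    simp only [pr]; rw [projIcc_of_mem _ ⟨h0.trans hτ.1.le, hτ.2⟩]
  rw [this]

theorem NearTrajectory.continuousOn {t₀ C η : ℝ} {γ : ℝ → Vec d} {α : ℝ → Vec r}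
    {w : ℝ → Vec d} (h : D.NearTrajectory t₀ C η γ α w) (ht : t₀ ≤ D.T) :
    ContinuousOn γ (Icc t₀ D.T) := by
  have := intervalIntegral.continuousOn_primitive_interval (a := t₀) (b := D.T) (f := w)
    (by rw [uIcc_of_le ht]; exact (intervalIntegrable_iff_integrableOn_Icc_of_le ht).1 h.integrable)
  rw [uIcc_of_le ht] at this
  exact (continuousOn_const.add this).congr h.integral_eq

/-- An approximate trajectory is close to the exact trajectory with the same control. -/
theorem NearTrajectory.exists_trajectory (c : D.Bounds) (h3 : D.H3) {t₀ C η : ℝ} (hC : 0 ≤ C)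
    (hη : 0 ≤ η) (ht : t₀ ∈ Icc 0 D.T) {γ : ℝ → Vec d} {α : ℝ → Vec r} {w : ℝ → Vec d}
    (h : D.NearTrajectory t₀ C η γ α w) :
    ∃ γ' : ℝ → Vec d, D.IsTrajectory t₀ (γ t₀) γ' α ∧ ∀ t ∈ Icc t₀ D.T,
      ‖γ' t - γ t‖ ≤ 2 * D.T * Real.exp (2 * (c.LA + c.LB * C) * D.T) * η := by
  have hLA := c.LA_pos
  have hLB := c.LB_pos
  have hCB := c.CB_pos
  have hmem : ∀ τ ∈ Ioc t₀ D.T, τ ∈ Icc 0 D.T := fun τ hτ => ⟨ht.1.trans hτ.1.le, hτ.2⟩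
  have hκ : 0 < c.LA + c.LB * C := by positivity
  obtain ⟨u, hu, hui, hus, hud⟩ := exists_solution_near (a := t₀) (b := D.T)
    (κ := c.LA + c.LB * C) (M := c.A0 + c.CB * C) (η := η) ht.2 hκ
    (f := fun τ x => D.A τ x + D.B τ x *ᵥ α τ)
    (fun u hu => aestronglyMeasurable_velocity h3 ht.1 hu h.measurable)
    (fun τ hτ x y => by
      have h1 := c.velocity_sub_le (hmem τ hτ) y x (α τ) (α τ)
      rw [sub_self, norm_zero, mul_zero, add_zero] at h1
      refine h1.trans ?_
      gcongr
      exact h.bound τ hτ)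
    (fun τ hτ => by
      refine (norm_add_le _ _).trans (add_le_add (c.A_zero τ (hmem τ hτ)) ?_)
      refine (c.B_le τ (hmem τ hτ) _ _).trans ?_
      gcongr
      exact h.bound τ hτ)
    h.integrable h.integral_eq hη h.near
  obtain ⟨R, hR⟩ := isCompact_Icc.exists_bound_of_continuousOn (s := Icc t₀ D.T) hu.continuousOn
  have hu0 : u t₀ = γ t₀ := by
    rw [hus t₀ ⟨le_rfl, ht.2⟩, intervalIntegral.integral_same, add_zero]
  refine ⟨u, ⟨?_, ⟨fun τ => D.A τ (u τ) + D.B τ (u τ) *ᵥ α τ, ⟨?_, ?_⟩, ?_⟩, hu0⟩, ?_⟩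
  · rw [← restrict_Ioc_eq_restrict_Icc]
    refine MemLp.of_bound h.measurable.aestronglyMeasurable C ?_
    filter_upwards [ae_restrict_mem measurableSet_Ioc] with τ hτ using h.bound τ hτ
  · rw [← restrict_Ioc_eq_restrict_Icc]
    refine MemLp.of_bound (aestronglyMeasurable_velocity h3 ht.1 hu h.measurable)
      (c.A0 + c.LA * R + c.CB * C) ?_
    filter_upwards [ae_restrict_mem measurableSet_Ioc] with τ hτ
    refine (norm_add_le _ _).trans (add_le_add ((c.A_le (hmem τ hτ) _).trans ?_) ?_)
    · gcongr
      exact hR τ (Ioc_subset_Icc_self hτ)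
    · refine (c.B_le τ (hmem τ hτ) _ _).trans ?_
      gcongr
      exact h.bound τ hτ
  · intro t htt
    rw [hus t htt, hu0]
  · exact Eventually.of_forall fun _ => rfl
  · intro t htt
    refine (hud t htt).trans ?_
    have : D.T - t₀ ≤ D.T := by linarith [ht.1]
    have := D.T_pos.le
    gcongr

theorem NearTrajectory.intervalIntegrable_ℓ (c : D.Bounds) (h1 : D.H1) (m : D.Flow) {t₀ C η : ℝ}
    (ht : t₀ ∈ Icc 0 D.T) {γ : ℝ → Vec d} {α : ℝ → Vec r} {w : ℝ → Vec d}
    (h : D.NearTrajectory t₀ C η γ α w) :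
    IntervalIntegrable (fun τ => D.ℓ τ (α τ) (γ τ) (D.atTime m τ)) volume t₀ D.T := by
  refine c.intervalIntegrable_ℓ h1 m ht.2 ht.1 le_rfl (h.continuousOn ht.2)
    h.measurable.aestronglyMeasurable ?_
  rw [intervalIntegrable_iff_integrableOn_Ioc_of_le ht.2]
  refine Integrable.of_bound (h.measurable.norm.pow_const _).aestronglyMeasurable (C ^ D.p) ?_
  filter_upwards [ae_restrict_mem measurableSet_Ioc] with τ hτ
  rw [Real.norm_of_nonneg (by positivity)]
  exact Real.rpow_le_rpow (norm_nonneg _) (h.bound τ hτ) D.p_pos.le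

/-- The cost of an approximate trajectory is almost bounded below by the value function. -/
theorem NearTrajectory.value_le (c : D.Bounds) (h1 : D.H1) (h3 : D.H3) (m : D.Flow) {t₀ C η : ℝ}
    (hC : 0 ≤ C) (hη : 0 ≤ η) (ht : t₀ ∈ Icc 0 D.T) {γ : ℝ → Vec d} {α : ℝ → Vec r} {w : ℝ → Vec d}
    (h : D.NearTrajectory t₀ C η γ α w) :
    D.value m t₀ (γ t₀) ≤ D.cost m t₀ γ α + (c.Ll * (1 + C ^ D.p) * D.T + c.Lg) *
      (2 * D.T * Real.exp (2 * (c.LA + c.LB * C) * D.T) * η) := by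
  obtain ⟨γ', hγ', hd⟩ := h.exists_trajectory c h3 hC hη ht
  refine (hγ'.value_le c h1 m ht).trans ?_
  set δ := 2 * D.T * Real.exp (2 * (c.LA + c.LB * C) * D.T) * η
  have hLl := c.Ll_pos
  have hLg := c.Lg_pos
  have hT := D.T_pos
  have hδ : 0 ≤ δ := by positivity
  have e1 : ∫ τ in t₀..D.T, D.ℓ τ (α τ) (γ' τ) (D.atTime m τ) ≤
      ∫ τ in t₀..D.T, (D.ℓ τ (α τ) (γ τ) (D.atTime m τ) + c.Ll * (1 + C ^ D.p) * δ) := by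
    refine intervalIntegral.integral_mono_on_of_le_Ioo ht.2 (hγ'.intervalIntegrable_ℓ c h1 m ht)
      ((h.intervalIntegrable_ℓ c h1 m ht).add intervalIntegrable_const) fun τ hτ => ?_
    have h5 := (abs_le.1 (c.ℓ_lip τ ⟨ht.1.trans hτ.1.le, hτ.2.le⟩ (α τ) (D.atTime m τ)
      (γ' τ) (γ τ))).2
    have h6 : c.Ll * (1 + ‖α τ‖ ^ D.p) * ‖γ' τ - γ τ‖ ≤ c.Ll * (1 + C ^ D.p) * δ := by
      gcongr
      · exact D.p_pos.le
      · exact h.bound τ ⟨hτ.1, hτ.2.le⟩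
      · exact hd τ ⟨hτ.1.le, hτ.2.le⟩
    linarith
  rw [intervalIntegral.integral_add (h.intervalIntegrable_ℓ c h1 m ht) intervalIntegrable_const,
    intervalIntegral.integral_const, smul_eq_mul] at e1
  have e2 := (abs_le.1 (c.g_lip (D.atTime m D.T) (γ' D.T) (γ D.T))).2
  have e3 := mul_le_mul_of_nonneg_left (hd D.T ⟨ht.2, le_rfl⟩) c.Lg_pos.le
  have e4 : (D.T - t₀) * (c.Ll * (1 + C ^ D.p) * δ) ≤ D.T * (c.Ll * (1 + C ^ D.p) * δ) := by
    gcongr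
    linarith [ht.1]
  unfold cost
  linarith

/-- The path at rest is an approximate trajectory for the zero control. -/
theorem Bounds.nearTrajectory_const (c : D.Bounds) {t₀ : ℝ} (ht : t₀ ∈ Icc 0 D.T) (x : Vec d) :
    D.NearTrajectory t₀ 0 (c.A0 + c.LA * ‖x‖) (fun _ => x) (fun _ => 0) (fun _ => 0) where
  measurable := measurable_const
  integrable := intervalIntegrable_const
  bound τ _ := by simp
  integral_eq t _ := by simp
  near τ hτ := by
    simpa using c.A_le ⟨ht.1.trans hτ.1.le, hτ.2⟩ x

/-- The value function is an infimum over a nonempty set, and it is bounded above on balls. -/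
theorem Bounds.exists_value_le (c : D.Bounds) (h1 : D.H1) (h2 : D.H2) (h3 : D.H3) (m : D.Flow)
    (R : ℝ) : ∃ K : ℝ, ∀ t ∈ Icc 0 D.T, ∀ x : Vec d, ‖x‖ ≤ R →
      D.value m t x ≤ K ∧ ∀ ε > 0, ∃ γ α, D.IsTrajectory t x γ α ∧
        D.cost m t γ α ≤ D.value m t x + ε := by
  obtain ⟨G, hG⟩ := (isCompact_closedBall (0 : Vec d) R).exists_bound_of_continuousOn
    (continuous_g_at h2 (D.atTime m D.T)).continuousOn
  have hLl := c.Ll_pos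
  have hLg := c.Lg_pos
  have hLA := c.LA_pos
  have hCl := c.Cl_pos
  have hT := D.T_pos
  have hA0 := c.A0_nonneg
  refine ⟨c.Cl * D.T + G + (c.Ll * (1 + 0 ^ D.p) * D.T + c.Lg) *
      (2 * D.T * Real.exp (2 * (c.LA + c.LB * 0) * D.T) * (c.A0 + c.LA * R)),
    fun t ht x hx => ⟨?_, fun ε hε => ?_⟩⟩
  · have h := (c.nearTrajectory_const ht x).value_le c h1 h3 m le_rfl
      (by positivity) ht
    refine h.trans ?_
    have : 0 ≤ c.LB * 0 := by simp
    have hz : (0 : ℝ) ≤ 0 ^ D.p := Real.rpow_nonneg le_rfl _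
    gcongr
    · unfold cost
      refine add_le_add ?_ ((le_abs_self _).trans (hG x (by simpa using hx)))
      have : ∫ τ in t..D.T, D.ℓ τ 0 x (D.atTime m τ) ≤ ∫ τ in t..D.T, c.Cl := by
        refine intervalIntegral.integral_mono_on ht.2
          ((c.nearTrajectory_const ht x).intervalIntegrable_ℓ c h1 m ht)
          intervalIntegrable_const fun τ hτ => ?_
        have := c.ℓ_le τ ⟨ht.1.trans hτ.1, hτ.2⟩ 0 x (D.atTime m τ)
        rwa [norm_zero, D.zero_rpow_p, mul_zero, zero_add] at this
      rw [intervalIntegral.integral_const, smul_eq_mul] at this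
      nlinarith [ht.1]
  · obtain ⟨γ', hγ', -⟩ := (c.nearTrajectory_const ht x).exists_trajectory c h3 le_rfl
      (by positivity) ht
    obtain ⟨_, ⟨γ, α, h, rfl⟩, hlt⟩ := exists_lt_of_csInf_lt
      (s := {c : ℝ | ∃ γ α, D.IsTrajectory t x γ α ∧ c = D.cost m t γ α})
      ⟨_, _, _, hγ', rfl⟩ (lt_add_of_pos_right (D.value m t x) hε)
    exact ⟨γ, α, h, hlt.le⟩

end Data
end MFG

namespace MFG

/-! ### Approximation of trajectories by the Euler scheme -/

theorem exists_le_mul_rpow {p : ℝ} (hp : 1 < p) {η : ℝ} (hη : 0 < η) :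
    ∃ ρ : ℝ, 1 ≤ ρ ∧ ∀ y : ℝ, ρ < y → y ≤ η * y ^ p := by
  refine ⟨max 1 ((1 / η) ^ (1 / (p - 1))), le_max_left _ _, fun y hy => ?_⟩
  have hp1 : 0 < p - 1 := by linarith
  have hy0 : 0 < y := lt_trans (by norm_num) ((le_max_left _ _).trans_lt hy)
  have h2 : 1 / η ≤ y ^ (p - 1) := by
    have := Real.rpow_le_rpow (by positivity) ((le_max_right _ _).trans hy.le) hp1.le
    rwa [← Real.rpow_mul (by positivity), one_div_mul_cancel hp1.ne', Real.rpow_one] at this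
  have h3 : y ^ p = y ^ (p - 1) * y := by
    rw [← Real.rpow_add_one hy0.ne']; congr 1; ring
  have h4 : 1 ≤ η * y ^ (p - 1) := by
    rw [div_le_iff₀ hη] at h2; linarith
  rw [h3, ← mul_assoc]; exact le_mul_of_one_le_left hy0.le h4

/-- Jensen's inequality on an interval. -/
theorem mul_le_integral_of_convexOn {E : Type*} [NormedAddCommGroup E] [NormedSpace ℝ E]
    [CompleteSpace E] {φ : E → ℝ} (hφ : ConvexOn ℝ univ φ) (hc : Continuous φ) {a b : ℝ}
    (hab : a < b) {f : ℝ → E} (hf : IntervalIntegrable f volume a b)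
    (hφf : IntervalIntegrable (fun τ => φ (f τ)) volume a b) :
    (b - a) * φ ((b - a)⁻¹ • ∫ τ in a..b, f τ) ≤ ∫ τ in a..b, φ (f τ) := by
  have h := hφ.map_set_average_le (μ := volume) (t := Ioc a b) (f := f) hc.continuousOn
    isClosed_univ (by simp [hab]) (by simp) (by simp)
    ((intervalIntegrable_iff_integrableOn_Ioc_of_le hab.le).1 hf)
    ((intervalIntegrable_iff_integrableOn_Ioc_of_le hab.le).1 hφf)
  have hba : 0 < b - a := sub_pos.2 hab
  rw [setAverage_eq, setAverage_eq, ← intervalIntegral.integral_of_le hab.le,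
    ← intervalIntegral.integral_of_le hab.le] at h
  simp only [measureReal_def, Real.volume_Ioc, ENNReal.toReal_ofReal hba.le, smul_eq_mul] at h
  calc _ ≤ (b - a) * ((b - a)⁻¹ * ∫ τ in a..b, φ (f τ)) := by gcongr
    _ = _ := by field_simp

namespace Data

variable {d r s : ℕ} {D : Data d r s}

theorem exists_step_le (D : Data d r s) {δ : ℝ} (hδ : 0 < δ) :
    ∃ N₀ : ℕ, 0 < N₀ ∧ ∀ N ≥ N₀, D.T / N ≤ δ := by
  obtain ⟨n, hn⟩ := exists_nat_gt (D.T / δ)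
  refine ⟨n + 1, Nat.succ_pos _, fun N hN => ?_⟩
  have h0 : (n : ℝ) + 1 ≤ N := by exact_mod_cast hN
  have hN0 : (0 : ℝ) < N := by linarith [(Nat.cast_nonneg n : (0 : ℝ) ≤ n)]
  rw [div_lt_iff₀ hδ] at hn
  rw [div_le_iff₀ hN0]
  nlinarith

theorem exists_lag_modulus (h1 : D.H1) (m : D.Flow) (C R : ℝ) {ε : ℝ} (hε : 0 < ε) :
    ∃ δ > 0, ∀ t ∈ Icc 0 D.T, ∀ t' ∈ Icc 0 D.T, ∀ (a b : Vec r) (x y : Vec d),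
      ‖a‖ ≤ C → ‖x‖ ≤ R → |t - t'| ≤ δ → ‖a - b‖ ≤ δ → ‖x - y‖ ≤ δ →
      |D.ℓ t a x (D.atTime m t) - D.ℓ t' b y (D.atTime m t')| ≤ ε := by
  obtain ⟨δ₁, hδ₁, h⟩ := exists_ℓ_modulus h1 m C R hε
  have hm : Continuous (D.atTime m) := m.continuous.comp continuous_projIcc
  obtain ⟨δ₂, hδ₂, h'⟩ := exists_modulus isCompact_Icc (hm.continuousOn (s := Icc 0 D.T)) hδ₁
  refine ⟨min δ₁ δ₂, lt_min hδ₁ hδ₂, fun t ht t' ht' a b x y ha hx e1 e2 e3 => ?_⟩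
  exact h t ht t' ht' a b x y _ ha hx (e1.trans (min_le_left _ _)) (e2.trans (min_le_left _ _))
    (e3.trans (min_le_left _ _)) (h' t ht t' ht' (e1.trans (min_le_right _ _)))

set_option maxHeartbeats 1000000 in
/-- Averaging the truncated control of a trajectory over the time steps gives controls for the
Euler scheme whose cost is not much larger. Here `ρ` is the level of truncation, `ε₁`, `ε₂` and
`o` are bounds on the oscillation of the velocity, of the running cost and of the trajectory over
a time step. -/
theorem IsTrajectory.exists_eulerCost_le (c : D.Bounds) (h1 : D.H1) (m : D.Flow)
    {N k : ℕ} (hN : 0 < N) (hk : k ≤ N) {x : Vec d} {γ : ℝ → Vec d} {α : ℝ → Vec r}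
    (h : D.IsTrajectory (k * (D.T / N)) x γ α) {F ρ η ε₁ ε₂ o : ℝ} (hρ : 1 ≤ ρ) (hη0 : 0 ≤ η)
    (hη : ∀ y : ℝ, ρ < y → y ≤ η * y ^ D.p)
    (hF : ∫ τ in (k * (D.T / N))..D.T, (1 + ‖α τ‖ + ‖α τ‖ ^ D.p) ≤ F) (hε₁ : 0 ≤ ε₁)
    (hε₂ : 0 ≤ ε₂) (ho0 : 0 ≤ o)
    (hV : ∀ t τ, k * (D.T / N) ≤ t → t ≤ τ → τ ≤ t + D.T / N → τ ≤ D.T →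
      ‖D.A τ (γ τ) - D.A t (γ t)‖ ≤ ε₁ ∧
        ∀ a : Vec r, ‖D.B τ (γ τ) *ᵥ a - D.B t (γ t) *ᵥ a‖ ≤ ε₁ * ‖a‖)
    (hL : ∀ t τ, k * (D.T / N) ≤ t → t ≤ τ → τ ≤ t + D.T / N → τ ≤ D.T → ∀ a : Vec r, ‖a‖ ≤ ρ →
      D.ℓ t a (γ τ) (D.atTime m t) ≤ D.ℓ τ a (γ τ) (D.atTime m τ) + ε₂)
    (ho : ∀ t τ, k * (D.T / N) ≤ t → t ≤ τ → τ ≤ t + D.T / N → τ ≤ D.T → ‖γ τ - γ t‖ ≤ o) :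
    ∃ a : ℕ → Vec r, D.eulerCost N m k x a ≤ D.cost m (k * (D.T / N)) γ α +
      (2 * c.Cl * η + ε₂ + c.Ll * ((ε₁ + c.CB * η) * F * Real.exp ((c.LA + c.LB) * F) + o)) * F +
      c.Lg * ((ε₁ + c.CB * η) * F * Real.exp ((c.LA + c.LB) * F)) := by
  have hLA := c.LA_pos
  have hLB := c.LB_pos
  have hCB := c.CB_pos
  have hLl := c.Ll_pos
  have hLg := c.Lg_pos
  have hCl := c.Cl_pos
  set Δ := D.T / N with hΔdef
  have hΔ : 0 < Δ := D.step_pos hN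
  have ht0 : (k : ℝ) * Δ ∈ Icc 0 D.T := D.step_time_mem hN hk
  set t : ℕ → ℝ := fun i => (k + i : ℕ) * Δ with ht
  have ht_zero : t 0 = k * Δ := by simp [ht]
  have ht_succ : ∀ i, t (i + 1) = t i + Δ := fun i => by simp only [ht]; push_cast; ring
  have ht_last : t (N - k) = D.T := by
    simp only [ht]
    rw [Nat.add_sub_cancel' hk, hΔdef]
    field_simp
  have ht_mono : Monotone t := monotone_nat_of_le_succ fun i => by rw [ht_succ]; linarith
  have ht_ge : ∀ i, k * Δ ≤ t i := fun i => ht_zero ▸ ht_mono (Nat.zero_le i)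
  have ht_le : ∀ i ≤ N - k, t i ≤ D.T := fun i hi => ht_last ▸ ht_mono hi
  obtain ⟨e1, e2, e3⟩ := memLp_iff_energy ht0.2 h.control
  obtain ⟨w, hw, hwae⟩ := h.dynamics
  have hwi := (memLp_iff_energy ht0.2 hw.1).2.2
  set f : ℝ → ℝ := fun τ => 1 + ‖α τ‖ + ‖α τ‖ ^ D.p with hf
  have hf1 : ∀ τ, 1 ≤ f τ := fun τ => by
    have : 0 ≤ ‖α τ‖ ^ D.p := by positivity
    simp only [hf]; linarith [norm_nonneg (α τ)]
  have hfi : IntervalIntegrable f volume (k * Δ) D.T :=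
    (intervalIntegrable_const.add e3.norm).add e2
  have hF0 : 0 ≤ F := (intervalIntegral.integral_nonneg ht0.2
    fun τ _ => zero_le_one.trans (hf1 τ)).trans hF
  have hsub : ∀ i < N - k, uIcc (t i) (t (i + 1)) ⊆ uIcc (k * Δ) D.T := fun i hi => by
    rw [uIcc_of_le (ht_mono (Nat.le_succ i)), uIcc_of_le ht0.2]
    exact Icc_subset_Icc (ht_ge i) (ht_le _ hi)
  -- truncation at `ρ` makes the modulus of continuity of the running cost in the control available
  set β : ℝ → Vec r := fun τ => if ‖α τ‖ ≤ ρ then α τ else 0 with hβ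
  have hβρ : ∀ τ, ‖β τ‖ ≤ ρ := fun τ => by
    simp only [hβ]; split_ifs with hc
    · exact hc
    · simp; linarith
  have hβα : ∀ τ, ‖β τ‖ ≤ ‖α τ‖ := fun τ => by
    simp only [hβ]; split_ifs <;> simp
  have hαβ : ∀ τ, ‖α τ - β τ‖ ≤ η * f τ := fun τ => by
    simp only [hβ]
    split_ifs with hc
    · simpa using mul_nonneg hη0 (zero_le_one.trans (hf1 τ))
    · rw [sub_zero]
      refine (hη _ (not_le.1 hc)).trans ?_
      gcongr
      simp only [hf]; linarith [norm_nonneg (α τ)]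
  have hβm : AEStronglyMeasurable β (volume.restrict (Ioc (k * Δ) D.T)) := by
    have hφ : Measurable fun a : Vec r => if ‖a‖ ≤ ρ then a else 0 :=
      Measurable.ite (measurableSet_le measurable_norm measurable_const) measurable_id
        measurable_const
    exact (hφ.comp_aemeasurable e1.aemeasurable).aestronglyMeasurable
  have hβi : IntervalIntegrable β volume (k * Δ) D.T := by
    rw [intervalIntegrable_iff_integrableOn_Ioc_of_le ht0.2]
    exact Integrable.of_bound hβm ρ (Eventually.of_forall hβρ)
  set a : ℕ → Vec r := fun j => Δ⁻¹ • ∫ τ in (j * Δ)..((j + 1 : ℕ) * Δ), β τ with ha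
  have ha_eq : ∀ i, a (k + i) = Δ⁻¹ • ∫ τ in (t i)..(t (i + 1)), β τ := fun i => rfl
  refine ⟨a, ?_⟩
  set X := D.eulerState N k x a with hX
  set φ : ℕ → ℝ := fun i => ∫ τ in (t i)..(t (i + 1)), f τ with hφ
  have hφ0 : ∀ i, 0 ≤ φ i := fun i => intervalIntegral.integral_nonneg (ht_mono (Nat.le_succ i))
    fun τ _ => zero_le_one.trans (hf1 τ)
  have hφF : ∀ i ≤ N - k, ∑ j ∈ Finset.range i, φ j ≤ F := by
    intro i hi
    refine (Finset.sum_le_sum_of_subset_of_nonneg (Finset.range_mono hi)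
      fun j _ _ => hφ0 j).trans ?_
    rw [intervalIntegral.sum_integral_adjacent_intervals fun j hj => hfi.mono_set (hsub j hj),
      ht_zero, ht_last]
    exact hF
  set δs := (ε₁ + c.CB * η) * F * Real.exp ((c.LA + c.LB) * F) with hδs
  have hδs0 : 0 ≤ δs := by positivity
  have hwae' : ∀ i < N - k, ∀ᵐ τ, τ ∈ Ioc (t i) (t (i + 1)) →
      w τ = D.A τ (γ τ) + D.B τ (γ τ) *ᵥ α τ := by
    intro i hi
    rw [ae_restrict_iff' measurableSet_Icc] at hwae
    filter_upwards [hwae] with τ hτ hm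
    exact hτ ⟨(ht_ge i).trans hm.1.le, hm.2.trans (ht_le _ hi)⟩
  have hγ_step : ∀ i < N - k, γ (t (i + 1)) - γ (t i) = ∫ τ in (t i)..(t (i + 1)), w τ := by
    intro i hi
    rw [hw.2 _ ⟨ht_ge _, ht_le _ hi⟩, hw.2 _ ⟨ht_ge _, ht_le _ hi.le⟩, add_sub_add_left_eq_sub]
    refine intervalIntegral.integral_interval_sub_left (hwi.mono_set ?_) (hwi.mono_set ?_)
    · rw [uIcc_of_le (ht_ge _), uIcc_of_le ht0.2]; exact Icc_subset_Icc le_rfl (ht_le _ hi)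
    · rw [uIcc_of_le (ht_ge _), uIcc_of_le ht0.2]; exact Icc_subset_Icc le_rfl (ht_le _ hi.le)
  have hX_step : ∀ i < N - k, X (i + 1) - X i = ∫ τ in (t i)..(t (i + 1)),
      (D.A (t i) (X i) + D.B (t i) (X i) *ᵥ β τ) := by
    intro i hi
    have hb := hβi.mono_set (hsub i hi)
    have hlin : ∫ τ in (t i)..(t (i + 1)), D.B (t i) (X i) *ᵥ β τ =
        D.B (t i) (X i) *ᵥ ∫ τ in (t i)..(t (i + 1)), β τ :=
      (LinearMap.toContinuousLinearMap (D.B (t i) (X i)).mulVecLin).intervalIntegral_comp_comm hb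
    have hbi : IntervalIntegrable (fun τ => D.B (t i) (X i) *ᵥ β τ) volume (t i) (t (i + 1)) :=
      ⟨(LinearMap.toContinuousLinearMap (D.B (t i) (X i)).mulVecLin).integrable_comp hb.1,
        (LinearMap.toContinuousLinearMap (D.B (t i) (X i)).mulVecLin).integrable_comp hb.2⟩
    rw [intervalIntegral.integral_add intervalIntegrable_const hbi, hlin,
      intervalIntegral.integral_const]
    have hs : X (i + 1) = X i + Δ • (D.A (t i) (X i) + D.B (t i) (X i) *ᵥ a (k + i)) := rfl
    rw [hs, ha_eq, add_sub_cancel_left, smul_add, Matrix.mulVec_smul, smul_smul,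
      mul_inv_cancel₀ hΔ.ne', one_smul, ht_succ, add_sub_cancel_left]
  -- both increments are integrals over the time step; the difference is controlled by `β - α`, by
  -- the modulus of the velocity and by the current error
  have hrec : ∀ i < N - k, ‖X (i + 1) - γ (t (i + 1))‖ ≤
      (1 + (c.LA + c.LB) * φ i) * ‖X i - γ (t i)‖ + (ε₁ + c.CB * η) * φ i := by
    intro i hi
    have hb := hβi.mono_set (hsub i hi)
    have hbi : IntervalIntegrable (fun τ => D.A (t i) (X i) + D.B (t i) (X i) *ᵥ β τ)
        volume (t i) (t (i + 1)) :=
      intervalIntegrable_const.add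
      ⟨(LinearMap.toContinuousLinearMap (D.B (t i) (X i)).mulVecLin).integrable_comp hb.1,
        (LinearMap.toContinuousLinearMap (D.B (t i) (X i)).mulVecLin).integrable_comp hb.2⟩
    have e : X (i + 1) - γ (t (i + 1)) = (X i - γ (t i)) + ∫ τ in (t i)..(t (i + 1)),
        (D.A (t i) (X i) + D.B (t i) (X i) *ᵥ β τ - w τ) := by
      rw [intervalIntegral.integral_sub hbi (hwi.mono_set (hsub i hi)), ← hX_step i hi,
        ← hγ_step i hi]
      abel
    have hn : ‖∫ τ in (t i)..(t (i + 1)), (D.A (t i) (X i) + D.B (t i) (X i) *ᵥ β τ - w τ)‖ ≤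
        ∫ τ in (t i)..(t (i + 1)), ((ε₁ + c.CB * η) + (c.LA + c.LB) * ‖X i - γ (t i)‖) * f τ := by
      refine intervalIntegral.norm_integral_le_of_norm_le (ht_mono (Nat.le_succ i)) ?_
        ((hfi.mono_set (hsub i hi)).const_mul _)
      filter_upwards [hwae' i hi] with τ hτ hm
      rw [hτ hm]
      have hti : t i ∈ Icc 0 D.T := ⟨ht0.1.trans (ht_ge i), ht_le _ hi.le⟩
      have hm2 : τ ≤ t i + Δ := by rw [← ht_succ]; exact hm.2
      obtain ⟨v1, v2⟩ := hV (t i) τ (ht_ge i) hm.1.le hm2 (hm.2.trans (ht_le _ hi))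
      have v3 := c.velocity_sub_le hti (X i) (γ (t i)) (β τ) (α τ)
      have v2' := v2 (α τ)
      have e : D.A (t i) (X i) + D.B (t i) (X i) *ᵥ β τ - (D.A τ (γ τ) + D.B τ (γ τ) *ᵥ α τ) =
        -((D.A τ (γ τ) - D.A (t i) (γ (t i))) +
          (D.B τ (γ τ) *ᵥ α τ - D.B (t i) (γ (t i)) *ᵥ α τ) +
          ((D.A (t i) (γ (t i)) + D.B (t i) (γ (t i)) *ᵥ α τ) -
            (D.A (t i) (X i) + D.B (t i) (X i) *ᵥ β τ))) := by abel
      rw [e, norm_neg]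
      refine norm_add₃_le.trans ?_
      rw [norm_sub_rev (γ (t i)) (X i)] at v3
      have u1 : ε₁ + ε₁ * ‖α τ‖ ≤ ε₁ * f τ := by
        have : 0 ≤ ‖α τ‖ ^ D.p := by positivity
        simp only [hf]; nlinarith
      have u2 : (c.LA + c.LB * ‖β τ‖) * ‖X i - γ (t i)‖ ≤
          (c.LA + c.LB) * f τ * ‖X i - γ (t i)‖ := by
        gcongr
        have h0 : 0 ≤ ‖α τ‖ ^ D.p := by positivity
        have : c.LB * ‖β τ‖ ≤ c.LB * f τ := by
          gcongr
          simp only [hf]; linarith [hβα τ]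
        nlinarith [hf1 τ]
      have u3 := mul_le_mul_of_nonneg_left (hαβ τ) hCB.le
      calc _ ≤ ε₁ + ε₁ * ‖α τ‖ + ((c.LA + c.LB * ‖β τ‖) * ‖X i - γ (t i)‖ +
            c.CB * ‖α τ - β τ‖) := by gcongr
        _ ≤ ε₁ * f τ + ((c.LA + c.LB) * f τ * ‖X i - γ (t i)‖ + c.CB * (η * f τ)) := by gcongr
        _ = _ := by ring
    rw [intervalIntegral.integral_const_mul] at hn
    rw [e]
    refine (norm_add_le _ _).trans ((add_le_add le_rfl hn).trans_eq ?_)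
    simp only [hφ]; ring
  have hδ : ∀ i ≤ N - k, ‖X i - γ (t i)‖ ≤ δs := by
    intro i hi
    have hg := gronwall_range (u := fun i => ‖X i - γ (t i)‖) (n := N - k) hrec (norm_nonneg _)
      (fun j _ => by have := hφ0 j; positivity) (fun j _ => by have := hφ0 j; positivity) i hi
    refine hg.trans ?_
    have h0 : ‖X 0 - γ (t 0)‖ = 0 := by
      rw [ht_zero, h.initial]; simp [hX, eulerState]
    rw [h0, zero_add, ← Finset.mul_sum, ← Finset.mul_sum, hδs]
    gcongr
    · exact hφF i hi
    · exact hφF i hi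
  -- on each time step Jensen's inequality compares the cost of the mean control with the mean cost
  have hstep : ∀ i < N - k, Δ * D.ℓ (t i) (a (k + i)) (X i) (D.atTime m (t i)) ≤
      (∫ τ in (t i)..(t (i + 1)), D.ℓ τ (α τ) (γ τ) (D.atTime m τ)) +
        (2 * c.Cl * η + ε₂ + c.Ll * (δs + o)) * φ i := by
    intro i hi
    have hti : t i ∈ Icc 0 D.T := ⟨ht0.1.trans (ht_ge i), ht_le _ hi.le⟩
    have hlt : t i < t (i + 1) := by rw [ht_succ]; linarith
    have hcont : Continuous fun b => D.ℓ (t i) b (X i) (D.atTime m (t i)) := by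
      have h := (continuous_lag h1 m).comp (f := fun b : Vec r => (t i, b, X i)) (by fun_prop)
      refine h.congr fun b => ?_
      exact D.lag_eq m hti _ _
    have hint : IntervalIntegrable (fun τ => D.ℓ (t i) (β τ) (X i) (D.atTime m (t i))) volume
        (t i) (t (i + 1)) := by
      rw [intervalIntegrable_iff_integrableOn_Ioc_of_le hlt.le]
      refine Integrable.of_bound ?_ ((c.up + c.lo) * ρ ^ D.p + c.Cl)
        (Eventually.of_forall fun τ => ?_)
      · exact hcont.comp_aestronglyMeasurable
          (hβm.mono_measure (Measure.restrict_mono (Ioc_subset_Ioc (ht_ge i) (ht_le _ hi)) le_rfl))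
      · refine (c.abs_ℓ_le hti _ _ _).trans ?_
        have := c.up_pos
        have := c.lo_pos
        have := D.p_pos
        gcongr
        exact hβρ τ
    have hJ := mul_le_integral_of_convexOn (h1.convex (t i) hti (X i) (D.atTime m (t i))) hcont
      hlt (hβi.mono_set (hsub i hi)) hint
    rw [ht_succ, add_sub_cancel_left, ← ht_succ] at hJ
    rw [ha_eq]
    refine hJ.trans ?_
    have hℓi : IntervalIntegrable (fun τ => D.ℓ τ (α τ) (γ τ) (D.atTime m τ)) volume
        (t i) (t (i + 1)) := (h.intervalIntegrable_ℓ c h1 m ht0).mono_set (hsub i hi)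
    rw [← intervalIntegral.integral_const_mul, ← intervalIntegral.integral_add hℓi
      ((hfi.mono_set (hsub i hi)).const_mul _)]
    refine intervalIntegral.integral_mono_on hlt.le hint
      (hℓi.add ((hfi.mono_set (hsub i hi)).const_mul _)) fun τ hτ => ?_
    have hτ2 : τ ≤ t i + Δ := by rw [← ht_succ]; exact hτ.2
    have hτT : τ ≤ D.T := hτ.2.trans (ht_le _ hi)
    have hτmem : τ ∈ Icc 0 D.T := ⟨hti.1.trans hτ.1, hτT⟩
    have u1 := (abs_le.1 (c.ℓ_lip (t i) hti (β τ) (D.atTime m (t i)) (X i) (γ τ))).2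
    have u2 := hL (t i) τ (ht_ge i) hτ.1 hτ2 hτT (β τ) (hβρ τ)
    have u3 : ‖X i - γ τ‖ ≤ δs + o := by
      have w1 := ho (t i) τ (ht_ge i) hτ.1 hτ2 hτT
      rw [norm_sub_rev] at w1
      calc _ ≤ ‖X i - γ (t i)‖ + ‖γ (t i) - γ τ‖ := norm_sub_le_norm_sub_add_norm_sub _ _ _
        _ ≤ _ := add_le_add (hδ i hi.le) w1
    have u4 : c.Ll * (1 + ‖β τ‖ ^ D.p) * ‖X i - γ τ‖ ≤ c.Ll * f τ * (δs + o) := by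
      have w1 : ‖β τ‖ ^ D.p ≤ ‖α τ‖ ^ D.p :=
        Real.rpow_le_rpow (norm_nonneg _) (hβα τ) D.p_pos.le
      have w2 := zero_le_one.trans (hf1 τ)
      gcongr
      simp only [hf]; linarith [norm_nonneg (α τ)]
    have u5 : D.ℓ τ (β τ) (γ τ) (D.atTime m τ) ≤
        D.ℓ τ (α τ) (γ τ) (D.atTime m τ) + 2 * c.Cl * (η * f τ) := by
      simp only [hβ]
      split_ifs with hc
      · have := mul_nonneg hη0 (zero_le_one.trans (hf1 τ))
        have : 0 ≤ 2 * c.Cl * (η * f τ) := by positivity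
        linarith
      · have w1 := c.ℓ_le τ hτmem 0 (γ τ) (D.atTime m τ)
        have w2 := c.ℓ_ge τ hτmem (α τ) (γ τ) (D.atTime m τ)
        rw [norm_zero, D.zero_rpow_p, mul_zero, zero_add] at w1
        have w3 : 0 ≤ c.lo * ‖α τ‖ ^ D.p := mul_nonneg c.lo_pos.le (by positivity)
        have w4 : 1 ≤ η * f τ := by
          have q := hη _ (not_le.1 hc)
          have : η * ‖α τ‖ ^ D.p ≤ η * f τ := by
            gcongr
            simp only [hf]; linarith [norm_nonneg (α τ)]
          linarith [not_le.1 hc]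
        nlinarith
    have u6 : ε₂ ≤ ε₂ * f τ := le_mul_of_one_le_right hε₂ (hf1 τ)
    have u7 : (2 * c.Cl * η + ε₂ + c.Ll * (δs + o)) * f τ =
        2 * c.Cl * (η * f τ) + ε₂ * f τ + c.Ll * f τ * (δs + o) := by ring
    rw [u7]
    linarith
  have hsum : Δ * ∑ i ∈ Finset.range (N - k), D.ℓ (t i) (a (k + i)) (X i) (D.atTime m (t i)) ≤
      (∫ τ in (k * Δ)..D.T, D.ℓ τ (α τ) (γ τ) (D.atTime m τ)) +
        (2 * c.Cl * η + ε₂ + c.Ll * (δs + o)) * F := by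
    rw [Finset.mul_sum]
    refine (Finset.sum_le_sum fun i hi => hstep i (Finset.mem_range.1 hi)).trans ?_
    rw [Finset.sum_add_distrib, ← Finset.mul_sum,
      intervalIntegral.sum_integral_adjacent_intervals fun j hj =>
        (h.intervalIntegrable_ℓ c h1 m ht0).mono_set (hsub j hj), ht_zero, ht_last]
    gcongr
    exact hφF _ le_rfl
  have hgT := (abs_le.1 (c.g_lip (D.atTime m D.T) (X (N - k)) (γ D.T))).2
  have hδT := hδ _ le_rfl
  rw [ht_last] at hδT
  have := mul_le_mul_of_nonneg_left hδT hLg.le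
  have hcost : D.eulerCost N m k x a = Δ * ∑ i ∈ Finset.range (N - k),
      D.ℓ (t i) (a (k + i)) (X i) (D.atTime m (t i)) + D.g (X (N - k)) (D.atTime m D.T) := rfl
  rw [hcost]
  unfold cost
  linarith

end Data
end MFG

namespace MFG
namespace Data

variable {d r s : ℕ} {D : Data d r s}

set_option maxHeartbeats 1000000 in
/-- The optimal Euler cost is almost bounded above by the value function, uniformly in the initial
step and in the initial state in a ball. The controls of almost optimal trajectories have bounded
`p`-energy, hence they can be truncated at a fixed level. -/
theorem exists_eulerCost_le_value (h1 : D.H1) (h2 : D.H2) (h3 : D.H3) (m : D.Flow) (R : ℝ)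
    {ε : ℝ} (hε : 0 < ε) : ∃ N₀ : ℕ, 0 < N₀ ∧ ∀ N ≥ N₀, ∀ k ≤ N, ∀ x : Vec d, ‖x‖ ≤ R →
      ∃ a : ℕ → Vec r, D.eulerCost N m k x a ≤ D.value m (k * (D.T / N)) x + ε := by
  obtain ⟨c⟩ := D.exists_bounds h1 h2 h3
  have hLA := c.LA_pos
  have hLB := c.LB_pos
  have hCB := c.CB_pos
  have hLl := c.Ll_pos
  have hLg := c.Lg_pos
  have hCl := c.Cl_pos
  have hlo := c.lo_pos
  have hA0 := c.A0_nonneg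
  have hT := D.T_pos
  obtain ⟨Kv, hKv⟩ := c.exists_value_le h1 h2 h3 m R
  obtain ⟨K1, hK1, hlin⟩ := exists_linear_le_rpow D.one_lt_p (η := 1) one_pos
  set K := max 0 ((Kv + ε + c.Cl * D.T - c.gl) / c.lo) with hK
  have hK0 : 0 ≤ K := le_max_left _ _
  set F := D.T + (K + D.T * K1) + K with hF
  have hF0 : 0 < F := by positivity
  set R1 := 2 * (|R| + (c.A0 * D.T + c.CB * F)) * Real.exp (2 * c.LA * D.T) with hR1
  have hR10 : 0 ≤ R1 := by positivity
  set E := Real.exp ((c.LA + c.LB) * F) with hE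
  have hE0 : 0 < E := Real.exp_pos _
  set Z := (2 * c.Cl + 1 + c.Ll * ((1 + c.CB) * F * E + 1)) * F +
    c.Lg * ((1 + c.CB) * F * E) with hZ
  have hZ0 : 0 < Z := by positivity
  set θ := ε / (2 * Z) with hθ
  have hθ0 : 0 < θ := by positivity
  obtain ⟨δ₁, hδ₁, hV⟩ := exists_velocity_modulus h3 R1 hθ0
  set o := min θ δ₁ with ho
  have ho0 : 0 < o := lt_min hθ0 hδ₁
  set η := min θ (o / (2 * (c.CB * K + 1))) with hη
  have hη0 : 0 < η := lt_min hθ0 (by positivity)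
  obtain ⟨ρ, hρ1, hρ⟩ := exists_le_mul_rpow D.one_lt_p hη0
  obtain ⟨δ₂, hδ₂, hL⟩ := exists_lag_modulus h1 m ρ R1 hθ0
  set Q := c.A0 + c.LA * R1 + c.CB * ρ with hQ
  have hQ0 : 0 ≤ Q := by positivity
  obtain ⟨N₀, hN₀, hstep⟩ := D.exists_step_le
    (δ := min (min δ₁ δ₂) (o / (2 * (Q + 1)))) (lt_min (lt_min hδ₁ hδ₂) (by positivity))
  refine ⟨N₀, hN₀, fun N hN k hk x hx => ?_⟩
  have hNpos : 0 < N := hN₀.trans_le hN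
  have hΔ := D.step_pos hNpos
  have hΔle := hstep N hN
  set Δ := D.T / N with hΔdef
  have hΔ1 : Δ ≤ δ₁ := hΔle.trans ((min_le_left _ _).trans (min_le_left _ _))
  have hΔ2 : Δ ≤ δ₂ := hΔle.trans ((min_le_left _ _).trans (min_le_right _ _))
  have hΔ3 : Δ * Q ≤ o / 2 := by
    have := hΔle.trans (min_le_right _ _)
    rw [le_div_iff₀ (by positivity)] at this
    have h6 : Δ * (2 * (Q + 1)) = 2 * (Δ * Q) + 2 * Δ := by ring
    linarith
  have ht0 : (k : ℝ) * Δ ∈ Icc 0 D.T := D.step_time_mem hNpos hk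
  obtain ⟨hv, hopt⟩ := hKv _ ht0 x hx
  obtain ⟨γ, α, h, hcost⟩ := hopt (ε / 2) (by positivity)
  obtain ⟨e1, e2, e3⟩ := memLp_iff_energy ht0.2 h.control
  obtain ⟨w, hw, hwae⟩ := h.dynamics
  have hwi := (memLp_iff_energy ht0.2 hw.1).2.2
  -- almost optimality bounds the `p`-energy of the control by the coercivity of the running cost
  have hen : ∫ τ in (k * Δ)..D.T, ‖α τ‖ ^ D.p ≤ K := by
    have := h.energy_le_cost c h1 m ht0
    refine le_trans ?_ (le_max_right _ _)
    rw [le_div_iff₀ hlo]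
    linarith
  have hTt : D.T - k * Δ ≤ D.T := by linarith [ht0.1]
  have hen1 : ∫ τ in (k * Δ)..D.T, ‖α τ‖ ≤ K + D.T * K1 := by
    have : ∫ τ in (k * Δ)..D.T, ‖α τ‖ ≤ ∫ τ in (k * Δ)..D.T, (‖α τ‖ ^ D.p + K1) := by
      refine intervalIntegral.integral_mono_on ht0.2 e3.norm (e2.add intervalIntegrable_const)
        fun τ _ => ?_
      simpa using hlin _ (norm_nonneg (α τ))
    rw [intervalIntegral.integral_add e2 intervalIntegrable_const,
      intervalIntegral.integral_const, smul_eq_mul] at this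
    have h6 := mul_le_mul_of_nonneg_right hTt hK1
    linarith
  have hFle : ∫ τ in (k * Δ)..D.T, (1 + ‖α τ‖ + ‖α τ‖ ^ D.p) ≤ F := by
    rw [intervalIntegral.integral_add (intervalIntegrable_const.add e3.norm) e2,
      intervalIntegral.integral_add intervalIntegrable_const e3.norm,
      intervalIntegral.integral_const, smul_eq_mul]
    linarith
  have hwae' : ∀ᵐ τ ∂(volume.restrict (Ioc (k * Δ) D.T)),
      w τ = D.A τ (γ τ) + D.B τ (γ τ) *ᵥ α τ := by rwa [restrict_Ioc_eq_restrict_Icc]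
  have hwle : ∀ᵐ τ ∂(volume.restrict (Ioc (k * Δ) D.T)),
      ‖w τ‖ ≤ c.LA * ‖γ τ‖ + (c.A0 + c.CB * ‖α τ‖) := by
    filter_upwards [hwae', ae_restrict_mem measurableSet_Ioc] with τ hτ hm
    have hτm : τ ∈ Icc 0 D.T := ⟨ht0.1.trans hm.1.le, hm.2⟩
    rw [hτ]
    have := norm_add_le (D.A τ (γ τ)) (D.B τ (γ τ) *ᵥ α τ)
    have := c.A_le hτm (γ τ)
    have := c.B_le τ hτm (γ τ) (α τ)
    linarith
  have hR1γ : ∀ t ∈ Icc (k * Δ) D.T, ‖γ t‖ ≤ R1 := by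
    intro t ht
    have := norm_le_of_speed_le hLA hwi (f := fun τ => c.A0 + c.CB * ‖α τ‖)
      (F := c.A0 * D.T + c.CB * F) (intervalIntegrable_const.add (e3.norm.const_mul _))
      (fun τ => by positivity) hw.2 hwle (by
        rw [intervalIntegral.integral_add intervalIntegrable_const (e3.norm.const_mul _),
          intervalIntegral.integral_const, intervalIntegral.integral_const_mul, smul_eq_mul]
        have h5 : ∫ τ in (k * Δ)..D.T, ‖α τ‖ ≤ F := by linarith
        have h6 := mul_le_mul_of_nonneg_right hTt hA0
        have h7 := mul_le_mul_of_nonneg_left h5 hCB.le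
        linarith) t ht
    refine this.trans ?_
    rw [h.initial, hR1]
    gcongr
    exact hx.trans (le_abs_self _)
  -- in the bound `‖α‖ ≤ ρ + η * ‖α‖ ^ p` the first term has a small integral over short times, and
  -- the second one by the bound on the energy
  have hosc : ∀ t τ, k * Δ ≤ t → t ≤ τ → τ ≤ t + Δ → τ ≤ D.T → ‖γ τ - γ t‖ ≤ o := by
    intro t τ q1 q2 q3 q4
    have hs1 : uIcc (k * Δ) τ ⊆ uIcc (k * Δ) D.T := by
      rw [uIcc_of_le (q1.trans q2), uIcc_of_le ht0.2]; exact Icc_subset_Icc le_rfl q4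
    have hs2 : uIcc (k * Δ) t ⊆ uIcc (k * Δ) D.T := by
      rw [uIcc_of_le q1, uIcc_of_le ht0.2]; exact Icc_subset_Icc le_rfl (q2.trans q4)
    have hs3 : uIcc t τ ⊆ uIcc (k * Δ) D.T := by
      rw [uIcc_of_le q2, uIcc_of_le ht0.2]; exact Icc_subset_Icc q1 q4
    rw [hw.2 τ ⟨q1.trans q2, q4⟩, hw.2 t ⟨q1, q2.trans q4⟩, add_sub_add_left_eq_sub,
      intervalIntegral.integral_interval_sub_left (hwi.mono_set hs1) (hwi.mono_set hs2)]
    have hn : ‖∫ σ in t..τ, w σ‖ ≤ ∫ σ in t..τ, (Q + c.CB * η * ‖α σ‖ ^ D.p) := by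
      refine intervalIntegral.norm_integral_le_of_norm_le q2 ?_
        (intervalIntegrable_const.add ((e2.mono_set hs3).const_mul _))
      rw [ae_restrict_iff' measurableSet_Ioc] at hwle
      filter_upwards [hwle] with σ hσ hm
      have hm' : σ ∈ Ioc (k * Δ) D.T := ⟨q1.trans_lt hm.1, hm.2.trans q4⟩
      have hb := hR1γ σ ⟨hm'.1.le, hm'.2⟩
      have hα : ‖α σ‖ ≤ ρ + η * ‖α σ‖ ^ D.p := by
        rcases le_or_gt ‖α σ‖ ρ with hc | hc
        · have : 0 ≤ η * ‖α σ‖ ^ D.p := by positivity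
          linarith
        · linarith [hρ _ hc]
      have u1 := mul_le_mul_of_nonneg_left hα hCB.le
      have u2 := mul_le_mul_of_nonneg_left hb hLA.le
      have := hσ hm'
      rw [hQ]
      linarith
    rw [intervalIntegral.integral_add intervalIntegrable_const ((e2.mono_set hs3).const_mul _),
      intervalIntegral.integral_const, intervalIntegral.integral_const_mul, smul_eq_mul] at hn
    have u1 : ∫ σ in t..τ, ‖α σ‖ ^ D.p ≤ K := by
      refine le_trans ?_ hen
      exact intervalIntegral.integral_mono_interval q1 q2 q4
        (Eventually.of_forall fun _ => by positivity) e2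
    have u2 : (τ - t) * Q ≤ Δ * Q := by gcongr; linarith
    have u3 : c.CB * η * K ≤ o / 2 := by
      have h5 : η ≤ o / (2 * (c.CB * K + 1)) := min_le_right _ _
      rw [le_div_iff₀ (by positivity)] at h5
      have h6 : η * (2 * (c.CB * K + 1)) = 2 * (c.CB * η * K) + 2 * η := by ring
      linarith
    have u4 : c.CB * η * ∫ σ in t..τ, ‖α σ‖ ^ D.p ≤ c.CB * η * K := by gcongr
    linarith
  have hmem : ∀ t τ, k * Δ ≤ t → t ≤ τ → τ ≤ D.T → t ∈ Icc 0 D.T ∧ τ ∈ Icc 0 D.T :=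
    fun t τ q1 q2 q3 => ⟨⟨ht0.1.trans q1, q2.trans q3⟩, ⟨ht0.1.trans (q1.trans q2), q3⟩⟩
  obtain ⟨a, ha⟩ := h.exists_eulerCost_le c h1 m hNpos hk hρ1 hη0.le hρ hFle hθ0.le hθ0.le ho0.le
    (fun t τ q1 q2 q3 q4 => by
      obtain ⟨m1, m2⟩ := hmem t τ q1 q2 q4
      refine hV τ m2 t m1 _ _ (hR1γ τ ⟨q1.trans q2, q4⟩) (hR1γ t ⟨q1, q2.trans q4⟩) ?_
        ((hosc t τ q1 q2 q3 q4).trans (min_le_right _ _))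
      rw [abs_of_nonneg (by linarith)]
      linarith)
    (fun t τ q1 q2 q3 q4 a ha => by
      obtain ⟨m1, m2⟩ := hmem t τ q1 q2 q4
      have := (abs_le.1 (hL t m1 τ m2 a a (γ τ) (γ τ) ha (hR1γ τ ⟨q1.trans q2, q4⟩)
        (by rw [abs_sub_comm, abs_of_nonneg (by linarith)]; linarith)
        (by simpa using hδ₂.le) (by simpa using hδ₂.le))).2
      linarith)
    hosc
  refine ⟨a, ha.trans ?_⟩
  have hηθ : η ≤ θ := min_le_left _ _
  have hoθ : o ≤ θ := min_le_left _ _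
  have herr : (2 * c.Cl * η + θ + c.Ll * ((θ + c.CB * η) * F * E + o)) * F +
      c.Lg * ((θ + c.CB * η) * F * E) ≤ ε / 2 := by
    calc _ ≤ (2 * c.Cl * θ + θ + c.Ll * ((θ + c.CB * θ) * F * E + θ)) * F +
          c.Lg * ((θ + c.CB * θ) * F * E) := by gcongr
      _ = θ * Z := by rw [hZ]; ring
      _ = ε / 2 := by rw [hθ]; field_simp
  linarith

end Data
end MFG

namespace MFG

/-! ### Grids -/

theorem norm_le_iff_div {n : ℕ} {x : Vec n} {R : ℝ} (hR : 0 ≤ R) :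
    ‖x‖ ≤ R ↔ ∀ i, |x i| ≤ R := pi_norm_le_iff_of_nonneg hR

/-- The grid points of a ball form a finite set with polynomially many elements. -/
theorem exists_grid_finset {N n : ℕ} (hN : 0 < N) {R : ℝ} (hR : 0 ≤ R) :
    ∃ F : Finset (Vec n), (∀ x ∈ grid N n, ‖x‖ ≤ R → x ∈ F) ∧
      (F.card : ℝ) ≤ ((2 * R + 3) * N) ^ n := by
  classical
  have hN' : (0 : ℝ) < N := by exact_mod_cast hN
  have hN1 : (1 : ℝ) ≤ N := by exact_mod_cast hN
  set m : ℕ := ⌈R * N⌉₊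
  refine ⟨(Fintype.piFinset fun _ : Fin n => Finset.Icc (-(m : ℤ)) m).image
    fun i j => (i j : ℝ) / N, ?_, ?_⟩
  · rintro x ⟨i, hi⟩ hx
    rw [Finset.mem_image]
    refine ⟨i, ?_, funext fun j => (hi j).symm⟩
    rw [Fintype.mem_piFinset]
    intro j
    have h1 := (norm_le_iff_div hR).1 hx j
    rw [hi j, abs_div, abs_of_pos hN', div_le_iff₀ hN'] at h1
    have h2 : |(i j : ℝ)| ≤ m := h1.trans (Nat.le_ceil _)
    rw [Finset.mem_Icc]
    rw [abs_le] at h2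
    exact ⟨by exact_mod_cast h2.1, by exact_mod_cast h2.2⟩
  · have h1 : (Fintype.piFinset fun _ : Fin n => Finset.Icc (-(m : ℤ)) m).card =
        (2 * m + 1) ^ n := by
      rw [Fintype.card_piFinset_const, Int.card_Icc]
      congr 1
      omega
    refine (Nat.cast_le.2 (Finset.card_image_le.trans h1.le)).trans ?_
    push_cast
    gcongr
    have := (Nat.ceil_lt_add_one (mul_nonneg hR hN'.le)).le
    change (m : ℝ) ≤ _ at this
    nlinarith

theorem exists_grid_near {N n : ℕ} (hN : 0 < N) (x : Vec n) :
    ∃ y ∈ grid N n, ‖y - x‖ ≤ 1 / N := by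
  have hN' : (0 : ℝ) < N := by exact_mod_cast hN
  refine ⟨fun j => (round (N * x j) : ℝ) / N, ⟨fun j => round (N * x j), fun j => rfl⟩, ?_⟩
  rw [norm_le_iff_div (by positivity)]
  intro j
  have h := abs_sub_round (N * x j)
  have e : ((round (N * x j) : ℝ) / N) - x j = -((N * x j - round (N * x j)) / N) := by
    field_simp; ring
  rw [Pi.sub_apply, e, abs_neg, abs_div, abs_of_pos hN']
  gcongr
  linarith

/-! ### Entropy -/

theorem neg_log_card_le_sum_mul_log {ι : Type*} {F : Finset ι} {q : ι → ℝ}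
    (h0 : ∀ i ∈ F, 0 ≤ q i) (h1 : ∑ i ∈ F, q i = 1) :
    -Real.log F.card ≤ ∑ i ∈ F, q i * Real.log (q i) := by
  have hne : F.Nonempty := by
    rw [Finset.nonempty_iff_ne_empty]; rintro rfl; simp at h1
  have hn : (0 : ℝ) < F.card := by exact_mod_cast hne.card_pos
  have : ∀ i ∈ F, q i - 1 / F.card ≤ q i * Real.log (q i) + q i * Real.log F.card := by
    intro i hi
    rcases (h0 i hi).eq_or_lt with h | h
    · rw [← h]; simp
    · have h2 := Real.add_one_le_exp (-(Real.log (q i * F.card)))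
      rw [Real.exp_neg, Real.exp_log (by positivity), Real.log_mul h.ne' hn.ne'] at h2
      have h3 := mul_le_mul_of_nonneg_left h2 h.le
      have h4 : q i * (q i * F.card)⁻¹ = 1 / F.card := by field_simp
      rw [h4] at h3
      linarith
  have h2 := Finset.sum_le_sum this
  rw [Finset.sum_sub_distrib, Finset.sum_add_distrib, ← Finset.sum_mul, h1] at h2
  have h3 : ∑ _i ∈ F, 1 / (F.card : ℝ) = 1 := by
    rw [Finset.sum_const, nsmul_eq_mul]; field_simp
  linarith

namespace Data

variable {d r s : ℕ} {D : Data d r s}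

/-! ### Splitting of the state -/

@[simp] theorem fst_join (D : Data d r s) (y₁ : Vec r) (y₂ : Vec s) : D.fst (D.join y₁ y₂) = y₁ := by
  ext j; simp [fst, join]

@[simp] theorem snd_join (D : Data d r s) (y₁ : Vec r) (y₂ : Vec s) : D.snd (D.join y₁ y₂) = y₂ := by
  ext j; simp [snd, join]

@[simp] theorem join_fst_snd (D : Data d r s) (x : Vec d) : D.join (D.fst x) (D.snd x) = x := by
  ext i
  unfold join
  obtain ⟨z, rfl⟩ := D.rows.surjective i
  rw [Equiv.symm_apply_apply]
  cases z <;> rfl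

theorem fst_add (D : Data d r s) (x y : Vec d) : D.fst (x + y) = D.fst x + D.fst y := rfl
theorem fst_sub (D : Data d r s) (x y : Vec d) : D.fst (x - y) = D.fst x - D.fst y := rfl
theorem fst_smul (D : Data d r s) (a : ℝ) (x : Vec d) : D.fst (a • x) = a • D.fst x := rfl
theorem snd_sub (D : Data d r s) (x y : Vec d) : D.snd (x - y) = D.snd x - D.snd y := rfl

theorem fst_mulVec (D : Data d r s) (t : ℝ) (x : Vec d) (a : Vec r) :
    D.fst (D.B t x *ᵥ a) = D.B₁ t x *ᵥ a := rfl

theorem norm_fst_le (D : Data d r s) (x : Vec d) : ‖D.fst x‖ ≤ ‖x‖ :=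
  (pi_norm_le_iff_of_nonneg (norm_nonneg _)).2 fun _ => norm_le_pi_norm x _

theorem norm_le_of_fst_snd {x : Vec d} {R : ℝ} (hR : 0 ≤ R) (h1 : ‖D.fst x‖ ≤ R)
    (h2 : ‖D.snd x‖ ≤ R) : ‖x‖ ≤ R := by
  rw [pi_norm_le_iff_of_nonneg hR]
  intro i
  obtain ⟨z, rfl⟩ := D.rows.surjective i
  cases z with
  | inl j => exact (norm_le_pi_norm (D.fst x) j).trans h1
  | inr j => exact (norm_le_pi_norm (D.snd x) j).trans h2

theorem continuous_fst' (D : Data d r s) : Continuous D.fst :=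
  continuous_pi fun _ => continuous_apply _

theorem mem_grid_of_fst_snd {N : ℕ} {x : Vec d} (h1 : D.fst x ∈ grid N r)
    (h2 : D.snd x ∈ grid N s) : x ∈ grid N d := by
  obtain ⟨i, hi⟩ := h1
  obtain ⟨j, hj⟩ := h2
  refine ⟨fun l => Sum.elim i j (D.rows.symm l), fun l => ?_⟩
  obtain ⟨z, rfl⟩ := D.rows.surjective l
  simp only [Equiv.symm_apply_apply]
  cases z with
  | inl l => exact hi l
  | inr l => exact hj l

/-! ### Steering the first component -/

theorem isUnit_det_B₁ (h3 : D.H3) {t : ℝ} (ht : t ∈ Icc 0 D.T) (x : Vec d) :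
    IsUnit (D.B₁ t x).det := by
  rw [← Matrix.isUnit_iff_isUnit_det, ← Matrix.linearIndependent_rows_iff_isUnit]
  exact h3.independent_rows t ht x

/-- The control which gives velocity `v` to the first component. -/
noncomputable def steer (D : Data d r s) (t : ℝ) (x : Vec d) (v : Vec r) : Vec r :=
  (D.B₁ t x)⁻¹ *ᵥ (v - D.fst (D.A t x))

theorem B₁_mulVec_steer (h3 : D.H3) {t : ℝ} (ht : t ∈ Icc 0 D.T) (x : Vec d) (v : Vec r) :
    D.B₁ t x *ᵥ D.steer t x v = v - D.fst (D.A t x) := by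
  rw [steer, Matrix.mulVec_mulVec, Matrix.mul_nonsing_inv _ (isUnit_det_B₁ h3 ht x),
    Matrix.one_mulVec]

theorem steer_velocity (h3 : D.H3) {t : ℝ} (ht : t ∈ Icc 0 D.T) (x : Vec d) (a : Vec r) :
    D.steer t x (D.fst (D.A t x + D.B t x *ᵥ a)) = a := by
  rw [steer, fst_add, add_sub_cancel_left, fst_mulVec, Matrix.mulVec_mulVec,
    Matrix.nonsing_inv_mul _ (isUnit_det_B₁ h3 ht x), Matrix.one_mulVec]

theorem fst_velocity_steer (h3 : D.H3) {t : ℝ} (ht : t ∈ Icc 0 D.T) (x : Vec d) (v : Vec r) :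
    D.fst (D.A t x + D.B t x *ᵥ D.steer t x v) = v := by
  rw [fst_add, fst_mulVec, B₁_mulVec_steer h3 ht, add_sub_cancel]

theorem continuousOn_steer (h3 : D.H3) :
    ContinuousOn (fun z : (ℝ × Vec d) × Vec r => D.steer z.1.1 z.1.2 z.2)
      ((Icc 0 D.T ×ˢ univ) ×ˢ univ) := by
  rw [continuousOn_iff_continuous_domRestrict]
  have hp : Continuous fun z : ((Icc 0 D.T ×ˢ (univ : Set (Vec d))) ×ˢ (univ : Set (Vec r)) :
      Set ((ℝ × Vec d) × Vec r)) => (⟨z.1.1, z.2.1⟩ : (Icc 0 D.T ×ˢ (univ : Set (Vec d)) :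
      Set (ℝ × Vec d))) := by fun_prop
  have hB := (continuousOn_iff_continuous_domRestrict.1 h3.continuous_B).comp hp
  have hA := (continuousOn_iff_continuous_domRestrict.1 h3.continuous_A).comp hp
  refine Continuous.matrix_mulVec (A := fun z : ((Icc 0 D.T ×ˢ (univ : Set (Vec d))) ×ˢ
    (univ : Set (Vec r)) : Set ((ℝ × Vec d) × Vec r)) => (D.B₁ z.1.1.1 z.1.1.2)⁻¹) ?_ ?_
  · have hB1 : Continuous fun z : ((Icc 0 D.T ×ˢ (univ : Set (Vec d))) ×ˢ
      (univ : Set (Vec r)) : Set ((ℝ × Vec d) × Vec r)) => D.B₁ z.1.1.1 z.1.1.2 :=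
      hB.matrix_submatrix _ _
    refine continuous_iff_continuousAt.2 fun z => ?_
    have hz := isUnit_det_B₁ h3 z.2.1.1 z.1.1.2
    refine ContinuousAt.comp (g := fun M : Matrix (Fin r) (Fin r) ℝ => M⁻¹) ?_ hB1.continuousAt
    refine continuousAt_matrix_inv _ ?_
    exact NormedRing.inverse_continuousAt hz.unit
  · refine Continuous.sub (by fun_prop) ?_
    exact D.continuous_fst'.comp hA

/-- The inverse of the block `B₁` is bounded on compact sets, so the control that realizes a given
velocity depends on it in a Lipschitz way. -/
theorem exists_steer_bound (h3 : D.H3) (R : ℝ) : ∃ κ > 0, ∀ t ∈ Icc 0 D.T, ∀ x : Vec d,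
    ‖x‖ ≤ R → ∀ (v : Vec r) (a : Vec r),
      ‖D.steer t x v - a‖ ≤ κ * ‖v - D.fst (D.A t x + D.B t x *ᵥ a)‖ := by
  have hc : ContinuousOn (fun z : (ℝ × Vec d) × Vec r =>
      D.steer z.1.1 z.1.2 (D.fst (D.A z.1.1 z.1.2) + z.2))
      ((Icc 0 D.T ×ˢ Metric.closedBall 0 R) ×ˢ Metric.closedBall 0 1) := by
    refine (continuousOn_steer h3).comp (f := fun z : (ℝ × Vec d) × Vec r =>
      (z.1, D.fst (D.A z.1.1 z.1.2) + z.2)) ?_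
      fun z hz => ⟨⟨hz.1.1, mem_univ _⟩, mem_univ _⟩
    refine continuousOn_fst.prodMk (ContinuousOn.add ?_ continuousOn_snd)
    refine D.continuous_fst'.comp_continuousOn ?_
    exact h3.continuous_A.comp continuousOn_fst fun z hz => ⟨hz.1.1, mem_univ _⟩
  obtain ⟨κ, hκ⟩ := ((isCompact_Icc.prod (isCompact_closedBall (0 : Vec d) R)).prod
    (isCompact_closedBall (0 : Vec r) 1)).exists_bound_of_continuousOn hc
  have hlin : ∀ t x (v : Vec r), D.steer t x (D.fst (D.A t x) + v) = (D.B₁ t x)⁻¹ *ᵥ v := by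
    intro t x v; rw [steer, add_sub_cancel_left]
  refine ⟨|κ| + 1, by positivity, fun t ht x hx v a => ?_⟩
  set u := v - D.fst (D.A t x + D.B t x *ᵥ a) with hu
  have e : D.steer t x v - a = (D.B₁ t x)⁻¹ *ᵥ u := by
    conv_lhs => rw [← steer_velocity h3 ht x a]
    rw [steer, steer, ← Matrix.mulVec_sub]
    congr 1
    rw [hu]
    abel
  have hn : ‖‖u‖⁻¹ • u‖ ≤ 1 := by
    rw [norm_smul, norm_inv, norm_norm]; exact inv_mul_le_one
  have h1 := hκ ((t, x), ‖u‖⁻¹ • u) ⟨⟨ht, by simpa using hx⟩, by simpa using hn⟩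
  simp only [hlin] at h1
  have hu' : ‖u‖ • (‖u‖⁻¹ • u) = u := by
    rcases eq_or_ne u 0 with h | h
    · rw [h]; simp
    · rw [smul_smul, mul_inv_cancel₀ (norm_ne_zero_iff.2 h), one_smul]
  rw [e]
  calc ‖(D.B₁ t x)⁻¹ *ᵥ u‖ = ‖u‖ * ‖(D.B₁ t x)⁻¹ *ᵥ (‖u‖⁻¹ • u)‖ := by
        conv_lhs => rw [← hu', Matrix.mulVec_smul, norm_smul, norm_norm]
    _ ≤ ‖u‖ * (|κ| + 1) := by
        gcongr
        exact h1.trans ((le_abs_self _).trans (by linarith))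
    _ = _ := mul_comm _ _

end Data
end MFG

namespace MFG
namespace Data

variable {d r s : ℕ} {D : Data d r s} {h : Discretization s} {C CI : ℝ} {K₀ : Set (Vec d)}

/-! ### The states of the discrete game -/

theorem dt_pos (D : Data d r s) (h : Discretization s) : 0 < D.dt h := D.step_pos h.Nt_pos

theorem dx_pos (h : Discretization s) : 0 < dx h :=
  one_div_pos.2 (by exact_mod_cast h.Ns_pos)

theorem time_mem (D : Data d r s) (h : Discretization s) {k : ℕ} (hk : k ≤ h.Nt) :
    D.time h k ∈ Icc 0 D.T := D.step_time_mem h.Nt_pos hk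

theorem time_last (D : Data d r s) (h : Discretization s) : D.time h h.Nt = D.T := by
  have : (h.Nt : ℝ) ≠ 0 := by exact_mod_cast h.Nt_pos.ne'
  unfold time dt
  field_simp

/-- One step of the Euler scheme from `x` at step `k` with control `a`. -/
noncomputable def move (D : Data d r s) (h : Discretization s) (k : ℕ) (x : Vec d) (a : Vec r) :
    Vec d :=
  x + D.dt h • (D.A (D.time h k) x + D.B (D.time h k) x *ᵥ a)

theorem fst_move_ctrl (h3 : D.H3) {k : ℕ} (hk : k ≤ h.Nt) (x : Vec d) (y₁ : Vec r) :
    D.fst (D.move h k x (D.ctrl h k x y₁)) = y₁ := by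
  have e : D.ctrl h k x y₁ = D.steer (D.time h k) x ((D.dt h)⁻¹ • (y₁ - D.fst x)) := rfl
  rw [move, fst_add, fst_smul, e, fst_velocity_steer h3 (D.time_mem h hk), smul_smul,
    mul_inv_cancel₀ (D.dt_pos h).ne', one_smul]
  abel

theorem snd_move_ctrl (k : ℕ) (x : Vec d) (y₁ : Vec r) :
    D.snd (D.move h k x (D.ctrl h k x y₁)) = D.next₂ h k x y₁ := rfl

theorem norm_sub_next₂_le (hβ : IsInterpolationBasis h.Ns s CI h.β) {k : ℕ} {x : Vec d}
    {y₁ : Vec r} {y₂ : Vec s} (hy : y₂ ∈ D.S₂ h k x y₁) :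
    ‖y₂ - D.next₂ h k x y₁‖ ≤ CI * dx h := by
  have := hβ.support y₂ hy.1 hy.2
  rw [Metric.mem_closedBall, dist_comm, dist_eq_norm] at this
  exact this

theorem join_sub_move_le (h3 : D.H3) (hβ : IsInterpolationBasis h.Ns s CI h.β) (hCI : 0 ≤ CI)
    {k : ℕ} (hk : k ≤ h.Nt) {x : Vec d} {y₁ : Vec r} {y₂ : Vec s} (hy : y₂ ∈ D.S₂ h k x y₁) :
    ‖D.join y₁ y₂ - D.move h k x (D.ctrl h k x y₁)‖ ≤ CI * dx h := by
  have hdx := dx_pos h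
  refine norm_le_of_fst_snd (D := D) (by positivity) ?_ ?_
  · rw [fst_sub, fst_join, fst_move_ctrl h3 hk, sub_self, norm_zero]; positivity
  · rw [snd_sub, snd_join, snd_move_ctrl]; exact norm_sub_next₂_le hβ hy

theorem sub_move_le_of_mem_SNext (h3 : D.H3) (hβ : IsInterpolationBasis h.Ns s CI h.β)
    (hCI : 0 ≤ CI) {k : ℕ} (hk : k ≤ h.Nt) {x y : Vec d} (hy : y ∈ D.SNext h C k x) :
    ‖y - D.move h k x (D.ctrl h k x (D.fst y))‖ ≤ CI * dx h := by
  have := join_sub_move_le h3 hβ hCI hk hy.2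
  rwa [join_fst_snd] at this

theorem join_mem_SNext {k : ℕ} {x : Vec d} {y₁ : Vec r} {y₂ : Vec s} (h1 : y₁ ∈ D.S₁ h C k x)
    (h2 : y₂ ∈ D.S₂ h k x y₁) : D.join y₁ y₂ ∈ D.SNext h C k x := by
  refine ⟨by rwa [fst_join], ?_⟩
  rwa [fst_join, snd_join]

theorem mem_S_succ {k : ℕ} {x y : Vec d} (hx : x ∈ D.S h C K₀ k) (hy : y ∈ D.SNext h C k x) :
    y ∈ D.S h C K₀ (k + 1) := by
  simp only [S, mem_iUnion]
  exact ⟨x, hx, hy⟩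

theorem S_subset_grid {k : ℕ} : D.S h C K₀ k ⊆ grid h.Ns d := by
  intro y hy
  cases k with
  | zero => exact hy.1
  | succ k =>
    simp only [S, mem_iUnion] at hy
    obtain ⟨x, -, hxy⟩ := hy
    exact mem_grid_of_fst_snd (D := D) hxy.1.1 hxy.2.1

theorem Bounds.norm_move_le (c : D.Bounds) {k : ℕ} (hk : k ≤ h.Nt) (x : Vec d) {a : Vec r}
    (ha : ‖a‖ ≤ C) :
    ‖D.move h k x a‖ ≤ ‖x‖ + D.dt h * (c.A0 + c.LA * ‖x‖ + c.CB * C) := by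
  have ht := D.time_mem h hk
  have h1 := c.A_le ht x
  have h2 := c.B_le _ ht x a
  have h3 := mul_le_mul_of_nonneg_left ha c.CB_pos.le
  have hdt := (D.dt_pos h).le
  refine (norm_add_le _ _).trans (add_le_add le_rfl ?_)
  rw [norm_smul, Real.norm_of_nonneg hdt]
  gcongr
  exact (norm_add_le _ _).trans (by linarith)

theorem Bounds.norm_le_of_mem_S₁ (c : D.Bounds) (h3 : D.H3) {k : ℕ} (hk : k ≤ h.Nt) {x : Vec d}
    {y₁ : Vec r} (hy : y₁ ∈ D.S₁ h C k x) :
    ‖y₁‖ ≤ ‖x‖ + D.dt h * (c.A0 + c.LA * ‖x‖ + c.CB * C) := by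
  rw [← fst_move_ctrl h3 hk x y₁]
  exact (D.norm_fst_le _).trans (c.norm_move_le hk x hy.2)

/-- The states of the game stay in a ball that does not depend on the discretization, by Gronwall's
inequality and the condition `dx ≤ dt`. -/
theorem Bounds.norm_le_of_mem_S (c : D.Bounds) (h3 : D.H3) (hC : 0 ≤ C) (hCI : 0 ≤ CI)
    (hh : D.Admissible h CI) {R : ℝ} (hR : 0 ≤ R) (hK : ∀ x ∈ K₀, ‖x‖ ≤ R) {k : ℕ}
    (hk : k ≤ h.Nt) {x : Vec d} (hx : x ∈ D.S h C K₀ k) :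
    ‖x‖ ≤ (R + D.T * (c.A0 + c.CB * C + CI)) * Real.exp (c.LA * D.T) := by
  have hLA := c.LA_pos
  have hCB := c.CB_pos
  have hA0 := c.A0_nonneg
  have hdt := D.dt_pos h
  set M := c.A0 + c.CB * C + CI with hM
  have hM0 : 0 ≤ M := by positivity
  have key : ∀ k ≤ h.Nt, ∀ x ∈ D.S h C K₀ k,
      ‖x‖ ≤ (R + D.time h k * M) * Real.exp (c.LA * D.time h k) := by
    intro k
    induction k with
    | zero =>
      intro _ x hx
      simpa [time] using hK x hx.2
    | succ k ih =>
      intro hk y hy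
      simp only [S, mem_iUnion] at hy
      obtain ⟨x, hx, hxy⟩ := hy
      have hk' : k ≤ h.Nt := (Nat.lt_of_succ_le hk).le
      have h1 := ih hk' x hx
      have h2 := sub_move_le_of_mem_SNext h3 hh.2 hCI hk' hxy
      have h4 := c.norm_move_le hk' x hxy.1.2
      have h5 := norm_le_norm_add_norm_sub' y (D.move h k x (D.ctrl h k x (D.fst y)))
      have h6 : CI * dx h ≤ CI * D.dt h := by gcongr; exact hh.1
      have ht0 := (D.time_mem h hk').1
      have e : D.time h (k + 1) = D.time h k + D.dt h := by
        simp only [time]; push_cast; ring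
      have h7 : ‖y‖ ≤ (1 + c.LA * D.dt h) * ‖x‖ + D.dt h * M := by
        rw [hM]; nlinarith
      rw [e, mul_add c.LA, Real.exp_add]
      set E := Real.exp (c.LA * D.time h k)
      set E' := Real.exp (c.LA * D.dt h)
      have hE : 1 ≤ E := Real.one_le_exp (by positivity)
      have hE' : 1 + c.LA * D.dt h ≤ E' := by linarith [Real.add_one_le_exp (c.LA * D.dt h)]
      have hE'1 : 1 ≤ E' := by nlinarith
      have hEE : 1 ≤ E * E' := one_le_mul_of_one_le_of_one_le hE hE'1
      calc ‖y‖ ≤ (1 + c.LA * D.dt h) * ‖x‖ + D.dt h * M := h7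
        _ ≤ E' * ((R + D.time h k * M) * E) + D.dt h * M * (E * E') := by
          refine add_le_add (by gcongr) ?_
          exact le_mul_of_one_le_right (by positivity) hEE
        _ = _ := by ring
  have hT := D.time_mem h hk
  refine (key k hk x hx).trans ?_
  have hT0 := D.T_pos
  gcongr
  · exact hT.2
  · exact hT.2

theorem S₂_finite (hβ : IsInterpolationBasis h.Ns s CI h.β) (hCI : 0 ≤ CI) (k : ℕ) (x : Vec d)
    (y₁ : Vec r) : (D.S₂ h k x y₁).Finite := by
  have hdx := dx_pos h
  obtain ⟨F, hF, -⟩ := exists_grid_finset (n := s) h.Ns_pos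
    (R := ‖D.next₂ h k x y₁‖ + CI * dx h) (by positivity)
  refine F.finite_toSet.subset fun y hy => hF y hy.1 ?_
  have h1 := norm_sub_next₂_le hβ hy
  have h2 := norm_le_norm_add_norm_sub' y (D.next₂ h k x y₁)
  linarith

/-- A bound on the states which can be reached in one step from the ball of radius `R`. -/
noncomputable def Bounds.reach (c : D.Bounds) (C R : ℝ) : ℝ :=
  R + D.T * (c.A0 + c.LA * R + c.CB * C)

theorem dt_le (D : Data d r s) (h : Discretization s) : D.dt h ≤ D.T := by
  have h1 : (1 : ℝ) ≤ h.Nt := by exact_mod_cast h.Nt_pos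
  exact div_le_self D.T_pos.le h1

theorem Bounds.S₁_finite (c : D.Bounds) (h3 : D.H3) (hC : 0 ≤ C) {k : ℕ} (hk : k ≤ h.Nt)
    (x : Vec d) {R : ℝ} (hx : ‖x‖ ≤ R) : ∃ hf : (D.S₁ h C k x).Finite,
      (hf.toFinset.card : ℝ) ≤ ((2 * c.reach C R + 3) * h.Ns) ^ r := by
  have hLA := c.LA_pos
  have hCB := c.CB_pos
  have hA0 := c.A0_nonneg
  have hT := D.T_pos
  have hR : 0 ≤ R := (norm_nonneg x).trans hx
  have hdt := D.dt_pos h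
  obtain ⟨F, hF, hcard⟩ := exists_grid_finset (n := r) h.Ns_pos (R := c.reach C R)
    (by unfold reach; positivity)
  have hsub : D.S₁ h C k x ⊆ F := fun y hy => hF y hy.1 <| by
    refine (c.norm_le_of_mem_S₁ h3 hk hy).trans ?_
    unfold reach
    gcongr
    exact D.dt_le h
  have hf := F.finite_toSet.subset hsub
  refine ⟨hf, le_trans ?_ hcard⟩
  exact_mod_cast Finset.card_le_card (by simpa using hsub)

theorem sum_β_eq_one (hβ : IsInterpolationBasis h.Ns s CI h.β) {k : ℕ} {x : Vec d} {y₁ : Vec r}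
    (hf : (D.S₂ h k x y₁).Finite) : ∑ y₂ ∈ hf.toFinset, h.β y₂ (D.next₂ h k x y₁) = 1 := by
  have h1 := hβ.sum_eq_one (D.next₂ h k x y₁)
  have h2 : HasSum ((grid h.Ns s).indicator fun z => h.β z (D.next₂ h k x y₁)) 1 :=
    hasSum_subtype_iff_indicator.1 h1
  have h3 := hasSum_sum_of_ne_finset_zero (s := hf.toFinset) (L := SummationFilter.unconditional _)
    (f := (grid h.Ns s).indicator fun z => h.β z (D.next₂ h k x y₁)) (fun z hz => by
      by_cases hg : z ∈ grid h.Ns s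
      · rw [indicator_of_mem hg]
        by_contra hne
        exact hz (hf.mem_toFinset.2 ⟨hg, subset_tsupport _ hne⟩)
      · exact indicator_of_notMem hg _)
  rw [← h3.unique h2]
  refine Finset.sum_congr rfl fun z hz => ?_
  rw [indicator_of_mem (hf.mem_toFinset.1 hz).1]

/-! ### Dynamic programming in the discrete game -/

theorem interp_eq {k : ℕ} {x : Vec d} {y₁ : Vec r} (hf : (D.S₂ h k x y₁).Finite)
    (φ : Vec d → ℝ) : D.interp h k x y₁ φ =
      ∑ y₂ ∈ hf.toFinset, h.β y₂ (D.next₂ h k x y₁) * φ (D.join y₁ y₂) :=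
  finsum_mem_eq_finite_toFinset_sum _ hf

theorem interp_le (hβ : IsInterpolationBasis h.Ns s CI h.β) (hCI : 0 ≤ CI) {k : ℕ} {x : Vec d}
    {y₁ : Vec r} {φ : Vec d → ℝ} {K : ℝ} (hφ : ∀ y₂ ∈ D.S₂ h k x y₁, φ (D.join y₁ y₂) ≤ K) :
    D.interp h k x y₁ φ ≤ K := by
  have hf := D.S₂_finite hβ hCI k x y₁
  rw [interp_eq hf]
  calc _ ≤ ∑ y₂ ∈ hf.toFinset, h.β y₂ (D.next₂ h k x y₁) * K := by
        refine Finset.sum_le_sum fun y₂ hy => ?_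
        have hy' := hf.mem_toFinset.1 hy
        exact mul_le_mul_of_nonneg_left (hφ y₂ hy') (hβ.nonneg _ hy'.1 _)
    _ = K := by rw [← Finset.sum_mul, sum_β_eq_one hβ hf, one_mul]

theorem exists_le_interp (hβ : IsInterpolationBasis h.Ns s CI h.β) (hCI : 0 ≤ CI) {k : ℕ}
    {x : Vec d} {y₁ : Vec r} (φ : Vec d → ℝ) :
    ∃ y₂ ∈ D.S₂ h k x y₁, φ (D.join y₁ y₂) ≤ D.interp h k x y₁ φ := by
  have hf := D.S₂_finite hβ hCI k x y₁
  have h1 := sum_β_eq_one hβ hf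
  rw [interp_eq hf]
  by_contra! hcon
  have : ∑ y₂ ∈ hf.toFinset, h.β y₂ (D.next₂ h k x y₁) *
      (∑ y₂ ∈ hf.toFinset, h.β y₂ (D.next₂ h k x y₁) * φ (D.join y₁ y₂)) <
      ∑ y₂ ∈ hf.toFinset, h.β y₂ (D.next₂ h k x y₁) * φ (D.join y₁ y₂) := by
    obtain ⟨z, hz, hne⟩ : ∃ z ∈ hf.toFinset, h.β z (D.next₂ h k x y₁) ≠ 0 := by
      by_contra! h0
      rw [Finset.sum_eq_zero h0] at h1
      exact zero_ne_one h1
    refine Finset.sum_lt_sum (fun y₂ hy => ?_) ⟨z, hz, ?_⟩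
    · have hy' := hf.mem_toFinset.1 hy
      exact mul_le_mul_of_nonneg_left (hcon y₂ hy').le (hβ.nonneg _ hy'.1 _)
    · have hy' := hf.mem_toFinset.1 hz
      exact mul_lt_mul_of_pos_left (hcon z hy') (lt_of_le_of_ne (hβ.nonneg _ hy'.1 _) hne.symm)
  rw [← Finset.sum_mul, h1, one_mul] at this
  exact lt_irrefl _ this

/-- The cost of steering the first component to `y₁`, before averaging over `y₁`. -/
noncomputable def moveCost (D : Data d r s) (h : Discretization s) (M : ℕ → P1 (Vec d))
    (V : ℕ → Vec d → ℝ) (k : ℕ) (x : Vec d) (y₁ : Vec r) : ℝ :=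
  D.dt h * D.ℓ (D.time h k) (D.ctrl h k x y₁) x (M k) + D.interp h k x y₁ (V (k + 1))

theorem stepCost_eq {M : ℕ → P1 (Vec d)} {V : ℕ → Vec d → ℝ} {k : ℕ} {x : Vec d}
    (hf : (D.S₁ h C k x).Finite) (q : Vec r → ℝ) :
    D.stepCost h C M V k x q = ∑ y₁ ∈ hf.toFinset, q y₁ * D.moveCost h M V k x y₁ +
      h.ε * ∑ y₁ ∈ hf.toFinset, q y₁ * Real.log (q y₁) := by
  rw [stepCost, finsum_mem_eq_finite_toFinset_sum _ hf, finsum_mem_eq_finite_toFinset_sum _ hf]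
  rfl

theorem isProbOn_iff {k : ℕ} {x : Vec d} (hf : (D.S₁ h C k x).Finite) (q : Vec r → ℝ) :
    IsProbOn (D.S₁ h C k x) q ↔
      (∀ y ∈ hf.toFinset, 0 ≤ q y) ∧ ∑ y ∈ hf.toFinset, q y = 1 := by
  rw [IsProbOn, finsum_mem_eq_finite_toFinset_sum _ hf]
  simp

variable {M : ℕ → P1 (Vec d)} {V : ℕ → Vec d → ℝ} {q : ℕ → Vec d → Vec r → ℝ}

theorem SolvesHJB.le_moveCost (hV : D.SolvesHJB h C K₀ M V q) {k : ℕ} (hk : k < h.Nt) {x : Vec d}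
    (hx : x ∈ D.S h C K₀ k) (hf : (D.S₁ h C k x).Finite) {y₁ : Vec r} (hy : y₁ ∈ D.S₁ h C k x) :
    V k x ≤ D.moveCost h M V k x y₁ := by
  classical
  have hy' := hf.mem_toFinset.2 hy
  rw [hV.value_eq k hk x hx]
  refine (hV.minimizer k hk x hx (fun z => if z = y₁ then 1 else 0) ?_).trans ?_
  · rw [isProbOn_iff hf]
    refine ⟨fun z _ => by positivity, ?_⟩
    rw [Finset.sum_ite_eq' hf.toFinset y₁, if_pos hy']
  · rw [stepCost_eq hf]
    have e1 : ∑ z ∈ hf.toFinset, (if z = y₁ then (1 : ℝ) else 0) * D.moveCost h M V k x z =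
        D.moveCost h M V k x y₁ := by
      simp only [ite_mul, one_mul, zero_mul]
      rw [Finset.sum_ite_eq' hf.toFinset y₁, if_pos hy']
    have e2 : ∑ z ∈ hf.toFinset, (if z = y₁ then (1 : ℝ) else 0) *
        Real.log (if z = y₁ then (1 : ℝ) else 0) = 0 :=
      Finset.sum_eq_zero fun z _ => by split_ifs <;> simp
    rw [e1, e2, mul_zero, add_zero]

theorem SolvesHJB.sum_moveCost_le (hV : D.SolvesHJB h C K₀ M V q) {k : ℕ} (hk : k < h.Nt)
    {x : Vec d} (hx : x ∈ D.S h C K₀ k) (hf : (D.S₁ h C k x).Finite) {E : ℝ}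
    (hE : h.ε * Real.log hf.toFinset.card ≤ E) :
    ∑ y₁ ∈ hf.toFinset, q k x y₁ * D.moveCost h M V k x y₁ ≤ V k x + E := by
  have h1 := hV.value_eq k hk x hx
  rw [stepCost_eq hf] at h1
  obtain ⟨p0, p1⟩ := (isProbOn_iff hf _).1 (hV.prob k hk x hx)
  have h2 := mul_le_mul_of_nonneg_left (neg_log_card_le_sum_mul_log p0 p1) h.ε_pos.le
  linarith

/-- Some successor of `x` has value at most `V k x` minus the running cost, up to the entropy. -/
theorem SolvesHJB.exists_successor (hV : D.SolvesHJB h C K₀ M V q)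
    (hβ : IsInterpolationBasis h.Ns s CI h.β) (hCI : 0 ≤ CI) {k : ℕ} (hk : k < h.Nt)
    {x : Vec d} (hx : x ∈ D.S h C K₀ k) (hf : (D.S₁ h C k x).Finite) {E : ℝ}
    (hE : h.ε * Real.log hf.toFinset.card ≤ E) : ∃ y ∈ D.SNext h C k x,
      D.dt h * D.ℓ (D.time h k) (D.ctrl h k x (D.fst y)) x (M k) + V (k + 1) y ≤ V k x + E := by
  obtain ⟨p0, p1⟩ := (isProbOn_iff hf _).1 (hV.prob k hk x hx)
  have h1 := hV.sum_moveCost_le hk hx hf hE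
  obtain ⟨y₁, hy₁, hle⟩ : ∃ y₁ ∈ hf.toFinset, D.moveCost h M V k x y₁ ≤ V k x + E := by
    by_contra! hcon
    have h2 : ∑ y₁ ∈ hf.toFinset, q k x y₁ * (V k x + E) <
        ∑ y₁ ∈ hf.toFinset, q k x y₁ * D.moveCost h M V k x y₁ := by
      obtain ⟨z, hz, hne⟩ : ∃ z ∈ hf.toFinset, q k x z ≠ 0 := by
        by_contra! h0
        rw [Finset.sum_eq_zero h0] at p1
        exact zero_ne_one p1
      refine Finset.sum_lt_sum (fun y hy => mul_le_mul_of_nonneg_left (hcon y hy).le (p0 y hy))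
        ⟨z, hz, mul_lt_mul_of_pos_left (hcon z hz) (lt_of_le_of_ne (p0 z hz) hne.symm)⟩
    rw [← Finset.sum_mul, p1, one_mul] at h2
    linarith
  obtain ⟨y₂, hy₂, hle₂⟩ := D.exists_le_interp hβ hCI (k := k) (x := x) (y₁ := y₁) (V (k + 1))
  refine ⟨D.join y₁ y₂, join_mem_SNext (hf.mem_toFinset.1 hy₁) hy₂, ?_⟩
  rw [fst_join]
  unfold moveCost at hle
  linarith

/-- The cost, from step `k` on, of a sequence of states. -/
noncomputable def chainCost (D : Data d r s) (h : Discretization s) (M : ℕ → P1 (Vec d)) (k : ℕ)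
    (X : ℕ → Vec d) : ℝ :=
  ∑ j ∈ Finset.Ico k h.Nt,
    D.dt h * D.ℓ (D.time h j) (D.ctrl h j (X j) (D.fst (X (j + 1)))) (X j) (M j) +
    D.g (X h.Nt) (M h.Nt)

/-- The value at `x` is almost attained along some chain of states. -/
theorem SolvesHJB.exists_chain (hV : D.SolvesHJB h C K₀ M V q)
    (hβ : IsInterpolationBasis h.Ns s CI h.β) (hCI : 0 ≤ CI) {E : ℝ}
    (hE : ∀ k < h.Nt, ∀ x ∈ D.S h C K₀ k, ∃ hf : (D.S₁ h C k x).Finite,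
      h.ε * Real.log hf.toFinset.card ≤ E) :
    ∀ i k, k + i = h.Nt → ∀ x ∈ D.S h C K₀ k, ∃ X : ℕ → Vec d, X k = x ∧
      (∀ j, k ≤ j → j < h.Nt → X (j + 1) ∈ D.SNext h C j (X j)) ∧
      D.chainCost h M k X ≤ V k x + i * E := by
  intro i
  induction i with
  | zero =>
    intro k hk x hx
    obtain rfl : k = h.Nt := by omega
    refine ⟨fun _ => x, rfl, fun j h1 h2 => by omega, ?_⟩
    simp [chainCost, hV.terminal x hx]
  | succ i ih =>
    intro k hk x hx
    have hkN : k < h.Nt := by omega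
    obtain ⟨hf, hfE⟩ := hE k hkN x hx
    obtain ⟨y, hy, hle⟩ := hV.exists_successor hβ hCI hkN hx hf hfE
    obtain ⟨X, hX0, hX1, hX2⟩ := ih (k + 1) (by omega) y (mem_S_succ hx hy)
    set X' : ℕ → Vec d := fun j => if j ≤ k then x else X j with hX'
    have e0 : X' k = x := by simp [hX']
    have e1 : ∀ j, k < j → X' j = X j := fun j hj => by simp [hX', not_le.2 hj]
    refine ⟨X', e0, fun j h1 h2 => ?_, ?_⟩
    · rcases h1.eq_or_lt with rfl | h1
      · rw [e0, e1 _ (Nat.lt_succ_self _), hX0]; exact hy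
      · rw [e1 j h1, e1 _ (by omega)]; exact hX1 j h1 h2
    · have : D.chainCost h M k X' =
          D.dt h * D.ℓ (D.time h k) (D.ctrl h k x (D.fst y)) x (M k) +
            D.chainCost h M (k + 1) X := by
        unfold chainCost
        rw [Finset.sum_eq_sum_Ico_succ_bot hkN, e0, e1 _ (Nat.lt_succ_self _), hX0,
          e1 h.Nt hkN, add_assoc]
        congr 2
        refine Finset.sum_congr rfl fun j hj => ?_
        rw [Finset.mem_Ico] at hj
        rw [e1 j (by omega), e1 (j + 1) (by omega)]
      rw [this]
      push_cast
      linarith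

theorem chain_mem_S {k : ℕ} {X : ℕ → Vec d} (hx : X k ∈ D.S h C K₀ k)
    (hX : ∀ j, k ≤ j → j < h.Nt → X (j + 1) ∈ D.SNext h C j (X j)) :
    ∀ j, k ≤ j → j ≤ h.Nt → X j ∈ D.S h C K₀ j := by
  intro j hj
  induction j, hj using Nat.le_induction with
  | base => exact fun _ => hx
  | succ j hj ih => exact fun h1 => mem_S_succ (ih (by omega)) (hX j hj (by omega))

end Data
end MFG

namespace MFG
namespace Data

variable {d r s : ℕ} {D : Data d r s} {h : Discretization s} {C CI : ℝ} {K₀ : Set (Vec d)}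
  {M : ℕ → P1 (Vec d)} {V : ℕ → Vec d → ℝ} {q : ℕ → Vec d → Vec r → ℝ}

/-! ### Upper bound for the discrete value function -/

/-- The Lipschitz constant of the Euler cost in the initial state for controls bounded by `C`. -/
noncomputable def Bounds.lip (c : D.Bounds) (C : ℝ) : ℝ :=
  (c.Ll * (D.T + D.T * C ^ D.p) + c.Lg) * Real.exp (D.T * (c.LA + c.LB * C))

theorem Bounds.lip_nonneg (c : D.Bounds) {C : ℝ} (hC : 0 ≤ C) : 0 ≤ c.lip C := by
  have := c.Ll_pos
  have := c.Lg_pos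
  have := D.T_pos
  unfold Bounds.lip
  positivity

/-- The discrete value is at most the Euler cost of any admissible sequence of controls, up to the
error of rounding the first components of the states to the grid. -/
theorem SolvesHJB.le_eulerCost (c : D.Bounds) (h3 : D.H3) (hV : D.SolvesHJB h C K₀ M V q)
    (hh : D.Admissible h CI) (hC : 0 ≤ C) (hCI : 0 ≤ CI) {κ R : ℝ} (hκ0 : 0 ≤ κ)
    (hκ : ∀ t ∈ Icc 0 D.T, ∀ x : Vec d, ‖x‖ ≤ R → ∀ (v : Vec r) (a : Vec r),
      ‖D.steer t x v - a‖ ≤ κ * ‖v - D.fst (D.A t x + D.B t x *ᵥ a)‖)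
    (hS : ∀ k ≤ h.Nt, ∀ x ∈ D.S h C K₀ k, ‖x‖ ≤ R) (m : D.Flow) {a : ℕ → Vec r} {k₀ : ℕ}
    (ha : ∀ j, k₀ ≤ j → j < h.Nt → ‖a j‖ + κ * (dx h / D.dt h) ≤ C) {ω : ℝ}
    (hℓ : ∀ k < h.Nt, ∀ (a b : Vec r) (x : Vec d), ‖a‖ ≤ C → ‖x‖ ≤ R →
      ‖a - b‖ ≤ κ * (dx h / D.dt h) →
      D.ℓ (D.time h k) b x (M k) ≤ D.ℓ (D.time h k) a x (D.atTime m (D.time h k)) + ω)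
    (hg : ∀ x : Vec d, ‖x‖ ≤ R → D.g x (M h.Nt) ≤ D.g x (D.atTime m D.T) + ω) :
    ∀ i k, k₀ ≤ k → k + i = h.Nt → ∀ x ∈ D.S h C K₀ k, V k x ≤ D.eulerCost h.Nt m k x a +
      i * (D.dt h * ω + c.lip C * ((CI + c.CB * κ) * dx h)) + ω := by
  have hdt := D.dt_pos h
  have hdx := dx_pos h
  have hCB := c.CB_pos
  intro i
  induction i with
  | zero =>
    intro k _ hk x hx
    obtain rfl : k = h.Nt := by omega
    rw [hV.terminal x hx, D.eulerCost_self]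
    have := hg x (hS _ le_rfl x hx)
    push_cast
    linarith
  | succ i ih =>
    intro k hk0 hk x hx
    have hkN : k < h.Nt := by omega
    have ht := D.time_mem h hkN.le
    have hxR := hS k hkN.le x hx
    obtain ⟨hf, -⟩ := c.S₁_finite h3 hC hkN.le x le_rfl
    -- the first component of the Euler step, rounded to the grid
    obtain ⟨y₁, hy₁, hnear⟩ := exists_grid_near h.Ns_pos (D.fst (D.move h k x (a k)))
    have hak := ha k hk0 hkN
    have hb : ‖D.ctrl h k x y₁ - a k‖ ≤ κ * (dx h / D.dt h) := by
      have e : D.ctrl h k x y₁ = D.steer (D.time h k) x ((D.dt h)⁻¹ • (y₁ - D.fst x)) := rfl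
      rw [e]
      refine (hκ _ ht x hxR _ _).trans ?_
      have e2 : (D.dt h)⁻¹ • (y₁ - D.fst x) -
          D.fst (D.A (D.time h k) x + D.B (D.time h k) x *ᵥ a k) =
          (D.dt h)⁻¹ • (y₁ - D.fst (D.move h k x (a k))) := by
        rw [move]
        generalize D.A (D.time h k) x + D.B (D.time h k) x *ᵥ a k = w
        rw [fst_add, fst_smul, ← sub_sub, smul_sub (D.dt h)⁻¹ (y₁ - D.fst x), smul_smul,
          inv_mul_cancel₀ hdt.ne', one_smul]
      rw [e2, norm_smul, Real.norm_of_nonneg (inv_nonneg.2 hdt.le), div_eq_inv_mul]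
      gcongr
      exact hnear
    have hbC : ‖D.ctrl h k x y₁‖ ≤ C := by
      have := norm_le_norm_add_norm_sub' (D.ctrl h k x y₁) (a k)
      linarith
    have hyS : y₁ ∈ D.S₁ h C k x := ⟨hy₁, hbC⟩
    have haC : ‖a k‖ ≤ C := by
      have : 0 ≤ κ * (dx h / D.dt h) := by positivity
      linarith
    refine (hV.le_moveCost hkN hx hf hyS).trans ?_
    have e : D.eulerCost h.Nt m k x a = D.dt h * D.ℓ (D.time h k) (a k) x
        (D.atTime m (D.time h k)) + D.eulerCost h.Nt m (k + 1) (D.move h k x (a k)) a :=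
      D.eulerCost_step hkN m x a
    have hint : D.interp h k x y₁ (V (k + 1)) ≤
        D.eulerCost h.Nt m (k + 1) (D.move h k x (a k)) a +
          c.lip C * ((CI + c.CB * κ) * dx h) +
          i * (D.dt h * ω + c.lip C * ((CI + c.CB * κ) * dx h)) + ω := by
      refine interp_le hh.2 hCI fun y₂ hy₂ => ?_
      have h1 := ih (k + 1) (by omega) (by omega) _ (mem_S_succ hx (join_mem_SNext hyS hy₂))
      have h2 := c.eulerCost_lipschitz hC h.Nt_pos (show k + 1 ≤ h.Nt by omega) m
        (α := a) (fun j hj1 hj2 => by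
          have := ha j (by omega) hj2
          have : 0 ≤ κ * (dx h / D.dt h) := by positivity
          linarith) (D.move h k x (a k)) (D.join y₁ y₂)
      have h4 : ‖D.join y₁ y₂ - D.move h k x (a k)‖ ≤ (CI + c.CB * κ) * dx h := by
        have u1 := join_sub_move_le h3 hh.2 hCI hkN.le hy₂
        have u2 : ‖D.move h k x (D.ctrl h k x y₁) - D.move h k x (a k)‖ ≤
            c.CB * κ * dx h := by
          rw [move, move, add_sub_add_left_eq_sub, ← smul_sub, add_sub_add_left_eq_sub,
            ← Matrix.mulVec_sub, norm_smul, Real.norm_of_nonneg hdt.le]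
          calc _ ≤ D.dt h * (c.CB * (κ * (dx h / D.dt h))) := by
                gcongr
                refine (c.B_le _ ht _ _).trans ?_
                gcongr
            _ = _ := by field_simp
        calc _ ≤ _ := norm_sub_le_norm_sub_add_norm_sub _ (D.move h k x (D.ctrl h k x y₁)) _
          _ ≤ CI * dx h + c.CB * κ * dx h := add_le_add u1 u2
          _ = _ := by ring
      have h5 := mul_le_mul_of_nonneg_left h4 (c.lip_nonneg hC)
      change _ ≤ c.lip C * _ at h2
      linarith
    have hl := mul_le_mul_of_nonneg_left (hℓ k hkN (a k) (D.ctrl h k x y₁) x haC hxR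
      (by rw [norm_sub_rev]; exact hb)) hdt.le
    rw [e, moveCost]
    push_cast
    linarith

theorem Bounds.norm_eulerState_le (c : D.Bounds) (hC : 0 ≤ C) {N k : ℕ} (hN : 0 < N) (x : Vec d)
    {α : ℕ → Vec r} (hα : ∀ j, k ≤ j → j < N → ‖α j‖ ≤ C) {i : ℕ} (hi : k + i ≤ N) :
    ‖D.eulerState N k x α i‖ ≤
      (‖x‖ + D.T * (c.A0 + c.CB * C)) * Real.exp (D.T * c.LA) := by
  have hΔ := (D.step_pos hN).le
  have hLA := c.LA_pos.le
  have hCB := c.CB_pos.le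
  have hA0 := c.A0_nonneg
  have hT := D.T_pos
  have := gronwall_range (u := fun i => ‖D.eulerState N k x α i‖) (n := i)
    (c := fun _ => D.T / N * c.LA) (b := fun _ => D.T / N * (c.A0 + c.CB * C)) ?_ (norm_nonneg _)
    (fun j _ => by positivity) (fun j _ => by positivity) i le_rfl
  · refine this.trans ?_
    have e1 : ∑ j ∈ Finset.range i, D.T / N * (c.A0 + c.CB * C) ≤ D.T * (c.A0 + c.CB * C) :=
      D.sum_step_const hN (by omega) (by positivity) fun _ _ => le_rfl
    have e2 : ∑ j ∈ Finset.range i, D.T / N * c.LA ≤ D.T * c.LA :=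
      D.sum_step_const hN (by omega) hLA fun _ _ => le_rfl
    change (‖x‖ + _) * _ ≤ _
    gcongr
  · intro j hj
    have ht := D.step_time_mem hN (show k + j ≤ N by omega)
    simp only [eulerState]
    refine (norm_add_le _ _).trans ?_
    rw [norm_smul, Real.norm_of_nonneg hΔ]
    have h1 := c.A_le ht (D.eulerState N k x α j)
    have h2 := c.B_le _ ht (D.eulerState N k x α j) (α (k + j))
    have h3 := mul_le_mul_of_nonneg_left (hα (k + j) (by omega) (by omega)) hCB
    have h4 := norm_add_le (D.A ((k + j : ℕ) * (D.T / N)) (D.eulerState N k x α j))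
      (D.B ((k + j : ℕ) * (D.T / N)) (D.eulerState N k x α j) *ᵥ α (k + j))
    have h5 := mul_le_mul_of_nonneg_left (h4.trans (add_le_add h1 (h2.trans h3))) hΔ
    linarith

/-- Multiplying bounded controls by a factor close to one increases the Euler cost by a small amount,
uniformly in the number of steps. -/
theorem exists_shrink (h1 : D.H1) (h2 : D.H2) (h3 : D.H3) (m : D.Flow) (hC : 0 ≤ C) (R : ℝ) {ε : ℝ}
    (hε : 0 < ε) : ∃ η : ℝ, 0 < η ∧ η < 1 ∧ ∀ N : ℕ, 0 < N → ∀ k ≤ N, ∀ x : Vec d, ‖x‖ ≤ R →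
      ∀ α : ℕ → Vec r, (∀ j, k ≤ j → j < N → ‖α j‖ ≤ C) →
        D.eulerCost N m k x (fun j => (1 - η) • α j) ≤ D.eulerCost N m k x α + ε := by
  obtain ⟨c⟩ := D.exists_bounds h1 h2 h3
  have hLA := c.LA_pos
  have hLB := c.LB_pos
  have hCB := c.CB_pos
  have hLl := c.Ll_pos
  have hLg := c.Lg_pos
  have hA0 := c.A0_nonneg
  have hT := D.T_pos
  set E := Real.exp (D.T * (c.LA + c.LB * C)) with hE
  have hE0 : 0 < E := Real.exp_pos _
  set R1 := (|R| + D.T * (c.A0 + c.CB * C)) * Real.exp (D.T * c.LA) with hR1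
  obtain ⟨δ, hδ, hL⟩ := exists_lag_modulus h1 m C R1 (ε := ε / (2 * D.T)) (by positivity)
  set G := (c.Ll * (D.T + D.T * C ^ D.p) + c.Lg) * (D.T * (c.CB * C) * E) with hG
  have hG0 : 0 ≤ G := by positivity
  set η := min (1 / 2) (min (δ / (C + 1)) (ε / (2 * (G + 1)))) with hη
  have hη0 : 0 < η := lt_min (by norm_num) (lt_min (by positivity) (by positivity))
  have hη1 : η ≤ 1 / 2 := min_le_left _ _
  have hηC : η * C ≤ δ := by
    have : η ≤ δ / (C + 1) := (min_le_right _ _).trans (min_le_left _ _)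
    rw [le_div_iff₀ (by positivity)] at this
    linarith
  have hηG : η * G ≤ ε / 2 := by
    have : η ≤ ε / (2 * (G + 1)) := (min_le_right _ _).trans (min_le_right _ _)
    rw [le_div_iff₀ (by positivity)] at this
    linarith
  refine ⟨η, hη0, by linarith, fun N hN k hk x hx α hα => ?_⟩
  set β : ℕ → Vec r := fun j => (1 - η) • α j with hβ
  have hΔ := D.step_pos hN
  have hαβ : ∀ j, k ≤ j → j < N → ‖β j - α j‖ ≤ η * C := by
    intro j h1 h2
    have e : β j - α j = -(η • α j) := by simp only [hβ]; rw [sub_smul, one_smul]; abel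
    rw [e, norm_neg, norm_smul, Real.norm_of_nonneg hη0.le]
    gcongr
    exact hα j h1 h2
  have hβC : ∀ j, k ≤ j → j < N → ‖β j‖ ≤ C := by
    intro j h1 h2
    simp only [hβ]
    rw [norm_smul, Real.norm_of_nonneg (by linarith)]
    calc (1 - η) * ‖α j‖ ≤ 1 * ‖α j‖ := by gcongr; linarith
      _ ≤ C := by rw [one_mul]; exact hα j h1 h2
  have h := c.eulerCost_sub_le (k := k) hN m x x α β (D.T * C ^ D.p) (D.T * (c.CB * (η * C)) * E)
    (fun i hi => by
      refine (c.eulerState_sub_le hN x x α β (by omega)).trans ?_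
      rw [sub_self, norm_zero, zero_add]
      gcongr
      · refine D.sum_step_const hN (by omega) (by positivity) fun j hj => ?_
        gcongr
        exact hαβ _ (by omega) (by omega)
      · rw [hE, Real.exp_le_exp]
        refine D.sum_step_const hN (by omega) (by positivity) fun j hj => ?_
        gcongr
        exact hα _ (by omega) (by omega))
    (by
      refine D.sum_step_const hN (by omega) (by positivity) fun j hj => ?_
      exact Real.rpow_le_rpow (norm_nonneg _) (hα _ (by omega) (by omega)) D.p_pos.le)
  have hfirst : D.T / N * ∑ i ∈ Finset.range (N - k),
        (D.ℓ ((k + i : ℕ) * (D.T / N)) (β (k + i)) (D.eulerState N k x β i)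
            (D.atTime m ((k + i : ℕ) * (D.T / N))) -
          D.ℓ ((k + i : ℕ) * (D.T / N)) (α (k + i)) (D.eulerState N k x β i)
            (D.atTime m ((k + i : ℕ) * (D.T / N)))) ≤ D.T * (ε / (2 * D.T)) := by
    rw [Finset.mul_sum]
    refine D.sum_step_const hN (by omega) (by positivity) fun i hi => ?_
    have ht := D.step_time_mem hN (show k + i ≤ N by omega)
    have hX : ‖D.eulerState N k x β i‖ ≤ R1 := by
      refine (c.norm_eulerState_le hC hN x hβC (by omega)).trans ?_
      rw [hR1]
      gcongr
      exact hx.trans (le_abs_self _)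
    refine (le_abs_self _).trans (hL _ ht _ ht _ _ _ _ (hβC _ (by omega) (by omega)) hX
      (by simpa using hδ.le) ((hαβ _ (by omega) (by omega)).trans hηC) (by simpa using hδ.le))
  have e1 : D.T * (ε / (2 * D.T)) = ε / 2 := by field_simp
  have e2 : (c.Ll * (D.T + D.T * C ^ D.p) + c.Lg) * (D.T * (c.CB * (η * C)) * E) = η * G := by
    rw [hG]; ring
  linarith

theorem dx_div_dt (D : Data d r s) (h : Discretization s) :
    dx h / D.dt h = (h.Nt / h.Ns : ℝ) / D.T := by
  have h1 : (h.Nt : ℝ) ≠ 0 := by exact_mod_cast h.Nt_pos.ne'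
  have h2 : (h.Ns : ℝ) ≠ 0 := by exact_mod_cast h.Ns_pos.ne'
  have h3 := D.T_pos.ne'
  unfold dx dt
  field_simp

/-- The discrete value function is at most the value function along a nearby flow, up to a small
error. -/
theorem exists_value_upper (h1 : D.H1) (h2 : D.H2) (h3 : D.H3) (hC : 0 < C)
    (hCb : D.IsControlBound C) (hCI : 0 ≤ CI) (m : D.Flow) (R : ℝ) {ε : ℝ} (hε : 0 < ε) :
    ∃ θ > 0, ∃ N₀ : ℕ, ∀ (h : Discretization s) (K₀ : Set (Vec d)) (M : ℕ → P1 (Vec d))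
      (V : ℕ → Vec d → ℝ) (q : ℕ → Vec d → Vec r → ℝ),
      D.Admissible h CI → D.SolvesHJB h C K₀ M V q →
      (∀ k ≤ h.Nt, ∀ x ∈ D.S h C K₀ k, ‖x‖ ≤ R) → N₀ ≤ h.Nt → (h.Nt : ℝ) / h.Ns ≤ θ →
      (∀ k ≤ h.Nt, dist (D.atTime m (D.time h k)) (M k) ≤ θ) →
      ∀ k ≤ h.Nt, ∀ x ∈ D.S h C K₀ k, V k x ≤ D.value m (D.time h k) x + ε := by
  obtain ⟨c⟩ := D.exists_bounds h1 h2 h3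
  have hT := D.T_pos
  have hCB := c.CB_pos
  obtain ⟨κ, hκ0, hκ⟩ := exists_steer_bound h3 R
  obtain ⟨N₀, hN₀, hU⟩ := exists_eulerCost_le_value h1 h2 h3 m R (ε := ε / 4) (by positivity)
  obtain ⟨η, hη0, hη1, hshrink⟩ := exists_shrink h1 h2 h3 m hC.le R (ε := ε / 4) (by positivity)
  set ω := ε / (4 * (D.T + 1)) with hω
  have hω0 : 0 < ω := by positivity
  obtain ⟨δ₁, hδ₁, hℓ⟩ := exists_ℓ_modulus h1 m C R hω0
  obtain ⟨δ₂, hδ₂, hg⟩ := exists_g_modulus h2 (D.atTime m D.T) R hω0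
  set G := c.lip C * (CI + c.CB * κ) with hG
  have hG0 : 0 ≤ G := by
    have := c.lip_nonneg hC.le
    positivity
  set θ := min (min δ₁ δ₂) (min (min δ₁ (η * C) * D.T / κ) (ε / (4 * (G + 1)))) with hθ
  have hθ0 : 0 < θ := by
    refine lt_min (lt_min hδ₁ hδ₂) (lt_min ?_ (by positivity))
    have : 0 < min δ₁ (η * C) := lt_min hδ₁ (by positivity)
    positivity
  refine ⟨θ, hθ0, N₀, fun h K₀ M V q hh hV hS hN hratio hdist k hk x hx => ?_⟩
  have hxR := hS k hk x hx
  have hκθ : κ * (dx h / D.dt h) ≤ min δ₁ (η * C) := by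
    have : (h.Nt : ℝ) / h.Ns ≤ min δ₁ (η * C) * D.T / κ :=
      hratio.trans ((min_le_right _ _).trans (min_le_left _ _))
    rw [le_div_iff₀ hκ0] at this
    rw [dx_div_dt, ← mul_div_assoc, div_le_iff₀ hT]
    linarith
  -- the control bound applies to a minimizer of the Euler cost; shrinking it leaves room for the
  -- correction due to rounding
  obtain ⟨a₀, ha₀⟩ := hU h.Nt hN k hk x hxR
  obtain ⟨α, hα⟩ := exists_eulerCost_minimizer h1 h2 h3 h.Nt_pos hk m x
  have hαC : ∀ j, k ≤ j → j < h.Nt → ‖α j‖ ≤ C := fun j hj1 hj2 =>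
    hCb h.Nt h.Nt_pos m k (hj1.trans_lt hj2) x α hα j hj1 hj2
  have hs := hshrink h.Nt h.Nt_pos k hk x hxR α hαC
  have hle := hV.le_eulerCost c h3 hh hC.le hCI hκ0.le hκ hS m
    (a := fun j => (1 - η) • α j) (k₀ := k) (fun j hj1 hj2 => by
      rw [norm_smul, Real.norm_of_nonneg (by linarith)]
      have u1 := mul_le_mul_of_nonneg_left (hαC j hj1 hj2) (show 0 ≤ 1 - η by linarith)
      have u2 := hκθ.trans (min_le_right _ _)
      linarith) (ω := ω)
    (fun j hj a b x ha hx hab => by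
      have ht := D.time_mem h hj.le
      have := (abs_le.1 (hℓ _ ht _ ht a b x x (M j) ha hx (by simpa using hδ₁.le)
        (hab.trans (hκθ.trans (min_le_left _ _))) (by simpa using hδ₁.le)
        ((hdist j hj.le).trans ((min_le_left _ _).trans (min_le_left _ _))))).1
      linarith)
    (fun x hx => by
      have hd := hdist h.Nt le_rfl
      rw [time_last] at hd
      have := (abs_le.1 (hg x x (M h.Nt) hx (by simpa using hδ₂.le)
        (hd.trans ((min_le_left _ _).trans (min_le_right _ _))))).1
      linarith) (h.Nt - k) k le_rfl (by omega) x hx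
  have herr : ((h.Nt - k : ℕ) : ℝ) * (D.dt h * ω + c.lip C * ((CI + c.CB * κ) * dx h)) + ω ≤
      ε / 2 := by
    have u0 : ((h.Nt - k : ℕ) : ℝ) ≤ h.Nt := by exact_mod_cast Nat.sub_le _ _
    have u1 : (h.Nt : ℝ) * D.dt h = D.T := D.time_last h
    have u2 : (h.Nt : ℝ) * dx h ≤ θ := by
      have : (h.Nt : ℝ) * dx h = h.Nt / h.Ns := by unfold dx; ring
      rw [this]; exact hratio
    have u3 : G * θ ≤ ε / 4 := by
      have : θ ≤ ε / (4 * (G + 1)) := (min_le_right _ _).trans (min_le_right _ _)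
      rw [le_div_iff₀ (by positivity)] at this
      linarith
    have hdt := D.dt_pos h
    have hdx := dx_pos h
    have hl := c.lip_nonneg hC.le
    calc _ ≤ (h.Nt : ℝ) * (D.dt h * ω + c.lip C * ((CI + c.CB * κ) * dx h)) + ω := by gcongr
      _ = (h.Nt * D.dt h) * ω + G * (h.Nt * dx h) + ω := by rw [hG]; ring
      _ ≤ D.T * ω + G * θ + ω := by rw [u1]; gcongr
      _ = (D.T + 1) * ω + G * θ := by ring
      _ ≤ ε / 4 + ε / 4 := by
        gcongr
        rw [hω]
        apply le_of_eq
        field_simp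
      _ = _ := by ring
  have := hα a₀
  change _ ≤ D.value m (k * (D.T / h.Nt)) x + ε
  linarith

end Data
end MFG

namespace MFG

/-! ### Polygonal paths -/

/-- The index `j` of the time step `(j Δ, (j + 1) Δ]` which contains `τ > 0`. -/
noncomputable def stepIdx (Δ τ : ℝ) : ℕ := ⌈τ / Δ⌉₊ - 1

theorem stepIdx_eq {Δ τ : ℝ} (hΔ : 0 < Δ) {j : ℕ} (hτ : τ ∈ Ioc (j * Δ) ((j + 1 : ℕ) * Δ)) :
    stepIdx Δ τ = j := by
  have h1 : (j : ℝ) < τ / Δ := by rw [lt_div_iff₀ hΔ]; exact hτ.1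
  have h2 : τ / Δ ≤ (j + 1 : ℕ) := by rw [div_le_iff₀ hΔ]; exact hτ.2
  have h3 := Nat.ceil_le.2 h2
  have h4 := Nat.lt_ceil.2 h1
  unfold stepIdx
  omega

theorem stepIdx_mem {Δ τ : ℝ} (hΔ : 0 < Δ) {k N : ℕ} (hτ : τ ∈ Ioc (k * Δ) (N * Δ)) :
    k ≤ stepIdx Δ τ ∧ stepIdx Δ τ < N ∧
      τ ∈ Ioc (stepIdx Δ τ * Δ) ((stepIdx Δ τ + 1 : ℕ) * Δ) := by
  have h1 : (k : ℝ) < τ / Δ := by rw [lt_div_iff₀ hΔ]; exact hτ.1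
  have h2 : τ / Δ ≤ N := by rw [div_le_iff₀ hΔ]; exact hτ.2
  have h3 := Nat.ceil_le.2 h2
  have h4 := Nat.lt_ceil.2 h1
  have h5 : stepIdx Δ τ + 1 = ⌈τ / Δ⌉₊ := by unfold stepIdx; omega
  have h0 : 0 < τ / Δ := (Nat.cast_nonneg k).trans_lt h1
  refine ⟨by omega, by omega, ?_, ?_⟩
  · have h6 := Nat.ceil_lt_add_one h0.le
    rw [← h5] at h6
    push_cast at h6
    rw [← lt_div_iff₀ hΔ]
    linarith
  · rw [h5, ← div_le_iff₀ hΔ]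
    exact Nat.le_ceil _

theorem measurable_stepIdx (Δ : ℝ) : Measurable (stepIdx Δ) :=
  (Measurable.of_discrete (f := fun n : ℕ => n - 1)).comp
    (Nat.measurable_ceil.comp (measurable_id.div_const Δ))

variable {d : ℕ}

/-- The speed at time `τ` of the polygonal path through the points `X j` at the times `j Δ`. -/
noncomputable def polySpeed (Δ : ℝ) (X : ℕ → Vec d) (τ : ℝ) : Vec d :=
  Δ⁻¹ • (X (stepIdx Δ τ + 1) - X (stepIdx Δ τ))

/-- The polygonal path through the points `X j` at the times `j Δ`. -/
noncomputable def polyline (Δ : ℝ) (X : ℕ → Vec d) (t : ℝ) : Vec d :=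
  X 0 + ∫ τ in 0..t, polySpeed Δ X τ

theorem polySpeed_eq {Δ τ : ℝ} (hΔ : 0 < Δ) {X : ℕ → Vec d} {j : ℕ}
    (hτ : τ ∈ Ioc (j * Δ) ((j + 1 : ℕ) * Δ)) : polySpeed Δ X τ = Δ⁻¹ • (X (j + 1) - X j) := by
  rw [polySpeed, stepIdx_eq hΔ hτ]

theorem step_mono {Δ : ℝ} (hΔ : 0 < Δ) : Monotone fun j : ℕ => (j : ℝ) * Δ := fun i j hij => by
  have : (i : ℝ) ≤ j := by exact_mod_cast hij
  dsimp only
  gcongr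

theorem intervalIntegrable_polySpeed_step {Δ : ℝ} (hΔ : 0 < Δ) (X : ℕ → Vec d) (j : ℕ) :
    IntervalIntegrable (polySpeed Δ X) volume (j * Δ) ((j + 1 : ℕ) * Δ) := by
  refine IntervalIntegrable.congr (f := fun _ => Δ⁻¹ • (X (j + 1) - X j)) (fun τ hτ => ?_)
    intervalIntegrable_const
  rw [uIoc_of_le (step_mono hΔ (Nat.le_succ j))] at hτ
  exact (polySpeed_eq hΔ hτ).symm

theorem intervalIntegrable_polySpeed {Δ : ℝ} (hΔ : 0 < Δ) (X : ℕ → Vec d) (n : ℕ) :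
    IntervalIntegrable (polySpeed Δ X) volume 0 (n * Δ) := by
  have := IntervalIntegrable.trans_iterate (a := fun j : ℕ => (j : ℝ) * Δ) (n := n)
    (fun j _ => intervalIntegrable_polySpeed_step hΔ X j)
  simpa using this

theorem intervalIntegrable_polySpeed_of_mem {Δ : ℝ} (hΔ : 0 < Δ) (X : ℕ → Vec d) {n : ℕ} {a b : ℝ}
    (ha : a ∈ Icc 0 (n * Δ)) (hb : b ∈ Icc 0 (n * Δ)) :
    IntervalIntegrable (polySpeed Δ X) volume a b := by
  refine (intervalIntegrable_polySpeed hΔ X n).mono_set (uIcc_subset_uIcc ?_ ?_)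
  · rwa [uIcc_of_le (ha.1.trans ha.2)]
  · rwa [uIcc_of_le (ha.1.trans ha.2)]

theorem polyline_sub {Δ : ℝ} (hΔ : 0 < Δ) (X : ℕ → Vec d) {n : ℕ} {a b : ℝ}
    (ha : a ∈ Icc 0 (n * Δ)) (hb : b ∈ Icc 0 (n * Δ)) :
    polyline Δ X b - polyline Δ X a = ∫ τ in a..b, polySpeed Δ X τ := by
  have h0 : (0 : ℝ) ∈ Icc 0 (n * Δ) := ⟨le_rfl, ha.1.trans ha.2⟩
  rw [polyline, polyline, add_sub_add_left_eq_sub]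
  exact intervalIntegral.integral_interval_sub_left
    (intervalIntegrable_polySpeed_of_mem hΔ X h0 hb)
    (intervalIntegrable_polySpeed_of_mem hΔ X h0 ha)

theorem integral_polySpeed {Δ : ℝ} (hΔ : 0 < Δ) (X : ℕ → Vec d) {j : ℕ} {t : ℝ}
    (ht : t ∈ Icc (j * Δ) ((j + 1 : ℕ) * Δ)) :
    ∫ τ in (j * Δ)..t, polySpeed Δ X τ = (t - j * Δ) • Δ⁻¹ • (X (j + 1) - X j) := by
  rw [← intervalIntegral.integral_const]
  refine intervalIntegral.integral_congr_ae (ae_of_all _ fun τ hτ => ?_)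
  rw [uIoc_of_le ht.1] at hτ
  exact polySpeed_eq hΔ ⟨hτ.1, hτ.2.trans ht.2⟩

theorem polyline_node {Δ : ℝ} (hΔ : 0 < Δ) (X : ℕ → Vec d) (j : ℕ) :
    polyline Δ X (j * Δ) = X j := by
  induction j with
  | zero => simp [polyline]
  | succ j ih =>
    have h1 := step_mono hΔ (Nat.le_succ j)
    have h0 : (0 : ℝ) ≤ j * Δ := by positivity
    have h2 := polyline_sub hΔ X (n := j + 1) (a := j * Δ) (b := (j + 1 : ℕ) * Δ) ⟨h0, h1⟩
      ⟨h0.trans h1, le_rfl⟩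
    rw [integral_polySpeed hΔ X ⟨h1, le_rfl⟩, ih, smul_smul] at h2
    have e : ((j + 1 : ℕ) * Δ - j * Δ) * Δ⁻¹ = 1 := by push_cast; field_simp; ring
    rw [e, one_smul] at h2
    exact sub_left_inj.1 h2

theorem polyline_apply {Δ : ℝ} (hΔ : 0 < Δ) (X : ℕ → Vec d) {j : ℕ} {t : ℝ}
    (ht : t ∈ Icc (j * Δ) ((j + 1 : ℕ) * Δ)) :
    polyline Δ X t = X j + (t - j * Δ) • Δ⁻¹ • (X (j + 1) - X j) := by
  have h1 := step_mono hΔ (Nat.le_succ j)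
  have h0 : (0 : ℝ) ≤ j * Δ := by positivity
  have h2 := polyline_sub hΔ X (n := j + 1) (a := j * Δ) (b := t) ⟨h0, h1⟩ ⟨h0.trans ht.1, ht.2⟩
  rw [integral_polySpeed hΔ X ht, polyline_node hΔ, sub_eq_iff_eq_add'] at h2
  exact h2

/-- A polygonal path with bounded slopes is Lipschitz. -/
theorem polyline_lipschitz {Δ : ℝ} (hΔ : 0 < Δ) {X : ℕ → Vec d} {k n : ℕ} {L : ℝ}
    (hX : ∀ j, k ≤ j → j < n → ‖X (j + 1) - X j‖ ≤ Δ * L) {a b : ℝ} (ha : a ∈ Icc (k * Δ) (n * Δ))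
    (hb : b ∈ Icc (k * Δ) (n * Δ)) : ‖polyline Δ X b - polyline Δ X a‖ ≤ L * |b - a| := by
  have hk : (0 : ℝ) ≤ k * Δ := by positivity
  rw [polyline_sub hΔ X (n := n) ⟨hk.trans ha.1, ha.2⟩ ⟨hk.trans hb.1, hb.2⟩]
  refine intervalIntegral.norm_integral_le_of_norm_le_const fun τ hτ => ?_
  have hτ' : τ ∈ Ioc (k * Δ) (n * Δ) :=
    ⟨(le_min ha.1 hb.1).trans_lt hτ.1, hτ.2.trans (max_le ha.2 hb.2)⟩
  obtain ⟨h1, h2, -⟩ := stepIdx_mem hΔ hτ'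
  rw [polySpeed, norm_smul, norm_inv, Real.norm_of_nonneg hΔ.le, inv_mul_le_iff₀ hΔ]
  exact hX _ h1 h2

theorem norm_polyline_le {Δ : ℝ} (hΔ : 0 < Δ) {X : ℕ → Vec d} {k n : ℕ} {R : ℝ}
    (hX : ∀ j, k ≤ j → j ≤ n → ‖X j‖ ≤ R) (hkn : k ≤ n) {t : ℝ} (ht : t ∈ Icc (k * Δ) (n * Δ)) :
    ‖polyline Δ X t‖ ≤ R := by
  rcases ht.1.eq_or_lt with h | h
  · rw [← h, polyline_node hΔ]
    exact hX k le_rfl hkn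
  · obtain ⟨h1, h2, h3⟩ := stepIdx_mem hΔ ⟨h, ht.2⟩
    rw [polyline_apply hΔ X ⟨h3.1.le, h3.2⟩]
    set j := stepIdx Δ t
    set θ := (t - j * Δ) * Δ⁻¹ with hθ
    have hθ0 : 0 ≤ θ := mul_nonneg (by linarith [h3.1]) (inv_nonneg.2 hΔ.le)
    have hθ1 : θ ≤ 1 := by
      rw [hθ, ← div_eq_mul_inv, div_le_one hΔ]
      have := h3.2
      push_cast at this
      linarith
    have e : X j + (t - j * Δ) • Δ⁻¹ • (X (j + 1) - X j) = (1 - θ) • X j + θ • X (j + 1) := by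
      rw [smul_smul, ← hθ, smul_sub, sub_smul, one_smul]
      abel
    rw [e]
    refine (norm_add_le _ _).trans ?_
    rw [norm_smul, norm_smul, Real.norm_of_nonneg hθ0, Real.norm_of_nonneg (sub_nonneg.2 hθ1)]
    have u1 := mul_le_mul_of_nonneg_left (hX j h1 h2.le) (sub_nonneg.2 hθ1)
    have u2 := mul_le_mul_of_nonneg_left (hX (j + 1) (by omega) (by omega)) hθ0
    linarith

namespace Data

variable {r s : ℕ} {D : Data d r s}

/-- A sequence of states which almost solves the Euler scheme gives, by polygonal interpolation, an
approximate trajectory of almost the same cost. -/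
theorem exists_nearTrajectory_of_chain (h1 : D.H1) (h2 : D.H2) (h3 : D.H3) (m : D.Flow) {C : ℝ}
    (hC : 0 ≤ C) (R : ℝ) {ε : ℝ} (hε : 0 < ε) :
    ∃ θ > 0, ∃ N₀ : ℕ, ∀ N ≥ N₀, 0 < N → ∀ M : ℕ → P1 (Vec d),
      (∀ k ≤ N, dist (D.atTime m (k * (D.T / N))) (M k) ≤ θ) → ∀ k ≤ N,
      ∀ (X : ℕ → Vec d) (a : ℕ → Vec r), (∀ j, k ≤ j → j ≤ N → ‖X j‖ ≤ R) →
      (∀ j, k ≤ j → j < N → ‖a j‖ ≤ C ∧ ‖X (j + 1) - (X j + (D.T / N) •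
        (D.A (j * (D.T / N)) (X j) + D.B (j * (D.T / N)) (X j) *ᵥ a j))‖ ≤ (D.T / N) * θ) →
      D.NearTrajectory (k * (D.T / N)) C ε (polyline (D.T / N) X)
        (fun τ => a (stepIdx (D.T / N) τ)) (polySpeed (D.T / N) X) ∧
      |D.cost m (k * (D.T / N)) (polyline (D.T / N) X) (fun τ => a (stepIdx (D.T / N) τ)) -
        (∑ j ∈ Finset.Ico k N, (D.T / N) * D.ℓ (j * (D.T / N)) (a j) (X j) (M j) +
          D.g (X N) (M N))| ≤ ε := by
  obtain ⟨c⟩ := D.exists_bounds h1 h2 h3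
  have hT := D.T_pos
  have hLA := c.LA_pos
  have hCB := c.CB_pos
  have hA0 := c.A0_nonneg
  obtain ⟨δ₁, hδ₁, hvel⟩ := exists_velocity_modulus h3 R (ε := ε / (2 * (1 + C))) (by positivity)
  obtain ⟨δ₂, hδ₂, hℓ⟩ := exists_ℓ_modulus h1 m C R (ε := ε / (2 * D.T)) (by positivity)
  obtain ⟨δ₃, hδ₃, hg⟩ := exists_g_modulus h2 (D.atTime m D.T) R (ε := ε / 2) (by positivity)
  have hmc : Continuous (D.atTime m) := m.continuous.comp continuous_projIcc
  obtain ⟨δ₄, hδ₄, hm⟩ := exists_modulus isCompact_Icc (hmc.continuousOn (s := Icc 0 D.T))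
    (half_pos hδ₂)
  set S := c.A0 + c.LA * |R| + c.CB * C + 1 with hS
  have hS1 : 1 ≤ S := by
    have : 0 ≤ c.A0 + c.LA * |R| + c.CB * C := by positivity
    linarith
  set δ := min (min δ₁ δ₂) (min δ₄ 1) with hδ
  have hδ0 : 0 < δ := lt_min (lt_min hδ₁ hδ₂) (lt_min hδ₄ one_pos)
  obtain ⟨N₀, -, hN₀⟩ := D.exists_step_le (δ := δ / S) (by positivity)
  set θ := min (min (ε / 2) 1) (min (δ₂ / 2) δ₃) with hθ
  have hθ0 : 0 < θ := lt_min (lt_min (by positivity) one_pos) (lt_min (by positivity) hδ₃)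
  refine ⟨θ, hθ0, N₀, fun N hN hNpos M hM k hk X a hXR ha => ?_⟩
  set Δ := D.T / N with hΔdef
  have hΔ : 0 < Δ := D.step_pos hNpos
  have hNT : N * Δ = D.T := by
    have : (N : ℝ) ≠ 0 := by exact_mod_cast hNpos.ne'
    rw [hΔdef]; field_simp
  have hΔS : Δ * S ≤ δ := by
    have := hN₀ N hN
    rwa [le_div_iff₀ (by positivity)] at this
  have hΔδ : Δ ≤ δ := by nlinarith
  have htmem : ∀ j ≤ N, (j : ℝ) * Δ ∈ Icc 0 D.T := fun j hj => D.step_time_mem hNpos hj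
  have hR : ∀ j, k ≤ j → j ≤ N → ‖X j‖ ≤ |R| := fun j h1 h2 =>
    (hXR j h1 h2).trans (le_abs_self R)
  have hvelb : ∀ j, k ≤ j → j < N →
      ‖D.A (j * Δ) (X j) + D.B (j * Δ) (X j) *ᵥ a j‖ ≤ S - 1 := by
    intro j hj1 hj2
    refine (norm_add_le _ _).trans ?_
    have u1 := c.A_le (htmem j hj2.le) (X j)
    have u2 := c.B_le _ (htmem j hj2.le) (X j) (a j)
    have u3 := mul_le_mul_of_nonneg_left (ha j hj1 hj2).1 hCB.le
    have u4 := mul_le_mul_of_nonneg_left (hR j hj1 hj2.le) hLA.le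
    rw [hS]
    linarith
  have hspeed : ∀ j, k ≤ j → j < N →
      ‖Δ⁻¹ • (X (j + 1) - X j) - (D.A (j * Δ) (X j) + D.B (j * Δ) (X j) *ᵥ a j)‖ ≤ θ := by
    intro j hj1 hj2
    have e : Δ⁻¹ • (X (j + 1) - X j) - (D.A (j * Δ) (X j) + D.B (j * Δ) (X j) *ᵥ a j) =
        Δ⁻¹ • (X (j + 1) - (X j + Δ • (D.A (j * Δ) (X j) + D.B (j * Δ) (X j) *ᵥ a j))) := by
      generalize D.A (j * Δ) (X j) + D.B (j * Δ) (X j) *ᵥ a j = v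
      rw [← sub_sub, smul_sub Δ⁻¹ (X (j + 1) - X j), smul_smul, inv_mul_cancel₀ hΔ.ne', one_smul]
    rw [e, norm_smul, norm_inv, Real.norm_of_nonneg hΔ.le, inv_mul_le_iff₀ hΔ]
    exact (ha j hj1 hj2).2
  have hstep : ∀ j, k ≤ j → j < N → ‖X (j + 1) - X j‖ ≤ Δ * S := by
    intro j hj1 hj2
    have u1 := norm_le_norm_add_norm_sub' (Δ⁻¹ • (X (j + 1) - X j))
      (D.A (j * Δ) (X j) + D.B (j * Δ) (X j) *ᵥ a j)
    have u2 := hspeed j hj1 hj2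
    have u3 := hvelb j hj1 hj2
    have u4 : θ ≤ 1 := (min_le_left _ _).trans (min_le_right _ _)
    have u5 : ‖Δ⁻¹ • (X (j + 1) - X j)‖ ≤ S := by linarith
    rwa [norm_smul, norm_inv, Real.norm_of_nonneg hΔ.le, inv_mul_le_iff₀ hΔ] at u5
  have hnear : ∀ j, k ≤ j → j < N → ∀ τ ∈ Ioc (j * Δ) ((j + 1 : ℕ) * Δ),
      τ ∈ Icc 0 D.T ∧ |τ - j * Δ| ≤ δ ∧ ‖polyline Δ X τ‖ ≤ R ∧
        ‖polyline Δ X τ - X j‖ ≤ δ := by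
    intro j hj1 hj2 τ hτ
    have hj0 := htmem j hj2.le
    have hj3 := htmem (j + 1) hj2
    have u1 : |τ - j * Δ| ≤ Δ := by
      have := hτ.2
      push_cast at this
      rw [abs_of_nonneg (by linarith [hτ.1])]
      linarith
    have hτk : τ ∈ Icc (k * Δ) (N * Δ) :=
      ⟨(step_mono hΔ hj1).trans hτ.1.le, hτ.2.trans (step_mono hΔ hj2)⟩
    refine ⟨⟨hj0.1.trans hτ.1.le, hτ.2.trans hj3.2⟩, u1.trans hΔδ,
      norm_polyline_le hΔ hXR hk hτk, ?_⟩
    rw [← polyline_node hΔ X j]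
    refine (polyline_lipschitz hΔ (k := k) (n := N) (L := S) hstep
      ⟨step_mono hΔ hj1, step_mono hΔ hj2.le⟩ hτk).trans ?_
    calc S * |τ - j * Δ| ≤ S * Δ := by gcongr
      _ ≤ δ := by linarith
  have hnt : D.NearTrajectory (k * Δ) C ε (polyline Δ X) (fun τ => a (stepIdx Δ τ))
      (polySpeed Δ X) := by
    have hidx : ∀ τ ∈ Ioc (k * Δ) D.T, k ≤ stepIdx Δ τ ∧ stepIdx Δ τ < N ∧
        τ ∈ Ioc (stepIdx Δ τ * Δ) ((stepIdx Δ τ + 1 : ℕ) * Δ) := fun τ hτ =>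
      stepIdx_mem hΔ (by rwa [hNT])
    refine ⟨(Measurable.of_discrete (f := a)).comp (measurable_stepIdx Δ), ?_, fun τ hτ => ?_,
      fun t ht => ?_, fun τ hτ => ?_⟩
    · refine intervalIntegrable_polySpeed_of_mem hΔ X (n := N) ?_ ?_
      · rw [hNT]; exact htmem k hk
      · rw [hNT]; exact ⟨hT.le, le_rfl⟩
    · obtain ⟨u1, u2, -⟩ := hidx τ hτ
      exact (ha _ u1 u2).1
    · rw [← polyline_sub hΔ X (n := N)]
      · abel
      · rw [hNT]; exact htmem k hk
      · rw [hNT]; exact ⟨(htmem k hk).1.trans ht.1, ht.2⟩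
    · obtain ⟨u1, u2, u3⟩ := hidx τ hτ
      set j := stepIdx Δ τ with hj
      obtain ⟨v1, v2, v3, v4⟩ := hnear j u1 u2 τ u3
      rw [polySpeed_eq hΔ u3]
      obtain ⟨w1, w2⟩ := hvel _ v1 _ (htmem j u2.le) (polyline Δ X τ) (X j) v3 (hXR j u1 u2.le)
        (v2.trans ((min_le_left _ _).trans (min_le_left _ _)))
        (v4.trans ((min_le_left _ _).trans (min_le_left _ _)))
      have w3 := hspeed j u1 u2
      have w4 := w2 (a j)
      have w5 := mul_le_mul_of_nonneg_left (ha j u1 u2).1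
        (show 0 ≤ ε / (2 * (1 + C)) by positivity)
      have w6 : θ ≤ ε / 2 := (min_le_left _ _).trans (min_le_left _ _)
      have w7 : ε / (2 * (1 + C)) + ε / (2 * (1 + C)) * C = ε / 2 := by field_simp
      have e : Δ⁻¹ • (X (j + 1) - X j) -
          (D.A τ (polyline Δ X τ) + D.B τ (polyline Δ X τ) *ᵥ a j) =
          (Δ⁻¹ • (X (j + 1) - X j) - (D.A (j * Δ) (X j) + D.B (j * Δ) (X j) *ᵥ a j)) -
          ((D.A τ (polyline Δ X τ) - D.A (j * Δ) (X j)) +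
            (D.B τ (polyline Δ X τ) *ᵥ a j - D.B (j * Δ) (X j) *ᵥ a j)) := by abel
      rw [e]
      have w8 := norm_sub_le (Δ⁻¹ • (X (j + 1) - X j) -
          (D.A (j * Δ) (X j) + D.B (j * Δ) (X j) *ᵥ a j))
          ((D.A τ (polyline Δ X τ) - D.A (j * Δ) (X j)) +
            (D.B τ (polyline Δ X τ) *ᵥ a j - D.B (j * Δ) (X j) *ᵥ a j))
      have w9 := norm_add_le (D.A τ (polyline Δ X τ) - D.A (j * Δ) (X j))
        (D.B τ (polyline Δ X τ) *ᵥ a j - D.B (j * Δ) (X j) *ᵥ a j)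
      linarith
  refine ⟨hnt, ?_⟩
  have hint := hnt.intervalIntegrable_ℓ c h1 m (htmem k hk)
  set f : ℝ → ℝ := fun τ => D.ℓ τ (a (stepIdx Δ τ)) (polyline Δ X τ) (D.atTime m τ) with hf
  -- the running costs are compared step by step
  have hsplit : ∫ τ in (k * Δ)..D.T, f τ =
      ∑ j ∈ Finset.Ico k N, ∫ τ in (j * Δ)..((j + 1 : ℕ) * Δ), f τ := by
    rw [← hNT]
    refine (intervalIntegral.sum_integral_adjacent_intervals_Ico (a := fun j : ℕ => (j : ℝ) * Δ)
      hk fun j hj => ?_).symm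
    refine hint.mono_set (uIcc_subset_uIcc ?_ ?_)
    · rw [uIcc_of_le (htmem k hk).2, ← hNT]
      exact ⟨step_mono hΔ hj.1, step_mono hΔ hj.2.le⟩
    · rw [uIcc_of_le (htmem k hk).2, ← hNT]
      exact ⟨step_mono hΔ (hj.1.trans (Nat.le_succ _)), step_mono hΔ hj.2⟩
  have hterm : ∀ j ∈ Finset.Ico k N, |(∫ τ in (j * Δ)..((j + 1 : ℕ) * Δ), f τ) -
      Δ * D.ℓ (j * Δ) (a j) (X j) (M j)| ≤ Δ * (ε / (2 * D.T)) := by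
    intro j hj
    rw [Finset.mem_Ico] at hj
    have hlen : (j + 1 : ℕ) * Δ - j * Δ = Δ := by push_cast; ring
    have hi : IntervalIntegrable f volume (j * Δ) ((j + 1 : ℕ) * Δ) := by
      refine hint.mono_set (uIcc_subset_uIcc ?_ ?_)
      · rw [uIcc_of_le (htmem k hk).2, ← hNT]
        exact ⟨step_mono hΔ hj.1, step_mono hΔ hj.2.le⟩
      · rw [uIcc_of_le (htmem k hk).2, ← hNT]
        exact ⟨step_mono hΔ (hj.1.trans (Nat.le_succ _)), step_mono hΔ hj.2⟩
    have e : Δ * D.ℓ (j * Δ) (a j) (X j) (M j) =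
        ∫ _τ in (j * Δ)..((j + 1 : ℕ) * Δ), D.ℓ (j * Δ) (a j) (X j) (M j) := by
      rw [intervalIntegral.integral_const, hlen, smul_eq_mul]
    rw [e, ← intervalIntegral.integral_sub hi intervalIntegrable_const]
    have := intervalIntegral.norm_integral_le_of_norm_le_const (a := j * Δ)
      (b := (j + 1 : ℕ) * Δ) (C := ε / (2 * D.T))
      (f := fun τ => f τ - D.ℓ (j * Δ) (a j) (X j) (M j)) (fun τ hτ => ?_)
    · rw [hlen, abs_of_pos hΔ] at this
      rw [mul_comm Δ (ε / (2 * D.T))]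
      exact this
    · rw [uIoc_of_le (step_mono hΔ (Nat.le_succ j))] at hτ
      obtain ⟨v1, v2, v3, v4⟩ := hnear j hj.1 hj.2 τ hτ
      simp only [hf]
      rw [stepIdx_eq hΔ hτ, Real.norm_eq_abs]
      refine hℓ _ v1 _ (htmem j hj.2.le) _ _ _ _ _ (ha j hj.1 hj.2).1 v3
        (v2.trans ((min_le_left _ _).trans (min_le_right _ _))) (by simpa using hδ₂.le)
        (v4.trans ((min_le_left _ _).trans (min_le_right _ _))) ?_
      have w1 := hm _ v1 _ (htmem j hj.2.le) (v2.trans ((min_le_right _ _).trans (min_le_left _ _)))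
      have w2 : θ ≤ δ₂ / 2 := (min_le_right _ _).trans (min_le_left _ _)
      have w3 := hM j hj.2.le
      have w4 := dist_triangle (D.atTime m τ) (D.atTime m (j * Δ)) (M j)
      linarith
  have hgN : |D.g (polyline Δ X D.T) (D.atTime m D.T) - D.g (X N) (M N)| ≤ ε / 2 := by
    have hd := hM N le_rfl
    rw [hNT] at hd
    have e : polyline Δ X D.T = X N := by rw [← hNT]; exact polyline_node hΔ X N
    rw [e]
    exact hg _ _ _ (hXR N hk le_rfl) (by simpa using hδ₃.le)
      (hd.trans ((min_le_right _ _).trans (min_le_right _ _)))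
  have hsum : |∑ j ∈ Finset.Ico k N, (∫ τ in (j * Δ)..((j + 1 : ℕ) * Δ), f τ) -
      ∑ j ∈ Finset.Ico k N, Δ * D.ℓ (j * Δ) (a j) (X j) (M j)| ≤ ε / 2 := by
    rw [← Finset.sum_sub_distrib]
    refine (Finset.abs_sum_le_sum_abs _ _).trans ((Finset.sum_le_sum hterm).trans ?_)
    rw [Finset.sum_const, nsmul_eq_mul, Nat.card_Ico]
    calc ((N - k : ℕ) : ℝ) * (Δ * (ε / (2 * D.T))) ≤ N * (Δ * (ε / (2 * D.T))) := by
          gcongr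
          exact Nat.sub_le _ _
      _ = (N * Δ) * (ε / (2 * D.T)) := by ring
      _ = ε / 2 := by rw [hNT]; field_simp
  have e : D.cost m (k * Δ) (polyline Δ X) (fun τ => a (stepIdx Δ τ)) =
      ∑ j ∈ Finset.Ico k N, (∫ τ in (j * Δ)..((j + 1 : ℕ) * Δ), f τ) +
        D.g (polyline Δ X D.T) (D.atTime m D.T) := by
    rw [cost, ← hsplit]
  rw [e]
  rw [abs_le] at hsum hgN ⊢
  constructor <;> linarith [hsum.1, hsum.2, hgN.1, hgN.2]

end Data
end MFG

namespace MFG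
namespace Data

variable {d r s : ℕ} {D : Data d r s} {C CI : ℝ}

/-! ### Lower bound for the discrete value function -/

/-- A bound on the loss due to the entropy in one step of the discrete dynamic programming
equation, for states in the ball of radius `R`. -/
noncomputable def Bounds.entropyLoss (c : D.Bounds) (h : Discretization s) (C R : ℝ) : ℝ :=
  h.ε * (r * Real.log ((2 * c.reach C R + 3) * h.Ns))

theorem Bounds.reach_nonneg (c : D.Bounds) (hC : 0 ≤ C) {R : ℝ} (hR : 0 ≤ R) :
    0 ≤ c.reach C R := by
  have hLA := c.LA_pos
  have hCB := c.CB_pos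
  have hA0 := c.A0_nonneg
  have hT := D.T_pos
  unfold reach
  positivity

theorem Bounds.entropyLoss_nonneg (c : D.Bounds) (h : Discretization s) (hC : 0 ≤ C) {R : ℝ}
    (hR : 0 ≤ R) : 0 ≤ c.entropyLoss h C R := by
  have h1 := c.reach_nonneg hC hR
  have h2 : (1 : ℝ) ≤ h.Ns := by exact_mod_cast h.Ns_pos
  have h4 : 0 ≤ Real.log ((2 * c.reach C R + 3) * h.Ns) := Real.log_nonneg (by nlinarith)
  have h5 := h.ε_pos
  unfold entropyLoss
  positivity

theorem Bounds.ε_mul_log_card_le (c : D.Bounds) (h3 : D.H3) (hC : 0 ≤ C) {h : Discretization s}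
    {k : ℕ} (hk : k ≤ h.Nt) {x : Vec d} {R : ℝ} (hx : ‖x‖ ≤ R) (hne : (D.S₁ h C k x).Nonempty) :
    ∃ hf : (D.S₁ h C k x).Finite,
      h.ε * Real.log hf.toFinset.card ≤ c.entropyLoss h C R := by
  obtain ⟨hf, hcard⟩ := c.S₁_finite h3 hC hk x hx
  refine ⟨hf, mul_le_mul_of_nonneg_left ?_ h.ε_pos.le⟩
  have hpos : (0 : ℝ) < hf.toFinset.card := by
    exact_mod_cast Finset.card_pos.2 (hf.toFinset_nonempty.2 hne)
  rw [← Real.log_pow]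
  exact Real.log_le_log hpos hcard

theorem SolvesHJB.nonempty_S₁ {h : Discretization s} {K₀ : Set (Vec d)} {M : ℕ → P1 (Vec d)}
    {V : ℕ → Vec d → ℝ} {q : ℕ → Vec d → Vec r → ℝ} (hV : D.SolvesHJB h C K₀ M V q) {k : ℕ}
    (hk : k < h.Nt) {x : Vec d} (hx : x ∈ D.S h C K₀ k) : (D.S₁ h C k x).Nonempty := by
  by_contra hne
  rw [not_nonempty_iff_eq_empty] at hne
  have := (hV.prob k hk x hx).2
  rw [hne] at this
  simp at this

/-- Along an admissible chain of states, the cost is almost bounded below by the value function. -/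
theorem exists_value_le_chainCost (h1 : D.H1) (h2 : D.H2) (h3 : D.H3) (hC : 0 ≤ C) (hCI : 0 ≤ CI)
    (m : D.Flow) (R : ℝ) {ε : ℝ} (hε : 0 < ε) :
    ∃ θ > 0, ∃ N₀ : ℕ, ∀ (h : Discretization s) (M : ℕ → P1 (Vec d)),
      D.Admissible h CI → N₀ ≤ h.Nt → (h.Nt : ℝ) / h.Ns ≤ θ →
      (∀ k ≤ h.Nt, dist (D.atTime m (D.time h k)) (M k) ≤ θ) →
      ∀ k ≤ h.Nt, ∀ X : ℕ → Vec d, (∀ j, k ≤ j → j ≤ h.Nt → ‖X j‖ ≤ R) →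
      (∀ j, k ≤ j → j < h.Nt → X (j + 1) ∈ D.SNext h C j (X j)) →
      ∃ α : ℝ → Vec r, D.NearTrajectory (D.time h k) C ε (polyline (D.dt h) X) α
        (polySpeed (D.dt h) X) ∧
      D.cost m (D.time h k) (polyline (D.dt h) X) α ≤ D.chainCost h M k X + ε ∧
      D.value m (D.time h k) (X k) ≤ D.chainCost h M k X + ε := by
  obtain ⟨c⟩ := D.exists_bounds h1 h2 h3
  have hT := D.T_pos
  have hLA := c.LA_pos
  have hLB := c.LB_pos
  have hLl := c.Ll_pos
  have hLg := c.Lg_pos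
  set G := (c.Ll * (1 + C ^ D.p) * D.T + c.Lg) *
    (2 * D.T * Real.exp (2 * (c.LA + c.LB * C) * D.T)) with hG
  have hG0 : 0 ≤ G := by positivity
  set ε' := ε / (1 + G) with hε'
  have hε'0 : 0 < ε' := by positivity
  have hε'1 : ε' * (1 + G) = ε := by rw [hε']; field_simp
  have hε'ε : ε' ≤ ε := by nlinarith
  obtain ⟨θ, hθ, N₀, hN₀⟩ := exists_nearTrajectory_of_chain h1 h2 h3 m hC R hε'0
  refine ⟨min θ (θ * D.T / (CI + 1)), lt_min hθ (by positivity), N₀,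
    fun h M hh hN hratio hdist k hk X hXR hX => ?_⟩
  have hdt := D.dt_pos h
  have hround : CI * dx h ≤ D.dt h * θ := by
    have u1 : (h.Nt : ℝ) / h.Ns ≤ θ * D.T / (CI + 1) := hratio.trans (min_le_right _ _)
    have u2 := D.dx_div_dt h
    rw [div_eq_iff hdt.ne'] at u2
    rw [le_div_iff₀ (by positivity)] at u1
    have u3 : 0 ≤ (h.Nt : ℝ) / h.Ns := by positivity
    rw [u2, ← mul_assoc, mul_comm (D.dt h)]
    gcongr
    rw [← mul_div_assoc, div_le_iff₀ hT]
    linarith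
  obtain ⟨w1, w2⟩ := hN₀ h.Nt hN h.Nt_pos M (fun k hk => (hdist k hk).trans (min_le_left _ _)) k hk
    X (fun j => D.ctrl h j (X j) (D.fst (X (j + 1)))) hXR (fun j hj1 hj2 => by
      have := hX j hj1 hj2
      exact ⟨this.1.2, (sub_move_le_of_mem_SNext h3 hh.2 hCI hj2.le this).trans hround⟩)
  have w3 := w1.value_le c h1 h3 m hC hε'0.le (D.time_mem h hk)
  have e : polyline (D.dt h) X (D.time h k) = X k := polyline_node hdt X k
  change D.value m (D.time h k) (polyline (D.dt h) X (D.time h k)) ≤ _ at w3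
  rw [e, ← mul_assoc, ← hG] at w3
  have w4 := (abs_le.1 w2).2
  change D.cost m (D.time h k) (polyline (D.dt h) X) _ - D.chainCost h M k X ≤ _ at w4
  change D.value m (D.time h k) (X k) ≤ D.cost m (D.time h k) (polyline (D.dt h) X) _ + _ at w3
  refine ⟨_, ⟨w1.1, w1.2, w1.3, w1.4, fun τ hτ => (w1.5 τ hτ).trans hε'ε⟩, ?_, ?_⟩ <;> linarith

/-- The discrete value function is at least the value function along a nearby flow, up to a small
error. -/
theorem exists_value_lower (c : D.Bounds) (h1 : D.H1) (h2 : D.H2) (h3 : D.H3) (hC : 0 ≤ C)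
    (hCI : 0 ≤ CI) (m : D.Flow) {R : ℝ} {ε : ℝ} (hε : 0 < ε) :
    ∃ θ > 0, ∃ N₀ : ℕ, ∀ (h : Discretization s) (K₀ : Set (Vec d)) (M : ℕ → P1 (Vec d))
      (V : ℕ → Vec d → ℝ) (q : ℕ → Vec d → Vec r → ℝ),
      D.Admissible h CI → D.SolvesHJB h C K₀ M V q →
      (∀ k ≤ h.Nt, ∀ x ∈ D.S h C K₀ k, ‖x‖ ≤ R) → N₀ ≤ h.Nt → (h.Nt : ℝ) / h.Ns ≤ θ →
      h.Nt * c.entropyLoss h C R ≤ θ →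
      (∀ k ≤ h.Nt, dist (D.atTime m (D.time h k)) (M k) ≤ θ) →
      ∀ k ≤ h.Nt, ∀ x ∈ D.S h C K₀ k, D.value m (D.time h k) x ≤ V k x + ε := by
  obtain ⟨θ, hθ, N₀, hN₀⟩ := exists_value_le_chainCost h1 h2 h3 hC hCI m R (half_pos hε)
  refine ⟨min θ (ε / 2), lt_min hθ (by positivity), N₀,
    fun h K₀ M V q hh hV hS hN hratio hloss hdist k hk x hx => ?_⟩
  have hR : 0 ≤ R := (norm_nonneg x).trans (hS k hk x hx)
  obtain ⟨X, hX0, hX1, hX2⟩ := hV.exists_chain hh.2 hCI (fun k hk x hx =>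
    c.ε_mul_log_card_le h3 hC hk.le (hS k hk.le x hx) (hV.nonempty_S₁ hk hx)) (h.Nt - k) k
    (by omega) x hx
  have hXS := chain_mem_S (hX0 ▸ hx) hX1
  obtain ⟨-, -, -, w⟩ := hN₀ h M hh hN (hratio.trans (min_le_left _ _))
    (fun k hk => (hdist k hk).trans (min_le_left _ _)) k hk X
    (fun j hj1 hj2 => hS j hj2 _ (hXS j hj1 hj2)) hX1
  have u1 : ((h.Nt - k : ℕ) : ℝ) * c.entropyLoss h C R ≤ h.Nt * c.entropyLoss h C R := by
    gcongr
    · exact c.entropyLoss_nonneg h hC hR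
    · exact Nat.sub_le _ _
  have u2 := hloss.trans (min_le_right _ _)
  rw [hX0] at w
  linarith

/-- The value function is uniformly continuous in the initial state, on bounded sets. -/
theorem exists_value_modulus (h1 : D.H1) (h2 : D.H2) (h3 : D.H3) (hC : 0 < C)
    (hCb : D.IsControlBound C) (m : D.Flow) (R : ℝ) {ε : ℝ} (hε : 0 < ε) :
    ∃ δ > 0, ∀ x y : Vec d, ‖x‖ ≤ R → ‖y‖ ≤ R → ‖x - y‖ ≤ δ →
      D.value m 0 y ≤ D.value m 0 x + ε := by
  obtain ⟨c⟩ := D.exists_bounds h1 h2 h3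
  have hT := D.T_pos
  have hLA := c.LA_pos
  have hLB := c.LB_pos
  have hLl := c.Ll_pos
  have hLg := c.Lg_pos
  have hCB := c.CB_pos
  have hA0 := c.A0_nonneg
  set R1 := (|R| + D.T * (c.A0 + c.CB * C)) * Real.exp (D.T * c.LA) with hR1
  set G := (c.Ll * (1 + C ^ D.p) * D.T + c.Lg) *
    (2 * D.T * Real.exp (2 * (c.LA + c.LB * C) * D.T)) with hG
  have hG0 : 0 ≤ G := by positivity
  set ε' := ε / (4 * (1 + G)) with hε'
  have hε'0 : 0 < ε' := by positivity
  have hε'1 : ε' * (1 + G) = ε / 4 := by rw [hε']; field_simp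
  obtain ⟨θ, hθ, N₀, hN₀⟩ := exists_nearTrajectory_of_chain h1 h2 h3 m hC.le R1 hε'0
  obtain ⟨N₁, hN₁, hU⟩ := exists_eulerCost_le_value h1 h2 h3 m R (ε := ε / 4) (by positivity)
  have hlip := c.lip_nonneg hC.le
  set N := max N₀ N₁ with hN
  have hNpos : 0 < N := lt_max_of_lt_right hN₁
  refine ⟨ε / (4 * (c.lip C + 1)), by positivity, fun x y hx hy hxy => ?_⟩
  obtain ⟨a₀, ha₀⟩ := hU N (le_max_right _ _) 0 (Nat.zero_le _) x hx
  obtain ⟨α, hα⟩ := exists_eulerCost_minimizer h1 h2 h3 hNpos (Nat.zero_le N) m x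
  have hαC : ∀ j, 0 ≤ j → j < N → ‖α j‖ ≤ C := fun j hj1 hj2 =>
    hCb N hNpos m 0 hNpos x α hα j hj1 hj2
  have hl := c.eulerCost_lipschitz hC.le hNpos (Nat.zero_le N) m hαC x y
  change _ ≤ c.lip C * _ at hl
  have hl2 : c.lip C * ‖x - y‖ ≤ ε / 4 := by
    rw [le_div_iff₀ (by positivity)] at hxy
    linarith [norm_nonneg (x - y)]
  obtain ⟨w1, w2⟩ := hN₀ N (le_max_left _ _) hNpos (fun k => D.atTime m (k * (D.T / N)))
    (fun k _ => by simpa using hθ.le) 0 (Nat.zero_le _) (D.eulerState N 0 y α) α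
    (fun j _ hj => by
      refine (c.norm_eulerState_le hC.le hNpos y hαC (by omega)).trans ?_
      rw [hR1]
      gcongr
      exact hy.trans (le_abs_self _))
    (fun j hj1 hj2 => ⟨hαC j hj1 hj2, by
      have hΔ := D.step_pos hNpos
      simp only [eulerState, Nat.zero_add]
      rw [sub_self, norm_zero]
      positivity⟩)
  have w3 := w1.value_le c h1 h3 m hC.le hε'0.le (D.step_time_mem hNpos (Nat.zero_le N))
  rw [polyline_node (D.step_pos hNpos), ← mul_assoc, ← hG] at w3
  have w4 := (abs_le.1 w2).2
  have e : ∑ j ∈ Finset.Ico 0 N, (D.T / N) * D.ℓ (j * (D.T / N)) (α j) (D.eulerState N 0 y α j)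
      (D.atTime m (j * (D.T / N))) + D.g (D.eulerState N 0 y α N)
        (D.atTime m (N * (D.T / N))) = D.eulerCost N m 0 y α := by
    have hNT : (N : ℝ) * (D.T / N) = D.T := by
      have : (N : ℝ) ≠ 0 := by exact_mod_cast hNpos.ne'
      field_simp
    rw [eulerCost, hNT, Nat.Ico_zero_eq_range, ← Finset.mul_sum]
    simp only [Nat.zero_add, Nat.sub_zero]
  rw [e] at w4
  have e0 : D.eulerState N 0 y α 0 = y := rfl
  rw [e0] at w3
  have w5 := hα a₀
  rw [norm_sub_rev] at hl2
  simp only [Nat.cast_zero, zero_mul] at w3 w4 ha₀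
  linarith

end Data
end MFG

namespace MFG

/-! ### Limits of approximate trajectories -/

theorem intervalIntegrable_deriv_of_lipschitzWith {n : ℕ} {L : NNReal} {γ : ℝ → Vec n}
    (h : LipschitzWith L γ) (a b : ℝ) : IntervalIntegrable (deriv γ) volume a b :=
  (intervalIntegrable_const (c := (L : ℝ))).mono_fun
    (measurable_deriv γ).aestronglyMeasurable (ae_of_all _ fun t => by
      change ‖deriv γ t‖ ≤ ‖(L : ℝ)‖
      rw [Real.norm_of_nonneg L.coe_nonneg]
      exact norm_deriv_le_of_lipschitz h)

theorem integral_deriv_of_lipschitzWith {n : ℕ} {L : NNReal} {γ : ℝ → Vec n}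
    (h : LipschitzWith L γ) (a b : ℝ) : ∫ t in a..b, deriv γ t = γ b - γ a := by
  ext j
  have h1 : LipschitzWith L fun t => γ t j := by
    have := (LipschitzWith.eval (α := fun _ : Fin n => ℝ) j).comp h
    rwa [one_mul] at this
  have h2 := (h1.lipschitzOnWith (s := uIcc a b)).absolutelyContinuousOnInterval
  have h3 := (ContinuousLinearMap.proj (R := ℝ) (φ := fun _ : Fin n => ℝ) j).intervalIntegral_comp_comm
    (intervalIntegrable_deriv_of_lipschitzWith h a b)
  simp only [ContinuousLinearMap.proj_apply] at h3
  rw [← h3, Pi.sub_apply, ← h2.integral_deriv_eq_sub]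
  refine intervalIntegral.integral_congr_ae ?_
  filter_upwards [h.ae_differentiableAt_real] with t ht _
  exact ((hasDerivAt_pi.1 ht.hasDerivAt) j).deriv.symm

namespace Data

variable {d r s : ℕ} {D : Data d r s} {C : ℝ}

/-- Over a short time step, an approximate trajectory moves as with a constant control, the mean of
its controls, and its running cost is at least the cost of this constant control. -/
theorem exists_mean_control (h1 : D.H1) (h2 : D.H2) (h3 : D.H3) (m : D.Flow) (hC : 0 ≤ C)
    (R L : ℝ) {ε : ℝ} (hε : 0 < ε) :
    ∃ δ > 0, ∀ (γ : ℝ → Vec d) (α : ℝ → Vec r) (w : ℝ → Vec d), D.NearTrajectory 0 C δ γ α w →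
      (∀ t ∈ Icc 0 D.T, ‖γ t‖ ≤ R) →
      (∀ a ∈ Icc 0 D.T, ∀ b ∈ Icc 0 D.T, ‖γ b - γ a‖ ≤ L * |b - a|) →
      ∀ t u : ℝ, 0 ≤ t → t < u → u ≤ D.T → u - t ≤ δ → ∃ a : Vec r, ‖a‖ ≤ C ∧
        ‖γ u - γ t - (u - t) • (D.A t (γ t) + D.B t (γ t) *ᵥ a)‖ ≤ ε * (u - t) ∧
        (u - t) * D.ℓ t a (γ t) (D.atTime m t) ≤
          (∫ τ in t..u, D.ℓ τ (α τ) (γ τ) (D.atTime m τ)) + ε * (u - t) := by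
  obtain ⟨c⟩ := D.exists_bounds h1 h2 h3
  have hT := D.T_pos
  obtain ⟨δ₁, hδ₁, hvel⟩ := exists_velocity_modulus h3 R (ε := ε / (2 * (1 + C))) (by positivity)
  obtain ⟨δ₂, hδ₂, hℓ⟩ := exists_lag_modulus h1 m C R hε
  set δ₃ := min δ₁ δ₂ with hδ₃
  have hδ₃0 : 0 < δ₃ := lt_min hδ₁ hδ₂
  refine ⟨min (ε / 2) (δ₃ / (1 + |L|)), lt_min (by positivity) (by positivity),
    fun γ α w hn hR hL t u ht htu hu hlen => ?_⟩
  have h0T : (0 : ℝ) ∈ Icc 0 D.T := ⟨le_rfl, hT.le⟩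
  have htm : t ∈ Icc 0 D.T := ⟨ht, htu.le.trans hu⟩
  have hum : u ∈ Icc 0 D.T := ⟨ht.trans htu.le, hu⟩
  have hsub : uIcc t u ⊆ uIcc 0 D.T := by
    rw [uIcc_of_le htu.le, uIcc_of_le hT.le]
    exact Icc_subset_Icc ht hu
  have hlen' : (u - t) * (1 + |L|) ≤ δ₃ := by
    have := hlen.trans (min_le_right _ _)
    rwa [le_div_iff₀ (by positivity)] at this
  have hut : 0 < u - t := sub_pos.2 htu
  have hclose : ∀ τ ∈ Ioc t u, τ ∈ Icc 0 D.T ∧ |τ - t| ≤ δ₃ ∧ ‖γ τ - γ t‖ ≤ δ₃ := by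
    intro τ hτ
    have hτm : τ ∈ Icc 0 D.T := ⟨ht.trans hτ.1.le, hτ.2.trans hu⟩
    have u1 : |τ - t| ≤ u - t := by
      rw [abs_of_pos (sub_pos.2 hτ.1)]; linarith [hτ.2]
    have u2 := hL t htm τ hτm
    have u3 : L * |τ - t| ≤ |L| * (u - t) :=
      mul_le_mul (le_abs_self L) u1 (abs_nonneg _) (abs_nonneg _)
    have u4 : 0 ≤ |L| * (u - t) := by positivity
    exact ⟨hτm, by nlinarith, by nlinarith⟩
  have hw := hn.integrable.mono_set hsub
  have hα : IntervalIntegrable α volume t u := by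
    refine (intervalIntegrable_const (c := C)).mono_fun hn.measurable.aestronglyMeasurable ?_
    rw [uIoc_of_le htu.le]
    refine (ae_restrict_mem measurableSet_Ioc).mono fun τ hτ => ?_
    rw [Real.norm_of_nonneg hC]
    exact hn.bound τ ⟨ht.trans_lt hτ.1, hτ.2.trans hu⟩
  have hlag := (hn.intervalIntegrable_ℓ c h1 m h0T).mono_set hsub
  set a : Vec r := (u - t)⁻¹ • ∫ τ in t..u, α τ with ha
  have haC : ‖a‖ ≤ C := by
    have := intervalIntegral.norm_integral_le_of_norm_le_const (a := t) (b := u) (C := C) (f := α)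
      (fun τ hτ => by
        rw [uIoc_of_le htu.le] at hτ
        exact hn.bound τ ⟨ht.trans_lt hτ.1, hτ.2.trans hu⟩)
    rw [abs_of_pos hut] at this
    rw [ha, norm_smul, norm_inv, Real.norm_of_nonneg hut.le, inv_mul_le_iff₀ hut]
    linarith
  refine ⟨a, haC, ?_, ?_⟩
  · have e1 : γ u - γ t = ∫ τ in t..u, w τ := by
      rw [hn.integral_eq u hum, hn.integral_eq t htm, add_sub_add_left_eq_sub]
      refine intervalIntegral.integral_interval_sub_left (hn.integrable.mono_set ?_)
        (hn.integrable.mono_set ?_)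
      · exact uIcc_subset_uIcc left_mem_uIcc (by rwa [uIcc_of_le hT.le])
      · exact uIcc_subset_uIcc left_mem_uIcc (by rwa [uIcc_of_le hT.le])
    set Bl : Vec r →L[ℝ] Vec d := LinearMap.toContinuousLinearMap (D.B t (γ t)).mulVecLin with hBl
    have hBl' : ∀ v, Bl v = D.B t (γ t) *ᵥ v := fun v => rfl
    have e2 : (u - t) • (D.A t (γ t) + D.B t (γ t) *ᵥ a) =
        ∫ τ in t..u, (D.A t (γ t) + Bl (α τ)) := by
      rw [intervalIntegral.integral_add intervalIntegrable_const
        (show IntervalIntegrable (fun τ => Bl (α τ)) volume t u from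
          ⟨Bl.integrable_comp hα.1, Bl.integrable_comp hα.2⟩),
        Bl.intervalIntegral_comp_comm hα, intervalIntegral.integral_const, smul_add, ← hBl', ha,
        map_smul, smul_smul, mul_inv_cancel₀ hut.ne', one_smul]
    rw [e1, e2, ← intervalIntegral.integral_sub hw (intervalIntegrable_const.add
      (show IntervalIntegrable (fun τ => Bl (α τ)) volume t u from
          ⟨Bl.integrable_comp hα.1, Bl.integrable_comp hα.2⟩))]
    have := intervalIntegral.norm_integral_le_of_norm_le_const (a := t) (b := u) (C := ε)
      (f := fun τ => w τ - (D.A t (γ t) + Bl (α τ))) (fun τ hτ => ?_)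
    · rwa [abs_of_pos hut] at this
    · rw [uIoc_of_le htu.le] at hτ
      have hτ' : τ ∈ Ioc 0 D.T := ⟨ht.trans_lt hτ.1, hτ.2.trans hu⟩
      obtain ⟨v1, v2, v3⟩ := hclose τ hτ
      obtain ⟨w1, w2⟩ := hvel τ v1 t htm (γ τ) (γ t) (hR τ v1) (hR t htm)
        (v2.trans (min_le_left _ _)) (v3.trans (min_le_left _ _))
      have w3 := (hn.near τ hτ').trans (min_le_left _ _)
      have w4 := w2 (α τ)
      have w5 := mul_le_mul_of_nonneg_left (hn.bound τ hτ')
        (show 0 ≤ ε / (2 * (1 + C)) by positivity)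
      have w7 : ε / (2 * (1 + C)) + ε / (2 * (1 + C)) * C = ε / 2 := by field_simp
      have e : w τ - (D.A t (γ t) + D.B t (γ t) *ᵥ α τ) =
          (w τ - (D.A τ (γ τ) + D.B τ (γ τ) *ᵥ α τ)) +
          ((D.A τ (γ τ) - D.A t (γ t)) + (D.B τ (γ τ) *ᵥ α τ - D.B t (γ t) *ᵥ α τ)) := by abel
      rw [hBl', e]
      refine (norm_add_le _ _).trans ?_
      have w9 := norm_add_le (D.A τ (γ τ) - D.A t (γ t))
        (D.B τ (γ τ) *ᵥ α τ - D.B t (γ t) *ᵥ α τ)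
      linarith
  · have hφ : Continuous fun b => D.lag m t b (γ t) :=
      (continuous_lag h1 m).comp (by fun_prop : Continuous fun b : Vec r => (t, b, γ t))
    have hφe : (fun b => D.lag m t b (γ t)) = fun b => D.ℓ t b (γ t) (D.atTime m t) :=
      funext fun b => D.lag_eq m htm b (γ t)
    rw [hφe] at hφ
    have hcost : ∀ τ ∈ Ioc t u, D.ℓ t (α τ) (γ t) (D.atTime m t) ≤
        D.ℓ τ (α τ) (γ τ) (D.atTime m τ) + ε := by
      intro τ hτ
      obtain ⟨v1, v2, v3⟩ := hclose τ hτ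
      have := (abs_le.1 (hℓ τ v1 t htm (α τ) (α τ) (γ τ) (γ t)
        (hn.bound τ ⟨ht.trans_lt hτ.1, hτ.2.trans hu⟩) (hR τ v1) (v2.trans (min_le_right _ _))
        (by simpa using hδ₂.le) (v3.trans (min_le_right _ _)))).1
      linarith
    have hint : IntervalIntegrable (fun τ => D.ℓ t (α τ) (γ t) (D.atTime m t)) volume t u := by
      refine (intervalIntegrable_const (c := (c.up + c.lo) * C ^ D.p + c.Cl)).mono_fun
        (hφ.measurable.comp hn.measurable).aestronglyMeasurable ?_
      rw [uIoc_of_le htu.le]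
      refine (ae_restrict_mem measurableSet_Ioc).mono fun τ hτ => ?_
      refine (c.abs_ℓ_le htm _ _ _).trans (le_trans ?_ (le_abs_self _))
      have := c.up_pos
      have := c.lo_pos
      gcongr
      · exact D.p_pos.le
      · exact hn.bound τ ⟨ht.trans_lt hτ.1, hτ.2.trans hu⟩
    refine (mul_le_integral_of_convexOn (h1.convex t htm (γ t) (D.atTime m t)) hφ htu hα hint).trans ?_
    have e : (∫ τ in t..u, D.ℓ τ (α τ) (γ τ) (D.atTime m τ)) + ε * (u - t) =
        ∫ τ in t..u, (D.ℓ τ (α τ) (γ τ) (D.atTime m τ) + ε) := by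
      rw [intervalIntegral.integral_add hlag intervalIntegrable_const,
        intervalIntegral.integral_const, smul_eq_mul, mul_comm]
    rw [e]
    refine intervalIntegral.integral_mono_on_of_le_Ioo htu.le hint
      (hlag.add intervalIntegrable_const) fun τ hτ => hcost τ ⟨hτ.1, hτ.2.le⟩

end Data
end MFG

namespace MFG
namespace Data

variable {d r s : ℕ} {D : Data d r s} {C : ℝ}

theorem abs_projIcc_sub_le (D : Data d r s) (a b : ℝ) :
    |(projIcc 0 D.T D.T_pos.le b : ℝ) - projIcc 0 D.T D.T_pos.le a| ≤ |b - a| := by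
  have := (LipschitzWith.projIcc D.T_pos.le).dist_le_mul b a
  simpa [Subtype.dist_eq, Real.dist_eq] using this

theorem atTime_of_mem {Y : Type*} (f : Icc (0 : ℝ) D.T → Y) {t : ℝ} (ht : t ∈ Icc 0 D.T) :
    D.atTime f t = f ⟨t, ht⟩ := by
  rw [atTime, projIcc_of_mem _ ht]

set_option maxHeartbeats 1000000 in
/-- A uniform limit of approximate trajectories with uniformly bounded controls, whose costs do not
exceed the value function in the limit, is an optimal trajectory.

The running costs along the approximations have a limit `F` along an ultrafilter. At almost every
time both the limit path and `F` are differentiable, and by convexity the derivative of `F` is at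
least the running cost of the control which produces the derivative of the path. -/
theorem exists_isOptimal_of_limit (h1 : D.H1) (h2 : D.H2) (h3 : D.H3) (hC : 0 ≤ C) (m : D.Flow)
    (R : ℝ) (L : NNReal) (γ : D.PathSpace)
    (hγ : ∀ ε > 0, ∃ (γ' : ℝ → Vec d) (α : ℝ → Vec r) (w : ℝ → Vec d),
      D.NearTrajectory 0 C ε γ' α w ∧ (∀ t ∈ Icc 0 D.T, ‖γ' t‖ ≤ R) ∧
      (∀ a ∈ Icc 0 D.T, ∀ b ∈ Icc 0 D.T, ‖γ' b - γ' a‖ ≤ L * |b - a|) ∧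
      (∀ t ∈ Icc 0 D.T, ‖γ' t - D.atTime γ t‖ ≤ ε) ∧
      D.cost m 0 γ' α ≤ D.value m 0 (D.atTime γ 0) + ε) :
    ∃ α, D.IsOptimal m (D.atTime γ 0) (D.atTime γ) α := by
  obtain ⟨c⟩ := D.exists_bounds h1 h2 h3
  have hT := D.T_pos
  have h0T : (0 : ℝ) ∈ Icc 0 D.T := ⟨le_rfl, hT.le⟩
  have hTT : D.T ∈ Icc 0 D.T := ⟨hT.le, le_rfl⟩
  choose γ' α w hn hR hL hlim hcost using fun i : ℕ => hγ (1 / ((i : ℝ) + 1)) (by positivity)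
  set U : Filter ℕ := (hyperfilter ℕ : Filter ℕ) with hU
  have hUt : U ≤ atTop := Nat.hyperfilter_le_atTop
  have heps : Tendsto (fun i : ℕ => 1 / ((i : ℝ) + 1)) U (𝓝 0) :=
    tendsto_one_div_add_atTop_nhds_zero_nat.mono_left hUt
  set G : ℝ → Vec d := D.atTime γ with hG
  set p : ℝ → ℝ := fun t => (projIcc 0 D.T hT.le t : ℝ) with hp
  have hpm : ∀ t, p t ∈ Icc 0 D.T := fun t => (projIcc 0 D.T hT.le t).2
  have hpe : ∀ t ∈ Icc 0 D.T, p t = t := fun t ht => by simp only [hp]; rw [projIcc_of_mem _ ht]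
  have hGp : ∀ t, G t = G (p t) := fun t => by
    rw [hG, D.atTime_of_mem γ (hpm t)]
    rfl
  have hGlim : ∀ t ∈ Icc 0 D.T, Tendsto (fun i => γ' i t) U (𝓝 (G t)) := fun t ht =>
    tendsto_iff_norm_sub_tendsto_zero.2
      (squeeze_zero (fun _ => norm_nonneg _) (fun i => hlim i t ht) heps)
  have hGL : LipschitzWith L G := LipschitzWith.of_dist_le_mul fun a b => by
    rw [dist_eq_norm, dist_comm, Real.dist_eq, hGp a, hGp b, norm_sub_rev]
    refine (le_of_tendsto ((hGlim _ (hpm b)).sub (hGlim _ (hpm a))).norm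
      (Eventually.of_forall fun i => hL i _ (hpm a) _ (hpm b))).trans ?_
    exact mul_le_mul_of_nonneg_left (D.abs_projIcc_sub_le a b) L.2
  have hGR : ∀ t, ‖G t‖ ≤ R := fun t => by
    rw [hGp]
    exact le_of_tendsto (hGlim _ (hpm t)).norm (Eventually.of_forall fun i => hR i _ (hpm t))
  -- the accumulated running costs `Fi` are equi-Lipschitz, hence have a limit `F` along `U`
  set f : ℕ → ℝ → ℝ := fun i τ => D.ℓ τ (α i τ) (γ' i τ) (D.atTime m τ) with hf
  have hfi : ∀ i, IntervalIntegrable (f i) volume 0 D.T := fun i =>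
    (hn i).intervalIntegrable_ℓ c h1 m h0T
  have hfi' : ∀ i, ∀ a ∈ Icc 0 D.T, ∀ b ∈ Icc 0 D.T, IntervalIntegrable (f i) volume a b :=
    fun i a ha b hb => (hfi i).mono_set (by
      rw [← uIcc_of_le hT.le] at ha hb
      exact uIcc_subset_uIcc ha hb)
  set K : ℝ := (c.up + c.lo) * C ^ D.p + c.Cl with hK
  have hup := c.up_pos
  have hlo := c.lo_pos
  have hCl := c.Cl_pos
  have hK0 : 0 ≤ K := by positivity
  have hfK : ∀ i, ∀ τ ∈ Ioc 0 D.T, ‖f i τ‖ ≤ K := fun i τ hτ => by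
    refine (c.abs_ℓ_le ⟨hτ.1.le, hτ.2⟩ _ _ _).trans ?_
    rw [hK]
    gcongr
    · exact D.p_pos.le
    · exact (hn i).bound τ hτ
  set Fi : ℕ → ℝ → ℝ := fun i t => ∫ τ in 0..(p t), f i τ with hFi
  have hFsub : ∀ i a b, Fi i b - Fi i a = ∫ τ in (p a)..(p b), f i τ := fun i a b =>
    intervalIntegral.integral_interval_sub_left (hfi' i _ h0T _ (hpm b)) (hfi' i _ h0T _ (hpm a))
  have hFL : ∀ i a b, ‖Fi i b - Fi i a‖ ≤ K * |b - a| := fun i a b => by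
    rw [hFsub]
    refine (intervalIntegral.norm_integral_le_of_norm_le_const (C := K) fun τ hτ => hfK i τ
      ⟨(le_min (hpm a).1 (hpm b).1).trans_lt hτ.1, hτ.2.trans (max_le (hpm a).2 (hpm b).2)⟩).trans ?_
    exact mul_le_mul_of_nonneg_left (D.abs_projIcc_sub_le a b) hK0
  have hF0 : ∀ i, Fi i 0 = 0 := fun i => by simp only [hFi]; rw [hpe 0 h0T]; simp
  have hexF : ∀ t, ∃ y, Tendsto (fun i => Fi i t) U (𝓝 y) := fun t => by
    have hc : IsCompact (Icc (-(K * |t|)) (K * |t|)) := isCompact_Icc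
    obtain ⟨y, -, hy⟩ := hc.ultrafilter_le_nhds ((hyperfilter ℕ).map fun i => Fi i t) (by
      rw [le_principal_iff]
      refine Filter.mem_map.2 (univ_mem' fun i => ?_)
      have := hFL i 0 t
      rw [hF0, sub_zero, sub_zero, Real.norm_eq_abs, abs_le] at this
      exact this)
    exact ⟨y, hy⟩
  choose F hF using hexF
  have hF00 : F 0 = 0 := tendsto_nhds_unique (hF 0) (by simp only [hF0]; exact tendsto_const_nhds)
  have hFLip : LipschitzWith ⟨K, hK0⟩ F := LipschitzWith.of_dist_le_mul fun a b => by
    rw [dist_eq_norm, dist_comm, Real.dist_eq, norm_sub_rev]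
    exact le_of_tendsto ((hF b).sub (hF a)).norm (Eventually.of_forall fun i => hFL i a b)
  -- the conclusion of `exists_mean_control` passes to the limit, by compactness of the ball of
  -- controls
  have hstep : ∀ ε > 0, ∃ δ > 0, ∀ t u : ℝ, 0 ≤ t → t < u → u ≤ D.T → u - t ≤ δ →
      ∃ a : Vec r, ‖a‖ ≤ C ∧
        ‖G u - G t - (u - t) • (D.A t (G t) + D.B t (G t) *ᵥ a)‖ ≤ ε * (u - t) ∧
        (u - t) * D.ℓ t a (G t) (D.atTime m t) ≤ F u - F t + ε * (u - t) := by
    intro ε hε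
    obtain ⟨δ, hδ, H⟩ := exists_mean_control h1 h2 h3 m hC R L hε
    refine ⟨δ, hδ, fun t u ht htu hu hlen => ?_⟩
    have htm : t ∈ Icc 0 D.T := ⟨ht, htu.le.trans hu⟩
    have hum : u ∈ Icc 0 D.T := ⟨ht.trans htu.le, hu⟩
    have hex : ∀ i : ℕ, ∃ a : Vec r, 1 / ((i : ℝ) + 1) ≤ δ → ‖a‖ ≤ C ∧
        ‖γ' i u - γ' i t - (u - t) • (D.A t (γ' i t) + D.B t (γ' i t) *ᵥ a)‖ ≤ ε * (u - t) ∧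
        (u - t) * D.ℓ t a (γ' i t) (D.atTime m t) ≤ Fi i u - Fi i t + ε * (u - t) := by
      intro i
      by_cases hi : 1 / ((i : ℝ) + 1) ≤ δ
      · have hni := hn i
        obtain ⟨a, ha1, ha2, ha3⟩ := H (γ' i) (α i) (w i)
          ⟨hni.1, hni.2, hni.3, hni.4, fun τ hτ => (hni.5 τ hτ).trans hi⟩ (hR i) (hL i) t u ht htu
          hu hlen
        refine ⟨a, fun _ => ⟨ha1, ha2, ?_⟩⟩
        rw [hFsub, hpe t htm, hpe u hum]
        exact ha3
      · exact ⟨0, fun h => absurd h hi⟩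
    choose a ha using hex
    have hev : ∀ᶠ i : ℕ in U, 1 / ((i : ℝ) + 1) ≤ δ := (heps.eventually (gt_mem_nhds hδ)).mono
      fun i hi => le_of_lt hi
    obtain ⟨b, hb, hab⟩ := (isCompact_closedBall (0 : Vec r) C).ultrafilter_le_nhds
      ((hyperfilter ℕ).map a) (by
        rw [le_principal_iff]
        exact Filter.mem_map.2 (hev.mono fun i hi => mem_closedBall_zero_iff.2 (ha i hi).1))
    have hab' : Tendsto a U (𝓝 b) := hab
    have hAt := ((continuous_A_at h3 htm).tendsto (G t)).comp (hGlim t htm)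
    have hBt : Tendsto (fun i => D.B t (γ' i t) *ᵥ a i) U (𝓝 (D.B t (G t) *ᵥ b)) := by
      have hc : Continuous fun z : Vec d × Vec r => D.B t z.1 *ᵥ z.2 :=
        ((continuous_B_at h3 htm).comp continuous_fst).matrix_mulVec continuous_snd
      exact (hc.tendsto (G t, b)).comp ((hGlim t htm).prodMk_nhds hab')
    have hlt : Tendsto (fun i => D.ℓ t (a i) (γ' i t) (D.atTime m t)) U
        (𝓝 (D.ℓ t b (G t) (D.atTime m t))) := by
      have hc : Continuous fun z : Vec r × Vec d => D.lag m t z.1 z.2 :=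
        (continuous_lag h1 m).comp
          (by fun_prop : Continuous fun z : Vec r × Vec d => (t, z.1, z.2))
      have := (hc.tendsto (b, G t)).comp (hab'.prodMk_nhds (hGlim t htm))
      simpa only [Function.comp_def, D.lag_eq m htm] using this
    refine ⟨b, mem_closedBall_zero_iff.1 hb, ?_, ?_⟩
    · exact le_of_tendsto (((hGlim u hum).sub (hGlim t htm)).sub
        ((hAt.add hBt).const_smul (u - t))).norm (hev.mono fun i hi => (ha i hi).2.1)
    · exact le_of_tendsto_of_tendsto (hlt.const_mul (u - t))
        (((hF u).sub (hF t)).add_const (ε * (u - t))) (hev.mono fun i hi => (ha i hi).2.2)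
  -- letting the time step shrink gives a control producing `deriv G t`; it is unique, since the
  -- first rows of `B` are independent, and given by `steer`
  obtain ⟨κ, hκ0, hκ⟩ := exists_steer_bound h3 R
  set β : ℝ → Vec r := fun t => D.steer t (G t) (D.fst (deriv G t)) with hβ
  have hpoint : ∀ t ∈ Ioo 0 D.T, DifferentiableAt ℝ G t → DifferentiableAt ℝ F t →
      ‖β t‖ ≤ C ∧ deriv G t = D.A t (G t) + D.B t (G t) *ᵥ β t ∧
        D.ℓ t (β t) (G t) (D.atTime m t) ≤ deriv F t := by
    intro t ht hdG hdF
    have htm : t ∈ Icc 0 D.T := ⟨ht.1.le, ht.2.le⟩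
    have happ : ∀ i : ℕ, ∃ a : Vec r, ‖a‖ ≤ C ∧
        ‖deriv G t - (D.A t (G t) + D.B t (G t) *ᵥ a)‖ ≤ 2 * (1 / ((i : ℝ) + 1)) ∧
        D.ℓ t a (G t) (D.atTime m t) ≤ deriv F t + 2 * (1 / ((i : ℝ) + 1)) := by
      intro i
      set ε := 1 / ((i : ℝ) + 1) with hε
      have hε0 : 0 < ε := by positivity
      obtain ⟨δ, hδ, H⟩ := hstep ε hε0
      have e1 := (hasDerivAt_iff_isLittleO.1 hdG.hasDerivAt).bound hε0
      have e2 := (hasDerivAt_iff_isLittleO.1 hdF.hasDerivAt).bound hε0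
      obtain ⟨ρ, hρ, hball⟩ := Metric.eventually_nhds_iff.1 (e1.and e2)
      set η := min (min δ (D.T - t)) (ρ / 2) with hη
      have hη0 : 0 < η := lt_min (lt_min hδ (sub_pos.2 ht.2)) (by positivity)
      have hηρ : η < ρ := (min_le_right _ _).trans_lt (half_lt_self hρ)
      have hηT : η ≤ D.T - t := (min_le_left _ _).trans (min_le_right _ _)
      obtain ⟨a, ha1, ha2, ha3⟩ := H t (t + η) ht.1.le (by linarith) (by linarith)
        (by rw [add_sub_cancel_left]; exact (min_le_left _ _).trans (min_le_left _ _))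
      obtain ⟨v1, v2⟩ := hball (y := t + η) (by
        rw [Real.dist_eq, add_sub_cancel_left, abs_of_pos hη0]; exact hηρ)
      rw [add_sub_cancel_left] at v1 v2 ha2 ha3
      rw [Real.norm_of_nonneg hη0.le] at v1 v2
      refine ⟨a, ha1, ?_, ?_⟩
      · have e : η • (deriv G t - (D.A t (G t) + D.B t (G t) *ᵥ a)) =
            (G (t + η) - G t - η • (D.A t (G t) + D.B t (G t) *ᵥ a)) -
            (G (t + η) - G t - η • deriv G t) := by
          rw [smul_sub]; abel
        have := norm_sub_le (G (t + η) - G t - η • (D.A t (G t) + D.B t (G t) *ᵥ a))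
          (G (t + η) - G t - η • deriv G t)
        rw [← e, norm_smul, Real.norm_of_nonneg hη0.le] at this
        refine le_of_mul_le_mul_left ?_ hη0
        linarith
      · rw [Real.norm_eq_abs, abs_le, smul_eq_mul] at v2
        refine le_of_mul_le_mul_left ?_ hη0
        linarith [v2.2]
    choose a ha1 ha2 ha3 using happ
    have heps2 : Tendsto (fun i : ℕ => 2 * (1 / ((i : ℝ) + 1))) atTop (𝓝 0) := by
      simpa using tendsto_one_div_add_atTop_nhds_zero_nat.const_mul (2 : ℝ)
    have hab : Tendsto a atTop (𝓝 (β t)) := by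
      rw [tendsto_iff_norm_sub_tendsto_zero]
      refine squeeze_zero (fun _ => norm_nonneg _) (fun i => ?_)
        (by have := heps2.const_mul κ; rwa [mul_zero] at this)
      rw [norm_sub_rev]
      refine (hκ t htm (G t) (hGR t) (D.fst (deriv G t)) (a i)).trans ?_
      rw [← fst_sub]
      exact mul_le_mul_of_nonneg_left ((D.norm_fst_le _).trans (ha2 i)) hκ0.le
    have hBt : Tendsto (fun i => D.B t (G t) *ᵥ a i) atTop (𝓝 (D.B t (G t) *ᵥ β t)) :=
      ((continuous_const.matrix_mulVec continuous_id).tendsto (β t)).comp hab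
    have hlt : Tendsto (fun i => D.ℓ t (a i) (G t) (D.atTime m t)) atTop
        (𝓝 (D.ℓ t (β t) (G t) (D.atTime m t))) := by
      have hc : Continuous fun z : Vec r => D.lag m t z (G t) :=
        (continuous_lag h1 m).comp (by fun_prop : Continuous fun z : Vec r => (t, z, G t))
      have := (hc.tendsto (β t)).comp hab
      simpa only [Function.comp_def, D.lag_eq m htm] using this
    refine ⟨le_of_tendsto hab.norm (Eventually.of_forall ha1), ?_, ?_⟩
    · have hl : ‖deriv G t - (D.A t (G t) + D.B t (G t) *ᵥ β t)‖ ≤ 0 :=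
        le_of_tendsto_of_tendsto' (tendsto_const_nhds.sub (tendsto_const_nhds.add hBt)).norm heps2
          ha2
      exact sub_eq_zero.1 (norm_le_zero_iff.1 hl)
    · have := le_of_tendsto_of_tendsto' hlt (heps2.const_add (deriv F t)) ha3
      rwa [add_zero] at this
  have hae : ∀ᵐ t ∂(volume.restrict (Ioc 0 D.T)),
      ‖β t‖ ≤ C ∧ deriv G t = D.A t (G t) + D.B t (G t) *ᵥ β t ∧
        D.ℓ t (β t) (G t) (D.atTime m t) ≤ deriv F t := by
    rw [← restrict_Ioo_eq_restrict_Ioc]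
    filter_upwards [ae_restrict_mem measurableSet_Ioo,
      ae_restrict_of_ae hGL.ae_differentiableAt_real,
      ae_restrict_of_ae hFLip.ae_differentiableAt_real] with t ht hdG hdF
    exact hpoint t ht hdG hdF
  -- the formula for `β` in terms of `deriv G` makes it measurable
  have hβm : AEStronglyMeasurable β (volume.restrict (Icc 0 D.T)) := by
    have hpc : Continuous p := continuous_subtype_val.comp continuous_projIcc
    have hs : Continuous fun z : ℝ × Vec r => D.steer (p z.1) (G z.1) z.2 :=
      (continuousOn_steer h3).comp_continuous
        (f := fun z : ℝ × Vec r => ((p z.1, G z.1), z.2))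
        (((hpc.comp continuous_fst).prodMk (hGL.continuous.comp continuous_fst)).prodMk
          continuous_snd) fun z => ⟨⟨hpm z.1, mem_univ _⟩, mem_univ _⟩
    have hmeas : Measurable fun t => (t, D.fst (deriv G t)) :=
      measurable_id.prodMk (D.continuous_fst'.measurable.comp (measurable_deriv G))
    refine (hs.measurable.comp hmeas).aestronglyMeasurable.congr ?_
    refine (ae_restrict_mem measurableSet_Icc).mono fun t ht => ?_
    simp only [Function.comp_apply, hβ]
    rw [hpe t ht]
  have htraj : D.IsTrajectory 0 (G 0) G β := by
    refine ⟨?_, ⟨deriv G, ⟨?_, fun t _ => ?_⟩, ?_⟩, rfl⟩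
    · refine MemLp.of_bound hβm C ?_
      rw [← restrict_Ioc_eq_restrict_Icc]
      exact hae.mono fun t ht => ht.1
    · exact MemLp.of_bound (measurable_deriv G).aestronglyMeasurable L
        (ae_of_all _ fun t => norm_deriv_le_of_lipschitz hGL)
    · rw [integral_deriv_of_lipschitzWith hGL]
      abel
    · rw [← restrict_Ioc_eq_restrict_Icc]
      exact hae.mono fun t ht => ht.2.1
  have hFderiv : ∫ t in 0..D.T, deriv F t = F D.T := by
    have := ((hFLip.lipschitzOnWith (s := uIcc 0 D.T)).absolutelyContinuousOnInterval).integral_deriv_eq_sub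
    rw [this, hF00, sub_zero]
  have hFint : IntervalIntegrable (deriv F) volume 0 D.T :=
    ((hFLip.lipschitzOnWith (s := uIcc 0 D.T)).absolutelyContinuousOnInterval).intervalIntegrable_deriv
  have hle : D.cost m 0 G β ≤ D.value m 0 (G 0) := by
    have u1 : ∫ t in 0..D.T, D.ℓ t (β t) (G t) (D.atTime m t) ≤ F D.T := by
      rw [← hFderiv]
      refine intervalIntegral.integral_mono_ae_restrict hT.le
        (htraj.intervalIntegrable_ℓ c h1 m h0T) hFint ?_
      rw [← restrict_Ioc_eq_restrict_Icc]
      exact hae.mono fun t ht => ht.2.2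
    have u2 : F D.T + D.g (G D.T) (D.atTime m D.T) ≤ D.value m 0 (G 0) := by
      have hgT := ((continuous_g_at h2 (D.atTime m D.T)).tendsto (G D.T)).comp (hGlim D.T hTT)
      have := le_of_tendsto_of_tendsto' ((hF D.T).add hgT) (heps.const_add (D.value m 0 (G 0)))
        (fun i => by
          have := hcost i
          rw [cost] at this
          simp only [hFi, Function.comp_apply]
          rw [hpe D.T hTT]
          exact this)
      rwa [add_zero] at this
    rw [cost]
    linarith
  exact ⟨β, htraj, fun γ'' α'' h'' => hle.trans (h''.value_le c h1 m h0T)⟩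

end Data
end MFG

namespace MFG

/-! ### Finite Markov chains -/

section Chain

variable {E : Type*} [Zero E] {F : Finset E}

/-- The sequence which starts with the entries of `X` and vanishes afterwards. -/
def seqOf {n : ℕ} (X : Fin (n + 1) → F) (j : ℕ) : E :=
  if hj : j < n + 1 then (X ⟨j, hj⟩ : E) else 0

theorem seqOf_of_le {n : ℕ} (X : Fin (n + 1) → F) {j : ℕ} (hj : j ≤ n) :
    seqOf X j = X ⟨j, Nat.lt_succ_of_le hj⟩ := dif_pos _

theorem seqOf_mem {n : ℕ} (X : Fin (n + 1) → F) {j : ℕ} (hj : j ≤ n) : seqOf X j ∈ F := by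
  rw [seqOf_of_le X hj]
  exact Subtype.coe_prop _

theorem seqOf_snoc {n : ℕ} (X : Fin (n + 1) → F) (y : F) :
    seqOf (Fin.snoc X y : Fin (n + 2) → F) = Function.update (seqOf X) (n + 1) (y : E) := by
  funext j
  rcases lt_trichotomy j (n + 1) with hj | rfl | hj
  · rw [Function.update_of_ne hj.ne, seqOf_of_le _ (by omega), seqOf_of_le _ (by omega)]
    congr 1
    exact Fin.snoc_castSucc (α := fun _ => F) y X ⟨j, hj⟩
  · rw [Function.update_self, seqOf_of_le _ le_rfl]
    congr 1
    exact Fin.snoc_last (α := fun _ => F) y X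
  · rw [Function.update_of_ne hj.ne']
    unfold seqOf
    rw [dif_neg (by omega), dif_neg (by omega)]

/-- The probability that a Markov chain with initial distribution `p₀` and transition probabilities
`P k x y` starts with `X 0, …, X n`. -/
def chainWeight (p₀ : E → ℝ) (P : ℕ → E → E → ℝ) (n : ℕ) (X : ℕ → E) : ℝ :=
  p₀ (X 0) * ∏ k ∈ Finset.range n, P k (X k) (X (k + 1))

variable {p₀ : E → ℝ} {P : ℕ → E → E → ℝ}

theorem chainWeight_update (n : ℕ) (X : ℕ → E) (y : E) :
    chainWeight p₀ P (n + 1) (Function.update X (n + 1) y) =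
      chainWeight p₀ P n X * P n (X n) y := by
  unfold chainWeight
  rw [Finset.prod_range_succ, Function.update_self, Function.update_of_ne (by omega),
    Function.update_of_ne (by omega), mul_assoc]
  congr 2
  refine Finset.prod_congr rfl fun k hk => ?_
  rw [Finset.mem_range] at hk
  rw [Function.update_of_ne (by omega), Function.update_of_ne (by omega)]

/-- The expectation of a function of the first `n + 1` states of the chain, with states in `F`. -/
noncomputable def chainExp (F : Finset E) (p₀ : E → ℝ) (P : ℕ → E → E → ℝ) (n : ℕ)
    (Φ : (ℕ → E) → ℝ) : ℝ :=
  ∑ X : Fin (n + 1) → F, chainWeight p₀ P n (seqOf X) * Φ (seqOf X)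

theorem chainExp_zero (Φ : (ℕ → E) → ℝ) (φ : E → ℝ) (hΦ : ∀ X, Φ X = φ (X 0)) :
    chainExp F p₀ P 0 Φ = ∑ x ∈ F, p₀ x * φ x := by
  unfold chainExp
  rw [← Finset.sum_coe_sort F, ← (Equiv.funUnique (Fin 1) F).sum_comp]
  refine Finset.sum_congr rfl fun X _ => ?_
  rw [hΦ, chainWeight, seqOf_of_le X le_rfl]
  simp

theorem chainExp_succ (n : ℕ) (Φ : (ℕ → E) → ℝ) :
    chainExp F p₀ P (n + 1) Φ =
      chainExp F p₀ P n fun X => ∑ y ∈ F, P n (X n) y * Φ (Function.update X (n + 1) y) := by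
  unfold chainExp
  rw [← (Fin.snocEquiv fun _ : Fin (n + 2) => (F : Type _)).sum_comp, Fintype.sum_prod_type_right]
  refine Finset.sum_congr rfl fun X _ => ?_
  rw [Finset.mul_sum, ← Finset.sum_coe_sort F]
  refine Finset.sum_congr rfl fun y _ => ?_
  have e : seqOf ((Fin.snocEquiv fun _ : Fin (n + 2) => (F : Type _)) (y, X)) =
      Function.update (seqOf X) (n + 1) (y : E) := seqOf_snoc X y
  rw [e, chainWeight_update, mul_assoc]

theorem chainExp_congr {n : ℕ} {Φ Ψ : (ℕ → E) → ℝ}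
    (h : ∀ X, (∀ j ≤ n, X j ∈ F) → chainWeight p₀ P n X ≠ 0 → Φ X = Ψ X) :
    chainExp F p₀ P n Φ = chainExp F p₀ P n Ψ := by
  refine Finset.sum_congr rfl fun X _ => ?_
  by_cases h0 : chainWeight p₀ P n (seqOf X) = 0
  · rw [h0, zero_mul, zero_mul]
  · rw [h _ (fun j hj => seqOf_mem X hj) h0]

theorem chainExp_mono {n : ℕ} {Φ Ψ : (ℕ → E) → ℝ}
    (h : ∀ X, (∀ j ≤ n, X j ∈ F) → chainWeight p₀ P n X ≠ 0 → 0 ≤ chainWeight p₀ P n X ∧ Φ X ≤ Ψ X) :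
    chainExp F p₀ P n Φ ≤ chainExp F p₀ P n Ψ := by
  refine Finset.sum_le_sum fun X _ => ?_
  by_cases h0 : chainWeight p₀ P n (seqOf X) = 0
  · rw [h0, zero_mul, zero_mul]
  · obtain ⟨h1, h2⟩ := h _ (fun j hj => seqOf_mem X hj) h0
    exact mul_le_mul_of_nonneg_left h2 h1

theorem chainExp_add (n : ℕ) (Φ Ψ : (ℕ → E) → ℝ) :
    chainExp F p₀ P n (fun X => Φ X + Ψ X) = chainExp F p₀ P n Φ + chainExp F p₀ P n Ψ := by
  unfold chainExp
  rw [← Finset.sum_add_distrib]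
  exact Finset.sum_congr rfl fun X _ => mul_add _ _ _

theorem chainExp_const_mul (n : ℕ) (a : ℝ) (Φ : (ℕ → E) → ℝ) :
    chainExp F p₀ P n (fun X => a * Φ X) = a * chainExp F p₀ P n Φ := by
  unfold chainExp
  rw [Finset.mul_sum]
  exact Finset.sum_congr rfl fun X _ => by ring

end Chain

namespace Data

variable {d r s : ℕ} {D : Data d r s} {h : Discretization s} {C CI : ℝ} {K₀ : Set (Vec d)}
  {M : ℕ → P1 (Vec d)} {V : ℕ → Vec d → ℝ} {q : ℕ → Vec d → Vec r → ℝ} {F : Finset (Vec d)}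

/-! ### The Markov chain of the discrete game -/

/-- Averaging with the transition probabilities is averaging over the first component with the
weights `q` and interpolating in the second one. -/
theorem sum_transition (hβ : IsInterpolationBasis h.Ns s CI h.β) (hCI : 0 ≤ CI) {k : ℕ}
    {x : Vec d} (hf : (D.S₁ h C k x).Finite) (hF : D.SNext h C k x ⊆ F) (φ : Vec d → ℝ) :
    ∑ y ∈ F, D.transition h C q k x y * φ y =
      ∑ y₁ ∈ hf.toFinset, q k x y₁ * D.interp h k x y₁ φ := by
  have hf2 := fun y₁ => D.S₂_finite hβ hCI k x y₁
  have e : ∑ y₁ ∈ hf.toFinset, q k x y₁ * D.interp h k x y₁ φ =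
      ∑ y₁ ∈ hf.toFinset, ∑ y₂ ∈ (hf2 y₁).toFinset,
        q k x y₁ * (h.β y₂ (D.next₂ h k x y₁) * φ (D.join y₁ y₂)) :=
    Finset.sum_congr rfl fun y₁ _ => by rw [interp_eq (hf2 y₁), Finset.mul_sum]
  rw [e, Finset.sum_sigma']
  symm
  refine Finset.sum_of_injOn (fun z => D.join z.1 z.2) ?_ ?_ ?_ ?_
  · rintro ⟨a1, a2⟩ _ ⟨b1, b2⟩ _ hab
    have h1 := congrArg D.fst hab
    have h2 := congrArg D.snd hab
    simp only [fst_join, snd_join] at h1 h2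
    rw [h1, h2]
  · rintro ⟨a1, a2⟩ ha
    rw [Finset.mem_coe, Finset.mem_sigma, hf.mem_toFinset, (hf2 _).mem_toFinset] at ha
    exact hF (join_mem_SNext ha.1 ha.2)
  · intro y _ hy
    have : y ∉ D.SNext h C k x := fun hy' => hy ⟨⟨D.fst y, D.snd y⟩, by
      rw [Finset.mem_coe, Finset.mem_sigma, hf.mem_toFinset, (hf2 _).mem_toFinset]
      exact hy', D.join_fst_snd y⟩
    rw [transition, indicator_of_notMem this, zero_mul]
  · rintro ⟨a1, a2⟩ ha
    rw [Finset.mem_sigma, hf.mem_toFinset, (hf2 _).mem_toFinset] at ha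
    rw [transition, indicator_of_mem (join_mem_SNext ha.1 ha.2)]
    simp only [fst_join, snd_join]
    ring

theorem sum_transition_eq_one (hV : D.SolvesHJB h C K₀ M V q)
    (hβ : IsInterpolationBasis h.Ns s CI h.β) (hCI : 0 ≤ CI) {k : ℕ} (hk : k < h.Nt)
    {x : Vec d} (hx : x ∈ D.S h C K₀ k) (hf : (D.S₁ h C k x).Finite)
    (hF : D.SNext h C k x ⊆ F) : ∑ y ∈ F, D.transition h C q k x y = 1 := by
  have h1 := sum_transition (q := q) hβ hCI hf hF fun _ => 1
  simp only [mul_one] at h1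
  refine h1.trans (Eq.trans ?_ ((isProbOn_iff hf _).1 (hV.prob k hk x hx)).2)
  refine Finset.sum_congr rfl fun y₁ _ => ?_
  have hf2 := D.S₂_finite hβ hCI k x y₁
  simp only [interp_eq hf2, mul_one]
  rw [sum_β_eq_one hβ hf2, mul_one]

theorem sum_transition_cost_le (hV : D.SolvesHJB h C K₀ M V q)
    (hβ : IsInterpolationBasis h.Ns s CI h.β) (hCI : 0 ≤ CI) {k : ℕ} (hk : k < h.Nt)
    {x : Vec d} (hx : x ∈ D.S h C K₀ k) (hf : (D.S₁ h C k x).Finite)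
    (hF : D.SNext h C k x ⊆ F) {E : ℝ} (hE : h.ε * Real.log hf.toFinset.card ≤ E) :
    ∑ y ∈ F, D.transition h C q k x y *
      (D.dt h * D.ℓ (D.time h k) (D.ctrl h k x (D.fst y)) x (M k) + V (k + 1) y) ≤
      V k x + E := by
  rw [sum_transition (q := q) hβ hCI hf hF]
  refine le_trans (le_of_eq ?_) (hV.sum_moveCost_le hk hx hf hE)
  refine Finset.sum_congr rfl fun y₁ _ => ?_
  have hf2 := D.S₂_finite hβ hCI k x y₁
  rw [moveCost, interp_eq hf2, interp_eq hf2]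
  congr 1
  simp only [fst_join, mul_add]
  rw [Finset.sum_add_distrib, ← Finset.sum_mul, sum_β_eq_one hβ hf2, one_mul]

/-- The probability of a sequence of states of the Markov chain of the discrete game. -/
noncomputable def seqWeight (D : Data d r s) (h : Discretization s) (C : ℝ) (M : ℕ → P1 (Vec d))
    (q : ℕ → Vec d → Vec r → ℝ) (n : ℕ) (X : ℕ → Vec d) : ℝ :=
  chainWeight (fun x => (M 0).toMeasure.real {x}) (D.transition h C q) n X

/-- The expectation along the Markov chain of the discrete game. -/
noncomputable def seqExp (D : Data d r s) (h : Discretization s) (C : ℝ) (M : ℕ → P1 (Vec d))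
    (q : ℕ → Vec d → Vec r → ℝ) (F : Finset (Vec d)) (n : ℕ) (Φ : (ℕ → Vec d) → ℝ) : ℝ :=
  chainExp F (fun x => (M 0).toMeasure.real {x}) (D.transition h C q) n Φ

theorem IsPropagated.mass_eq_zero (hM : D.IsPropagated h C K₀ q M) {k : ℕ} (hk : k ≤ h.Nt)
    {x : Vec d} (hx : x ∉ D.S h C K₀ k) : (M k).toMeasure.real {x} = 0 := by
  rw [measureReal_eq_zero_iff]
  exact measure_mono_null (singleton_subset_iff.2 hx) (hM.support k hk)

/-- Only chains of successive states have positive probability. -/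
theorem IsPropagated.chain_of_seqWeight_ne_zero (hM : D.IsPropagated h C K₀ q M) {n : ℕ}
    {X : ℕ → Vec d} (hX : D.seqWeight h C M q n X ≠ 0) :
    X 0 ∈ D.S h C K₀ 0 ∧ ∀ j < n, X (j + 1) ∈ D.SNext h C j (X j) := by
  refine ⟨?_, fun j hj => ?_⟩
  · by_contra h0
    exact hX (by rw [seqWeight, chainWeight, hM.mass_eq_zero (Nat.zero_le _) h0, zero_mul])
  · by_contra h0
    refine hX ?_
    rw [seqWeight, chainWeight, Finset.prod_eq_zero (Finset.mem_range.2 hj), mul_zero]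
    exact indicator_of_notMem h0 _

theorem mem_S_of_chain {n : ℕ} {X : ℕ → Vec d} (h0 : X 0 ∈ D.S h C K₀ 0)
    (hX : ∀ j < n, X (j + 1) ∈ D.SNext h C j (X j)) : ∀ j ≤ n, X j ∈ D.S h C K₀ j := by
  intro j
  induction j with
  | zero => exact fun _ => h0
  | succ j ih => exact fun hj => mem_S_succ (ih (by omega)) (hX j (by omega))

theorem transition_nonneg (hV : D.SolvesHJB h C K₀ M V q)
    (hβ : IsInterpolationBasis h.Ns s CI h.β) {k : ℕ} (hk : k < h.Nt) {x : Vec d}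
    (hx : x ∈ D.S h C K₀ k) (y : Vec d) : 0 ≤ D.transition h C q k x y := by
  refine indicator_apply_nonneg fun hy => ?_
  exact mul_nonneg ((hV.prob k hk x hx).1 _ hy.1) (hβ.nonneg _ hy.2.1 _)

theorem seqWeight_nonneg (hV : D.SolvesHJB h C K₀ M V q) (hM : D.IsPropagated h C K₀ q M)
    (hβ : IsInterpolationBasis h.Ns s CI h.β) {n : ℕ} (hn : n ≤ h.Nt) (X : ℕ → Vec d) :
    0 ≤ D.seqWeight h C M q n X := by
  by_cases h0 : D.seqWeight h C M q n X = 0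
  · rw [h0]
  · obtain ⟨h1, h2⟩ := hM.chain_of_seqWeight_ne_zero h0
    have h3 := mem_S_of_chain h1 h2
    refine mul_nonneg measureReal_nonneg (Finset.prod_nonneg fun j hj => ?_)
    have hj' := Finset.mem_range.1 hj
    exact transition_nonneg hV hβ (hj'.trans_le hn) (h3 j hj'.le) _

theorem SNext_subset (hF : ∀ k ≤ h.Nt, D.S h C K₀ k ⊆ F) {k : ℕ} (hk : k < h.Nt) {x : Vec d}
    (hx : x ∈ D.S h C K₀ k) : D.SNext h C k x ⊆ F := fun _ hy => hF (k + 1) hk (mem_S_succ hx hy)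

theorem sum_transition_mass (hM : D.IsPropagated h C K₀ q M) (hF : ∀ k ≤ h.Nt, D.S h C K₀ k ⊆ F)
    {k : ℕ} (hk : k < h.Nt) (y : Vec d) :
    ∑ x ∈ F, (M k).toMeasure.real {x} * D.transition h C q k x y =
      (M (k + 1)).toMeasure.real {y} := by
  have hfin : (D.S h C K₀ k).Finite := F.finite_toSet.subset (hF k hk.le)
  have e : ∑ x ∈ F, (M k).toMeasure.real {x} * D.transition h C q k x y =
      ∑ x ∈ hfin.toFinset, (M k).toMeasure.real {x} * D.transition h C q k x y := by
    symm
    refine Finset.sum_subset (by simpa using hF k hk.le) fun x _ hx => ?_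
    rw [hfin.mem_toFinset] at hx
    rw [hM.mass_eq_zero hk.le hx, zero_mul]
  rw [e]
  by_cases hy : y ∈ D.S h C K₀ (k + 1)
  · rw [hM.step k hk y hy, finsum_mem_eq_finite_toFinset_sum _ hfin]
    exact Finset.sum_congr rfl fun x _ => mul_comm _ _
  · rw [hM.mass_eq_zero hk hy]
    refine Finset.sum_eq_zero fun x hx => ?_
    rw [hfin.mem_toFinset] at hx
    rw [transition, indicator_of_notMem fun hxy => hy (mem_S_succ hx hxy), mul_zero]

/-- The law of the last state of the chain of length `n`. -/
theorem seqExp_last (hM : D.IsPropagated h C K₀ q M) (hF : ∀ k ≤ h.Nt, D.S h C K₀ k ⊆ F) :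
    ∀ n ≤ h.Nt, ∀ φ : Vec d → ℝ, D.seqExp h C M q F n (fun X => φ (X n)) =
      ∑ x ∈ F, (M n).toMeasure.real {x} * φ x := by
  intro n
  induction n with
  | zero => exact fun _ φ => chainExp_zero _ φ fun _ => rfl
  | succ n ih =>
    intro hn φ
    rw [seqExp, chainExp_succ]
    simp only [Function.update_self]
    have := ih (by omega) fun x => ∑ y ∈ F, D.transition h C q n x y * φ y
    rw [seqExp] at this
    rw [this]
    simp only [Finset.mul_sum]
    rw [Finset.sum_comm]
    refine Finset.sum_congr rfl fun y _ => ?_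
    rw [← sum_transition_mass hM hF hn y, Finset.sum_mul]
    exact Finset.sum_congr rfl fun x _ => by ring

/-- The law of the `k`-th state of the chain is the `k`-th distribution of the population. -/
theorem seqExp_eval (hV : D.SolvesHJB h C K₀ M V q) (hM : D.IsPropagated h C K₀ q M)
    (hβ : IsInterpolationBasis h.Ns s CI h.β) (hCI : 0 ≤ CI) (hF : ∀ k ≤ h.Nt, D.S h C K₀ k ⊆ F)
    (hfin : ∀ k < h.Nt, ∀ x ∈ D.S h C K₀ k, (D.S₁ h C k x).Finite) {k : ℕ} :
    ∀ n, k ≤ n → n ≤ h.Nt → ∀ φ : Vec d → ℝ, D.seqExp h C M q F n (fun X => φ (X k)) =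
      ∑ x ∈ F, (M k).toMeasure.real {x} * φ x := by
  intro n hkn
  induction n, hkn using Nat.le_induction with
  | base => exact fun hk φ => seqExp_last hM hF k hk φ
  | succ n hkn ih =>
    intro hn φ
    rw [← ih (by omega) φ, seqExp, chainExp_succ]
    refine chainExp_congr fun X _ hX => ?_
    obtain ⟨h1, h2⟩ := hM.chain_of_seqWeight_ne_zero hX
    have h3 := mem_S_of_chain h1 h2 n le_rfl
    have hne : k ≠ n + 1 := by omega
    simp only [Function.update_of_ne hne]
    rw [← Finset.sum_mul, sum_transition_eq_one hV hβ hCI hn h3 (hfin n hn _ h3) (SNext_subset hF hn h3), one_mul]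

/-- The mean cost along the Markov chain is at most the mean of the discrete value function, up to
the entropy. -/
theorem seqExp_cost_le (hV : D.SolvesHJB h C K₀ M V q) (hM : D.IsPropagated h C K₀ q M)
    (hβ : IsInterpolationBasis h.Ns s CI h.β) (hCI : 0 ≤ CI) (hF : ∀ k ≤ h.Nt, D.S h C K₀ k ⊆ F)
    {E : ℝ} (hE : ∀ k < h.Nt, ∀ x ∈ D.S h C K₀ k, ∃ hf : (D.S₁ h C k x).Finite,
      h.ε * Real.log hf.toFinset.card ≤ E) :
    D.seqExp h C M q F h.Nt (fun X => D.chainCost h M 0 X - V 0 (X 0)) ≤ h.Nt * E := by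
  have hfin := fun k hk x hx => (hE k hk x hx).choose
  have hone : ∀ n ≤ h.Nt, D.seqExp h C M q F n (fun _ => 1) = 1 := by
    intro n hn
    have e1 := seqExp_eval hV hM hβ hCI hF hfin n (Nat.zero_le n) hn fun _ => 1
    have e2 := (seqExp_last hM hF 0 (Nat.zero_le _) fun _ => 1)
    rw [e1]
    simp only [mul_one]
    have h2 := sum_measureReal_singleton (μ := (M 0).toMeasure) F
    rw [h2, ← probReal_univ (μ := (M 0).toMeasure)]
    refine measureReal_congr ?_
    rw [ae_eq_univ]
    exact measure_mono_null (compl_subset_compl.2 (hF 0 (Nat.zero_le _))) (hM.support 0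
      (Nat.zero_le _))
  set e : ℕ → (ℕ → Vec d) → ℝ := fun n X =>
    ∑ j ∈ Finset.range n,
      D.dt h * D.ℓ (D.time h j) (D.ctrl h j (X j) (D.fst (X (j + 1)))) (X j) (M j) +
      V n (X n) - V 0 (X 0) with he
  have key : ∀ n ≤ h.Nt, D.seqExp h C M q F n (e n) ≤ n * E := by
    intro n
    induction n with
    | zero =>
      intro _
      have : e 0 = fun _ => (0 : ℝ) := by funext X; simp [he]
      rw [this]
      simp [seqExp, chainExp]
    | succ n ih =>
      intro hn
      have h1 : D.seqExp h C M q F (n + 1) (e (n + 1)) ≤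
          D.seqExp h C M q F n (fun X => e n X + E * 1) := by
        rw [seqExp, chainExp_succ]
        refine chainExp_mono fun X _ hX => ⟨seqWeight_nonneg hV hM hβ (by omega) X, ?_⟩
        obtain ⟨h1, h2⟩ := hM.chain_of_seqWeight_ne_zero hX
        have h3 := mem_S_of_chain h1 h2 n le_rfl
        obtain ⟨hf, hfE⟩ := hE n hn _ h3
        have h4 := sum_transition_cost_le hV hβ hCI hn h3 hf (SNext_subset hF hn h3) hfE
        have h5 := sum_transition_eq_one hV hβ hCI hn h3 hf (SNext_subset hF hn h3)
        have h6 : ∀ y, e (n + 1) (Function.update X (n + 1) y) =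
            (e n X - V n (X n)) +
            (D.dt h * D.ℓ (D.time h n) (D.ctrl h n (X n) (D.fst y)) (X n) (M n) +
              V (n + 1) y) := by
          intro y
          simp only [he]
          rw [Finset.sum_range_succ, Function.update_self, Function.update_of_ne (by omega),
            Function.update_of_ne (by omega)]
          have : ∑ j ∈ Finset.range n, D.dt h * D.ℓ (D.time h j)
              (D.ctrl h j (Function.update X (n + 1) y j)
                (D.fst (Function.update X (n + 1) y (j + 1))))
              (Function.update X (n + 1) y j) (M j) =
              ∑ j ∈ Finset.range n, D.dt h * D.ℓ (D.time h j)
                (D.ctrl h j (X j) (D.fst (X (j + 1)))) (X j) (M j) := by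
            refine Finset.sum_congr rfl fun j hj => ?_
            rw [Finset.mem_range] at hj
            rw [Function.update_of_ne (by omega), Function.update_of_ne (by omega)]
          rw [this]
          ring
        simp only [h6, mul_add]
        rw [Finset.sum_add_distrib, ← Finset.sum_mul, h5]
        simp only [mul_add] at h4
        linarith
      have h2 : D.seqExp h C M q F n (fun X => e n X + E * 1) =
          D.seqExp h C M q F n (e n) + E := by
        have := hone n (by omega)
        rw [seqExp] at this ⊢
        rw [chainExp_add, chainExp_const_mul, this, mul_one, seqExp]
      have h3 := ih (by omega)
      push_cast
      linarith
  refine le_trans (le_of_eq (chainExp_congr fun X _ hX => ?_)) (key h.Nt le_rfl)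
  obtain ⟨h1, h2⟩ := hM.chain_of_seqWeight_ne_zero hX
  have h3 := mem_S_of_chain h1 h2 h.Nt le_rfl
  simp only [he]
  rw [chainCost, Nat.Ico_zero_eq_range, hV.terminal _ h3]

end Data
end MFG

namespace MFG

theorem continuousOn_polyline {d : ℕ} {Δ : ℝ} (hΔ : 0 < Δ) (X : ℕ → Vec d) (n : ℕ) :
    ContinuousOn (polyline Δ X) (Icc 0 (n * Δ)) := by
  have h0 : (0 : ℝ) ≤ n * Δ := by positivity
  have h1 := intervalIntegral.continuousOn_primitive_interval' (b₁ := 0) (b₂ := n * Δ) (a := 0)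
    (intervalIntegrable_polySpeed hΔ X n) left_mem_uIcc
  rw [uIcc_of_le h0] at h1
  exact continuousOn_const.add h1

namespace Data

variable {d r s : ℕ} {D : Data d r s} {h : Discretization s} {C CI : ℝ} {K₀ : Set (Vec d)}
  {M : ℕ → P1 (Vec d)} {V : ℕ → Vec d → ℝ} {q : ℕ → Vec d → Vec r → ℝ} {F : Finset (Vec d)}

/-! ### The law on paths of the interpolated Markov chain -/

theorem Nt_mul_dt (D : Data d r s) (h : Discretization s) : h.Nt * D.dt h = D.T := D.time_last h

/-- The path on `[0,T]` which is affine between the grid times, where it takes the values `X k`. -/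
noncomputable def pathOf (D : Data d r s) (h : Discretization s) (X : ℕ → Vec d) : D.PathSpace where
  toFun t := polyline (D.dt h) X t
  continuous_toFun := by
    refine (continuousOn_polyline (D.dt_pos h) X h.Nt).comp_continuous continuous_subtype_val
      fun t => ?_
    rw [D.Nt_mul_dt]
    exact t.2

theorem atTime_pathOf (X : ℕ → Vec d) {t : ℝ} (ht : t ∈ Icc 0 D.T) :
    D.atTime (D.pathOf h X) t = polyline (D.dt h) X t := by
  rw [D.atTime_of_mem _ ht]
  rfl

theorem atTime_pathOf_time (X : ℕ → Vec d) {k : ℕ} (hk : k ≤ h.Nt) :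
    D.atTime (D.pathOf h X) (D.time h k) = X k := by
  rw [atTime_pathOf X (D.time_mem h hk)]
  exact polyline_node (D.dt_pos h) X k

theorem exists_step_of_mem (D : Data d r s) (h : Discretization s) {t : ℝ} (ht : t ∈ Icc 0 D.T) :
    ∃ j < h.Nt, t ∈ Icc (j * D.dt h) ((j + 1 : ℕ) * D.dt h) := by
  rcases ht.1.eq_or_lt with h0 | h0
  · refine ⟨0, h.Nt_pos, ?_⟩
    rw [← h0]
    have := D.dt_pos h
    constructor
    · simp
    · positivity
  · obtain ⟨-, h2, h3⟩ := stepIdx_mem (D.dt_pos h) (k := 0) (N := h.Nt) (τ := t)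
      ⟨by simpa using h0, by rw [D.Nt_mul_dt]; exact ht.2⟩
    exact ⟨_, h2, h3.1.le, h3.2⟩

theorem polyline_affine {Δ : ℝ} (hΔ : 0 < Δ) (X : ℕ → Vec d) (k : ℕ) {θ : ℝ}
    (hθ : θ ∈ Icc (0 : ℝ) 1) :
    polyline Δ X (k * Δ + θ * Δ) = (1 - θ) • X k + θ • X (k + 1) := by
  rw [polyline_apply hΔ X (j := k)]
  · rw [add_sub_cancel_left, smul_smul, mul_assoc, mul_inv_cancel₀ hΔ.ne', mul_one, smul_sub,
      sub_smul, one_smul]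
    abel
  · have h1 := mul_nonneg hθ.1 hΔ.le
    have h2 := mul_le_mul_of_nonneg_right hθ.2 hΔ.le
    push_cast
    constructor <;> linarith

theorem pathOf_mem_gridPaths {X : ℕ → Vec d} (hX : ∀ k ≤ h.Nt, X k ∈ D.S h C K₀ k) :
    D.pathOf h X ∈ D.gridPaths h C K₀ := by
  refine ⟨fun k hk => by rw [atTime_pathOf_time X hk]; exact hX k hk, fun k hk θ hθ => ?_⟩
  have hdt := D.dt_pos h
  have h1 := D.time_mem h hk.le
  have h2 := D.time_mem h (Nat.succ_le_of_lt hk)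
  have h3 : D.time h (k + 1) = D.time h k + D.dt h := by simp only [time]; push_cast; ring
  have h4 := mul_nonneg hθ.1 hdt.le
  have h5 := mul_le_mul_of_nonneg_right hθ.2 hdt.le
  rw [atTime_pathOf_time X hk.le, atTime_pathOf_time X (Nat.succ_le_of_lt hk), atTime_pathOf X]
  · exact polyline_affine hdt X k hθ
  · rw [Nat.succ_eq_add_one, h3] at h2
    constructor <;> linarith [h1.1, h2.2]

theorem eq_pathOf {γ : D.PathSpace} (hγ : γ ∈ D.gridPaths h C K₀) {X : ℕ → Vec d}
    (hX : ∀ k ≤ h.Nt, X k = D.atTime γ (D.time h k)) : γ = D.pathOf h X := by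
  ext1 t
  have hdt := D.dt_pos h
  obtain ⟨j, hj, htj⟩ := D.exists_step_of_mem h t.2
  set θ : ℝ := ((t : ℝ) - (j : ℝ) * D.dt h) / D.dt h with hθ
  have h3 := htj.2
  push_cast at h3
  have hθm : θ ∈ Icc (0 : ℝ) 1 :=
    ⟨div_nonneg (by linarith [htj.1]) hdt.le, by rw [hθ, div_le_one hdt]; linarith⟩
  have e : (t : ℝ) = j * D.dt h + θ * D.dt h := by rw [hθ, div_mul_cancel₀ _ hdt.ne']; ring
  have h1 := hγ.2 j hj θ hθm
  change D.atTime γ (j * D.dt h + θ * D.dt h) = _ at h1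
  rw [← e, D.atTime_of_mem _ t.2, ← hX j hj.le, ← hX (j + 1) hj] at h1
  change γ t = polyline (D.dt h) X t
  rw [e, polyline_affine hdt X j hθm]
  exact h1

/-- The law on paths as a finite sum over sequences of states. -/
theorem pathMeasure_apply (hM : D.IsPropagated h C K₀ q M) (hF : ∀ k ≤ h.Nt, D.S h C K₀ k ⊆ F)
    {U : Set D.PathSpace} (hU : MeasurableSet U) :
    D.pathMeasure h C K₀ M q U = ∑ X : Fin (h.Nt + 1) → F,
      ENNReal.ofReal (D.seqWeight h C M q h.Nt (seqOf X)) *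
        U.indicator 1 (D.pathOf h (seqOf X)) := by
  set f : (Fin (h.Nt + 1) → F) → ℝ≥0∞ := fun X =>
    ENNReal.ofReal (D.seqWeight h C M q h.Nt (seqOf X)) *
      U.indicator 1 (D.pathOf h (seqOf X)) with hf
  set g : D.gridPaths h C K₀ → (Fin (h.Nt + 1) → F) := fun γ j =>
    ⟨D.atTime γ.1 (D.time h j), hF j (Nat.le_of_lt_succ j.2)
      (γ.2.1 j (Nat.le_of_lt_succ j.2))⟩ with hg
  have hseq : ∀ γ, ∀ k ≤ h.Nt, seqOf (g γ) k = D.atTime γ.1 (D.time h k) := fun γ k hk => by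
    rw [seqOf_of_le _ hk]
  have hpath : ∀ γ, γ.1 = D.pathOf h (seqOf (g γ)) := fun γ => eq_pathOf γ.2 (hseq γ)
  have hinj : Function.Injective g := fun γ γ' hγ => by
    apply Subtype.ext
    rw [hpath γ, hpath γ', hγ]
  have hsupp : Function.support f ⊆ range g := by
    intro X hX
    have hw : D.seqWeight h C M q h.Nt (seqOf X) ≠ 0 := fun h0 => hX (by
      simp only [hf, h0, ENNReal.ofReal_zero, zero_mul])
    obtain ⟨h1, h2⟩ := hM.chain_of_seqWeight_ne_zero hw
    refine ⟨⟨_, pathOf_mem_gridPaths (mem_S_of_chain h1 h2)⟩, ?_⟩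
    funext j
    apply Subtype.ext
    simp only [hg]
    rw [atTime_pathOf_time _ (Nat.le_of_lt_succ j.2), seqOf_of_le _ (Nat.le_of_lt_succ j.2)]
  have hfg : ∀ γ, f (g γ) = ENNReal.ofReal ((M 0).toMeasure.real {D.atTime γ.1 0} *
      ∏ k ∈ Finset.range h.Nt,
        D.transition h C q k (D.atTime γ.1 (D.time h k)) (D.atTime γ.1 (D.time h (k + 1)))) *
      U.indicator 1 γ.1 := by
    intro γ
    simp only [hf]
    rw [← hpath, seqWeight, chainWeight, hseq γ 0 (Nat.zero_le _)]
    have e0 : D.time h 0 = 0 := by simp [time]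
    rw [e0]
    congr 3
    refine Finset.prod_congr rfl fun k hk => ?_
    rw [Finset.mem_range] at hk
    rw [hseq γ k hk.le, hseq γ (k + 1) hk]
  rw [← tsum_fintype (L := SummationFilter.unconditional _), ← hinj.tsum_eq hsupp, pathMeasure,
    Measure.sum_apply _ hU]
  refine tsum_congr fun γ => ?_
  rw [hfg, Measure.smul_apply, Measure.dirac_apply' _ hU, smul_eq_mul]

theorem pathMeasure_real (hV : D.SolvesHJB h C K₀ M V q) (hM : D.IsPropagated h C K₀ q M)
    (hβ : IsInterpolationBasis h.Ns s CI h.β) (hF : ∀ k ≤ h.Nt, D.S h C K₀ k ⊆ F)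
    {U : Set D.PathSpace} (hU : MeasurableSet U) :
    (D.pathMeasure h C K₀ M q).real U =
      D.seqExp h C M q F h.Nt fun X => U.indicator 1 (D.pathOf h X) := by
  have hfin : ∀ X : Fin (h.Nt + 1) → F,
      ENNReal.ofReal (D.seqWeight h C M q h.Nt (seqOf X)) *
        U.indicator 1 (D.pathOf h (seqOf X)) ≠ ∞ := fun X => by
    refine ENNReal.mul_ne_top ENNReal.ofReal_ne_top ?_
    by_cases hX : D.pathOf h (seqOf X) ∈ U <;> simp [hX]
  rw [Measure.real, pathMeasure_apply hM hF hU, ENNReal.toReal_sum fun X _ => hfin X]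
  refine Finset.sum_congr rfl fun X _ => ?_
  rw [ENNReal.toReal_mul, ENNReal.toReal_ofReal (seqWeight_nonneg hV hM hβ le_rfl _)]
  congr 1
  by_cases hX : D.pathOf h (seqOf X) ∈ U <;> simp [hX]

theorem pathMeasure_null (hM : D.IsPropagated h C K₀ q M) (hF : ∀ k ≤ h.Nt, D.S h C K₀ k ⊆ F)
    {U : Set D.PathSpace} (hU : MeasurableSet U)
    (hX : ∀ X : ℕ → Vec d, X 0 ∈ D.S h C K₀ 0 →
      (∀ j < h.Nt, X (j + 1) ∈ D.SNext h C j (X j)) → D.pathOf h X ∉ U) :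
    D.pathMeasure h C K₀ M q U = 0 := by
  rw [pathMeasure_apply hM hF hU]
  refine Finset.sum_eq_zero fun X _ => ?_
  by_cases h0 : D.seqWeight h C M q h.Nt (seqOf X) = 0
  · rw [h0, ENNReal.ofReal_zero, zero_mul]
  · obtain ⟨h1, h2⟩ := hM.chain_of_seqWeight_ne_zero h0
    rw [indicator_of_notMem (hX _ h1 h2), mul_zero]

theorem sum_mass_indicator (hM : D.IsPropagated h C K₀ q M) (hF : ∀ k ≤ h.Nt, D.S h C K₀ k ⊆ F)
    {k : ℕ} (hk : k ≤ h.Nt) (A : Set (Vec d)) :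
    ∑ x ∈ F, (M k).toMeasure.real {x} * A.indicator 1 x = (M k).toMeasure.real A := by
  classical
  have h1 : ∑ x ∈ F, (M k).toMeasure.real {x} * A.indicator 1 x =
      ∑ x ∈ F with x ∈ A, (M k).toMeasure.real {x} := by
    rw [Finset.sum_filter]
    refine Finset.sum_congr rfl fun x _ => ?_
    by_cases hx : x ∈ A <;> simp [hx]
  rw [h1, sum_measureReal_singleton]
  refine measureReal_congr ?_
  have h2 : ∀ᵐ x ∂(M k).toMeasure, x ∈ D.S h C K₀ k := hM.support k hk
  filter_upwards [h2] with x hx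
  have := hF k hk hx
  rw [Finset.mem_coe] at this
  change (x ∈ ((Finset.filter (· ∈ A) F : Finset (Vec d)) : Set (Vec d))) = (x ∈ A)
  simp [this]

theorem isProbabilityMeasure_pathMeasure (hV : D.SolvesHJB h C K₀ M V q)
    (hM : D.IsPropagated h C K₀ q M) (hβ : IsInterpolationBasis h.Ns s CI h.β) (hCI : 0 ≤ CI)
    (hF : ∀ k ≤ h.Nt, D.S h C K₀ k ⊆ F)
    (hfin : ∀ k < h.Nt, ∀ x ∈ D.S h C K₀ k, (D.S₁ h C k x).Finite) :
    IsProbabilityMeasure (D.pathMeasure h C K₀ M q) := by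
  have h1 := pathMeasure_real hV hM hβ hF MeasurableSet.univ
  have h2 := seqExp_eval hV hM hβ hCI hF hfin h.Nt (Nat.zero_le _) le_rfl
    ((univ : Set (Vec d)).indicator 1)
  rw [sum_mass_indicator hM hF (Nat.zero_le _), probReal_univ] at h2
  have h3 : (D.pathMeasure h C K₀ M q).real univ = 1 := by
    rw [h1, ← h2]
    simp
  constructor
  rw [Measure.real] at h3
  rwa [ENNReal.toReal_eq_one_iff] at h3

theorem pathMeasure_map (hV : D.SolvesHJB h C K₀ M V q)
    (hM : D.IsPropagated h C K₀ q M) (hβ : IsInterpolationBasis h.Ns s CI h.β) (hCI : 0 ≤ CI)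
    (hF : ∀ k ≤ h.Nt, D.S h C K₀ k ⊆ F)
    (hfin : ∀ k < h.Nt, ∀ x ∈ D.S h C K₀ k, (D.S₁ h C k x).Finite) {k : ℕ} (hk : k ≤ h.Nt) :
    (D.pathMeasure h C K₀ M q).map (fun γ : D.PathSpace => D.atTime γ (D.time h k)) =
      (M k).toMeasure := by
  have := isProbabilityMeasure_pathMeasure hV hM hβ hCI hF hfin
  have hev : Measurable fun γ : D.PathSpace => D.atTime γ (D.time h k) :=
    (ContinuousEvalConst.continuous_eval_const _).measurable
  ext A hA
  rw [Measure.map_apply hev hA]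
  have h1 := pathMeasure_real hV hM hβ hF (hev hA)
  have h2 := seqExp_eval hV hM hβ hCI hF hfin h.Nt hk le_rfl (A.indicator 1)
  rw [sum_mass_indicator hM hF hk] at h2
  have h3 : (D.pathMeasure h C K₀ M q).real
      ((fun γ : D.PathSpace => D.atTime γ (D.time h k)) ⁻¹' A) = (M k).toMeasure.real A := by
    rw [h1, ← h2]
    refine Finset.sum_congr rfl fun X _ => ?_
    congr 1
    beta_reduce
    have e := atTime_pathOf_time (D := D) (h := h) (seqOf X) hk
    by_cases hX : seqOf X k ∈ A
    · rw [indicator_of_mem hX, indicator_of_mem]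
      · rfl
      · rw [mem_preimage, e]; exact hX
    · rw [indicator_of_notMem hX, indicator_of_notMem]
      rw [mem_preimage, e]; exact hX
  exact (ENNReal.toReal_eq_toReal_iff' (measure_ne_top _ _) (measure_ne_top _ _)).1 h3

/-- Markov's inequality for the excess of the cost of the chain over the discrete value function. -/
theorem mul_pathMeasure_le (hV : D.SolvesHJB h C K₀ M V q)
    (hM : D.IsPropagated h C K₀ q M) (hβ : IsInterpolationBasis h.Ns s CI h.β) (hCI : 0 ≤ CI)
    (hF : ∀ k ≤ h.Nt, D.S h C K₀ k ⊆ F) {E : ℝ}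
    (hE : ∀ k < h.Nt, ∀ x ∈ D.S h C K₀ k, ∃ hf : (D.S₁ h C k x).Finite,
      h.ε * Real.log hf.toFinset.card ≤ E)
    {U : Set D.PathSpace} (hU : MeasurableSet U) {ε₀ η : ℝ} (hη : 0 ≤ η)
    (hlow : ∀ X : ℕ → Vec d, X 0 ∈ D.S h C K₀ 0 →
      (∀ j < h.Nt, X (j + 1) ∈ D.SNext h C j (X j)) → V 0 (X 0) - η ≤ D.chainCost h M 0 X)
    (hhigh : ∀ X : ℕ → Vec d, X 0 ∈ D.S h C K₀ 0 →
      (∀ j < h.Nt, X (j + 1) ∈ D.SNext h C j (X j)) → D.pathOf h X ∈ U →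
        V 0 (X 0) + ε₀ ≤ D.chainCost h M 0 X) :
    ε₀ * (D.pathMeasure h C K₀ M q).real U ≤ η + h.Nt * E := by
  have hfin := fun k hk x hx => (hE k hk x hx).choose
  have hprob := isProbabilityMeasure_pathMeasure hV hM hβ hCI hF hfin
  have h1 := seqExp_cost_le hV hM hβ hCI hF hE
  have h2 : D.seqExp h C M q F h.Nt (fun X => ε₀ * U.indicator 1 (D.pathOf h X) +
      (-η) * (univ : Set D.PathSpace).indicator 1 (D.pathOf h X)) ≤
      D.seqExp h C M q F h.Nt (fun X => D.chainCost h M 0 X - V 0 (X 0)) := by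
    refine chainExp_mono fun X _ hX => ⟨seqWeight_nonneg hV hM hβ le_rfl X, ?_⟩
    obtain ⟨u1, u2⟩ := hM.chain_of_seqWeight_ne_zero hX
    rw [indicator_of_mem (mem_univ _)]
    by_cases hXU : D.pathOf h X ∈ U
    · have := hhigh X u1 u2 hXU
      rw [indicator_of_mem hXU]
      simp only [Pi.one_apply, mul_one]
      linarith
    · have := hlow X u1 u2
      rw [indicator_of_notMem hXU]
      simp only [Pi.one_apply, mul_one, mul_zero]
      linarith
  rw [seqExp, chainExp_add, chainExp_const_mul, chainExp_const_mul] at h2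
  have h3 := pathMeasure_real hV hM hβ hF hU
  have h4 := pathMeasure_real hV hM hβ hF MeasurableSet.univ
  rw [probReal_univ] at h4
  rw [seqExp] at h3 h4
  rw [← h3, ← h4] at h2
  linarith

end Data
end MFG

namespace MFG

/-! ### Narrow convergence and the Monge--Kantorovich distance -/

namespace P1

/-- The underlying element of the space of probability measures with the narrow topology. -/
def toPM {X : Type*} [PseudoMetricSpace X] [MeasurableSpace X] (μ : P1 X) :
    ProbabilityMeasure X := ⟨μ.toMeasure, μ.isProb⟩

variable {X : Type*} [MetricSpace X] [SecondCountableTopology X] [CompleteSpace X]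
  [MeasurableSpace X] [BorelSpace X]

/-- A measure `ρ` on the product whose marginals are dominated by `μ` and `ν` is completed to a
coupling by a multiple of the product of the two remainders, which have the same mass. -/
theorem dist_le_of_partial_coupling {μ ν : P1 X} {ρ : Measure (X × X)}
    (h1 : ρ.map Prod.fst ≤ μ.toMeasure) (h2 : ρ.map Prod.snd ≤ ν.toMeasure) {δ b : ℝ}
    (hδ : ∀ᵐ z ∂ρ, dist z.1 z.2 ≤ δ) {K : Set X} (hK : ∀ x ∈ K, ∀ y ∈ K, dist x y ≤ b)
    (hμ : μ.toMeasure Kᶜ = 0) (hν : ν.toMeasure Kᶜ = 0) :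
    dist μ ν ≤ δ * ρ.real univ + b * (1 - ρ.real univ) := by
  have e1 : (ρ.map Prod.fst) univ = ρ univ := by
    rw [Measure.map_apply measurable_fst MeasurableSet.univ, preimage_univ]
  have e2 : (ρ.map Prod.snd) univ = ρ univ := by
    rw [Measure.map_apply measurable_snd MeasurableSet.univ, preimage_univ]
  have hle : ρ univ ≤ 1 := by
    rw [← e1, ← measure_univ (μ := μ.toMeasure)]
    exact h1 _
  have : IsFiniteMeasure ρ := ⟨hle.trans_lt ENNReal.one_lt_top⟩
  set μ' := μ.toMeasure - ρ.map Prod.fst with hμ'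
  set ν' := ν.toMeasure - ρ.map Prod.snd with hν'
  have a1 : μ' + ρ.map Prod.fst = μ.toMeasure := Measure.sub_add_cancel_of_le h1
  have a2 : ν' + ρ.map Prod.snd = ν.toMeasure := Measure.sub_add_cancel_of_le h2
  have m1 : μ' univ = 1 - ρ univ := by
    rw [hμ', Measure.sub_apply MeasurableSet.univ h1, e1, measure_univ]
  have m2 : ν' univ = 1 - ρ univ := by
    rw [hν', Measure.sub_apply MeasurableSet.univ h2, e2, measure_univ]
  set c : ℝ≥0∞ := 1 - ρ univ with hc
  have hct : c ≠ ⊤ := (tsub_le_self.trans_lt ENNReal.one_lt_top).ne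
  have : IsFiniteMeasure μ' := ⟨by rw [m1]; exact hct.lt_top⟩
  have : IsFiniteMeasure ν' := ⟨by rw [m2]; exact hct.lt_top⟩
  have hcancel : ∀ κ : Measure X, κ univ = c → c⁻¹ • c • κ = κ := by
    intro κ hκ
    by_cases h0 : c = 0
    · rw [h0, Measure.measure_univ_eq_zero] at hκ
      simp [hκ]
    · rw [smul_smul, ENNReal.inv_mul_cancel h0 hct, one_smul]
  have hcoup : IsCoupling μ ν (ρ + c⁻¹ • μ'.prod ν') := by
    constructor
    · rw [Measure.map_add _ _ measurable_fst, Measure.map_smul, Measure.map_fst_prod, m2,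
        hcancel _ m1, add_comm, a1]
    · rw [Measure.map_add _ _ measurable_snd, Measure.map_smul, Measure.map_snd_prod, m1,
        hcancel _ m2, add_comm, a2]
  have hint := hcoup.integrable
  have hle' := d1_le hcoup
  obtain ⟨i1, i2⟩ := integrable_add_measure.1 hint
  have : IsFiniteMeasure (ρ + c⁻¹ • μ'.prod ν') :=
    have := hcoup.isProb
    inferInstance
  have hfin2 : IsFiniteMeasure (c⁻¹ • μ'.prod ν') :=
    isFiniteMeasure_of_le _ (Measure.le_add_left le_rfl : _ ≤ ρ + c⁻¹ • μ'.prod ν')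
  have hmass : ρ.real univ + (c⁻¹ • μ'.prod ν').real univ = 1 := by
    have := hcoup.isProb
    rw [← measureReal_add_apply, probReal_univ]
  have k1 : ∫ z, dist z.1 z.2 ∂ρ ≤ δ * ρ.real univ := by
    refine (integral_mono_ae i1 (integrable_const δ) hδ).trans_eq ?_
    simp [mul_comm]
  have n1 : μ' Kᶜ = 0 := by
    refine le_antisymm (le_trans ?_ hμ.le) zero_le
    rw [← a1]
    exact Measure.le_add_right le_rfl _
  have n2 : ν' Kᶜ = 0 := by
    refine le_antisymm (le_trans ?_ hν.le) zero_le
    rw [← a2]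
    exact Measure.le_add_right le_rfl _
  have hae : ∀ᵐ z ∂(c⁻¹ • μ'.prod ν'), dist z.1 z.2 ≤ b := by
    refine Measure.ae_smul_measure ?_ _
    have q1 : ∀ᵐ z ∂μ'.prod ν', z.1 ∈ K :=
      Measure.quasiMeasurePreserving_fst.ae (p := fun x => x ∈ K) (by rw [ae_iff]; exact n1)
    have q2 : ∀ᵐ z ∂μ'.prod ν', z.2 ∈ K :=
      Measure.quasiMeasurePreserving_snd.ae (p := fun x => x ∈ K) (by rw [ae_iff]; exact n2)
    filter_upwards [q1, q2] with z z1 z2 using hK _ z1 _ z2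
  have k2 : ∫ z, dist z.1 z.2 ∂(c⁻¹ • μ'.prod ν') ≤ b * (c⁻¹ • μ'.prod ν').real univ := by
    refine (integral_mono_ae i2 (integrable_const b) hae).trans_eq ?_
    simp only [integral_const, smul_eq_mul, mul_comm]
  rw [integral_add_measure i1 i2] at hle'
  have : (c⁻¹ • μ'.prod ν').real univ = 1 - ρ.real univ := by linarith
  rw [this] at k2
  change d1 μ ν ≤ _
  linarith

/-- The part common to `μ` and `ν` on the cells `E k` is transported within the cells. -/
theorem dist_le_of_partition {μ ν : P1 X} {E : ℕ → Set X} (n : ℕ)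
    (hE : ∀ k, MeasurableSet (E k)) (hd : Pairwise (Function.onFun Disjoint E)) {δ b : ℝ}
    (hδ0 : 0 ≤ δ) (hδ : ∀ k, ∀ x ∈ E k, ∀ y ∈ E k, dist x y ≤ δ) {K : Set X} (hb : 0 ≤ b)
    (hK : ∀ x ∈ K, ∀ y ∈ K, dist x y ≤ b)
    (hμ : μ.toMeasure Kᶜ = 0) (hν : ν.toMeasure Kᶜ = 0) :
    dist μ ν ≤ δ + b * (1 - ∑ k ∈ Finset.range n,
      min (μ.toMeasure.real (E k)) (ν.toMeasure.real (E k))) := by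
  set κ : ℕ → ℝ≥0∞ := fun k => (max (μ.toMeasure (E k)) (ν.toMeasure (E k)))⁻¹ with hκ
  set ρ : Measure (X × X) := ∑ k ∈ Finset.range n,
    κ k • (μ.toMeasure.restrict (E k)).prod (ν.toMeasure.restrict (E k)) with hρ
  have hsum : ∀ (θ : Measure X) (a : ℕ → ℝ≥0∞), (∀ k, a k ≤ 1) →
      ∑ k ∈ Finset.range n, a k • θ.restrict (E k) ≤ θ := by
    intro θ a ha
    have : ∑ k ∈ Finset.range n, a k • θ.restrict (E k) ≤
        ∑ k ∈ Finset.range n, θ.restrict (E k) := by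
      refine Finset.sum_le_sum fun k _ => Measure.le_iff.2 fun s hs => ?_
      rw [Measure.smul_apply, smul_eq_mul]
      exact mul_le_of_le_one_left zero_le (ha k)
    refine this.trans ?_
    rw [Measure.le_iff]
    intro s hs
    rw [Measure.finsetSum_apply]
    simp only [Measure.restrict_apply hs]
    rw [← measure_biUnion_finset]
    · exact measure_mono (iUnion₂_subset fun _ _ => inter_subset_left)
    · intro i _ j _ hij
      exact (hd hij).mono inter_subset_right inter_subset_right
    · exact fun k _ => hs.inter (hE k)
  have hκ1 : ∀ k, κ k * ν.toMeasure (E k) ≤ 1 := fun k =>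
    (mul_le_mul_right (le_max_right _ _) _).trans (ENNReal.inv_mul_le_one _)
  have hκ2 : ∀ k, κ k * μ.toMeasure (E k) ≤ 1 := fun k =>
    (mul_le_mul_right (le_max_left _ _) _).trans (ENNReal.inv_mul_le_one _)
  have h1 : ρ.map Prod.fst ≤ μ.toMeasure := by
    rw [hρ, Measure.map_finset_sum measurable_fst.aemeasurable]
    simp only [Measure.map_smul, Measure.map_fst_prod, smul_smul, Measure.restrict_apply_univ]
    exact hsum _ _ hκ1
  have h2 : ρ.map Prod.snd ≤ ν.toMeasure := by
    rw [hρ, Measure.map_finset_sum measurable_snd.aemeasurable]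
    simp only [Measure.map_smul, Measure.map_snd_prod, smul_smul, Measure.restrict_apply_univ]
    exact hsum _ _ hκ2
  have hae : ∀ᵐ z ∂ρ, dist z.1 z.2 ≤ δ := by
    rw [ae_iff, hρ, Measure.finsetSum_apply]
    refine Finset.sum_eq_zero fun k _ => ?_
    rw [Measure.smul_apply, Measure.prod_restrict, smul_eq_mul]
    refine mul_eq_zero_of_right _ ?_
    rw [← ae_iff]
    filter_upwards [ae_restrict_mem ((hE k).prod (hE k))] with z hz using hδ k _ hz.1 _ hz.2
  have hle := dist_le_of_partial_coupling h1 h2 hae hK hμ hν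
  have hmass1 : ρ univ ≤ 1 := by
    rw [← measure_univ (μ := μ.toMeasure)]
    refine le_trans ?_ (h1 univ)
    rw [Measure.map_apply measurable_fst MeasurableSet.univ, preimage_univ]
  have : IsFiniteMeasure ρ := ⟨hmass1.trans_lt ENNReal.one_lt_top⟩
  have hmass : ∑ k ∈ Finset.range n,
      min (μ.toMeasure.real (E k)) (ν.toMeasure.real (E k)) ≤ ρ.real univ := by
    have : ∑ k ∈ Finset.range n, min (μ.toMeasure (E k)) (ν.toMeasure (E k)) ≤ ρ univ := by
      rw [hρ, Measure.finsetSum_apply]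
      refine Finset.sum_le_sum fun k _ => ?_
      rw [Measure.smul_apply, ← univ_prod_univ, Measure.prod_prod, Measure.restrict_apply_univ,
        Measure.restrict_apply_univ, smul_eq_mul]
      simp only [hκ]
      rw [← max_mul_min (μ.toMeasure (E k)) (ν.toMeasure (E k)), ← mul_assoc]
      by_cases h0 : max (μ.toMeasure (E k)) (ν.toMeasure (E k)) = 0
      · have := le_trans (min_le_left _ (ν.toMeasure (E k))) ((le_max_left _ _).trans h0.le)
        exact this.trans zero_le
      · rw [ENNReal.inv_mul_cancel h0, one_mul]
        exact (max_lt (measure_lt_top _ _) (measure_lt_top _ _)).ne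
    have h' := ENNReal.toReal_mono (measure_ne_top _ _) this
    rw [ENNReal.toReal_sum fun k _ => ((min_le_left _ _).trans_lt (measure_lt_top _ _)).ne] at h'
    refine le_trans (Finset.sum_le_sum fun k _ => ?_) h'
    rw [ENNReal.toReal_min (measure_ne_top _ _) (measure_ne_top _ _)]
    rfl
  have hr1 : ρ.real univ ≤ 1 := by
    have := ENNReal.toReal_mono ENNReal.one_ne_top hmass1
    rwa [ENNReal.toReal_one] at this
  have : δ * ρ.real univ ≤ δ := mul_le_of_le_one_right hδ0 hr1
  have : b * (1 - ρ.real univ) ≤ b * (1 - ∑ k ∈ Finset.range n,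
      min (μ.toMeasure.real (E k)) (ν.toMeasure.real (E k))) := by
    refine mul_le_mul_of_nonneg_left ?_ hb
    linarith
  linarith

/-- Narrow convergence of measures carried by a fixed compact set implies convergence for `d₁`. -/
theorem tendsto_of_tendsto_toPM {ι : Type*} {l : Filter ι} {ν : ι → P1 X} {μ : P1 X} {K : Set X}
    (hKc : IsCompact K) (hν : ∀ i, (ν i).toMeasure Kᶜ = 0) (hμ : μ.toMeasure Kᶜ = 0)
    (hlim : Tendsto (fun i => (ν i).toPM) l (𝓝 μ.toPM)) : Tendsto ν l (𝓝 μ) := by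
  have : Nonempty X := ⟨μ.moment.choose⟩
  rw [Metric.tendsto_nhds]
  intro ε hε
  have hr : ∀ k : ℕ, ∃ r ∈ Ioo (ε / 8) (ε / 4), μ.toMeasure
      (frontier (Metric.thickening r {TopologicalSpace.denseSeq X k})) = 0 := fun k =>
    exists_null_frontier_thickening _ _ (by linarith)
  choose ρ hρ hfr using hr
  set B : ℕ → Set X := fun k => Metric.ball (TopologicalSpace.denseSeq X k) (ρ k) with hB
  have hBfr : ∀ k, μ.toMeasure (frontier (B k)) = 0 := fun k => by
    have := hfr k
    rwa [Metric.thickening_singleton] at this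
  have hcov : K ⊆ ⋃ k, B k := by
    intro x _
    obtain ⟨k, hk⟩ := (TopologicalSpace.denseRange_denseSeq X).exists_dist_lt x
      (show (0 : ℝ) < ε / 8 by positivity)
    exact mem_iUnion.2 ⟨k, hk.trans (hρ k).1⟩
  obtain ⟨t, ht⟩ := hKc.elim_finite_subcover B (fun k => Metric.isOpen_ball) hcov
  obtain ⟨n, hn⟩ : ∃ n, ∀ k ∈ t, k < n := ⟨t.sup id + 1, fun k hk =>
    Nat.lt_succ_of_le (Finset.le_sup (f := id) hk)⟩
  set E := disjointed B with hE
  have hp : ∀ k, MeasurableSet (E k) ∧ μ.toMeasure (frontier (E k)) = 0 := by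
    intro k
    refine disjointedRec (p := fun s => MeasurableSet s ∧ μ.toMeasure (frontier s) = 0) ?_
      ⟨Metric.isOpen_ball.measurableSet, hBfr k⟩
    rintro s i ⟨hs1, hs2⟩
    refine ⟨hs1.diff Metric.isOpen_ball.measurableSet, ?_⟩
    refine measure_mono_null ((frontier_inter_subset s (B i)ᶜ).trans
      (union_subset_union inter_subset_left inter_subset_right)) ?_
    rw [frontier_compl]
    exact measure_union_null hs2 (hBfr i)
  have hEB : ∀ k, E k ⊆ B k := disjointed_subset B
  have hsmall : ∀ k, ∀ x ∈ E k, ∀ y ∈ E k, dist x y ≤ ε / 2 := by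
    intro k x hx y hy
    have h1 : dist x _ < _ := hEB k hx
    have h2 : dist y _ < _ := hEB k hy
    have := dist_triangle_right x y (TopologicalSpace.denseSeq X k)
    have := (hρ k).2
    linarith
  have hKE : K ⊆ ⋃ k ∈ Finset.range n, E k := by
    intro x hx
    obtain ⟨k, hk, hxk⟩ := mem_iUnion₂.1 (ht hx)
    have : x ∈ partialSups B k := le_partialSups B k hxk
    rw [← partialSups_disjointed, partialSups_eq_biSup] at this
    simp only [iSup_eq_iUnion] at this
    obtain ⟨j, hj, hxj⟩ := mem_iUnion₂.1 this
    exact mem_iUnion₂.2 ⟨j, Finset.mem_range.2 (lt_of_le_of_lt hj (hn k hk)), hxj⟩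
  have hone : ∑ k ∈ Finset.range n, μ.toMeasure.real (E k) = 1 := by
    rw [← measureReal_biUnion_finset (fun i _ j _ hij => disjoint_disjointed B hij)
      (fun k _ => (hp k).1), ← probReal_univ (μ := μ.toMeasure)]
    refine measureReal_congr (ae_eq_univ.2 (measure_mono_null (compl_subset_compl.2 hKE) hμ))
  have hT : Tendsto (fun i => Metric.diam K * (1 - ∑ k ∈ Finset.range n,
      min (μ.toMeasure.real (E k)) ((ν i).toMeasure.real (E k)))) l (𝓝 0) := by
    have h1 : ∀ k, Tendsto (fun i => (ν i).toMeasure.real (E k)) l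
        (𝓝 (μ.toMeasure.real (E k))) := fun k =>
      (ENNReal.tendsto_toReal (measure_ne_top _ _)).comp
        (ProbabilityMeasure.tendsto_measure_of_null_frontier_of_tendsto' hlim (hp k).2)
    have h2 := (tendsto_const_nhds (x := Metric.diam K) (f := l)).mul
      ((tendsto_const_nhds (x := (1 : ℝ)) (f := l)).sub
      (tendsto_finsetSum (Finset.range n) fun k _ =>
        (tendsto_const_nhds (x := μ.toMeasure.real (E k)) (f := l)).min (h1 k)))
    simpa only [min_self, hone, sub_self, mul_zero] using h2
  filter_upwards [hT.eventually (gt_mem_nhds (half_pos hε))] with i hi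
  rw [dist_comm]
  have := dist_le_of_partition (μ := μ) (ν := ν i) n (fun k => (hp k).1)
    (disjoint_disjointed B) (half_pos hε).le hsmall Metric.diam_nonneg
    (fun x hx y hy => Metric.dist_le_diam_of_mem hKc.isBounded hx hy) hμ (hν i)
  linarith

/-- A coupling carried by pairs of points at distance at most `δ`. -/
theorem dist_le_of_coupling {μ ν : P1 X} {π : Measure (X × X)} (hπ : IsCoupling μ ν π) {δ : ℝ}
    (hδ : ∀ᵐ z ∂π, dist z.1 z.2 ≤ δ) : dist μ ν ≤ δ := by
  have := hπ.isProb
  refine (d1_le hπ).trans ((integral_mono_ae hπ.integrable (integrable_const δ) hδ).trans_eq ?_)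
  simp

end P1
end MFG

namespace MFG
namespace Data

variable {d r s : ℕ} {D : Data d r s} {R : ℝ} {L : NNReal}

/-! ### Measures carried by a set of equi-Lipschitz paths -/

/-- The paths with values in the closed ball of radius `R` and Lipschitz constant `L`. -/
def lipPaths (D : Data d r s) (R : ℝ) (L : NNReal) : Set D.PathSpace :=
  {γ | (∀ t, ‖γ t‖ ≤ R) ∧ LipschitzWith L γ}

theorem isClosed_lipPaths : IsClosed (D.lipPaths R L) := by
  have h1 : IsClosed {γ : D.PathSpace | ∀ t, ‖γ t‖ ≤ R} := by
    simp only [ofPred_forall]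
    exact isClosed_iInter fun t => isClosed_le (continuous_eval_const t).norm continuous_const
  have h2 : IsClosed {γ : D.PathSpace | LipschitzWith L γ} := by
    simp only [lipschitzWith_iff_dist_le_mul, ofPred_forall]
    exact isClosed_iInter fun t => isClosed_iInter fun u =>
      isClosed_le ((continuous_eval_const t).dist (continuous_eval_const u)) continuous_const
  exact h1.inter h2

theorem isCompact_lipPaths : IsCompact (D.lipPaths R L) := by
  refine ArzelaAscoli.isCompact_of_equicontinuous _ ?_ ?_
  · have e : ContinuousMap.toFun '' D.lipPaths R L =
        {f : Icc (0 : ℝ) D.T → Vec d | (∀ t, f t ∈ Metric.closedBall 0 R) ∧ LipschitzWith L f} := by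
      ext f
      constructor
      · rintro ⟨γ, hγ, rfl⟩
        exact ⟨fun t => mem_closedBall_zero_iff.2 (hγ.1 t), hγ.2⟩
      · rintro ⟨h1, h2⟩
        exact ⟨⟨f, h2.continuous⟩, ⟨fun t => mem_closedBall_zero_iff.1 (h1 t), h2⟩, rfl⟩
    rw [e]
    refine IsCompact.of_isClosed_subset
      (isCompact_univ_pi fun _ : Icc (0 : ℝ) D.T => isCompact_closedBall (0 : Vec d) R) ?_
      fun f hf t _ => hf.1 t
    have h1 : IsClosed {f : Icc (0 : ℝ) D.T → Vec d | ∀ t, f t ∈ Metric.closedBall 0 R} := by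
      simp only [ofPred_forall]
      exact isClosed_iInter fun t => Metric.isClosed_closedBall.preimage (continuous_apply t)
    have h2 : IsClosed {f : Icc (0 : ℝ) D.T → Vec d | LipschitzWith L f} := by
      simp only [lipschitzWith_iff_dist_le_mul, ofPred_forall]
      exact isClosed_iInter fun t => isClosed_iInter fun u =>
        isClosed_le ((continuous_apply t).dist (continuous_apply u)) continuous_const
    exact h1.inter h2
  · refine UniformEquicontinuous.equicontinuous ?_
    exact LipschitzWith.uniformEquicontinuous _ L fun γ => γ.2.2

variable {ξ : ProbabilityMeasure D.PathSpace}

theorem lipPaths_null_of_tendsto {ι : Type*} {l : Filter ι} [l.NeBot]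
    {ξs : ι → ProbabilityMeasure D.PathSpace} (hlim : Tendsto ξs l (𝓝 ξ))
    (hξ : ∀ i, (ξs i : Measure D.PathSpace) (D.lipPaths R L)ᶜ = 0) :
    (ξ : Measure D.PathSpace) (D.lipPaths R L)ᶜ = 0 := by
  have h1 := ProbabilityMeasure.le_liminf_measure_open_of_tendsto hlim
    (isClosed_lipPaths (D := D) (R := R) (L := L)).isOpen_compl
  simp only [hξ, liminf_const] at h1
  exact le_antisymm h1 zero_le

theorem isCompact_closure_range_of_lipPaths {ι : Type*}
    {ξs : ι → ProbabilityMeasure D.PathSpace}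
    (hξ : ∀ i, (ξs i : Measure D.PathSpace) (D.lipPaths R L)ᶜ = 0) :
    IsCompact (closure (range ξs)) := by
  refine isCompact_closure_of_isTightMeasureSet ?_
  rw [isTightMeasureSet_iff_exists_isCompact_measure_compl_le]
  refine fun ε _ => ⟨D.lipPaths R L, isCompact_lipPaths, ?_⟩
  rintro _ ⟨_, ⟨i, rfl⟩, rfl⟩
  rw [hξ i]
  exact zero_le

theorem measurable_eval (t : Icc (0 : ℝ) D.T) : Measurable fun γ : D.PathSpace => γ t :=
  (continuous_eval_const t).measurable

theorem ae_lipPaths (hξ : (ξ : Measure D.PathSpace) (D.lipPaths R L)ᶜ = 0) :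
    ∀ᵐ γ ∂(ξ : Measure D.PathSpace), γ ∈ D.lipPaths R L := by
  rw [ae_iff]
  exact hξ

/-- The law at time `t` of a measure carried by `lipPaths`. -/
noncomputable def marginal (ξ : ProbabilityMeasure D.PathSpace)
    (hξ : (ξ : Measure D.PathSpace) (D.lipPaths R L)ᶜ = 0) (t : Icc (0 : ℝ) D.T) :
    P1 (Vec d) where
  toMeasure := (ξ : Measure D.PathSpace).map fun γ => γ t
  isProb := Measure.isProbabilityMeasure_map (measurable_eval t).aemeasurable
  moment := by
    refine ⟨0, ?_⟩
    rw [integrable_map_measure (by fun_prop) (measurable_eval t).aemeasurable]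
    refine Integrable.of_bound (C := R) ?_ ?_
    · exact (Measurable.dist (measurable_eval t) measurable_const).aestronglyMeasurable
    · filter_upwards [ae_lipPaths hξ] with γ hγ
      simpa using hγ.1 t

theorem dist_marginal_le (hξ : (ξ : Measure D.PathSpace) (D.lipPaths R L)ᶜ = 0)
    (t u : Icc (0 : ℝ) D.T) : dist (marginal ξ hξ t) (marginal ξ hξ u) ≤ L * dist t u := by
  have hm : Measurable fun γ : D.PathSpace => (γ t, γ u) :=
    (measurable_eval t).prodMk (measurable_eval u)
  refine P1.dist_le_of_coupling
    (π := (ξ : Measure D.PathSpace).map fun γ => (γ t, γ u)) ⟨?_, ?_⟩ ?_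
  · rw [Measure.map_map measurable_fst hm]
    rfl
  · rw [Measure.map_map measurable_snd hm]
    rfl
  · rw [ae_map_iff hm.aemeasurable
      (measurableSet_le (measurable_fst.dist measurable_snd) measurable_const)]
    filter_upwards [ae_lipPaths hξ] with γ hγ using hγ.2.dist_le_mul t u

/-- The marginals of a measure carried by `lipPaths` form a continuous flow. -/
noncomputable def marginalFlow (ξ : ProbabilityMeasure D.PathSpace)
    (hξ : (ξ : Measure D.PathSpace) (D.lipPaths R L)ᶜ = 0) : D.Flow where
  toFun := marginal ξ hξ
  continuous_toFun := (LipschitzWith.of_dist_le_mul (dist_marginal_le hξ)).continuous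

theorem isMarginalFlow_marginalFlow (hξ : (ξ : Measure D.PathSpace) (D.lipPaths R L)ᶜ = 0) :
    D.IsMarginalFlow ξ (marginalFlow ξ hξ) := fun _ => rfl

theorem marginal_null (hξ : (ξ : Measure D.PathSpace) (D.lipPaths R L)ᶜ = 0)
    (t : Icc (0 : ℝ) D.T) :
    (marginal ξ hξ t).toMeasure (Metric.closedBall (0 : Vec d) R)ᶜ = 0 := by
  change ((ξ : Measure D.PathSpace).map fun γ => γ t) _ = 0
  rw [Measure.map_apply (measurable_eval t) Metric.isClosed_closedBall.measurableSet.compl]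
  have hsub : (fun γ : D.PathSpace => γ t) ⁻¹' (Metric.closedBall (0 : Vec d) R)ᶜ ⊆
      (D.lipPaths R L)ᶜ := fun γ hγ hγ' => hγ (mem_closedBall_zero_iff.2 (hγ'.1 t))
  exact measure_mono_null hsub hξ

theorem support_marginal_subset (hξ : (ξ : Measure D.PathSpace) (D.lipPaths R L)ᶜ = 0)
    (t : Icc (0 : ℝ) D.T) :
    (marginal ξ hξ t).toMeasure.support ⊆ Metric.closedBall (0 : Vec d) R :=
  Measure.support_subset_of_isClosed Metric.isClosed_closedBall (by
    rw [mem_ae_iff]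
    exact marginal_null hξ t)

/-- Pointwise convergence of the marginals is uniform in time because they are equi-Lipschitz. -/
theorem tendsto_marginalFlow {ι : Type*} {l : Filter ι}
    {ξs : ι → ProbabilityMeasure D.PathSpace} (hlim : Tendsto ξs l (𝓝 ξ))
    (hs : ∀ i, (ξs i : Measure D.PathSpace) (D.lipPaths R L)ᶜ = 0)
    (hξ : (ξ : Measure D.PathSpace) (D.lipPaths R L)ᶜ = 0) :
    Tendsto (fun i => marginalFlow (ξs i) (hs i)) l (𝓝 (marginalFlow ξ hξ)) := by
  have hpt : ∀ t, Tendsto (fun i => marginal (ξs i) (hs i) t) l (𝓝 (marginal ξ hξ t)) := by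
    intro t
    refine P1.tendsto_of_tendsto_toPM (isCompact_closedBall (0 : Vec d) R)
      (fun i => marginal_null (hs i) t) (marginal_null hξ t) ?_
    exact ProbabilityMeasure.tendsto_map_of_tendsto_of_continuous ξs ξ hlim
      (f := fun γ : D.PathSpace => γ t) (continuous_eval_const t)
  have heq : Equicontinuous fun i => marginal (ξs i) (hs i) :=
    (LipschitzWith.uniformEquicontinuous _ L fun i =>
      LipschitzWith.of_dist_le_mul (dist_marginal_le (hs i))).equicontinuous
  have hu := (heq.tendsto_uniformFun_iff_pi l (marginal ξ hξ)).2 (tendsto_pi_nhds.2 hpt)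
  rw [ContinuousMap.tendsto_iff_tendstoUniformly]
  exact UniformFun.tendsto_iff_tendstoUniformly.1 hu

/-! ### The initial distribution -/

/-- The point of `N⁻¹ ℤᵈ` whose cell contains `y`. -/
noncomputable def nearestNode (N : ℕ) (y : Vec d) : Vec d :=
  fun i => (⌊N * y i + 1 / 2⌋ : ℝ) / N

theorem measurable_nearestNode (N : ℕ) : Measurable (nearestNode N : Vec d → Vec d) := by
  refine measurable_pi_lambda _ fun i => ?_
  have : Measurable fun y : Vec d => ⌊N * y i + 1 / 2⌋ :=
    Int.measurable_floor.comp (by fun_prop)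
  exact (measurable_from_top.comp this).div_const _

theorem dist_nearestNode_le {N : ℕ} (hN : 0 < N) (y : Vec d) :
    dist y (nearestNode N y) ≤ 1 / N / 2 := by
  have hN' : (0 : ℝ) < N := by exact_mod_cast hN
  refine (dist_pi_le_iff (by positivity)).2 fun i => ?_
  have h1 := Int.floor_le (N * y i + 1 / 2)
  have h2 := Int.lt_floor_add_one (N * y i + 1 / 2)
  have e : y i - nearestNode N y i = (N * y i - ⌊N * y i + 1 / 2⌋) / N := by
    simp only [nearestNode]
    field_simp
  rw [Real.dist_eq, e, abs_div, abs_of_pos hN', div_le_iff₀ hN']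
  have : 1 / (N : ℝ) / 2 * N = 1 / 2 := by field_simp
  rw [this, abs_le]
  constructor <;> linarith

theorem nearestNode_eq_of_mem_ball {N : ℕ} (hN : 0 < N) {x y : Vec d} (hx : x ∈ grid N d)
    (hy : y ∈ Metric.ball x (1 / N / 2)) : nearestNode N y = x := by
  have hN' : (0 : ℝ) < N := by exact_mod_cast hN
  obtain ⟨i, hi⟩ := hx
  funext j
  have h1 : dist (y j) (x j) < 1 / N / 2 := (dist_le_pi_dist y x j).trans_lt hy
  rw [hi j, Real.dist_eq, abs_lt] at h1
  have e : (i j : ℝ) / N * N = i j := by field_simp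
  have e' : 1 / (N : ℝ) / 2 * N = 1 / 2 := by field_simp
  have h2 := mul_lt_mul_of_pos_right h1.1 hN'
  have h3 := mul_lt_mul_of_pos_right h1.2 hN'
  rw [neg_mul, e', sub_mul, e] at h2
  rw [sub_mul, e, e'] at h3
  have : ⌊N * y j + 1 / 2⌋ = i j := by
    rw [Int.floor_eq_iff]
    constructor <;> linarith
  rw [nearestNode, this, hi j]

variable {h : Discretization s} {C : ℝ} {K₀ : Set (Vec d)}
  {M : ℕ → P1 (Vec d)} {q : ℕ → Vec d → Vec r → ℝ}

/-- The initial distribution of the chain is the image of `m₀` under projection to the grid. Cell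
boundaries do not matter since they are `m₀`-negligible. -/
theorem IsPropagated.initial_eq_map (hM : D.IsPropagated h C K₀ q M)
    (hfin : (D.S h C K₀ 0).Finite)
    (hfr : ∀ x ∈ grid h.Ns d, D.m₀ (frontier (Metric.closedBall x (dx h / 2))) = 0) :
    (M 0).toMeasure = D.m₀.map (nearestNode h.Ns) := by
  have := D.m₀_prob
  have hQ := measurable_nearestNode (d := d) h.Ns
  have : IsProbabilityMeasure (D.m₀.map (nearestNode h.Ns)) :=
    Measure.isProbabilityMeasure_map hQ.aemeasurable
  have hNs : (0 : ℝ) < h.Ns := by exact_mod_cast h.Ns_pos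
  have hsing : ∀ x ∈ D.S h C K₀ 0, (M 0).toMeasure {x} = D.m₀.map (nearestNode h.Ns) {x} := by
    intro x hx
    have h1 := hM.initial x hx
    rw [measureReal_eq_measureReal_iff] at h1
    rw [h1, Measure.map_apply hQ (measurableSet_singleton x)]
    have hr : dx h / 2 ≠ 0 := by
      simp only [dx]
      positivity
    refine le_antisymm ?_ (measure_mono ?_)
    · have : Metric.closedBall x (dx h / 2) ⊆
          nearestNode h.Ns ⁻¹' {x} ∪ frontier (Metric.closedBall x (dx h / 2)) := by
        intro y hy
        rcases (Metric.mem_closedBall.1 hy).lt_or_eq with hlt | he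
        · exact Or.inl (nearestNode_eq_of_mem_ball h.Ns_pos hx.1 hlt)
        · right
          rw [frontier_closedBall _ hr]
          exact he
      refine (measure_mono this).trans ((measure_union_le _ _).trans ?_)
      rw [hfr x hx.1, add_zero]
    · intro y hy
      have := dist_nearestNode_le h.Ns_pos y
      rw [show nearestNode h.Ns y = x from hy] at this
      exact this
  refine Measure.eq_of_le_of_isProbabilityMeasure (Measure.le_iff.2 fun A hA => ?_)
  have h1 : (M 0).toMeasure A = (M 0).toMeasure (A ∩ D.S h C K₀ 0) :=
    (measure_inter_conull (hM.support 0 (Nat.zero_le _))).symm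
  rw [h1]
  refine le_trans (le_of_eq ?_) (measure_mono (inter_subset_left (t := D.S h C K₀ 0)))
  have hf : (A ∩ D.S h C K₀ 0).Finite := hfin.subset inter_subset_right
  rw [← hf.coe_toFinset, ← sum_measure_singleton, ← sum_measure_singleton]
  exact Finset.sum_congr rfl fun x hx => hsing x (hf.mem_toFinset.1 hx).2

theorem tendsto_map_nearestNode (m₀ : ProbabilityMeasure (Vec d)) {N : ℕ → ℕ}
    (hN : ∀ n, 0 < N n) (hNt : Tendsto N atTop atTop) :
    Tendsto (fun n => m₀.map (measurable_nearestNode (N n)).aemeasurable) atTop (𝓝 m₀) := by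
  rw [ProbabilityMeasure.tendsto_iff_forall_integral_tendsto]
  intro f
  have e : ∀ n, ∫ y, f y ∂((m₀.map (measurable_nearestNode (N n)).aemeasurable :
      ProbabilityMeasure (Vec d)) : Measure (Vec d)) =
      ∫ y, f (nearestNode (N n) y) ∂(m₀ : Measure (Vec d)) := fun n =>
    integral_map (measurable_nearestNode (N n)).aemeasurable f.continuous.aestronglyMeasurable
  simp only [e]
  refine tendsto_integral_of_dominated_convergence (fun _ => ‖f‖) (fun n =>
    (f.continuous.measurable.comp (measurable_nearestNode (N n))).aestronglyMeasurable)
    (integrable_const _) (fun n => ae_of_all _ fun y => f.norm_coe_le_norm _)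
    (ae_of_all _ fun y => ?_)
  refine (f.continuous.tendsto y).comp ?_
  rw [tendsto_iff_dist_tendsto_zero]
  have h1 : Tendsto (fun n => (1 : ℝ) / (N n : ℝ) / 2) atTop (𝓝 0) := by
    simpa using ((tendsto_const_nhds (x := (1 : ℝ))).div_atTop
      (tendsto_natCast_atTop_atTop.comp hNt)).div_const 2
  refine squeeze_zero (fun n => dist_nonneg) (fun n => ?_) h1
  rw [dist_comm]
  exact dist_nearestNode_le (hN n) y

end Data
end MFG

namespace MFG

theorem P1.ext {X : Type*} [PseudoMetricSpace X] [MeasurableSpace X] {μ ν : P1 X}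
    (h : μ.toMeasure = ν.toMeasure) : μ = ν := by
  cases μ
  cases ν
  cases h
  rfl

namespace Data

variable {d r s : ℕ} {D : Data d r s} {C CI R : ℝ} {K₀ : Set (Vec d)}

/-! ### Limits of discrete equilibria -/

theorem time_zero (D : Data d r s) (h : Discretization s) : D.time h 0 = 0 := by
  simp [time]

/-- A bound on the speed of the interpolated chains with states in the ball of radius `R`. -/
noncomputable def Bounds.speed (c : D.Bounds) (C CI R : ℝ) : ℝ :=
  c.A0 + c.LA * R + c.CB * C + CI

theorem Bounds.norm_sub_le_of_mem_SNext (c : D.Bounds) (h3 : D.H3) (hCI : 0 ≤ CI)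
    {h : Discretization s} (hh : D.Admissible h CI) {k : ℕ} (hk : k ≤ h.Nt) {x y : Vec d}
    (hx : ‖x‖ ≤ R) (hy : y ∈ D.SNext h C k x) : ‖y - x‖ ≤ D.dt h * c.speed C CI R := by
  have ht := D.time_mem h hk
  set a := D.ctrl h k x (D.fst y) with ha
  have haC : ‖a‖ ≤ C := hy.1.2
  have h1 := sub_move_le_of_mem_SNext h3 hh.2 hCI hk hy
  have h2 : CI * dx h ≤ CI * D.dt h := mul_le_mul_of_nonneg_left hh.1 hCI
  have hdt := (D.dt_pos h).le
  have h4 : ‖D.move h k x a - x‖ ≤ D.dt h * (c.A0 + c.LA * R + c.CB * C) := by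
    have e : D.move h k x a - x = D.dt h • (D.A (D.time h k) x + D.B (D.time h k) x *ᵥ a) := by
      simp [move]
    rw [e, norm_smul, Real.norm_of_nonneg hdt]
    refine mul_le_mul_of_nonneg_left ((norm_add_le _ _).trans ?_) hdt
    have w1 := c.A_le ht x
    have w2 := c.B_le _ ht x a
    have w3 := mul_le_mul_of_nonneg_left haC c.CB_pos.le
    have w4 := mul_le_mul_of_nonneg_left hx c.LA_pos.le
    linarith
  have h5 := norm_sub_le_norm_sub_add_norm_sub y (D.move h k x a) x
  unfold speed
  linarith

theorem Bounds.pathOf_mem_lipPaths (c : D.Bounds) (h3 : D.H3) (hCI : 0 ≤ CI)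
    {h : Discretization s} (hh : D.Admissible h CI) {X : ℕ → Vec d}
    (hR : ∀ j ≤ h.Nt, ‖X j‖ ≤ R) (hX : ∀ j < h.Nt, X (j + 1) ∈ D.SNext h C j (X j))
    {L : NNReal} (hL : c.speed C CI R ≤ L) : D.pathOf h X ∈ D.lipPaths R L := by
  have hmem : ∀ t : Icc (0 : ℝ) D.T, (t : ℝ) ∈ Icc ((0 : ℕ) * D.dt h) (h.Nt * D.dt h) := by
    intro t
    rw [D.Nt_mul_dt]
    simp
  refine ⟨fun t => norm_polyline_le (D.dt_pos h) (fun j _ hj => hR j hj) (Nat.zero_le _) (hmem t),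
    LipschitzWith.of_dist_le_mul fun t u => ?_⟩
  rw [dist_eq_norm, Subtype.dist_eq, Real.dist_eq]
  refine (polyline_lipschitz (D.dt_pos h) (L := c.speed C CI R) (fun j _ hj =>
    c.norm_sub_le_of_mem_SNext h3 hCI hh hj.le (hR j hj.le) (hX j hj)) (hmem u) (hmem t)).trans ?_
  exact mul_le_mul_of_nonneg_right hL (abs_nonneg _)

theorem NearTrajectory.mono {t₀ η η' : ℝ} {γ : ℝ → Vec d} {α : ℝ → Vec r} {w : ℝ → Vec d}
    (h : D.NearTrajectory t₀ C η γ α w) (hη : η ≤ η') : D.NearTrajectory t₀ C η' γ α w :=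
  ⟨h.measurable, h.integrable, h.bound, h.integral_eq, fun τ hτ => (h.near τ hτ).trans hη⟩

/-- The entropy becomes negligible after summation over the time steps. -/
theorem Bounds.tendsto_Nt_mul_entropyLoss (c : D.Bounds) (hC : 0 ≤ C) (hR : 0 ≤ R)
    {h : ℕ → Discretization s} (hNs : Tendsto (fun n => (h n).Ns) atTop atTop)
    (hε : (fun n => (h n).ε) =o[atTop] (fun n => 1 / ((h n).Nt * Real.log (h n).Ns))) :
    Tendsto (fun n => (h n).Nt * c.entropyLoss (h n) C R) atTop (𝓝 0) := by
  set κ := 2 * c.reach C R + 3 with hκ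
  have hκ1 : 1 ≤ κ := by linarith [c.reach_nonneg hC hR]
  have hlog : Tendsto (fun n => Real.log (h n).Ns) atTop atTop :=
    Real.tendsto_log_atTop.comp (tendsto_natCast_atTop_atTop.comp hNs)
  have h1 := (hε.tendsto_div_nhds_zero).const_mul (r * (Real.log κ + 1))
  rw [mul_zero] at h1
  refine squeeze_zero' (Eventually.of_forall fun n =>
    mul_nonneg (Nat.cast_nonneg _) (c.entropyLoss_nonneg (h n) hC hR)) ?_ h1
  filter_upwards [hlog.eventually_ge_atTop 1] with n hn
  have hNs0 : (0 : ℝ) < (h n).Ns := by exact_mod_cast (h n).Ns_pos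
  have h2 : Real.log (κ * (h n).Ns) ≤ (Real.log κ + 1) * Real.log (h n).Ns := by
    rw [Real.log_mul (by linarith) hNs0.ne']
    nlinarith [Real.log_nonneg hκ1]
  have h3 : (h n).ε / (1 / ((h n).Nt * Real.log (h n).Ns)) =
      (h n).ε * ((h n).Nt * Real.log (h n).Ns) := by
    rw [div_div_eq_mul_div, div_one]
  rw [h3]
  have hε0 := (h n).ε_pos
  calc (h n).Nt * c.entropyLoss (h n) C R
      = (h n).Nt * (h n).ε * r * Real.log (κ * (h n).Ns) := by unfold entropyLoss; ring
    _ ≤ (h n).Nt * (h n).ε * r * ((Real.log κ + 1) * Real.log (h n).Ns) :=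
        mul_le_mul_of_nonneg_left h2 (by positivity)
    _ = _ := by ring

/-- A sequence of discrete equilibria with states in the ball of radius `R`, along which the
discretization parameters converge. -/
structure EquilibriumSequence (c : D.Bounds) (C CI R : ℝ) (K₀ : Set (Vec d))
    (h : ℕ → Discretization s) (M : ℕ → ℕ → P1 (Vec d)) (V : ℕ → ℕ → Vec d → ℝ)
    (q : ℕ → ℕ → Vec d → Vec r → ℝ) : Prop where
  admissible : ∀ n, D.Admissible (h n) CI
  hjb : ∀ n, D.SolvesHJB (h n) C K₀ (M n) (V n) (q n)
  propagated : ∀ n, D.IsPropagated (h n) C K₀ (q n) (M n)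
  finite : ∀ n, ∃ F : Finset (Vec d), ∀ k ≤ (h n).Nt, D.S (h n) C K₀ k ⊆ F
  bound : ∀ n, ∀ k ≤ (h n).Nt, ∀ x ∈ D.S (h n) C K₀ k, ‖x‖ ≤ R
  Nt_tendsto : Tendsto (fun n => (h n).Nt) atTop atTop
  ratio_tendsto : Tendsto (fun n => ((h n).Nt : ℝ) / (h n).Ns) atTop (𝓝 0)
  loss_tendsto : Tendsto (fun n => (h n).Nt * c.entropyLoss (h n) C R) atTop (𝓝 0)

/-- Uniform convergence to the flow `m` of the distributions at the grid times. -/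
def TendstoAtNodes (h : ℕ → Discretization s) (M : ℕ → ℕ → P1 (Vec d)) (m : D.Flow) : Prop :=
  ∀ δ > 0, ∀ᶠ n in atTop, ∀ k ≤ (h n).Nt, dist (D.atTime m (D.time (h n) k)) (M n k) ≤ δ

section Sequence

variable {c : D.Bounds} {h : ℕ → Discretization s} {M : ℕ → ℕ → P1 (Vec d)}
  {V : ℕ → ℕ → Vec d → ℝ} {q : ℕ → ℕ → Vec d → Vec r → ℝ}

theorem EquilibriumSequence.comp (H : EquilibriumSequence c C CI R K₀ h M V q) {φ : ℕ → ℕ}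
    (hφ : Tendsto φ atTop atTop) :
    EquilibriumSequence c C CI R K₀ (h ∘ φ) (M ∘ φ) (V ∘ φ) (q ∘ φ) where
  admissible _ := H.admissible _
  hjb _ := H.hjb _
  propagated _ := H.propagated _
  finite _ := H.finite _
  bound _ := H.bound _
  Nt_tendsto := H.Nt_tendsto.comp hφ
  ratio_tendsto := H.ratio_tendsto.comp hφ
  loss_tendsto := H.loss_tendsto.comp hφ

theorem EquilibriumSequence.S₁_finite (H : EquilibriumSequence c C CI R K₀ h M V q) (h3 : D.H3)
    (hC : 0 ≤ C) (n : ℕ) : ∀ k < (h n).Nt, ∀ x ∈ D.S (h n) C K₀ k,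
      ∃ hf : (D.S₁ (h n) C k x).Finite,
        (h n).ε * Real.log hf.toFinset.card ≤ c.entropyLoss (h n) C R := fun k hk x hx =>
  c.ε_mul_log_card_le h3 hC hk.le (H.bound n k hk.le x hx) ((H.hjb n).nonempty_S₁ hk hx)

theorem EquilibriumSequence.bound_chain (H : EquilibriumSequence c C CI R K₀ h M V q) (n : ℕ)
    {X : ℕ → Vec d} (h0 : X 0 ∈ D.S (h n) C K₀ 0)
    (hX : ∀ j < (h n).Nt, X (j + 1) ∈ D.SNext (h n) C j (X j)) :
    ∀ j ≤ (h n).Nt, ‖X j‖ ≤ R := fun j hj =>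
  H.bound n j hj _ (mem_S_of_chain h0 hX j hj)

theorem EquilibriumSequence.isProbabilityMeasure (H : EquilibriumSequence c C CI R K₀ h M V q)
    (h3 : D.H3) (hC : 0 ≤ C) (hCI : 0 ≤ CI) (n : ℕ) :
    IsProbabilityMeasure (D.pathMeasure (h n) C K₀ (M n) (q n)) := by
  obtain ⟨F, hF⟩ := H.finite n
  exact isProbabilityMeasure_pathMeasure (H.hjb n) (H.propagated n) (H.admissible n).2 hCI hF
    fun k hk x hx => (H.S₁_finite h3 hC n k hk x hx).choose

theorem EquilibriumSequence.map_eval (H : EquilibriumSequence c C CI R K₀ h M V q)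
    (h3 : D.H3) (hC : 0 ≤ C) (hCI : 0 ≤ CI) (n : ℕ) {k : ℕ} (hk : k ≤ (h n).Nt) :
    (D.pathMeasure (h n) C K₀ (M n) (q n)).map
      (fun γ : D.PathSpace => D.atTime γ (D.time (h n) k)) = (M n k).toMeasure := by
  obtain ⟨F, hF⟩ := H.finite n
  exact pathMeasure_map (H.hjb n) (H.propagated n) (H.admissible n).2 hCI hF
    (fun k hk x hx => (H.S₁_finite h3 hC n k hk x hx).choose) hk

theorem EquilibriumSequence.lipPaths_null (H : EquilibriumSequence c C CI R K₀ h M V q)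
    (h3 : D.H3) (hCI : 0 ≤ CI) {L : NNReal} (hL : c.speed C CI R ≤ L) (n : ℕ) :
    D.pathMeasure (h n) C K₀ (M n) (q n) (D.lipPaths R L)ᶜ = 0 := by
  obtain ⟨F, hF⟩ := H.finite n
  exact pathMeasure_null (H.propagated n) hF isClosed_lipPaths.measurableSet.compl
    fun X h0 hX hn => hn (c.pathOf_mem_lipPaths h3 hCI (H.admissible n)
      (H.bound_chain n h0 hX) hX hL)

/-- The discrete value functions converge to the value function of the limit flow. -/
theorem EquilibriumSequence.tendsto_value (H : EquilibriumSequence c C CI R K₀ h M V q)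
    (h1 : D.H1) (h2 : D.H2) (h3 : D.H3) (hC : 0 < C) (hCb : D.IsControlBound C) (hCI : 0 ≤ CI)
    {m : D.Flow} (hm : TendstoAtNodes h M m) {δ : ℝ} (hδ : 0 < δ) :
    ∀ᶠ n in atTop, ∀ k ≤ (h n).Nt, ∀ x ∈ D.S (h n) C K₀ k,
      |V n k x - D.value m (D.time (h n) k) x| ≤ δ := by
  obtain ⟨θ₁, hθ₁, N₁, u1⟩ := exists_value_upper h1 h2 h3 hC hCb hCI m R hδ
  obtain ⟨θ₂, hθ₂, N₂, u2⟩ := exists_value_lower c h1 h2 h3 hC.le hCI m (R := R) hδ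
  filter_upwards [H.Nt_tendsto.eventually_ge_atTop N₁, H.Nt_tendsto.eventually_ge_atTop N₂,
    H.ratio_tendsto.eventually (ge_mem_nhds hθ₁), H.ratio_tendsto.eventually (ge_mem_nhds hθ₂),
    H.loss_tendsto.eventually (ge_mem_nhds hθ₂), hm _ hθ₁, hm _ hθ₂]
    with n a1 a2 a3 a4 a5 a6 a7 k hk x hx
  have v1 := u1 (h n) K₀ (M n) (V n) (q n) (H.admissible n) (H.hjb n) (H.bound n) a1 a3 a6 k hk x hx
  have v2 := u2 (h n) K₀ (M n) (V n) (q n) (H.admissible n) (H.hjb n) (H.bound n) a2 a4 a5 a7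
    k hk x hx
  rw [abs_le]
  constructor <;> linarith

/-- Paths in the support of a limit are optimal: a neighbourhood of such a path keeps some mass
along the sequence, while chains whose cost is far from the value carry little mass, so the
neighbourhood contains interpolated chains that are almost optimal. -/
theorem EquilibriumSequence.exists_isOptimal (H : EquilibriumSequence c C CI R K₀ h M V q)
    (h1 : D.H1) (h2 : D.H2) (h3 : D.H3) (hC : 0 < C) (hCb : D.IsControlBound C) (hCI : 0 ≤ CI)
    {m : D.Flow} (hm : TendstoAtNodes h M m) {ξs : ℕ → ProbabilityMeasure D.PathSpace}
    (hξs : ∀ n, (ξs n : Measure D.PathSpace) = D.pathMeasure (h n) C K₀ (M n) (q n))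
    {ξ : ProbabilityMeasure D.PathSpace} (hlim : Tendsto ξs atTop (𝓝 ξ)) {L : NNReal}
    (hL : c.speed C CI R ≤ L) {γ : D.PathSpace} (hγL : γ ∈ D.lipPaths R L)
    (hγ : γ ∈ (ξ : Measure D.PathSpace).support) :
    ∃ α, D.IsOptimal m (D.atTime γ 0) (D.atTime γ) α := by
  refine exists_isOptimal_of_limit h1 h2 h3 hC.le m R L γ fun ε hε => ?_
  obtain ⟨δ, hδ, hmod⟩ := exists_value_modulus h1 h2 h3 hC hCb m R (ε := ε / 4) (by positivity)
  set U := Metric.ball γ (min ε δ) with hU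
  have hUo : IsOpen U := Metric.isOpen_ball
  have hUpos : 0 < (ξ : Measure D.PathSpace) U :=
    (Measure.mem_support_iff_forall γ).1 hγ U (Metric.ball_mem_nhds γ (lt_min hε hδ))
  obtain ⟨b, hb0, hbU⟩ := exists_between hUpos
  have hbt : b ≠ ⊤ := (hbU.trans_le le_top).ne
  have hb0' : 0 < b.toReal := ENNReal.toReal_pos hb0.ne' hbt
  have hb1 : b.toReal ≤ 1 := by
    have := ENNReal.toReal_mono ENNReal.one_ne_top (hbU.le.trans prob_le_one)
    simpa using this
  have hmass := eventually_lt_of_lt_liminf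
    (hbU.trans_le (ProbabilityMeasure.le_liminf_measure_open_of_tendsto hlim hUo))
  -- the tolerance is small compared with the mass of `U`, so that Markov's inequality applies
  set ε₂ := ε / 4 * b.toReal / 4 with hε₂
  have hε₂0 : 0 < ε₂ := by positivity
  have hε₂1 : ε₂ ≤ ε / 16 := by
    rw [hε₂]
    nlinarith
  obtain ⟨θ₁, hθ₁, N₁, u1⟩ := exists_value_upper h1 h2 h3 hC hCb hCI m R hε₂0
  obtain ⟨θ₂, hθ₂, N₂, u2⟩ := exists_value_le_chainCost h1 h2 h3 hC.le hCI m R hε₂0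
  obtain ⟨n, a0, a1, a2, a3, a4, a5, a6, a7⟩ := (hmass.and <|
    (H.Nt_tendsto.eventually_ge_atTop N₁).and <| (H.Nt_tendsto.eventually_ge_atTop N₂).and <|
    (H.ratio_tendsto.eventually (ge_mem_nhds hθ₁)).and <|
    (H.ratio_tendsto.eventually (ge_mem_nhds hθ₂)).and <|
    (H.loss_tendsto.eventually (ge_mem_nhds hε₂0)).and <| (hm _ hθ₁).and (hm _ hθ₂)).exists
  have hup := fun x hx => u1 (h n) K₀ (M n) (V n) (q n) (H.admissible n) (H.hjb n) (H.bound n)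
    a1 a3 a6 0 (Nat.zero_le _) x hx
  have hlow := fun (X : ℕ → Vec d) (hX0 : X 0 ∈ D.S (h n) C K₀ 0)
      (hX : ∀ j < (h n).Nt, X (j + 1) ∈ D.SNext (h n) C j (X j)) =>
    u2 (h n) (M n) (H.admissible n) a2 a4 a7 0 (Nat.zero_le _) X
      (fun j _ hj => H.bound_chain n hX0 hX j hj) (fun j _ hj => hX j hj)
  obtain ⟨X, hX0, hX, hXU, hcost⟩ : ∃ X : ℕ → Vec d, X 0 ∈ D.S (h n) C K₀ 0 ∧
      (∀ j < (h n).Nt, X (j + 1) ∈ D.SNext (h n) C j (X j)) ∧ D.pathOf (h n) X ∈ U ∧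
      D.chainCost (h n) (M n) 0 X < V n 0 (X 0) + ε / 4 := by
    by_contra hcon
    push Not at hcon
    obtain ⟨F, hF⟩ := H.finite n
    have hle := mul_pathMeasure_le (H.hjb n) (H.propagated n) (H.admissible n).2 hCI hF
      (H.S₁_finite h3 hC.le n) hUo.measurableSet (ε₀ := ε / 4) (η := 2 * ε₂) (by positivity)
      (fun X hX0 hX => by
        obtain ⟨-, -, -, w⟩ := hlow X hX0 hX
        have := hup _ hX0
        linarith) hcon
    rw [← hξs n] at hle
    have hbr : b.toReal ≤ (ξs n : Measure D.PathSpace).real U :=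
      ENNReal.toReal_mono (measure_ne_top _ _) a0.le
    have := mul_le_mul_of_nonneg_left hbr (show 0 ≤ ε / 4 by positivity)
    have e : ε / 4 * b.toReal = 4 * ε₂ := by rw [hε₂]; ring
    linarith
  obtain ⟨α, w1, w2, -⟩ := hlow X hX0 hX
  have hR := H.bound_chain n hX0 hX
  have hmem := c.pathOf_mem_lipPaths h3 hCI (H.admissible n) hR hX hL
  have hpoly : ∀ t (ht : t ∈ Icc 0 D.T), polyline (D.dt (h n)) X t = D.pathOf (h n) X ⟨t, ht⟩ :=
    fun t ht => rfl
  have hdist : ∀ t ∈ Icc 0 D.T, ‖polyline (D.dt (h n)) X t - D.atTime γ t‖ < min ε δ := by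
    intro t ht
    rw [D.atTime_of_mem γ ht, hpoly t ht, ← dist_eq_norm]
    exact (ContinuousMap.dist_apply_le_dist _).trans_lt hXU
  have h0T : (0 : ℝ) ∈ Icc 0 D.T := ⟨le_rfl, D.T_pos.le⟩
  have ht0 := D.time_zero (h n)
  rw [ht0] at w1 w2
  refine ⟨_, α, _, w1.mono (by linarith), fun t ht => ?_, fun a ha b hb => ?_,
    fun t ht => (hdist t ht).le.trans (min_le_left _ _), ?_⟩
  · rw [hpoly t ht]
    exact hmem.1 _
  · rw [hpoly a ha, hpoly b hb, ← dist_eq_norm, ← Real.dist_eq]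
    exact hmem.2.dist_le_mul ⟨b, hb⟩ ⟨a, ha⟩
  · have e0 : polyline (D.dt (h n)) X 0 = X 0 := by
      have := polyline_node (D.dt_pos (h n)) X 0
      simpa using this
    have v1 := hup _ hX0
    rw [ht0] at v1
    have hd0 := (hdist 0 h0T).le.trans (min_le_right _ _)
    rw [e0, norm_sub_rev] at hd0
    have v2 := hmod (D.atTime γ 0) (X 0) (hγL.1 _) (hR 0 (Nat.zero_le _)) hd0
    linarith

/-- Limits of path measures of discrete equilibria are Lagrangian equilibria. -/
theorem EquilibriumSequence.isLagrangianEquilibrium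
    (H : EquilibriumSequence c C CI R K₀ h M V q)
    (h1 : D.H1) (h2 : D.H2) (h3 : D.H3) (hC : 0 < C) (hCb : D.IsControlBound C) (hCI : 0 ≤ CI)
    (hNs : Tendsto (fun n => (h n).Ns) atTop atTop)
    (hfr : ∀ n, ∀ x ∈ grid (h n).Ns d,
      D.m₀ (frontier (Metric.closedBall x (dx (h n) / 2))) = 0)
    {ξs : ℕ → ProbabilityMeasure D.PathSpace}
    (hξs : ∀ n, (ξs n : Measure D.PathSpace) = D.pathMeasure (h n) C K₀ (M n) (q n))
    {ξ : ProbabilityMeasure D.PathSpace} (hlim : Tendsto ξs atTop (𝓝 ξ)) {L : NNReal}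
    (hL : c.speed C CI R ≤ L) (hξ : (ξ : Measure D.PathSpace) (D.lipPaths R L)ᶜ = 0)
    (hm : TendstoAtNodes h M (marginalFlow ξ hξ)) : D.IsLagrangianEquilibrium ξ where
  moment := by
    refine ⟨0, Integrable.of_bound (C := max R 0)
      (continuous_id.dist continuous_const).aestronglyMeasurable ?_⟩
    filter_upwards [ae_lipPaths hξ] with γ hγ
    rw [Real.norm_of_nonneg dist_nonneg, ContinuousMap.dist_le (le_max_right _ _)]
    intro t
    simpa using Or.inl (hγ.1 t)
  initial := by
    have := D.m₀_prob
    set m₀ : ProbabilityMeasure (Vec d) := ⟨D.m₀, D.m₀_prob⟩ with hm₀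
    have hev : Continuous fun γ : D.PathSpace => D.atTime γ 0 := continuous_eval_const _
    have t1 := ProbabilityMeasure.tendsto_map_of_tendsto_of_continuous ξs ξ hlim hev
    have t2 := tendsto_map_nearestNode m₀ (fun n => (h n).Ns_pos) hNs
    have e : ∀ n, (ξs n).map hev.measurable.aemeasurable =
        m₀.map (measurable_nearestNode (h n).Ns).aemeasurable := by
      intro n
      apply Subtype.ext
      change (ξs n : Measure D.PathSpace).map (fun γ : D.PathSpace => D.atTime γ 0) =
        D.m₀.map (nearestNode (h n).Ns)
      obtain ⟨F, hF⟩ := H.finite n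
      rw [← (H.propagated n).initial_eq_map (F.finite_toSet.subset (hF 0 (Nat.zero_le _)))
        (hfr n), ← H.map_eval h3 hC.le hCI n (Nat.zero_le _), hξs n, D.time_zero]
    simp only [e] at t1
    have t3 : ξ.map hev.measurable.aemeasurable = m₀ := tendsto_nhds_unique t1 t2
    exact congrArg (fun μ : ProbabilityMeasure (Vec d) => (μ : Measure (Vec d))) t3
  optimal := by
    refine ⟨marginalFlow ξ hξ, isMarginalFlow_marginalFlow hξ, ?_⟩
    filter_upwards [ae_lipPaths hξ, Measure.support_mem_ae] with γ hγ1 hγ2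
    exact H.exists_isOptimal h1 h2 h3 hC hCb hCI hm hξs hlim hL hγ1 hγ2

end Sequence

end Data
end MFG

theorem theorem4p1 {d r s : ℕ} (D : MFG.Data d r s)
    (h1 : D.H1) (h2 : D.H2) (h3 : D.H3) (h4 : D.H4)
    (K₀ : Set (MFG.Vec d)) (hK₀ : IsCompact K₀) (hm₀ : D.m₀.support ⊆ K₀)
    (CI : ℝ) (hCI : 0 < CI) :
    (∃ C : ℝ, 0 < C ∧ D.IsControlBound C) ∧
    ∀ C : ℝ, 0 < C → D.IsControlBound C →
    ∃ Cinf : ℝ, 0 < Cinf ∧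
      (∀ h : MFG.Discretization s, D.Admissible h CI →
        ∀ k ≤ h.Nt, D.S h C K₀ k ⊆ Metric.closedBall 0 Cinf) ∧
      ∀ (h : ℕ → MFG.Discretization s) (M : ℕ → ℕ → MFG.P1 (MFG.Vec d))
        (V : ℕ → ℕ → MFG.Vec d → ℝ) (q : ℕ → ℕ → MFG.Vec d → MFG.Vec r → ℝ),
        (∀ n, D.Admissible (h n) CI) →
        (∀ n, ∀ x ∈ MFG.grid (h n).Ns d,
          D.m₀ (frontier (Metric.closedBall x (MFG.Data.dx (h n) / 2))) = 0) →
        (∀ n, D.IsDiscreteEquilibrium (h n) C K₀ (M n) (V n) (q n)) →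
        Tendsto (fun n => (h n).Nt) atTop atTop →
        Tendsto (fun n => (h n).Ns) atTop atTop →
        Tendsto (fun n => ((h n).Nt : ℝ) / (h n).Ns) atTop (𝓝 0) →
        (fun n => (h n).ε) =o[atTop] (fun n => 1 / ((h n).Nt * Real.log (h n).Ns)) →
        ∃ (ξ : ℕ → ProbabilityMeasure D.PathSpace) (Mflow : ℕ → D.Flow),
          (∀ n, (ξ n : Measure D.PathSpace) = D.pathMeasure (h n) C K₀ (M n) (q n)) ∧
          (∀ n, D.IsMarginalFlow (ξ n) (Mflow n)) ∧
          (∀ n, ∀ k ≤ (h n).Nt,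
            (D.atTime (Mflow n) (D.time (h n) k)).toMeasure = (M n k).toMeasure) ∧
          IsCompact (closure (Set.range ξ)) ∧
          (∃ (ξstar : ProbabilityMeasure D.PathSpace) (φ : ℕ → ℕ), StrictMono φ ∧
            Tendsto (fun l => ξ (φ l)) atTop (𝓝 ξstar)) ∧
          (∀ ξstar, MapClusterPt ξstar atTop ξ → D.IsLagrangianEquilibrium ξstar) ∧
          ∀ (φ : ℕ → ℕ), StrictMono φ → ∀ ξstar : ProbabilityMeasure D.PathSpace,
            Tendsto (fun l => ξ (φ l)) atTop (𝓝 ξstar) →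
            ∃ mstar : D.Flow, D.IsMarginalFlow ξstar mstar ∧
              (∀ t, (mstar t).toMeasure.support ⊆ Metric.closedBall 0 Cinf) ∧
              Tendsto (fun l => Mflow (φ l)) atTop (𝓝 mstar) ∧
              ∀ δ > 0, ∀ᶠ l in atTop, ∀ k ≤ (h (φ l)).Nt, ∀ x ∈ D.S (h (φ l)) C K₀ k,
                |V (φ l) k x - D.value mstar (D.time (h (φ l)) k) x| ≤ δ := by
  obtain ⟨c⟩ := D.exists_bounds h1 h2 h3
  refine ⟨c.exists_controlBound, fun C hC hCb => ?_⟩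
  obtain ⟨R₀, hR₀⟩ := hK₀.isBounded.exists_norm_le
  have hLA := c.LA_pos
  have hCB := c.CB_pos
  have hA0 := c.A0_nonneg
  have hT := D.T_pos
  set R := (|R₀| + D.T * (c.A0 + c.CB * C + CI)) * Real.exp (c.LA * D.T) with hR
  have hR0 : 0 < R := by positivity
  have hS : ∀ h : MFG.Discretization s, D.Admissible h CI →
      ∀ k ≤ h.Nt, ∀ x ∈ D.S h C K₀ k, ‖x‖ ≤ R := fun h hh k hk x hx =>
    c.norm_le_of_mem_S h3 hC.le hCI.le hh (abs_nonneg R₀)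
      (fun x hx => (hR₀ x hx).trans (le_abs_self R₀)) hk hx
  refine ⟨R, hR0, fun h hh k hk x hx => mem_closedBall_zero_iff.2 (hS h hh k hk x hx), ?_⟩
  intro h M V q hadm hfr heq hNt hNs hratio hε
  have H : MFG.Data.EquilibriumSequence c C CI R K₀ h M V q :=
    { admissible := hadm
      hjb := fun n => (heq n).1
      propagated := fun n => (heq n).2
      finite := fun n => by
        obtain ⟨F, hF, -⟩ := MFG.exists_grid_finset (n := d) (h n).Ns_pos hR0.le
        exact ⟨F, fun k hk x hx => hF x (MFG.Data.S_subset_grid hx) (hS (h n) (hadm n) k hk x hx)⟩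
      bound := fun n => hS (h n) (hadm n)
      Nt_tendsto := hNt
      ratio_tendsto := hratio
      loss_tendsto := c.tendsto_Nt_mul_entropyLoss hC.le hR0.le hNs hε }
  set L : NNReal := (c.speed C CI R).toNNReal
  have hL : c.speed C CI R ≤ L := Real.le_coe_toNNReal _
  set ξ : ℕ → ProbabilityMeasure D.PathSpace := fun n =>
    ⟨D.pathMeasure (h n) C K₀ (M n) (q n), H.isProbabilityMeasure h3 hC.le hCI.le n⟩
  have hξ : ∀ n, (ξ n : Measure D.PathSpace) = D.pathMeasure (h n) C K₀ (M n) (q n) := fun _ => rfl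
  have hnull : ∀ n, (ξ n : Measure D.PathSpace) (D.lipPaths R L)ᶜ = 0 := fun n =>
    H.lipPaths_null h3 hCI.le hL n
  have hnode : ∀ n, ∀ k ≤ (h n).Nt,
      D.atTime (MFG.Data.marginalFlow (ξ n) (hnull n)) (D.time (h n) k) = M n k := fun n k hk =>
    MFG.P1.ext (H.map_eval h3 hC.le hCI.le n hk)
  have hcompact := MFG.Data.isCompact_closure_range_of_lipPaths hnull
  -- convergence of the path measures gives convergence of the flows, in particular at the nodes
  have hsub : ∀ φ : ℕ → ℕ, StrictMono φ → ∀ ξstar : ProbabilityMeasure D.PathSpace,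
      Tendsto (fun l => ξ (φ l)) atTop (𝓝 ξstar) →
      ∃ hstar : (ξstar : Measure D.PathSpace) (D.lipPaths R L)ᶜ = 0,
        Tendsto (fun l => MFG.Data.marginalFlow (ξ (φ l)) (hnull (φ l))) atTop
          (𝓝 (MFG.Data.marginalFlow ξstar hstar)) ∧
        MFG.Data.TendstoAtNodes (h ∘ φ) (M ∘ φ) (MFG.Data.marginalFlow ξstar hstar) := by
    intro φ hφ ξstar hlim
    have hstar := MFG.Data.lipPaths_null_of_tendsto hlim fun l => hnull (φ l)
    have hflow := MFG.Data.tendsto_marginalFlow hlim (fun l => hnull (φ l)) hstar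
    refine ⟨hstar, hflow, fun δ hδ => ?_⟩
    filter_upwards [Metric.tendsto_nhds.1 hflow δ hδ] with l hl k hk
    rw [dist_comm]
    change dist (M (φ l) k) _ ≤ δ
    rw [← hnode (φ l) k hk]
    exact (ContinuousMap.dist_apply_le_dist _).trans hl.le
  refine ⟨ξ, fun n => MFG.Data.marginalFlow (ξ n) (hnull n), hξ,
    fun n => MFG.Data.isMarginalFlow_marginalFlow _, fun n k hk => by rw [hnode n k hk],
    hcompact, ?_, fun ξstar hcl => ?_, fun φ hφ ξstar hlim => ?_⟩
  · obtain ⟨ξstar, -, φ, hφ, hlim⟩ :=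
      hcompact.tendsto_subseq fun n => subset_closure (mem_range_self n)
    exact ⟨ξstar, φ, hφ, hlim⟩
  · obtain ⟨φ, hφ, hlim⟩ := hcl.tendsto_subseq
    obtain ⟨hstar, -, hm⟩ := hsub φ hφ ξstar hlim
    exact (H.comp hφ.tendsto_atTop).isLagrangianEquilibrium h1 h2 h3 hC hCb hCI.le
      (hNs.comp hφ.tendsto_atTop) (fun l => hfr (φ l)) (fun l => hξ (φ l)) hlim hL hstar hm
  · obtain ⟨hstar, hflow, hm⟩ := hsub φ hφ ξstar hlim
    refine ⟨MFG.Data.marginalFlow ξstar hstar, MFG.Data.isMarginalFlow_marginalFlow _,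
      MFG.Data.support_marginal_subset hstar, hflow, fun δ hδ => ?_⟩
    exact (H.comp hφ.tendsto_atTop).tendsto_value h1 h2 h3 hC hCb hCI.le hm hδ
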